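/- Let $M$ be a countable $\omega$-categorical structure in a countable language. Definable sets are taken in $M^{eq}$; "$c$-definable" means definable over $c$, and "definable" without qualification allows arbitrary parameters. A $0$-interpretable set is the quotient of a $0$-definable set of tuples of $M$ by a $0$-definable equivalence relation. *Linear orders.* A linear order $(V,\le)$ definable over $A$ is *weakly transitive over $A$* if it is non-empty, dense, without first or last element, and every non-empty $A$-definable subset of $V$ is dense in $V$. It has *topological rank 1* if no definable convex equivalence relation on $V$ has infinitely many infinite classes. It is *minimal over $A$* if both hold. Its completion $\overline V$ is the set of definable cuts (non-empty proper initial segments without last element). If $V,W$ are weakly transitive over $A$, they are *intertwined over $A$* if there is an $A$-definable non-decreasing map $V\to\overline W$. Two linear orders $V,W$ definable over $A$ are *independent* if there are no parameter set $B\supseteq A$ and infinite $B$-definable subsets $X\subseteq V$, $Y\subseteq W$ which, with the induced orders, are weakly transitive over $B$ and such that $X$ is intertwined over $B$ with $Y$ or with the reverse of $Y$. *Circular orders.* A subset $I$ of a circular order $V$ is *convex* if for all $a\ne b$ in $I$ one of the open intervals $(a,b)$, $(b,a)$ is contained in $I$. The completion $\overline V$ consists of the non-empty definable convex sets with infinite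 complement and no last element, two of them being identified when one is an end segment of the other; it is circularly ordered, and $a\in V$ is identified with the class of the intervals $(b,a)$. Topological rank 1 is defined as for linear orders. $V$ is *minimal over $A$* if it is infinite, densely ordered, of topological rank 1, no element of $\overline V$ is algebraic over $A$, and there is no definable (over any parameters) order-preserving injective map $V\to\overline V$ other than the identity. Open intervals of a circular order are regarded as linear orders; a circular order is *independent* from another circular order (respectively from a linear order) if each of its open intervals is independent from each open interval of the other (respectively from that linear order). *Rank.* For a definable set $D$: $\mathrm{rk}(D)\ge 1$ if $D$ is infinite; for $\alpha\ge1$, $\mathrm{rk}(D)\ge\alpha+1$ if there is in $M^{eq}$ an infinite uniformly definable family $(X_t)_{t\in E}$ of subsets of $D$, $k$-inconsistent for some $k$, with $\mathrm{rk}(X_t)\ge\alpha$ for all $t\in E$; for limit $\lambda$, $\mathrm{rk}(D)\ge\lambda$ if $\mathrm{rk}(D)\ge\alpha$ for all $\alpha<\lambda$. $D$ is *ranked* if $\mathrm{rk}(D)\not\ge\alpha$ for some ordinal $\alpha$. **Theorem.** Let $(V_a,\le_a)_{a\in D}$ be a $0$-definable family (in $M^{eq}$) of linear orders, with $V_a$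 minimal over $a$ for each $a\in D$, and suppose that $D$ is ranked. Then there are a $0$-interpretable set $F$ and a $0$-interpretable family $(W_e)_{e\in F}$ of linear or circular orders such that: 1. for every $e\in F$, $W_e$ is minimal over $e$; 2. for all $e\ne e'$ in $F$, either $W_e$ and $W_{e'}$ are independent, or there is a definable order-reversing bijection between $W_e$ and $W_{e'}$; 3. for every $a\in D$, there is a unique $e\in F$ such that $V_a$ admits a definable (strictly) order-preserving map into $W_e$. -/

import Mathlib

universe u v w

namespace DefOrd

open scoped FirstOrder

/-! ### Omega-categorical structures, interpretable sets, definability -/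

/-- `Aut(M)` has finitely many orbits on `M ^ n` for every `n`. For a countable structure `M` this
is one of the standard definitions of omega-categoricity. -/
def OmegaCategorical (L : FirstOrder.Language.{v, w}) (M : Type u) [L.Structure M] : Prop :=
  ∀ n : ℕ, ∃ T : Set (Fin n → M), T.Finite ∧
    ∀ x : Fin n → M, ∃ t ∈ T, ∃ σ : M ≃[L] M, σ ∘ t = x

/-- A presentation of `X` as a `0`-interpretable set of `M`, i.e. as the quotient of a `0`-definable
set of finite tuples by a `0`-definable equivalence relation. The relation `rep m x` says that the
tuple `m` lies in the `0`-definable set and that its class is `x`; the equivalence relation is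
`∃ x, rep m x ∧ rep m' x`, and the `0`-definable set is its domain. -/
class Interp (L : FirstOrder.Language.{v, w}) (M : Type u) [L.Structure M] (X : Type*) where
  ι : Type
  finite : Finite ι
  rep : (ι → M) → X → Prop
  rep_unique : ∀ m x y, rep m x → rep m y → x = y
  rep_surj : ∀ x, ∃ m, rep m x
  definable_rel : (∅ : Set M).Definable L
    {p : ι ⊕ ι → M | ∃ x, rep (p ∘ Sum.inl) x ∧ rep (p ∘ Sum.inr) x}

/-- Products of interpretable sets. -/
instance instInterpProd (L : FirstOrder.Language.{v, w}) (M : Type u) [L.Structure M] (X Y : Type*)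
    [hX : Interp L M X] [hY : Interp L M Y] : Interp L M (X × Y) where
  ι := hX.ι ⊕ hY.ι
  finite := by
    have := hX.finite
    have := hY.finite
    infer_instance
  rep m p := hX.rep (m ∘ Sum.inl) p.1 ∧ hY.rep (m ∘ Sum.inr) p.2
  rep_unique := by
    rintro m ⟨x, y⟩ ⟨x', y'⟩ ⟨h1, h2⟩ ⟨h3, h4⟩
    exact Prod.ext (hX.rep_unique _ _ _ h1 h3) (hY.rep_unique _ _ _ h2 h4)
  rep_surj := by
    rintro ⟨x, y⟩
    obtain ⟨m, hm⟩ := hX.rep_surj x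
    obtain ⟨n, hn⟩ := hY.rep_surj y
    exact ⟨Sum.elim m n, by simpa using hm, by simpa using hn⟩
  definable_rel := by
    have h1 := hX.definable_rel.preimage_comp
      (Sum.map Sum.inl Sum.inl : hX.ι ⊕ hX.ι → (hX.ι ⊕ hY.ι) ⊕ (hX.ι ⊕ hY.ι))
    have h2 := hY.definable_rel.preimage_comp
      (Sum.map Sum.inr Sum.inr : hY.ι ⊕ hY.ι → (hX.ι ⊕ hY.ι) ⊕ (hX.ι ⊕ hY.ι))
    convert h1.inter h2 using 1
    ext p
    constructor
    · rintro ⟨⟨x, y⟩, ⟨a, b⟩, c, d⟩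
      exact ⟨⟨x, a, c⟩, ⟨y, b, d⟩⟩
    · rintro ⟨⟨x, a, c⟩, ⟨y, b, d⟩⟩
      exact ⟨⟨x, y⟩, ⟨a, b⟩, c, d⟩

section Definability

variable (L : FirstOrder.Language.{v, w}) (M : Type u) [L.Structure M]

/-- The set of tuples of `M` that represent an element of `Z`. -/
def pullback {X : Type*} [h : Interp L M X] (Z : Set X) : Set (h.ι → M) :=
  {m | ∃ x ∈ Z, h.rep m x}

/-- `Z` is `0`-definable (in `M^eq`). -/
def ZeroDef {X : Type*} [Interp L M X] (Z : Set X) : Prop :=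
  (∅ : Set M).Definable L (pullback L M Z)

/-- `Z` is definable, with arbitrary parameters from `M`. -/
def ParamDef {X : Type*} [Interp L M X] (Z : Set X) : Prop :=
  (Set.univ : Set M).Definable L (pullback L M Z)

/-- The fibre of `R ⊆ K × X` at `c`. -/
def fiber {K X : Type*} (R : Set (K × X)) (c : K) : Set X := {x | (c, x) ∈ R}

/-- `Z` is definable over the imaginary element `c`: it is the fibre at `c` of a `0`-definable
relation, i.e. the solution set of `φ(x; c)` for a formula `φ(x; y)` without parameters.
A finite tuple of imaginary elements is an element of a product of interpretable sets. -/
def DefOver {K X : Type*} [Interp L M K] [Interp L M X] (c : K) (Z : Set X) : Prop :=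
  ∃ R : Set (K × X), ZeroDef L M R ∧ Z = fiber R c

end Definability

/-! ### Rank -/

/-- `RankGE L M α D` is `rk(D) ≥ α`. -/
inductive RankGE (L : FirstOrder.Language.{v, w}) (M : Type u) [L.Structure M] {X : Type u} [Interp L M X] :
    Ordinal.{0} → Set X → Prop
  | zero (D : Set X) : RankGE L M 0 D
  | one (D : Set X) (h : D.Infinite) : RankGE L M 1 D
  | succ (D : Set X) (α : Ordinal.{0}) (hα : 1 ≤ α)
      (E : Type u) [Interp L M E] (T : Set E) (R : Set (E × X))
      (hT : ParamDef L M T) (hR : ParamDef L M R) (infinite : T.Infinite)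
      (subset : ∀ t ∈ T, fiber R t ⊆ D)
      (k : ℕ) (inconsistent : ∀ s : Finset E, (s : Set E) ⊆ T → s.card = k →
        (⋂ t ∈ s, fiber R t) = ∅)
      (rank : ∀ t ∈ T, RankGE L M α (fiber R t)) : RankGE L M (α + 1) D
  | limit (D : Set X) (α : Ordinal.{0}) (hα : Order.IsSuccLimit α)
      (h : ∀ β < α, RankGE L M β D) : RankGE L M α D

/-- `rk(D) < ∞`. -/
def Ranked (L : FirstOrder.Language.{v, w}) (M : Type u) [L.Structure M] {X : Type u} [Interp L M X]
    (D : Set X) : Prop :=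
  ∃ α : Ordinal.{0}, ¬ RankGE L M α D

/-! ### Linear orders -/

/-- A linear order whose underlying set is a subset of `X`. Only the restriction of `le` to
`carrier` is meaningful. -/
structure LinOrdOn (X : Type u) where
  carrier : Set X
  le : X → X → Prop
  linear : IsLinearOrder carrier (fun x y => le x y)

namespace LinOrdOn

variable {X Y : Type u}

/-- The strict order (used on elements of the underlying set). -/
def lt (V : LinOrdOn X) (x y : X) : Prop := V.le x y ∧ x ≠ y

/-- The induced order on a subset. -/
def restrict (V : LinOrdOn X) (A : Set X) (hA : A ⊆ V.carrier) : LinOrdOn X where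
  carrier := A
  le := V.le
  linear :=
    have h := V.linear
    { refl := fun x => h.refl ⟨x, hA x.2⟩
      trans := fun x y z => h.trans ⟨x, hA x.2⟩ ⟨y, hA y.2⟩ ⟨z, hA z.2⟩
      antisymm := fun x y h1 h2 => by
        have := h.antisymm ⟨x, hA x.2⟩ ⟨y, hA y.2⟩ h1 h2
        simpa [Subtype.ext_iff] using this
      total := fun x y => h.total ⟨x, hA x.2⟩ ⟨y, hA y.2⟩ }

/-- The reverse order. -/
def reverse (V : LinOrdOn X) : LinOrdOn X where
  carrier := V.carrier
  le x y := V.le y x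
  linear :=
    have h := V.linear
    { refl := fun x => h.refl x
      trans := fun x y z h1 h2 => h.trans z y x h2 h1
      antisymm := fun x y h1 h2 => h.antisymm x y h2 h1
      total := fun x y => h.total y x }

/-- A non-empty dense order without first or last element. -/
def DenseNoEnds (V : LinOrdOn X) : Prop :=
  V.carrier.Nonempty ∧
  (∀ x ∈ V.carrier, ∀ y ∈ V.carrier, V.lt x y → ∃ z ∈ V.carrier, V.lt x z ∧ V.lt z y) ∧
  (∀ x ∈ V.carrier, ∃ y ∈ V.carrier, V.lt y x) ∧
  (∀ x ∈ V.carrier, ∃ y ∈ V.carrier, V.lt x y)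

/-- `Z` meets every open interval with end-points in the order. -/
def DenseSubset (V : LinOrdOn X) (Z : Set X) : Prop :=
  ∀ x ∈ V.carrier, ∀ y ∈ V.carrier, V.lt x y → ∃ z ∈ Z, V.lt x z ∧ V.lt z y

/-- A cut: a non-empty proper initial segment without last element. -/
def IsCut (V : LinOrdOn X) (I : Set X) : Prop :=
  I ⊆ V.carrier ∧ I.Nonempty ∧ I ≠ V.carrier ∧
  (∀ x ∈ I, ∀ y ∈ V.carrier, V.le y x → y ∈ I) ∧
  (∀ x ∈ I, ∃ y ∈ I, V.lt x y)

section

variable (L : FirstOrder.Language.{v, w}) (M : Type u) [L.Structure M] [Interp L M X] [Interp L M Y]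

/-- No parameter-definable convex equivalence relation on `V` has infinitely many infinite
classes. -/
def TopRankOne (V : LinOrdOn X) : Prop :=
  ¬ ∃ E : Set (X × X), ParamDef L M E ∧ E ⊆ V.carrier ×ˢ V.carrier ∧
    Equivalence (fun x y : V.carrier => ((x : X), (y : X)) ∈ E) ∧
    (∀ x ∈ V.carrier, ∀ y ∈ V.carrier, ∀ z ∈ V.carrier,
      V.le x z → V.le z y → (x, y) ∈ E → (x, z) ∈ E) ∧
    {C : Set X | C.Infinite ∧ ∃ x ∈ V.carrier, C = fiber E x}.Infinite

variable {K : Type u} [Interp L M K]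

/-- Weak transitivity over `c`. -/
def WeaklyTransitive (c : K) (V : LinOrdOn X) : Prop :=
  V.DenseNoEnds ∧ ∀ Z ⊆ V.carrier, DefOver L M c Z → Z.Nonempty → V.DenseSubset Z

/-- Minimality over `c`. -/
def Minimal (c : K) (V : LinOrdOn X) : Prop :=
  V.WeaklyTransitive L M c ∧ V.TopRankOne L M

/-- There is a `c`-definable non-decreasing map from `V` to the definable completion of `W`. The
map is given by a `c`-definable relation `R` whose fibre at `x` is the cut that is the image
of `x`. -/
def Intertwined (c : K) (V : LinOrdOn X) (W : LinOrdOn Y) : Prop :=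
  ∃ R : Set (X × Y), DefOver L M c R ∧ (∀ x ∈ V.carrier, W.IsCut (fiber R x)) ∧
    ∀ x ∈ V.carrier, ∀ y ∈ V.carrier, V.le x y → fiber R x ⊆ fiber R y

/-- Independence of two orders that are definable over `c`. The parameter `b` ranges over all
imaginary elements, so that `(c, b)` ranges over the finite sets of parameters extending `c`; larger
sets of parameters make no difference, since `A`, `B` and the map between them are definable over
finitely many parameters. -/
def Independent (c : K) (V : LinOrdOn X) (W : LinOrdOn Y) : Prop :=
  ¬ ∃ (Q : Type u) (_ : Interp L M Q) (b : Q)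
      (A : Set X) (hA : A ⊆ V.carrier) (B : Set Y) (hB : B ⊆ W.carrier),
    A.Infinite ∧ B.Infinite ∧ DefOver L M (c, b) A ∧ DefOver L M (c, b) B ∧
    (V.restrict A hA).WeaklyTransitive L M (c, b) ∧
    (W.restrict B hB).WeaklyTransitive L M (c, b) ∧
    ((V.restrict A hA).Intertwined L M (c, b) (W.restrict B hB) ∨
      (V.restrict A hA).Intertwined L M (c, b) (W.restrict B hB).reverse)

end

end LinOrdOn

/-! ### Circular orders -/

/-- A circular order whose underlying set is a subset of `X`. Only the restriction of `btw` to
`carrier` is meaningful. -/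
structure CircOrdOn (X : Type u) where
  carrier : Set X
  btw : X → X → X → Prop
  circular : ∃ o : CircularOrder carrier, ∀ x y z : carrier, o.btw x y z ↔ btw x y z

namespace CircOrdOn

variable {X : Type u}

/-- `x < y < z`: the points are pairwise distinct, in the underlying set, and in this order. -/
def lt (V : CircOrdOn X) (x y z : X) : Prop :=
  x ∈ V.carrier ∧ y ∈ V.carrier ∧ z ∈ V.carrier ∧ x ≠ y ∧ y ≠ z ∧ x ≠ z ∧ V.btw x y z

/-- The open interval `s < x < t`. -/
def arc (V : CircOrdOn X) (s t : X) : Set X := {x | V.lt s x t}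

/-- The open interval `s < x < t` with its canonical linear order. -/
def interval (V : CircOrdOn X) (s t : X) : LinOrdOn X where
  carrier := V.arc s t
  le x y := V.btw s x y
  linear := by
    obtain ⟨o, ho⟩ := V.circular
    have key : ∀ x : V.arc s t, ∃ h : (x : X) ∈ V.carrier, s ≠ x := fun x => ⟨x.2.2.1, x.2.2.2.2.1⟩
    by_cases hs : s ∈ V.carrier
    swap
    · exact { refl := fun x => absurd x.2.1 hs, trans := fun x => absurd x.2.1 hs,
              antisymm := fun x => absurd x.2.1 hs, total := fun x => absurd x.2.1 hs }
    have tot : ∀ x y : V.arc s t, V.btw s x y ∨ V.btw s y x := by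
      intro x y
      rcases o.btw_total ⟨s, hs⟩ ⟨x, (key x).1⟩ ⟨y, (key y).1⟩ with h | h
      · exact Or.inl ((ho _ _ _).1 h)
      · exact Or.inr ((ho _ _ _).1 (btw_cyclic_right h))
    have anti : ∀ x y : V.arc s t, V.btw s x y → V.btw s y x → x = y := by
      intro x y h1 h2
      have h1' := (ho ⟨s, hs⟩ ⟨x, (key x).1⟩ ⟨y, (key y).1⟩).2 h1
      have h2' := (ho ⟨s, hs⟩ ⟨y, (key y).1⟩ ⟨x, (key x).1⟩).2 h2
      rcases o.btw_antisymm h1' (o.btw_cyclic_left h2') with h | h | h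
      · exact absurd (congrArg Subtype.val h) (key x).2
      · simpa [Subtype.ext_iff] using h
      · exact absurd (congrArg Subtype.val h).symm (key y).2
    refine { refl := fun x => ?_, trans := fun x y z h1 h2 => ?_, antisymm := anti, total := tot }
    · rcases tot x x with h | h <;> exact h
    · by_cases hxy : x = y
      · subst hxy; exact h2
      by_cases hyz : y = z
      · subst hyz; exact h1
      have strict : ∀ a b : V.arc s t, a ≠ b → V.btw s a b →
          o.sbtw ⟨s, hs⟩ ⟨a, (key a).1⟩ ⟨b, (key b).1⟩ := by
        intro a b hab h
        refine o.sbtw_iff_btw_not_btw.2 ⟨(ho _ _ _).2 h, fun h' => hab (anti a b h ?_)⟩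
        exact (ho ⟨s, hs⟩ ⟨b, (key b).1⟩ ⟨a, (key a).1⟩).1 (btw_cyclic_right h')
      exact (ho _ _ _).1
        (btw_of_sbtw (sbtw_trans_right (strict x y hxy h1) (strict y z hyz h2)))

/-- For any two distinct points of `I`, one of the two intervals between them is included
in `I`. -/
def Convex (V : CircOrdOn X) (I : Set X) : Prop :=
  I ⊆ V.carrier ∧ ∀ x ∈ I, ∀ y ∈ I, x ≠ y → V.arc x y ⊆ I ∨ V.arc y x ⊆ I

/-- The canonical strict linear order on a bounded convex set `I` (used on elements of `I`). -/
def ltOn (V : CircOrdOn X) (I : Set X) (x y : X) : Prop := x ≠ y ∧ V.arc x y ⊆ I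

/-- A non-empty bounded convex set without last element. If it is definable, it represents an
element of the definable completion. -/
def IsCutRep (V : CircOrdOn X) (I : Set X) : Prop :=
  V.Convex I ∧ I.Nonempty ∧ (V.carrier \ I).Infinite ∧ ∀ x ∈ I, ∃ y ∈ I, V.ltOn I x y

/-- `J` is an end segment of `I`. -/
def EndSegment (V : CircOrdOn X) (J I : Set X) : Prop :=
  J ⊆ I ∧ ∀ x ∈ J, ∀ y ∈ I, V.ltOn I x y → y ∈ J

/-- `I` and `J` represent the same cut. -/
def SameCut (V : CircOrdOn X) (I J : Set X) : Prop := V.EndSegment I J ∨ V.EndSegment J I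

/-- `I` represents the point `x`, i.e. the cut of the intervals `(b, x)`. -/
def CutAt (V : CircOrdOn X) (x : X) (I : Set X) : Prop :=
  ∃ b ∈ V.carrier, b ≠ x ∧ V.SameCut I (V.arc b x)

/-- The strict circular order on cuts: the cuts represented by `I₁, I₂, I₃` satisfy `c₁ < c₂ < c₃`
if all points `x₁, x₂, x₃` taken far enough in `I₁, I₂, I₃` satisfy `x₁ < x₂ < x₃`. -/
def CutLt (V : CircOrdOn X) (I₁ I₂ I₃ : Set X) : Prop :=
  ∃ a₁ ∈ I₁, ∃ a₂ ∈ I₂, ∃ a₃ ∈ I₃, ∀ x₁ ∈ I₁, ∀ x₂ ∈ I₂, ∀ x₃ ∈ I₃,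
    V.ltOn I₁ a₁ x₁ → V.ltOn I₂ a₂ x₂ → V.ltOn I₃ a₃ x₃ → V.lt x₁ x₂ x₃

section

variable (L : FirstOrder.Language.{v, w}) (M : Type u) [L.Structure M] [Interp L M X]

/-- No parameter-definable convex equivalence relation on `V` has infinitely many infinite
classes. -/
def TopRankOne (V : CircOrdOn X) : Prop :=
  ¬ ∃ E : Set (X × X), ParamDef L M E ∧ E ⊆ V.carrier ×ˢ V.carrier ∧
    Equivalence (fun x y : V.carrier => ((x : X), (y : X)) ∈ E) ∧
    (∀ x ∈ V.carrier, V.Convex (fiber E x)) ∧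
    {C : Set X | C.Infinite ∧ ∃ x ∈ V.carrier, C = fiber E x}.Infinite

variable {K : Type u} [Interp L M K]

/-- Some element of the definable completion of `V` is algebraic over `c`: there is a non-empty
`c`-definable set `Z` of codes for cuts (`R` being the relation that associates to a code a set
representing the cut), in which only finitely many cuts are coded. -/
def HasAlgebraicCut (c : K) (V : CircOrdOn X) : Prop :=
  ∃ (Q : Type u) (_ : Interp L M Q) (Z : Set Q) (R : Set (Q × X)),
    DefOver L M c Z ∧ DefOver L M c R ∧ Z.Nonempty ∧ (∀ z ∈ Z, V.IsCutRep (fiber R z)) ∧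
    ∃ T ⊆ Z, T.Finite ∧ ∀ z ∈ Z, ∃ t ∈ T, V.SameCut (fiber R z) (fiber R t)

/-- Weak transitivity over `c`: densely ordered (and not degenerate), and no element of the
definable completion is algebraic over `c`. -/
def WeaklyTransitive (c : K) (V : CircOrdOn X) : Prop :=
  V.carrier.Infinite ∧
  (∀ x ∈ V.carrier, ∀ y ∈ V.carrier, x ≠ y → (V.arc x y).Nonempty) ∧
  ¬ V.HasAlgebraicCut L M c

/-- There is a parameter-definable order-preserving injective map from `V` to its definable
completion that is not the identity. The image of `x` is the cut represented by the fibre of `R`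
at `x`. Preserving `x < y < z` amounts to being injective and preserving the circular order. -/
def HasSelfIntertwining (V : CircOrdOn X) : Prop :=
  ∃ R : Set (X × X), ParamDef L M R ∧ (∀ x ∈ V.carrier, V.IsCutRep (fiber R x)) ∧
    (∀ x y z, V.lt x y z → V.CutLt (fiber R x) (fiber R y) (fiber R z)) ∧
    ∃ x ∈ V.carrier, ¬ V.CutAt x (fiber R x)

/-- Minimality over `c`. -/
def Minimal (c : K) (V : CircOrdOn X) : Prop :=
  V.WeaklyTransitive L M c ∧ V.TopRankOne L M ∧ ¬ V.HasSelfIntertwining L M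

end

end CircOrdOn

/-! ### Linear or circular orders, and families of them -/

/-- A linear or circular order on a subset of `X`. -/
inductive LinOrCircOn (X : Type u) where
  | linear (V : LinOrdOn X) : LinOrCircOn X
  | circular (V : CircOrdOn X) : LinOrCircOn X

namespace LinOrCircOn

variable {X Y : Type u}

/-- The underlying set. -/
def carrier : LinOrCircOn X → Set X
  | linear V => V.carrier
  | circular V => V.carrier

/-- `V` is linear. -/
def IsLin : LinOrCircOn X → Prop
  | linear _ => True
  | circular _ => False

/-- `x ≤ y` in a linear order (never in a circular order). -/
def leRel : LinOrCircOn X → X → X → Prop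
  | linear V, x, y => x ∈ V.carrier ∧ y ∈ V.carrier ∧ V.le x y
  | circular _, _, _ => False

/-- `x ≤ y ≤ z` in a circular order (never in a linear order). -/
def btwRel : LinOrCircOn X → X → X → X → Prop
  | linear _, _, _, _ => False
  | circular V, x, y, z => x ∈ V.carrier ∧ y ∈ V.carrier ∧ z ∈ V.carrier ∧ V.btw x y z

section

variable (L : FirstOrder.Language.{v, w}) (M : Type u) [L.Structure M]
  [Interp L M X] [Interp L M Y]

/-- Minimality over `c`. -/
def Minimal {K : Type u} [Interp L M K] (c : K) : LinOrCircOn X → Prop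
  | linear V => V.Minimal L M c
  | circular V => V.Minimal L M c

/-- Independence of two orders that are definable over `c`. For circular orders, this is
independence (as linear orders) of their open intervals. -/
def Independent {K : Type u} [Interp L M K] (c : K) : LinOrCircOn X → LinOrCircOn Y → Prop
  | linear V, linear W => V.Independent L M c W
  | circular V, linear W => ∀ s ∈ V.carrier, ∀ t ∈ V.carrier, s ≠ t →
      (V.interval s t).Independent L M (c, s, t) W
  | linear V, circular W => ∀ s ∈ W.carrier, ∀ t ∈ W.carrier, s ≠ t →
      V.Independent L M (c, s, t) (W.interval s t)
  | circular V, circular W => ∀ s ∈ V.carrier, ∀ t ∈ V.carrier, s ≠ t →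
      ∀ s' ∈ W.carrier, ∀ t' ∈ W.carrier, s' ≠ t' →
      (V.interval s t).Independent L M (c, (s, t), (s', t')) (W.interval s' t')

/-- The map `f` reverses the order. -/
def ReversesOrder (f : X → Y) : LinOrCircOn X → LinOrCircOn Y → Prop
  | linear V, linear W =>
      ∀ x ∈ V.carrier, ∀ y ∈ V.carrier, V.le x y → W.le (f y) (f x)
  | circular V, circular W => ∀ x ∈ V.carrier, ∀ y ∈ V.carrier, ∀ z ∈ V.carrier,
      V.btw x y z → W.btw (f z) (f y) (f x)
  | _, _ => False

/-- There is a parameter-definable order-reversing bijection between `V` and `W`. -/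
def InReversingBijection (V : LinOrCircOn X) (W : LinOrCircOn Y) : Prop :=
  ∃ f : X → Y, Set.BijOn f V.carrier W.carrier ∧
    ParamDef L M {p : X × Y | p.1 ∈ V.carrier ∧ p.2 = f p.1} ∧ ReversesOrder f V W

/-- The map `f` preserves strict inequalities from the linear order `V`. -/
def PreservesOrder (f : X → Y) (V : LinOrdOn X) : LinOrCircOn Y → Prop
  | linear W => ∀ x ∈ V.carrier, ∀ y ∈ V.carrier, V.lt x y → W.lt (f x) (f y)
  | circular W => ∀ x ∈ V.carrier, ∀ y ∈ V.carrier, ∀ z ∈ V.carrier,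
      V.lt x y → V.lt y z → W.lt (f x) (f y) (f z)

/-- There is a parameter-definable order-preserving map from the linear order `V` into `W`. -/
def Embeds (V : LinOrdOn X) (W : LinOrCircOn Y) : Prop :=
  ∃ f : X → Y, Set.MapsTo f V.carrier W.carrier ∧
    ParamDef L M {p : X × Y | p.1 ∈ V.carrier ∧ p.2 = f p.1} ∧ PreservesOrder f V W

end

end LinOrCircOn

section Families

variable (L : FirstOrder.Language.{v, w}) (M : Type u) [L.Structure M]
  {F X : Type u} [Interp L M F] [Interp L M X]

/-- `(V a)` is a `0`-definable family of linear orders. -/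
def ZeroDefLinFamily (V : F → LinOrdOn X) : Prop :=
  ZeroDef L M {p : F × X | p.2 ∈ (V p.1).carrier} ∧
  ZeroDef L M {p : F × X × X |
    p.2.1 ∈ (V p.1).carrier ∧ p.2.2 ∈ (V p.1).carrier ∧ (V p.1).le p.2.1 p.2.2}

/-- `(W e)` is a `0`-interpretable family of linear or circular orders. -/
def ZeroDefFamily (W : F → LinOrCircOn X) : Prop :=
  ZeroDef L M {e : F | (W e).IsLin} ∧
  ZeroDef L M {p : F × X | p.2 ∈ (W p.1).carrier} ∧
  ZeroDef L M {p : F × X × X | (W p.1).leRel p.2.1 p.2.2} ∧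
  ZeroDef L M {p : F × X × X × X | (W p.1).btwRel p.2.1 p.2.2.1 p.2.2.2}

end Families

end DefOrd

open DefOrd

/-! Let G be the automorphism group of M. By the Ryll-Nardzewski theorem, a set of imaginaries is
0-definable iff it is G-invariant, definable over c iff it is invariant under the stabilizer of c,
and definable with parameters iff it is invariant under the pointwise stabilizer of some finite set
(`zeroDef_iff`, `defOver_iff`, `paramDef_iff`). So the whole argument can be carried out with group
actions. The basic object is a partial order Ω with an action of G: the disjoint union of the
definable completions of all the V_a and of their reverses. The properties that are used are
collected in `OrdSys`: definable suprema exist, finitely many cuts are fixed by a given open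
subgroup, a definable family of disjoint non-trivial convex sets is finite (topological rank 1), and
no cut is fixed by the stabilizer of its order (weak transitivity). A first consequence is
`rel_total`: a convex relation invariant under the stabilizer of an order is trivial, so a local
property that holds on one interval holds on the whole order.

Call two elements of Ω equivalent (`Eqv`) if a definable isomorphism between intervals around them
takes one to the other. Minimal orders are rigid: equivalent elements of the same order are equal
(`Eqv.eq_of_cmp`), and an order is nowhere locally isomorphic to its reverse (`not_eqv_nu`).
Otherwise an interval would contain arbitrarily many disjoint copies of one of its subintervals;
each copy contains an element definable over two points of the model interval
(`exists_fixed_of_copy`), and by omega-categoricity the number of such elements is bounded.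
Therefore the orders can be glued along equivalent points, and the W_e are the connected components
of the result.

The rank of D makes this gluing Hausdorff. If two orders agree up to some cut but not at it, then
branching occurs cofinally in the order (`Branch.exists_gt`). The sets of orders that branch off at
distinct cuts are disjoint, and the same phenomenon recurs inside each of them, so D has rank at
least α for every α (`rankGE_covering`). Once the gluing is Hausdorff, two overlapping intervals
either form an interval or close up (`Hausdorff.arc_trans`), so every component is a line or a
circle. G acts on the glued points and on the components with finitely many orbits and open
stabilizers, so both sets are interpretable (`exists_interp`).

The remaining claims rest on one principle: a strictly increasing definable map from a dense part of
an interval to a completion agrees somewhere with a local isomorphism, i.e. with `Eqv`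
(`exists_eqv_of_strictMono`). Hence, if suborders of two components are intertwined, possibly after
a reversal, then the components are equal or reverse to each other; a definable embedding of V_a in
a component forces V_a to belong to that component; and a definable order-preserving map from a
circle to its completion is the identity. Topological rank 1 and weak transitivity pass from the
charts to the components (`Chartable.finite_classes`, `exists_mem_of_invariant`). -/

namespace DefOrd

open FirstOrder FirstOrder.Language

/-! ### Types, automorphisms and the Ryll-Nardzewski theorem -/

section RyllNardzewski

variable (L : FirstOrder.Language.{v, w}) {M : Type u} [L.Structure M]

/-- Two tuples have the same complete type over the empty set. -/
def TpEq {ι : Type*} (a b : ι → M) : Prop :=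
  ∀ S : Set (ι → M), (∅ : Set M).Definable L S → (a ∈ S ↔ b ∈ S)

variable {L}

theorem TpEq.symm {ι : Type*} {a b : ι → M} (h : TpEq L a b) : TpEq L b a :=
  fun S hS => (h S hS).symm

theorem TpEq.comp {ι κ : Type*} {a b : ι → M} (h : TpEq L a b) (f : κ → ι) :
    TpEq L (a ∘ f) (b ∘ f) := fun S hS => by
  simpa using h _ (hS.preimage_comp f)

theorem tpEq_equiv {ι : Type*} (a : ι → M) (σ : M ≃[L] M) : TpEq L a (σ ∘ a) := by
  intro S hS
  obtain ⟨φ, rfl⟩ := Set.empty_definable_iff.1 hS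
  exact (StrongHomClass.realize_formula σ φ).symm

theorem OmegaCategorical.finite_reps (hM : OmegaCategorical L M) (ι : Type*) [Finite ι] :
    ∃ T : Set (ι → M), T.Finite ∧ ∀ x, ∃ t ∈ T, ∃ σ : M ≃[L] M, σ ∘ t = x := by
  obtain ⟨n, ⟨e⟩⟩ := Finite.exists_equiv_fin ι
  obtain ⟨T, hT, h⟩ := hM n
  refine ⟨(fun t => t ∘ e) '' T, hT.image _, fun x => ?_⟩
  obtain ⟨t, ht, σ, hσ⟩ := h (x ∘ e.symm)
  refine ⟨_, ⟨t, ht, rfl⟩, σ, ?_⟩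
  funext i
  have := congrFun hσ (e i)
  simpa using this

/-- Finitely many orbits of tuples realize finitely many types, so intersecting one separating
definable set for each representative isolates the type of `a`. -/
theorem OmegaCategorical.definable_tpClass (hM : OmegaCategorical L M) {ι : Type*} [Finite ι]
    (a : ι → M) : (∅ : Set M).Definable L {x | TpEq L a x} := by
  classical
  obtain ⟨T, hT, h⟩ := hM.finite_reps ι
  have sep : ∀ t : ι → M, ∃ S, (∅ : Set M).Definable L S ∧ a ∈ S ∧ (¬ TpEq L a t → t ∉ S) := by
    intro t
    by_cases ht : TpEq L a t
    · exact ⟨Set.univ, Set.definable_univ, trivial, fun h => absurd ht h⟩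
    · have ht' := ht
      simp only [TpEq, not_forall] at ht'
      obtain ⟨S, hS, hn⟩ := ht'
      by_cases haS : a ∈ S
      · exact ⟨S, hS, haS, fun _ htS => hn (by simp [haS, htS])⟩
      · refine ⟨Sᶜ, hS.compl, haS, fun _ htS => hn ?_⟩
        have : t ∉ S := htS
        simp [haS, this]
  choose S hS haS htS using sep
  have key : {x | TpEq L a x} = ⋂ t ∈ hT.toFinset, S t := by
    ext x
    simp only [Set.mem_ofPred_eq, Set.mem_iInter, Set.Finite.mem_toFinset]
    constructor
    · intro hx t _
      exact (hx _ (hS t)).1 (haS t)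
    · intro hx
      obtain ⟨t, ht, σ, rfl⟩ := h x
      have h1 := tpEq_equiv t σ
      by_cases hat : TpEq L a t
      · exact fun S' hS' => (hat S' hS').trans (h1 S' hS')
      · exact absurd ((h1 _ (hS t)).2 (hx t ht)) (htS t hat)
  rw [key]
  exact Set.definable_biInter_finset hS _

/-- The back-and-forth step: the type of `(a, c)` is isolated by a definable set, whose projection
is definable and contains `a`, hence `b`. -/
theorem OmegaCategorical.tpEq_extend (hM : OmegaCategorical L M) {ι : Type u} [Finite ι]
    {a b : ι → M} (h : TpEq L a b) (c : M) :
    ∃ d, TpEq L (Sum.elim a (fun _ : Unit => c)) (Sum.elim b (fun _ : Unit => d)) := by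
  have h1 := (hM.definable_tpClass (Sum.elim a (fun _ : Unit => c)))
  have h2 := h1.image_comp (Sum.inl : ι → ι ⊕ Unit)
  have h3 := (h _ h2).1 ⟨_, fun _ _ => Iff.rfl, by simp⟩
  obtain ⟨x, hx, hxb⟩ := h3
  refine ⟨x (Sum.inr ()), ?_⟩
  subst hxb
  have e : Sum.elim ((fun g : ι ⊕ Unit → M => g ∘ Sum.inl) x) (fun _ : Unit => x (Sum.inr ()))
      = x := by
    funext i
    rcases i with i | i <;> rfl
  rw [e]
  exact hx

/-- A finite partial elementary map. -/
def ElemPairs (L : FirstOrder.Language.{v, w}) {M : Type u} [L.Structure M]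
    (f : Finset (M × M)) : Prop :=
  TpEq L (fun p : f => p.1.1) (fun p : f => p.1.2)

theorem elemPairs_of_tpEq {ι : Type u} {a b : ι → M} (h : TpEq L a b) (f : Finset (M × M))
    (hf : ∀ p ∈ f, ∃ i, (a i, b i) = p) : ElemPairs L f := by
  choose g hg using fun p : f => hf p.1 p.2
  have e1 : (fun p : f => p.1.1) = a ∘ g := funext fun p => (congrArg Prod.fst (hg p)).symm
  have e2 : (fun p : f => p.1.2) = b ∘ g := funext fun p => (congrArg Prod.snd (hg p)).symm
  unfold ElemPairs
  rw [e1, e2]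
  exact h.comp g

theorem OmegaCategorical.elemPairs_extend (hM : OmegaCategorical L M) {f : Finset (M × M)}
    (hf : ElemPairs L f) (c : M) : ∃ g, f ⊆ g ∧ ElemPairs L g ∧ ∃ d, (c, d) ∈ g := by
  classical
  obtain ⟨d, hd⟩ := hM.tpEq_extend hf c
  refine ⟨insert (c, d) f, Finset.subset_insert _ _, ?_, d, Finset.mem_insert_self _ _⟩
  have h2 := hd
  refine elemPairs_of_tpEq (hd.comp (fun x : ↥f ⊕ PUnit.{u+1} => x.map id (fun _ => ()))) _ ?_
  intro p hp
  rcases Finset.mem_insert.1 hp with rfl | hp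
  · exact ⟨Sum.inr ⟨⟩, rfl⟩
  · exact ⟨Sum.inl ⟨p, hp⟩, rfl⟩

theorem ElemPairs.swap {f : Finset (M × M)} (hf : ElemPairs L f) :
    ElemPairs L (f.map (Equiv.prodComm M M).toEmbedding) := by
  refine elemPairs_of_tpEq hf.symm _ ?_
  intro p hp
  obtain ⟨q, hq, rfl⟩ := Finset.mem_map.1 hp
  exact ⟨⟨q, hq⟩, rfl⟩

theorem OmegaCategorical.elemPairs_extend' (hM : OmegaCategorical L M) {f : Finset (M × M)}
    (hf : ElemPairs L f) (d : M) : ∃ g, f ⊆ g ∧ ElemPairs L g ∧ ∃ c, (c, d) ∈ g := by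
  obtain ⟨g, hg, hgE, c, hc⟩ := hM.elemPairs_extend hf.swap d
  refine ⟨_, ?_, hgE.swap, c, Finset.mem_map.2 ⟨_, hc, rfl⟩⟩
  intro p hp
  exact Finset.mem_map.2 ⟨p.swap, hg (Finset.mem_map.2 ⟨p, hp, rfl⟩), by simp⟩

theorem ElemPairs.tpEq {f : Finset (M × M)} (hf : ElemPairs L f) {ι : Type*} {x y : ι → M}
    (h : ∀ i, (x i, y i) ∈ f) : TpEq L x y :=
  hf.comp (fun i => (⟨(x i, y i), h i⟩ : f))

theorem definable_eq_funMap {n : ℕ} (F : L.Functions n) :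
    (∅ : Set M).Definable L
      {v : Option (Fin n) → M | v none = Structure.funMap F (v ∘ some)} := by
  rw [Set.empty_definable_iff]
  refine ⟨Term.equal (Term.var none) (Term.func F fun i => Term.var (some i)), ?_⟩
  ext v
  simp [Formula.Realize, Term.equal, Function.comp_def]

theorem definable_relMap {n : ℕ} (R : L.Relations n) :
    (∅ : Set M).Definable L {v : Fin n → M | Structure.RelMap R v} := by
  rw [Set.empty_definable_iff]
  refine ⟨Relations.formula R fun i => Term.var i, ?_⟩
  ext v
  simp [Formula.realize_rel]

/-- Tuples with the same type are conjugate under automorphisms. -/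
theorem OmegaCategorical.exists_equiv [Countable M] (hM : OmegaCategorical L M) {ι : Type}
    [Finite ι] {a b : ι → M} (h : TpEq L a b) : ∃ σ : M ≃[L] M, σ ∘ a = b := by
  classical
  let P := {f : Finset (M × M) // ElemPairs L f}
  have := Fintype.ofFinite ι
  let f0 : P := ⟨Finset.univ.image fun i => (a i, b i),
    elemPairs_of_tpEq (h.comp (ULift.down : ULift.{u} ι → ι)) _ fun p hp => by
      obtain ⟨i, -, rfl⟩ := Finset.mem_image.1 hp
      exact ⟨⟨i⟩, rfl⟩⟩
  -- Back and forth in the form of a generic ideal. For each element of M there is one cofinal set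
  -- of partial maps having it in the domain and one having it in the range; these are countably
  -- many, and the union of an ideal that meets them all is the graph of the automorphism.
  let C : M ⊕ M → Order.Cofinal P := Sum.elim
    (fun c => ⟨{f | ∃ d, (c, d) ∈ f.1}, fun f => by
      obtain ⟨g, h1, h2, h3⟩ := hM.elemPairs_extend f.2 c
      exact ⟨⟨g, h2⟩, h3, h1⟩⟩)
    (fun d => ⟨{f | ∃ c, (c, d) ∈ f.1}, fun f => by
      obtain ⟨g, h1, h2, h3⟩ := hM.elemPairs_extend' f.2 d
      exact ⟨⟨g, h2⟩, h3, h1⟩⟩)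
  have : Encodable (M ⊕ M) := Encodable.ofCountable _
  let I := Order.idealOfCofinals f0 C
  let R : Set (M × M) := {p | ∃ f ∈ I, p ∈ f.1}
  have tot1 : ∀ c, ∃ d, (c, d) ∈ R := fun c => by
    obtain ⟨f, ⟨d, hd⟩, hf⟩ := Order.cofinal_meets_idealOfCofinals f0 C (Sum.inl c)
    exact ⟨d, f, hf, hd⟩
  have tot2 : ∀ d, ∃ c, (c, d) ∈ R := fun c => by
    obtain ⟨f, ⟨d, hd⟩, hf⟩ := Order.cofinal_meets_idealOfCofinals f0 C (Sum.inr c)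
    exact ⟨d, f, hf, hd⟩
  -- By directedness, finitely many pairs of `R` lie in a single finite elementary map; so finite
  -- tuples related by `R` have the same type.
  have fin : ∀ s : Finset (M × M), (s : Set (M × M)) ⊆ R → ∃ f ∈ I, s ⊆ f.1 := by
    intro s
    induction s using Finset.induction_on with
    | empty => exact fun _ => ⟨f0, Order.mem_idealOfCofinals f0 C, by simp⟩
    | insert p s _ ih =>
      intro hs
      obtain ⟨f, hf, hsf⟩ := ih (fun q hq => hs (by simp [Finset.mem_coe.1 hq]))
      obtain ⟨g, hg, hpg⟩ := hs (show p ∈ _ by simp)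
      obtain ⟨k, hk, h1, h2⟩ := I.directed f hf g hg
      refine ⟨k, hk, fun q hq => ?_⟩
      rcases Finset.mem_insert.1 hq with rfl | hq
      · exact h2 hpg
      · exact h1 (hsf hq)
  have tp : ∀ (κ : Type) [Finite κ] (x y : κ → M), (∀ i, (x i, y i) ∈ R) → TpEq L x y := by
    intro κ _ x y hxy
    have := Fintype.ofFinite κ
    obtain ⟨f, hf, hs⟩ := fin (Finset.univ.image fun i => (x i, y i)) (by
      intro p hp
      obtain ⟨i, -, rfl⟩ := Finset.mem_image.1 (Finset.mem_coe.1 hp)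
      exact hxy i)
    exact f.2.tpEq (fun i => hs (Finset.mem_image.2 ⟨i, Finset.mem_univ _, rfl⟩))
  have diag : (∅ : Set M).Definable L {v : Fin 2 → M | v 0 = v 1} := by
    rw [Set.empty_definable_iff]
    refine ⟨Term.equal (Term.var 0) (Term.var 1), ?_⟩
    ext v
    simp [Formula.Realize, Term.equal]
  have inj : ∀ c d c' d', (c, d) ∈ R → (c', d') ∈ R → (c = c' ↔ d = d') := by
    intro c d c' d' h1 h2
    have := tp (Fin 2) ![c, c'] ![d, d'] (by
      intro i; fin_cases i
      · exact h1
      · exact h2) _ diag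
    simpa using this
  choose F hF using tot1
  choose G hG using tot2
  let e : M ≃ M := ⟨F, G, fun x => ((inj _ _ _ _ (hG (F x)) (hF x)).2 rfl),
    fun x => (inj _ _ _ _ (hF (G x)) (hG x)).1 rfl⟩
  refine ⟨⟨e, ?_, ?_⟩, ?_⟩
  · intro n f x
    have := tp (Option (Fin n)) (fun o => o.elim (Structure.funMap f x) x)
      (fun o => o.elim (F (Structure.funMap f x)) (F ∘ x)) (by
        intro i; cases i
        · exact hF _
        · exact hF _) _ (definable_eq_funMap f)
    exact this.1 rfl
  · intro n r x
    exact (tp (Fin n) x (F ∘ x) (fun i => hF _) _ (definable_relMap r)).symm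
  · funext i
    have h1 : (a i, b i) ∈ R :=
      ⟨f0, Order.mem_idealOfCofinals f0 C, Finset.mem_image.2 ⟨i, Finset.mem_univ _, rfl⟩⟩
    exact (inj _ _ _ _ (hF (a i)) h1).1 rfl

/-- The Ryll-Nardzewski theorem: invariant sets of finite tuples are definable. -/
theorem OmegaCategorical.definable_of_invariant [Countable M] (hM : OmegaCategorical L M)
    {ι : Type} [Finite ι] {S : Set (ι → M)} (hS : ∀ σ : M ≃[L] M, ∀ x ∈ S, σ ∘ x ∈ S) :
    (∅ : Set M).Definable L S := by
  classical
  obtain ⟨T, hT, h⟩ := hM.finite_reps ι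
  have key : S = ⋃ t ∈ (hT.subset (Set.inter_subset_left : T ∩ S ⊆ T)).toFinset,
      {x | TpEq L t x} := by
    ext x
    simp only [Set.mem_iUnion, Set.Finite.mem_toFinset, Set.mem_ofPred_eq, exists_prop]
    constructor
    · intro hx
      obtain ⟨t, ht, σ, rfl⟩ := h x
      refine ⟨t, ⟨ht, ?_⟩, tpEq_equiv t σ⟩
      have := hS σ.symm _ hx
      convert this
      funext i
      simp
    · rintro ⟨t, ⟨_, ht⟩, htx⟩
      obtain ⟨σ, rfl⟩ := hM.exists_equiv htx
      exact hS σ t ht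
  rw [key]
  exact Set.definable_biUnion_finset hM.definable_tpClass _

end RyllNardzewski

end DefOrd

/-! ### The automorphism group acting on imaginaries; definability as invariance -/

namespace DefOrd

open FirstOrder FirstOrder.Language

section Action

variable (L : FirstOrder.Language.{v, w}) (M : Type u) [L.Structure M]

/-- The automorphism group of `M`, as a group of permutations. -/
def autGroup : Subgroup (Equiv.Perm M) where
  carrier := {e | ∃ σ : M ≃[L] M, ⇑σ = ⇑e}
  one_mem' := ⟨FirstOrder.Language.Equiv.refl L M, rfl⟩
  mul_mem' := by
    rintro a b ⟨σ, hσ⟩ ⟨τ, hτ⟩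
    refine ⟨σ.comp τ, ?_⟩
    funext x
    simp [hσ, hτ]
  inv_mem' := by
    rintro a ⟨σ, hσ⟩
    refine ⟨σ.symm, ?_⟩
    funext x
    apply σ.injective
    have := congrFun hσ (a⁻¹ x)
    rw [this]
    simp

variable {L M}

/-- An automorphism as an element of the automorphism group. -/
def autGroup.ofEquiv (σ : M ≃[L] M) : autGroup L M := ⟨σ.toEquiv, σ, rfl⟩

/-- `g` fixes `s` pointwise. -/
def Fixes (s : Finset M) (g : autGroup L M) : Prop := ∀ m ∈ s, g.1 m = m

variable {X Y : Type*} [hX : Interp L M X] [hY : Interp L M Y]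

/-- The equivalence relation that presents `X` is 0-definable, so automorphisms preserve it; this
makes `act` independent of the representing tuple. -/
theorem rep_smul_aux (g : autGroup L M) {m m' : hX.ι → M} {x : X} (h : hX.rep m x)
    (h' : hX.rep m' x) : ∃ y, hX.rep (g.1 ∘ m) y ∧ hX.rep (g.1 ∘ m') y := by
  obtain ⟨σ, hσ⟩ := g.2
  have := tpEq_equiv (Sum.elim m m') σ _ hX.definable_rel
  obtain ⟨y, h1, h2⟩ := this.1 ⟨x, by simpa using h, by simpa using h'⟩
  refine ⟨y, ?_, ?_⟩
  · rw [← hσ]; exact h1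
  · rw [← hσ]; exact h2

/-- The action of an automorphism on an interpretable set. -/
noncomputable def act (g : autGroup L M) (x : X) : X :=
  (rep_smul_aux g (hX.rep_surj x).choose_spec (hX.rep_surj x).choose_spec).choose

theorem rep_act (g : autGroup L M) {m : hX.ι → M} {x : X} (h : hX.rep m x) :
    hX.rep (g.1 ∘ m) (act g x) := by
  obtain ⟨y, h1, h2⟩ := rep_smul_aux g h (hX.rep_surj x).choose_spec
  have h3 := (rep_smul_aux g (hX.rep_surj x).choose_spec (hX.rep_surj x).choose_spec).choose_spec.1
  have : y = act g x := hX.rep_unique _ _ _ h2 h3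
  exact this ▸ h1

theorem act_eq_of_rep (g : autGroup L M) {m : hX.ι → M} {x y : X} (h : hX.rep m x)
    (h' : hX.rep (g.1 ∘ m) y) : act g x = y :=
  hX.rep_unique _ _ _ (rep_act g h) h'

@[simp] theorem act_one (x : X) : act (1 : autGroup L M) x = x := by
  obtain ⟨m, hm⟩ := hX.rep_surj x
  exact act_eq_of_rep _ hm hm

theorem act_mul (g h : autGroup L M) (x : X) : act (g * h) x = act g (act h x) := by
  obtain ⟨m, hm⟩ := hX.rep_surj x
  exact act_eq_of_rep _ hm (rep_act g (rep_act h hm))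

@[simp] theorem act_prod (g : autGroup L M) (p : X × Y) : act g p = (act g p.1, act g p.2) := by
  obtain ⟨m, hm⟩ := hX.rep_surj p.1
  obtain ⟨n, hn⟩ := hY.rep_surj p.2
  refine act_eq_of_rep (hX := instInterpProd L M X Y) g (m := Sum.elim m n) ⟨hm, hn⟩ ⟨?_, ?_⟩
  · exact rep_act g hm
  · exact rep_act g hn

@[simp] theorem act_inv_act (g : autGroup L M) (x : X) : act g⁻¹ (act g x) = x := by
  rw [← act_mul]; simp

@[simp] theorem act_act_inv (g : autGroup L M) (x : X) : act g (act g⁻¹ x) = x := by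
  rw [← act_mul]; simp

theorem act_injective (g : autGroup L M) : Function.Injective (act g : X → X) :=
  fun x y h => by rw [← act_inv_act g x, h, act_inv_act]

variable (L M) in
/-- Every element has a finite support. -/
theorem exists_support (x : X) : ∃ s : Finset M, ∀ g : autGroup L M, Fixes s g → act g x = x := by
  classical
  obtain ⟨m, hm⟩ := hX.rep_surj x
  have := hX.finite
  have := Fintype.ofFinite hX.ι
  refine ⟨Finset.univ.image m, fun g hg => act_eq_of_rep g hm ?_⟩
  have : g.1 ∘ m = m := funext fun i => hg _ (Finset.mem_image.2 ⟨i, Finset.mem_univ _, rfl⟩)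
  rw [this]
  exact hm

theorem exists_tuple (s : Finset M) : ∃ (n : ℕ) (m : Fin n → M), Set.range m = s :=
  ⟨s.card, fun i => (s.equivFin.symm i).1, by
    ext x
    constructor
    · rintro ⟨i, rfl⟩
      exact (s.equivFin.symm i).2
    · intro hx
      exact ⟨s.equivFin ⟨x, hx⟩, by simp⟩⟩

theorem fixes_iff_comp {s : Finset M} {n : ℕ} {m : Fin n → M} (hm : Set.range m = s)
    (g : autGroup L M) : Fixes s g ↔ g.1 ∘ m = m := by
  constructor
  · exact fun h => funext fun i => h _ (by rw [← Finset.mem_coe, ← hm]; exact ⟨i, rfl⟩)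
  · intro h x hx
    rw [← Finset.mem_coe, ← hm] at hx
    obtain ⟨i, rfl⟩ := hx
    exact congrFun h i

variable (X) in
/-- The pointwise stabilizer of a finite set has finitely many orbits. -/
theorem OmegaCategorical.finite_orbits (hM : OmegaCategorical L M) (s : Finset M) :
    ∃ T : Set X, T.Finite ∧ ∀ x, ∃ t ∈ T, ∃ g : autGroup L M, Fixes s g ∧ act g t = x := by
  classical
  obtain ⟨n, m, hm⟩ := exists_tuple s
  have := hX.finite
  obtain ⟨T, hT, h⟩ := hM.finite_reps (Fin n ⊕ hX.ι)
  -- A conjugate of `t` prolongs the enumeration `m` of `s` by a tuple representing `x`. Two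
  -- elements that are good for the same `t` are conjugate by an automorphism fixing `m`, so one of
  -- them is kept for each `t`.
  let Good (t : Fin n ⊕ hX.ι → M) (x : X) : Prop :=
    ∃ (σ : M ≃[L] M) (v : hX.ι → M), σ ∘ t = Sum.elim m v ∧ hX.rep v x
  refine ⟨{x | ∃ t ∈ T, ∃ h : ∃ x, Good t x, x = h.choose}, ?_, fun x => ?_⟩
  · refine (hT.biUnion (t := fun t => {x | ∃ h : ∃ x, Good t x, x = h.choose})
      fun t _ => ?_).subset ?_
    · refine Set.Subsingleton.finite ?_
      rintro _ ⟨h, rfl⟩ _ ⟨h', rfl⟩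
      rfl
    · rintro x ⟨t, ht, h⟩
      exact Set.mem_biUnion ht h
  · obtain ⟨v, hv⟩ := hX.rep_surj x
    obtain ⟨t, ht, σ, hσ⟩ := h (Sum.elim m v)
    have ex : ∃ x, Good t x := ⟨x, σ, v, hσ, hv⟩
    obtain ⟨σ', v', hσ', hv'⟩ := ex.choose_spec
    refine ⟨ex.choose, ⟨t, ht, ex, rfl⟩, autGroup.ofEquiv σ * (autGroup.ofEquiv σ')⁻¹, ?_, ?_⟩
    · rw [fixes_iff_comp hm]
      funext i
      have h1 := congrFun hσ' (Sum.inl i)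
      have h2 := congrFun hσ (Sum.inl i)
      simp only [Function.comp, Sum.elim_inl] at h1 h2 ⊢
      have h3 : (autGroup.ofEquiv σ').1⁻¹ (m i) = t (Sum.inl i) := by
        rw [Equiv.Perm.inv_eq_iff_eq, ← h1]; rfl
      change σ ((autGroup.ofEquiv σ').1⁻¹ (m i)) = m i
      rw [h3, h2]
    · refine act_eq_of_rep _ hv' ?_
      convert hv using 1
      funext i
      have h1 := congrFun hσ' (Sum.inr i)
      have h2 := congrFun hσ (Sum.inr i)
      simp only [Function.comp, Sum.elim_inr] at h1 h2 ⊢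
      have h3 : (autGroup.ofEquiv σ').1⁻¹ (v' i) = t (Sum.inr i) := by
        rw [Equiv.Perm.inv_eq_iff_eq, ← h1]; rfl
      change σ ((autGroup.ofEquiv σ').1⁻¹ (v' i)) = v i
      rw [h3, h2]

/-- For the converse, let `m` enumerate the finite set `s`. The union of the conjugates of {m} × Z
is invariant, hence 0-definable, and its fibre at `m` is Z again, because an automorphism taking `m`
to itself fixes `s` pointwise. -/
theorem paramDef_iff [Countable M] (hM : OmegaCategorical L M) {Z : Set X} :
    ParamDef L M Z ↔
      ∃ s : Finset M, ∀ g : autGroup L M, Fixes s g → ∀ x ∈ Z, act g x ∈ Z := by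
  constructor
  · intro h
    obtain ⟨A, -, hA⟩ := Set.definable_iff_finitely_definable.1 h
    obtain ⟨φ, hφ⟩ := Set.definable_iff_exists_formula_sum.1 hA
    refine ⟨A, fun g hg x hx => ?_⟩
    obtain ⟨m, hm⟩ := hX.rep_surj x
    obtain ⟨σ, hσ⟩ := g.2
    have h1 : m ∈ pullback L M Z := ⟨x, hx, hm⟩
    rw [hφ] at h1
    have h2 := (StrongHomClass.realize_formula σ φ).2 h1
    have h3 : (σ ∘ Sum.elim (fun a : (A : Set M) => (a : M)) m)
        = Sum.elim (fun a : (A : Set M) => (a : M)) (g.1 ∘ m) := by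
      funext i
      rcases i with i | i
      · simp only [Function.comp, Sum.elim_inl, hσ]
        exact hg _ i.2
      · simp [hσ]
    rw [h3] at h2
    have h4 : g.1 ∘ m ∈ pullback L M Z := by rw [hφ]; exact h2
    obtain ⟨y, hy, hy'⟩ := h4
    rwa [act_eq_of_rep g hm hy']
  · rintro ⟨s, hs⟩
    obtain ⟨n, m, hm⟩ := exists_tuple s
    have := hX.finite
    have hd : (∅ : Set M).Definable L {p : Fin n ⊕ hX.ι → M | ∃ g : autGroup L M,
        ∃ v ∈ pullback L M Z, p = g.1 ∘ Sum.elim m v} := by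
      refine hM.definable_of_invariant ?_
      rintro σ _ ⟨g, v, hv, rfl⟩
      exact ⟨autGroup.ofEquiv σ * g, v, hv, rfl⟩
    obtain ⟨φ, hφ⟩ := Set.empty_definable_iff.1 hd
    refine Set.definable_iff_exists_formula_sum.2
      ⟨φ.relabel (Sum.map (fun i => ⟨m i, trivial⟩) id), ?_⟩
    ext v
    have e : (Sum.elim (fun a : (Set.univ : Set M) => (a : M)) v) ∘
        (Sum.map (fun i => (⟨m i, trivial⟩ : (Set.univ : Set M))) id) = Sum.elim m v := by
      funext i
      rcases i with i | i <;> rfl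
    rw [Set.mem_ofPred_eq, Formula.realize_relabel, e]
    have h1 : φ.Realize (Sum.elim m v) ↔ Sum.elim m v ∈ {p : Fin n ⊕ hX.ι → M |
      ∃ g : autGroup L M, ∃ v ∈ pullback L M Z, p = g.1 ∘ Sum.elim m v} := by rw [hφ]; rfl
    rw [h1]
    constructor
    · exact fun hv => ⟨1, v, hv, rfl⟩
    · rintro ⟨g, v', ⟨x, hx, hx'⟩, he⟩
      have hg : Fixes s g := by
        rw [fixes_iff_comp hm]
        funext i
        exact (congrFun he (Sum.inl i)).symm
      refine ⟨_, hs g hg x hx, ?_⟩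
      have : v = g.1 ∘ v' := funext fun i => congrFun he (Sum.inr i)
      rw [this]
      exact rep_act g hx'

theorem zeroDef_iff [Countable M] (hM : OmegaCategorical L M) {Z : Set X} :
    ZeroDef L M Z ↔ ∀ g : autGroup L M, ∀ x ∈ Z, act g x ∈ Z := by
  constructor
  · intro h g x hx
    obtain ⟨m, hm⟩ := hX.rep_surj x
    obtain ⟨σ, hσ⟩ := g.2
    obtain ⟨y, hy, hy'⟩ := (tpEq_equiv m σ _ h).1 ⟨x, hx, hm⟩
    rw [hσ] at hy'
    rwa [act_eq_of_rep g hm hy']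
  · intro h
    have := hX.finite
    refine hM.definable_of_invariant ?_
    rintro σ m ⟨x, hx, hm⟩
    exact ⟨_, h (autGroup.ofEquiv σ) x hx, rep_act (autGroup.ofEquiv σ) hm⟩

theorem defOver_iff [Countable M] (hM : OmegaCategorical L M) {c : Y} {Z : Set X} :
    DefOver L M c Z ↔ ∀ g : autGroup L M, act g c = c → ∀ x ∈ Z, act g x ∈ Z := by
  constructor
  · rintro ⟨R, hR, rfl⟩ g hg x hx
    have := (zeroDef_iff hM).1 hR g _ hx
    rwa [act_prod, hg] at this
  · intro h
    refine ⟨{p | ∃ g : autGroup L M, ∃ x ∈ Z, p = (act g c, act g x)}, ?_, ?_⟩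
    · rw [zeroDef_iff hM]
      rintro g _ ⟨k, x, hx, rfl⟩
      exact ⟨g * k, x, hx, by simp [act_mul]⟩
    · ext x
      constructor
      · exact fun hx => ⟨1, x, hx, by simp⟩
      · rintro ⟨g, y, hy, he⟩
        rw [Prod.mk.injEq] at he
        rw [he.2]
        exact h g he.1.symm y hy

/-- An action with finitely many orbits and open stabilizers comes from a presentation as an
interpretable set. -/
theorem exists_interp [Countable M] [Nontrivial M] (hM : OmegaCategorical L M) {Y : Type u}
    [MulAction (autGroup L M) Y] (T : Set Y) (hT : T.Finite)
    (orb : ∀ y, ∃ t ∈ T, ∃ g : autGroup L M, g • t = y)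
    (supp : ∀ y : Y, ∃ s : Finset M, ∀ g : autGroup L M, Fixes s g → g • y = y) :
    ∃ h : Interp L M Y, ∀ (g : autGroup L M) (y : Y), act (hX := h) g y = g • y := by
  classical
  choose S hS using supp
  obtain ⟨n, m, hm⟩ := exists_tuple (hT.toFinset.biUnion S)
  have hT' : ∀ t ∈ T, ∀ g : autGroup L M, g.1 ∘ m = m → g • t = t := by
    intro t ht g hg
    refine hS t g fun x hx => (fixes_iff_comp hm g).2 hg x ?_
    exact Finset.mem_biUnion.2 ⟨t, hT.mem_toFinset.2 ht, hx⟩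
  have := hT.to_subtype
  obtain ⟨k, ⟨e⟩⟩ := Finite.exists_equiv_fin T
  -- The element g • t is coded by the tuple g ∘ m, where `m` enumerates supports of all the
  -- representatives, together with the index `i` of t. The index is coded by equalities only, so
  -- that automorphisms preserve it: `i` is the unique place where the second block differs from its
  -- coordinate `none`. This takes two distinct elements of M.
  let R (p : Fin n ⊕ Option (Fin k) → M) (y : Y) : Prop := ∃ (i : Fin k) (g : autGroup L M),
    p ∘ Sum.inl = g.1 ∘ m ∧ (∀ j, p (Sum.inr (some j)) ≠ p (Sum.inr none) ↔ j = i) ∧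
      y = g • (e.symm i).1
  have R_smul : ∀ (σ : autGroup L M) p y, R p y → R (σ.1 ∘ p) (σ • y) := by
    rintro σ p y ⟨i, g, h1, h2, rfl⟩
    refine ⟨i, σ * g, ?_, ?_, ?_⟩
    · rw [Function.comp_assoc, h1]
      rfl
    · intro j
      rw [← h2]
      simp
    · rw [mul_smul]
  have R_unique : ∀ p x y, R p x → R p y → x = y := by
    rintro p x y ⟨i, g, h1, h2, rfl⟩ ⟨j, h, h3, h4, rfl⟩
    have : j = i := by rw [← h2, h4]
    subst this
    have h5 : (g⁻¹ * h) • (e.symm j).1 = (e.symm j).1 := by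
      apply hT' _ (e.symm j).2
      have : h.1 ∘ m = g.1 ∘ m := by rw [← h1, ← h3]
      funext i
      have := congrFun this i
      simp only [Function.comp] at this
      simp [this]
    rw [mul_smul, inv_smul_eq_iff] at h5
    exact h5.symm
  have R_surj : ∀ y, ∃ p, R p y := by
    intro y
    obtain ⟨t, ht, g, rfl⟩ := orb y
    obtain ⟨a, b, hab⟩ := exists_pair_ne M
    refine ⟨Sum.elim (g.1 ∘ m) (fun o => if o = some (e ⟨t, ht⟩) then a else b),
      e ⟨t, ht⟩, g, rfl, fun j => ?_, by simp⟩
    by_cases hj : j = e ⟨t, ht⟩ <;> simp [hj, hab]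
  have R_def : (∅ : Set M).Definable L {p : (Fin n ⊕ Option (Fin k)) ⊕ (Fin n ⊕ Option (Fin k)) → M |
      ∃ x, R (p ∘ Sum.inl) x ∧ R (p ∘ Sum.inr) x} := by
    refine hM.definable_of_invariant ?_
    rintro σ p ⟨x, h1, h2⟩
    exact ⟨autGroup.ofEquiv σ • x, R_smul (autGroup.ofEquiv σ) _ _ h1,
      R_smul (autGroup.ofEquiv σ) _ _ h2⟩
  refine ⟨⟨Fin n ⊕ Option (Fin k), inferInstance, R, R_unique, R_surj, R_def⟩, fun g y => ?_⟩
  obtain ⟨p, hp⟩ := R_surj y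
  exact act_eq_of_rep (hX := ⟨Fin n ⊕ Option (Fin k), inferInstance, R, R_unique, R_surj, R_def⟩)
    g hp (R_smul g p y hp)

end Action

end DefOrd

/-! ### Abstract systems of minimal orders; invariant convex relations -/

namespace DefOrd

open MulAction Set

/-- Two points of a disjoint union of linear orders are in the same component. -/
def Cmp {Ω : Type*} [PartialOrder Ω] (x y : Ω) : Prop := x ≤ y ∨ y ≤ x

theorem Cmp.symm {Ω : Type*} [PartialOrder Ω] {x y : Ω} (h : Cmp x y) : Cmp y x := Or.symm h

theorem Cmp.lt_or_le {Ω : Type*} [PartialOrder Ω] {x y : Ω} (h : Cmp x y) : x < y ∨ y ≤ x := by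
  rcases h with h | h
  · rcases h.lt_or_eq with h | h
    · exact Or.inl h
    · exact Or.inr h.ge
  · exact Or.inr h

theorem Cmp.lt_or_eq_or_gt {Ω : Type*} [PartialOrder Ω] {x y : Ω} (h : Cmp x y) :
    x < y ∨ x = y ∨ y < x := by
  rcases h.lt_or_le with h | h
  · exact Or.inl h
  · exact Or.inr (h.lt_or_eq.symm.imp_left Eq.symm)

theorem Cmp.refl {Ω : Type*} [PartialOrder Ω] (x : Ω) : Cmp x x := Or.inl le_rfl

theorem _root_.LE.le.cmp {Ω : Type*} [PartialOrder Ω] {x y : Ω} (h : x ≤ y) : Cmp x y := Or.inl h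

theorem _root_.LT.lt.cmp {Ω : Type*} [PartialOrder Ω] {x y : Ω} (h : x < y) : Cmp x y :=
  Or.inl h.le

/-- An abstract version of the family of definable completions of a definable family of minimal
linear orders (closed under reversal), acted upon by the automorphism group. -/
structure OrdSys (G Ω : Type*) [Group G] [MulAction G Ω] [PartialOrder Ω] where
  /-- The open subgroups. -/
  Op : Subgroup G → Prop
  op_mono : ∀ {K H : Subgroup G}, K ≤ H → Op K → Op H
  op_inf : ∀ {K H : Subgroup G}, Op K → Op H → Op (K ⊓ H)
  op_conj : ∀ (g : G) {K : Subgroup G}, Op K → ∃ K', Op K' ∧ ∀ k ∈ K', g⁻¹ * k * g ∈ K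
  op_stab : ∀ x : Ω, Op (stabilizer G x)
  /-- The reversal. -/
  nu : Ω → Ω
  nu_nu : ∀ x, nu (nu x) = x
  nu_lt : ∀ {x y}, x < y → nu y < nu x
  nu_smul : ∀ (g : G) x, nu (g • x) = g • nu x
  smul_lt : ∀ (g : G) {x y : Ω}, x < y → g • x < g • y
  cmp_trans : ∀ {x y z : Ω}, Cmp x y → Cmp y z → Cmp x z
  dense : ∀ {x y : Ω}, x < y → ∃ z, x < z ∧ z < y
  exists_lt : ∀ x : Ω, ∃ y, y < x
  -- The completion contains definable cuts only, so `A` has to be invariant under an open subgroup.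
  exists_lub : ∀ {A : Set Ω}, A.Nonempty → BddAbove A →
    (∃ K, Op K ∧ ∀ k ∈ K, ∀ x ∈ A, k • x ∈ A) → ∃ s, IsLUB A s
  -- Comes from omega-categoricity: an order has finitely many cuts definable over given parameters.
  fix_fin : ∀ {K : Subgroup G}, Op K → ∀ x : Ω, {y | Cmp x y ∧ ∀ k ∈ K, k • y = y}.Finite
  -- Topological rank 1, with `C` the set of non-trivial classes of a definable convex equivalence
  -- relation.
  rank : ∀ {K : Subgroup G}, Op K → ∀ (x : Ω) (C : Set (Set Ω)), (∀ c ∈ C, ∀ y ∈ c, Cmp x y) →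
    (∀ c ∈ C, ∃ y ∈ c, ∃ z ∈ c, y < z) → (∀ c ∈ C, c.OrdConnected) → C.PairwiseDisjoint id →
    (∀ k ∈ K, ∀ c ∈ C, (fun y => k • y) '' c ∈ C) → C.Finite
  -- Weak transitivity: no cut is definable over the index of its order.
  nofix : ∀ x : Ω, ∃ g : G, Cmp x (g • x) ∧ g • x ≠ x
  /-- The actual points, as opposed to the cuts. -/
  Pt : Set Ω
  pt_smul : ∀ (g : G), ∀ x ∈ Pt, g • x ∈ Pt
  pt_nu : ∀ x ∈ Pt, nu x ∈ Pt
  pt_dense : ∀ {x y : Ω}, x < y → ∃ p ∈ Pt, x < p ∧ p < y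
  -- The bound is uniform in the two points, because pairs of points fall into finitely many orbits.
  -- For pairs of arbitrary cuts no such bound is available, which is why `Pt` is part of the
  -- structure.
  pt_bound : ∀ x0 : Ω, ∃ N : ℕ, ∀ x ∈ Pt, ∀ y ∈ Pt, Cmp x0 x → Cmp x0 y →
    {z | Cmp x0 z ∧ ∀ g : G, g • x = x → g • y = y → g • z = z}.ncard ≤ N

namespace OrdSys

variable {G Ω : Type*} [Group G] [MulAction G Ω] [PartialOrder Ω]
  {K : Subgroup G} {x y z w : Ω}

theorem nu_lt_iff (S : OrdSys G Ω) : S.nu x < S.nu y ↔ y < x :=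
  ⟨fun h => by simpa [S.nu_nu] using S.nu_lt h, S.nu_lt⟩

theorem nu_inj (S : OrdSys G Ω) : S.nu x = S.nu y ↔ x = y :=
  ⟨fun h => by simpa [S.nu_nu] using congrArg S.nu h, fun h => by rw [h]⟩

theorem nu_le_iff (S : OrdSys G Ω) : S.nu x ≤ S.nu y ↔ y ≤ x := by
  rw [le_iff_lt_or_eq, le_iff_lt_or_eq, S.nu_lt_iff, S.nu_inj, eq_comm]

theorem nu_cmp (S : OrdSys G Ω) : Cmp (S.nu x) (S.nu y) ↔ Cmp x y := by
  simp only [Cmp, S.nu_le_iff, or_comm]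

theorem smul_lt_iff (S : OrdSys G Ω) (g : G) : g • x < g • y ↔ x < y :=
  ⟨fun h => by simpa using S.smul_lt g⁻¹ h, S.smul_lt g⟩

theorem smul_le_iff (S : OrdSys G Ω) (g : G) : g • x ≤ g • y ↔ x ≤ y := by
  rw [le_iff_lt_or_eq, le_iff_lt_or_eq, S.smul_lt_iff, smul_left_cancel_iff]

theorem smul_cmp (S : OrdSys G Ω) (g : G) : Cmp (g • x) (g • y) ↔ Cmp x y := by
  simp only [Cmp, S.smul_le_iff]

theorem exists_gt (S : OrdSys G Ω) (x : Ω) : ∃ y, x < y := by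
  obtain ⟨y, hy⟩ := S.exists_lt (S.nu x)
  exact ⟨S.nu y, by rw [← S.nu_lt_iff, S.nu_nu]; exact hy⟩

theorem exists_lt_both (S : OrdSys G Ω) (h : Cmp x y) : ∃ z, z < x ∧ z < y := by
  rcases h with h | h
  · obtain ⟨z, hz⟩ := S.exists_lt x
    exact ⟨z, hz, hz.trans_le h⟩
  · obtain ⟨z, hz⟩ := S.exists_lt y
    exact ⟨z, hz.trans_le h, hz⟩

/-- A point above `x` and below both `y` and `z`. -/
theorem dense_two (S : OrdSys G Ω) (hy : x < y) (hz : x < z) : ∃ w, x < w ∧ w < y ∧ w < z := by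
  rcases S.cmp_trans hy.cmp.symm hz.cmp with h | h
  · obtain ⟨w, h1, h2⟩ := S.dense hy
    exact ⟨w, h1, h2, h2.trans_le h⟩
  · obtain ⟨w, h1, h2⟩ := S.dense hz
    exact ⟨w, h1, h2.trans_le h, h2⟩

theorem dense_two' (S : OrdSys G Ω) (hy : y < x) (hz : z < x) : ∃ w, w < x ∧ y < w ∧ z < w := by
  rcases S.cmp_trans hy.cmp hz.cmp.symm with h | h
  · obtain ⟨w, h1, h2⟩ := S.dense hz
    exact ⟨w, h2, h.trans_lt h1, h1⟩
  · obtain ⟨w, h1, h2⟩ := S.dense hy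
    exact ⟨w, h2, h1, h.trans_lt h1⟩

theorem op_top_stab₂ (S : OrdSys G Ω) (x y : Ω) : S.Op (stabilizer G x ⊓ stabilizer G y) :=
  S.op_inf (S.op_stab x) (S.op_stab y)

theorem smul_isLUB (S : OrdSys G Ω) {A : Set Ω} {s : Ω} (hs : IsLUB A s)
    (hA : ∀ k ∈ K, ∀ a ∈ A, k • a ∈ A) {k : G} (hk : k ∈ K) : k • s = s := by
  have key : ∀ k ∈ K, k • s ≤ s := by
    intro k hk
    rw [← S.smul_le_iff k⁻¹, inv_smul_smul]
    refine hs.2 fun a ha => ?_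
    rw [← S.smul_le_iff k, smul_inv_smul]
    exact hs.1 (hA k hk a ha)
  refine le_antisymm (key k hk) ?_
  have := key k⁻¹ (K.inv_mem hk)
  rwa [← S.smul_le_iff k, smul_inv_smul] at this

/-- The stabilizer of the component of `x`. -/
def fib (S : OrdSys G Ω) (x : Ω) : Subgroup G where
  carrier := {g | Cmp x (g • x)}
  one_mem' := by simp [Cmp]
  mul_mem' := by
    intro a b ha hb
    have := (S.smul_cmp a).2 hb
    rw [smul_smul] at this
    exact S.cmp_trans ha this
  inv_mem' := by
    intro a ha
    have := (S.smul_cmp a⁻¹).2 ha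
    rw [inv_smul_smul] at this
    exact this.symm

theorem mem_fib (S : OrdSys G Ω) {g : G} : g ∈ S.fib x ↔ Cmp x (g • x) := Iff.rfl

theorem fib_smul_cmp (S : OrdSys G Ω) {g : G} (hg : g ∈ S.fib x) (h : Cmp x y) : Cmp x (g • y) :=
  S.cmp_trans hg ((S.smul_cmp g).2 h)

theorem op_fib (S : OrdSys G Ω) (x : Ω) : S.Op (S.fib x) :=
  S.op_mono (fun g hg => by rw [S.mem_fib, mem_stabilizer_iff.1 hg]; exact Cmp.refl x)
    (S.op_stab x)

theorem fib_congr (S : OrdSys G Ω) (h : Cmp x y) : S.fib x = S.fib y := by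
  have key : ∀ {x y : Ω}, Cmp x y → S.fib x ≤ S.fib y := fun {x y} h g hg =>
    S.cmp_trans h.symm (S.cmp_trans hg ((S.smul_cmp g).2 h))
  exact le_antisymm (key h) (key h.symm)

theorem fib_nu (S : OrdSys G Ω) : S.fib (S.nu x) = S.fib x := by
  ext g
  rw [S.mem_fib, S.mem_fib, ← S.nu_smul, S.nu_cmp]

/-- There is no definable cut. -/
theorem no_invariant_cut (S : OrdSys G Ω) {A : Set Ω} (hA : A.Nonempty) (hb : BddAbove A)
    (hinv : ∀ k ∈ S.fib x, ∀ a ∈ A, k • a ∈ A) (hx : ∀ a ∈ A, Cmp x a) : False := by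
  obtain ⟨s, hs⟩ := S.exists_lub hA hb ⟨_, S.op_fib x, hinv⟩
  obtain ⟨a, ha⟩ := hA
  obtain ⟨g, hg, hne⟩ := S.nofix s
  have : Cmp x s := S.cmp_trans (hx a ha) (hs.1 ha).cmp
  exact hne (S.smul_isLUB hs hinv (by rw [S.fib_congr this]; exact hg))

/-- A definable map that strictly increases cannot be iterated for ever. -/
theorem iter_up (S : OrdSys G Ω) (hK : S.Op K) {U : Set Ω} {Φ : Ω → Ω} (hU : U.Nonempty) (hm : MapsTo Φ U U)
    (hlt : ∀ w ∈ U, w < Φ w) (hfix : ∀ k ∈ K, ∀ w ∈ U, k • w = w → k • Φ w = Φ w) : False := by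
  obtain ⟨u, hu⟩ := hU
  have mem : ∀ n, Φ^[n] u ∈ U := fun n => hm.iterate n hu
  have mono : StrictMono fun n => Φ^[n] u := strictMono_nat_of_lt_succ fun n => by
    rw [Function.iterate_succ_apply']
    exact hlt _ (mem n)
  -- All the iterates of `u` are fixed by the stabilizer of `u` in `K`, and they are infinitely many
  -- elements of one order: this contradicts `fix_fin`.
  refine (Set.infinite_range_of_injective mono.injective)
    ((S.fix_fin (S.op_inf hK (S.op_stab u)) u).subset ?_)
  rintro _ ⟨n, rfl⟩
  refine ⟨(mono.monotone (Nat.zero_le n)).cmp, fun k hk => ?_⟩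
  induction n with
  | zero => exact mem_stabilizer_iff.1 hk.2
  | succ n ih =>
    simp only [Function.iterate_succ_apply'] at ih ⊢
    exact hfix k hk.1 _ (mem n) ih

theorem iter_down (S : OrdSys G Ω) (hK : S.Op K) {U : Set Ω} {Φ : Ω → Ω} (hU : U.Nonempty) (hm : MapsTo Φ U U)
    (hlt : ∀ w ∈ U, Φ w < w) (hfix : ∀ k ∈ K, ∀ w ∈ U, k • w = w → k • Φ w = Φ w) : False := by
  refine S.iter_up hK (U := S.nu ⁻¹' U) (Φ := fun w => S.nu (Φ (S.nu w))) ?_ ?_ ?_ ?_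
  · obtain ⟨u, hu⟩ := hU
    exact ⟨S.nu u, by simpa [S.nu_nu] using hu⟩
  · intro w hw
    simpa [S.nu_nu] using hm hw
  · intro w hw
    have := S.nu_lt (hlt _ hw)
    rwa [S.nu_nu] at this
  · intro k hk w hw hkw
    rw [← S.nu_smul, hfix k hk _ hw]
    rw [← S.nu_smul, hkw]

/-- `E`, restricted to pairs `x ≤ y`, defines a `K`-invariant convex equivalence relation. -/
structure ConvRel (K : Subgroup G) (E : Ω → Ω → Prop) : Prop where
  smul : ∀ k ∈ K, ∀ {x y}, x ≤ y → E x y → E (k • x) (k • y)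
  trans : ∀ {x y z}, x ≤ y → y ≤ z → E x y → E y z → E x z
  left : ∀ {x y z}, x ≤ y → y ≤ z → E x z → E x y
  right : ∀ {x y z}, x ≤ y → y ≤ z → E x z → E y z

variable {E : Ω → Ω → Prop}

/-- The class of `x` is non-trivial, so by `rank` it has finitely many conjugates under `K`, and
some power `k ^ p` with p > 0 sends `x` into its own class. Since `k • x` lies between `x` and `k ^
p • x`, convexity puts it in the class as well. -/
theorem rel_fixed (S : OrdSys G Ω) (hK : S.Op K) (hE : ConvRel K E) (hc : K ≤ S.fib x) (hxy : x < y)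
    (h : E x y) {k : G} (hk : k ∈ K) :
    (x < k • x → E x (k • x)) ∧ (k • x < x → E (k • x) x) := by
  let cls (z : Ω) : Set Ω := {w | z = w ∨ (z < w ∧ E z w) ∨ (w < z ∧ E w z)}
  have cls_symm : ∀ {z w}, w ∈ cls z → z ∈ cls w := by
    rintro z w (h | h | h)
    · exact Or.inl h.symm
    · exact Or.inr (Or.inr h)
    · exact Or.inr (Or.inl h)
  have cls_cmp : ∀ {z w}, w ∈ cls z → Cmp z w := by
    rintro z w (h | h | h)
    · exact h ▸ Cmp.refl _
    · exact h.1.cmp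
    · exact h.1.cmp.symm
  have cls_trans : ∀ {z w v}, w ∈ cls z → v ∈ cls w → v ∈ cls z := by
    intro z w v h1 h2
    have hzv := S.cmp_trans (cls_cmp h1) (cls_cmp h2)
    rcases h1 with rfl | h1 | h1
    · exact h2
    · rcases h2 with rfl | h2 | h2
      · exact Or.inr (Or.inl h1)
      · exact Or.inr (Or.inl ⟨h1.1.trans h2.1, hE.trans h1.1.le h2.1.le h1.2 h2.2⟩)
      · rcases hzv.lt_or_eq_or_gt with h | h | h
        · exact Or.inr (Or.inl ⟨h, hE.left h.le h2.1.le h1.2⟩)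
        · exact Or.inl h
        · exact Or.inr (Or.inr ⟨h, hE.left h.le h1.1.le h2.2⟩)
    · rcases h2 with rfl | h2 | h2
      · exact Or.inr (Or.inr h1)
      · rcases hzv.lt_or_eq_or_gt with h | h | h
        · exact Or.inr (Or.inl ⟨h, hE.right h1.1.le h.le h2.2⟩)
        · exact Or.inl h
        · exact Or.inr (Or.inr ⟨h, hE.right h2.1.le h.le h1.2⟩)
      · exact Or.inr (Or.inr ⟨h2.1.trans h1.1, hE.trans h2.1.le h1.1.le h2.2 h1.2⟩)
  have cls_smul : ∀ g ∈ K, ∀ {z w}, w ∈ cls z → g • w ∈ cls (g • z) := by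
    rintro g hg z w (h | h | h)
    · exact Or.inl (by rw [h])
    · exact Or.inr (Or.inl ⟨S.smul_lt g h.1, hE.smul g hg h.1.le h.2⟩)
    · exact Or.inr (Or.inr ⟨S.smul_lt g h.1, hE.smul g hg h.1.le h.2⟩)
  have cls_image : ∀ g ∈ K, ∀ z, (fun w => g • w) '' cls z = cls (g • z) := by
    intro g hg z
    ext w
    constructor
    · rintro ⟨w, hw, rfl⟩
      exact cls_smul g hg hw
    · intro hw
      refine ⟨g⁻¹ • w, ?_, by simp⟩
      simpa using cls_smul g⁻¹ (K.inv_mem hg) hw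
  have fin : {C | ∃ g ∈ K, C = cls (g • x)}.Finite := by
    refine S.rank hK x _ ?_ ?_ ?_ ?_ ?_
    · rintro _ ⟨g, hg, rfl⟩ w hw
      exact S.cmp_trans (hc hg) (cls_cmp hw)
    · rintro _ ⟨g, hg, rfl⟩
      exact ⟨g • x, Or.inl rfl, g • y, Or.inr (Or.inl ⟨S.smul_lt g hxy, hE.smul g hg hxy.le h⟩),
        S.smul_lt g hxy⟩
    · rintro _ ⟨g, hg, rfl⟩
      refine ⟨fun a ha b hb c hc => ?_⟩
      have hab := cls_trans (cls_symm ha) hb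
      refine cls_trans ha ?_
      rcases hc.1.lt_or_eq with h1 | h1
      · rcases hab with h2 | h2 | h2
        · exact absurd (h1.trans_le hc.2) (by rw [h2]; exact lt_irrefl _)
        · exact Or.inr (Or.inl ⟨h1, hE.left hc.1 hc.2 h2.2⟩)
        · exact absurd (h1.trans_le hc.2) h2.1.not_gt
      · exact Or.inl h1
    · rintro _ ⟨g, hg, rfl⟩ _ ⟨g', hg', rfl⟩ hne
      rw [Function.onFun, id, id, Set.disjoint_left]
      intro w h1 h2
      refine hne ?_
      ext v
      constructor
      · exact fun hv => cls_trans h2 (cls_trans (cls_symm h1) hv)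
      · exact fun hv => cls_trans h1 (cls_trans (cls_symm h2) hv)
    · rintro g hg _ ⟨g', hg', rfl⟩
      exact ⟨g * g', K.mul_mem hg hg', by rw [cls_image g hg, mul_smul]⟩
  have hp : ∃ p : ℕ, 0 < p ∧ k ^ p • x ∈ cls x := by
    obtain ⟨m, n, hmn, he⟩ := Set.Finite.exists_lt_map_eq_of_forall_mem
      (t := {C | ∃ g ∈ K, C = cls (g • x)})
      (f := fun n : ℕ => cls (k ^ n • x)) (fun n => ⟨k ^ n, K.pow_mem hk n, rfl⟩) fin
    refine ⟨n - m, Nat.sub_pos_of_lt hmn, ?_⟩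
    have h1 : k ^ n • x ∈ cls (k ^ m • x) := by
      rw [show cls (k ^ m • x) = cls (k ^ n • x) from he]
      exact Or.inl rfl
    have h2 := cls_smul (k ^ m)⁻¹ (K.inv_mem (K.pow_mem hk m)) h1
    rwa [inv_smul_smul, smul_smul, ← pow_sub_mul_pow k hmn.le, pow_mul_comm, inv_mul_cancel_left] at h2
  obtain ⟨p, hp0, hp⟩ := hp
  obtain ⟨q, rfl⟩ : ∃ q, p = q + 1 := ⟨p - 1, by omega⟩
  constructor
  · intro hlt
    have h1 : k • x ≤ k ^ (q + 1) • x := by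
      clear hp hp0
      induction q with
      | zero => simp
      | succ q ih =>
        rw [pow_succ', mul_smul]
        exact (S.smul_le_iff k).2 (hlt.le.trans ih)
    rcases hp with h2 | h2 | h2
    · exact absurd (hlt.trans_le h1) (by rw [← h2]; exact lt_irrefl _)
    · exact hE.left hlt.le h1 h2.2
    · exact absurd (hlt.trans_le h1) h2.1.not_gt
  · intro hlt
    have h1 : k ^ (q + 1) • x ≤ k • x := by
      clear hp hp0
      induction q with
      | zero => simp
      | succ q ih =>
        rw [pow_succ', mul_smul]
        exact (S.smul_le_iff k).2 (ih.trans hlt.le)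
    rcases hp with h2 | h2 | h2
    · exact absurd (h1.trans_lt hlt) (by rw [← h2]; exact lt_irrefl _)
    · exact absurd (h1.trans_lt hlt) h2.1.not_gt
    · exact hE.right h1 hlt.le h2.2

/-- By `rel_fixed`, the class of `x` is preserved by the whole of `K` and not only by the stabilizer
of `x` in `K`. So its supremum, which exists because `z` is outside the class, is fixed by `K`. -/
theorem rel_sup (S : OrdSys G Ω) (hK : S.Op K) (hE : ConvRel K E) (hc : K ≤ S.fib x) (hxy : x < y)
    (h : E x y) (hxz : x < z) (hn : ¬ E x z) :
    ∃ s, (∀ k ∈ K, k • s = s) ∧ y ≤ s ∧ s ≤ z := by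
  let A := {w | x < w ∧ E x w}
  have hb : ∀ w ∈ A, w ≤ z := by
    rintro w ⟨h1, h2⟩
    rcases (S.cmp_trans h1.cmp.symm hxz.cmp) with h3 | h3
    · exact h3
    · exact absurd (hE.left hxz.le h3 h2) hn
  obtain ⟨s, hs⟩ := S.exists_lub (A := A) ⟨y, hxy, h⟩ ⟨z, hb⟩
    ⟨K ⊓ stabilizer G x, S.op_inf hK (S.op_stab x), by
      rintro k ⟨hk, hkx⟩ w ⟨h1, h2⟩
      have h3 := S.smul_lt k h1
      have h4 := hE.smul k hk h1.le h2
      rw [mem_stabilizer_iff.1 hkx] at h3 h4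
      exact ⟨h3, h4⟩⟩
  have key : ∀ k ∈ K, k • s ≤ s := by
    intro k hk
    rw [← S.smul_le_iff k⁻¹, inv_smul_smul]
    refine hs.2 fun a ha => ?_
    rw [← S.smul_le_iff k, smul_inv_smul]
    have h3 := S.smul_lt k ha.1
    have h4 := hE.smul k hk ha.1.le ha.2
    obtain ⟨h5, h6⟩ := S.rel_fixed hK hE hc hxy h hk
    rcases Cmp.lt_or_eq_or_gt (hc hk) with h7 | h7 | h7
    · exact hs.1 ⟨h7.trans h3, hE.trans h7.le h3.le (h5 h7) h4⟩
    · rw [← h7] at h3 h4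
      exact hs.1 ⟨h3, h4⟩
    · rcases Cmp.lt_or_le (S.cmp_trans h7.cmp.symm h3.cmp) with h8 | h8
      · exact hs.1 ⟨h8, hE.right h7.le h8.le h4⟩
      · exact h8.trans (hxy.le.trans (hs.1 ⟨hxy, h⟩))
  refine ⟨s, fun k hk => le_antisymm (key k hk) ?_, hs.1 ⟨hxy, h⟩, hs.2 hb⟩
  have := key k⁻¹ (K.inv_mem hk)
  rwa [← S.smul_le_iff k, smul_inv_smul] at this

/-- A class ending before `z` would have a supremum fixed by the stabilizer of the order, which
`nofix` forbids. -/
theorem rel_total_right (S : OrdSys G Ω) (hE : ConvRel (S.fib x) E) (hxy : x < y) (h : E x y) (hxz : x < z) :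
    E x z := by
  by_contra hn
  obtain ⟨s, hs, h1, -⟩ := S.rel_sup (S.op_fib x) hE le_rfl hxy h hxz hn
  obtain ⟨g, hg, hne⟩ := S.nofix s
  refine hne (hs g ?_)
  rw [S.fib_congr (hxy.le.trans h1).cmp]
  exact hg

theorem ConvRel.dual (S : OrdSys G Ω) (hE : ConvRel K E) : ConvRel K fun a b => E (S.nu b) (S.nu a) where
  smul k hk {x y} hxy h := by
    rw [S.nu_smul, S.nu_smul]
    exact hE.smul k hk (S.nu_le_iff.2 hxy) h
  trans h1 h2 h3 h4 := hE.trans (S.nu_le_iff.2 h2) (S.nu_le_iff.2 h1) h4 h3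
  left h1 h2 h3 := hE.right (S.nu_le_iff.2 h2) (S.nu_le_iff.2 h1) h3
  right h1 h2 h3 := hE.left (S.nu_le_iff.2 h2) (S.nu_le_iff.2 h1) h3

/-- A `0`-definable convex equivalence relation on a minimal order is trivial. -/
theorem rel_total (S : OrdSys G Ω) (hE : ConvRel (S.fib x) E) (hxy : x < y) (h : E x y) (hxz : Cmp x z)
    (hzw : z < w) : E z w := by
  have right : ∀ {z}, x < z → E x z := fun hz => S.rel_total_right hE hxy h hz
  have left : ∀ {z}, z < x → E z x := by
    intro z hz
    have hE' := hE.dual S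
    rw [← S.fib_nu, S.fib_congr (S.nu_lt hxy).cmp.symm] at hE'
    have := S.rel_total_right hE' (S.nu_lt hxy) (by simpa [S.nu_nu] using h)
      (z := S.nu z) (S.nu_lt (hz.trans hxy))
    simp only [S.nu_nu] at this
    exact hE.left hz.le hxy.le this
  rcases hxz.lt_or_eq_or_gt with h1 | h1 | h1
  · exact hE.right h1.le hzw.le (right (h1.trans hzw))
  · subst h1
    exact right hzw
  · rcases (S.cmp_trans h1.cmp.symm hzw.cmp).lt_or_eq_or_gt with h2 | h2 | h2
    · exact hE.trans h1.le h2.le (left h1) (right h2)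
    · subst h2; exact left h1
    · exact hE.left hzw.le h2.le (left h1)

end OrdSys

end DefOrd

/-! ### Definable isomorphisms of intervals, and rigidity of minimal orders -/

namespace DefOrd

open MulAction Set

namespace OrdSys

variable {G Ω : Type*} [Group G] [MulAction G Ω] [PartialOrder Ω]
  {S : OrdSys G Ω} {K : Subgroup G} {x y z w u v t : Ω} {f g : Ω → Ω}

/-- `f` is a definable isomorphism between the intervals `[u, v]` and `[f u, f v]`. -/
structure IsoOn (S : OrdSys G Ω) (f : Ω → Ω) (u v : Ω) : Prop where
  lt : u < v
  mono : StrictMonoOn f (Icc u v)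
  surj : SurjOn f (Icc u v) (Icc (f u) (f v))
  equiv : ∃ K, S.Op K ∧ ∀ k ∈ K, k • u = u ∧ k • v = v ∧ ∀ w ∈ Icc u v, f (k • w) = k • f w

namespace IsoOn

theorem left_mem (h : S.IsoOn f u v) : u ∈ Icc u v := ⟨le_rfl, h.lt.le⟩

theorem right_mem (h : S.IsoOn f u v) : v ∈ Icc u v := ⟨h.lt.le, le_rfl⟩

theorem map_lt (h : S.IsoOn f u v) : f u < f v := h.mono h.left_mem h.right_mem h.lt

theorem mapsTo (h : S.IsoOn f u v) (hw : w ∈ Icc u v) : f w ∈ Icc (f u) (f v) :=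
  ⟨h.mono.monotoneOn h.left_mem hw hw.1, h.mono.monotoneOn hw h.right_mem hw.2⟩

theorem cmp (_ : S.IsoOn f u v) (hw : w ∈ Icc u v) (hz : z ∈ Icc u v) : Cmp w z :=
  S.cmp_trans hw.1.cmp.symm hz.1.cmp

theorem le_iff (h : S.IsoOn f u v) (hw : w ∈ Icc u v) (hz : z ∈ Icc u v) :
    f w ≤ f z ↔ w ≤ z := by
  constructor
  · intro h1
    rcases (h.cmp hz hw).lt_or_le with h2 | h2
    · exact absurd (h.mono hz hw h2) (not_lt_of_ge h1)
    · exact h2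
  · exact fun h1 => h.mono.monotoneOn hw hz h1

theorem lt_iff (h : S.IsoOn f u v) (hw : w ∈ Icc u v) (hz : z ∈ Icc u v) :
    f w < f z ↔ w < z := by
  rw [lt_iff_le_not_ge, lt_iff_le_not_ge, h.le_iff hw hz, h.le_iff hz hw]

theorem restrict (h : S.IsoOn f u v) (hx : u ≤ x) (hxy : x < y) (hy : y ≤ v) :
    S.IsoOn f x y := by
  have hsub : Icc x y ⊆ Icc u v := Icc_subset_Icc hx hy
  have hxm : x ∈ Icc u v := ⟨hx, hxy.le.trans hy⟩
  have hym : y ∈ Icc u v := ⟨hx.trans hxy.le, hy⟩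
  refine ⟨hxy, h.mono.mono hsub, ?_, ?_⟩
  · intro w hw
    obtain ⟨a, ha, rfl⟩ := h.surj ⟨(h.mapsTo hxm).1.trans hw.1, hw.2.trans (h.mapsTo hym).2⟩
    exact ⟨a, ⟨(h.le_iff hxm ha).1 hw.1, (h.le_iff ha hym).1 hw.2⟩, rfl⟩
  · obtain ⟨K, hK, hk⟩ := h.equiv
    exact ⟨_, S.op_inf hK (S.op_top_stab₂ x y), fun k hk' => ⟨hk'.2.1, hk'.2.2,
      fun w hw => (hk k hk'.1).2.2 w (hsub hw)⟩⟩

theorem comp (h : S.IsoOn f u v) (h' : S.IsoOn g (f u) (f v)) :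
    S.IsoOn (fun w => g (f w)) u v := by
  refine ⟨h.lt, ?_, ?_, ?_⟩
  · exact fun a ha b hb hab => h'.mono (h.mapsTo ha) (h.mapsTo hb) (h.mono ha hb hab)
  · intro w hw
    obtain ⟨a, ha, rfl⟩ := h'.surj hw
    obtain ⟨b, hb, rfl⟩ := h.surj ha
    exact ⟨b, hb, rfl⟩
  · obtain ⟨K, hK, hk⟩ := h.equiv
    obtain ⟨K', hK', hk'⟩ := h'.equiv
    refine ⟨_, S.op_inf hK hK', fun k hkk => ⟨(hk k hkk.1).1, (hk k hkk.1).2.1, fun w hw => ?_⟩⟩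
    rw [(hk k hkk.1).2.2 w hw, (hk' k hkk.2).2.2 _ (h.mapsTo hw)]

theorem exists_inv (h : S.IsoOn f u v) :
    ∃ g, S.IsoOn g (f u) (f v) ∧ (∀ w ∈ Icc u v, g (f w) = w) ∧
      ∀ w ∈ Icc (f u) (f v), f (g w) = w ∧ g w ∈ Icc u v := by
  classical
  have : Nonempty Ω := ⟨u⟩
  have inj : InjOn f (Icc u v) := fun a ha b hb hab =>
    le_antisymm ((h.le_iff ha hb).1 hab.le) ((h.le_iff hb ha).1 hab.ge)
  let g := Function.invFunOn f (Icc u v)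
  have g1 : ∀ w ∈ Icc u v, g (f w) = w := fun w hw => inj.leftInvOn_invFunOn hw
  have g2 : ∀ w ∈ Icc (f u) (f v), f (g w) = w ∧ g w ∈ Icc u v := fun w hw =>
    ⟨Function.invFunOn_eq (h.surj hw), Function.invFunOn_mem (h.surj hw)⟩
  refine ⟨g, ⟨h.map_lt, ?_, ?_, ?_⟩, g1, g2⟩
  · intro a ha b hb hab
    rw [← h.lt_iff (g2 a ha).2 (g2 b hb).2, (g2 a ha).1, (g2 b hb).1]
    exact hab
  · rw [g1 u h.left_mem, g1 v h.right_mem]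
    exact fun w hw => ⟨f w, h.mapsTo hw, g1 w hw⟩
  · obtain ⟨K, hK, hk⟩ := h.equiv
    have fixu : ∀ k ∈ K, k • f u = f u := fun k hk' => by
      rw [← (hk k hk').2.2 u h.left_mem, (hk k hk').1]
    have fixv : ∀ k ∈ K, k • f v = f v := fun k hk' => by
      rw [← (hk k hk').2.2 v h.right_mem, (hk k hk').2.1]
    refine ⟨K, hK, fun k hk' => ⟨fixu k hk', fixv k hk', fun w hw => ?_⟩⟩
    obtain ⟨a, ha, rfl⟩ := h.surj hw
    rw [g1 a ha, ← (hk k hk').2.2 a ha, g1]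
    rw [← (hk k hk').1, ← (hk k hk').2.1]
    exact ⟨(S.smul_le_iff k).2 ha.1, (S.smul_le_iff k).2 ha.2⟩

theorem conj (h : S.IsoOn f u v) (γ : G) :
    S.IsoOn (fun w => γ • f (γ⁻¹ • w)) (γ • u) (γ • v) := by
  have mem : ∀ {w}, w ∈ Icc (γ • u) (γ • v) → γ⁻¹ • w ∈ Icc u v := by
    intro w hw
    constructor
    · rw [← S.smul_le_iff γ, smul_inv_smul]; exact hw.1
    · rw [← S.smul_le_iff γ, smul_inv_smul]; exact hw.2
  refine ⟨S.smul_lt γ h.lt, ?_, ?_, ?_⟩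
  · exact fun a ha b hb hab => S.smul_lt γ (h.mono (mem ha) (mem hb) (S.smul_lt _ hab))
  · intro w hw
    simp only [inv_smul_smul] at hw
    obtain ⟨a, ha, hw'⟩ := h.surj (show γ⁻¹ • w ∈ Icc (f u) (f v) by
      constructor
      · rw [← S.smul_le_iff γ, smul_inv_smul]; exact hw.1
      · rw [← S.smul_le_iff γ, smul_inv_smul]; exact hw.2)
    refine ⟨γ • a, ⟨(S.smul_le_iff γ).2 ha.1, (S.smul_le_iff γ).2 ha.2⟩, ?_⟩
    simp [hw']
  · obtain ⟨K, hK, hk⟩ := h.equiv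
    obtain ⟨K', hK', hk'⟩ := S.op_conj γ hK
    have key : ∀ k : G, ∀ w : Ω, k • γ • w = γ • (γ⁻¹ * k * γ) • w := by
      intro k w
      simp [smul_smul, mul_assoc]
    refine ⟨K', hK', fun k hkK => ⟨?_, ?_, fun w hw => ?_⟩⟩
    · rw [key, (hk _ (hk' k hkK)).1]
    · rw [key, (hk _ (hk' k hkK)).2.1]
    · rw [key, ← (hk _ (hk' k hkK)).2.2 _ (mem hw)]
      simp [smul_smul, mul_assoc]

theorem nu (h : S.IsoOn f u v) : S.IsoOn (fun w => S.nu (f (S.nu w))) (S.nu v) (S.nu u) := by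
  have mem : ∀ {w}, w ∈ Icc (S.nu v) (S.nu u) → S.nu w ∈ Icc u v := by
    intro w hw
    constructor
    · rw [← S.nu_le_iff, S.nu_nu]; exact hw.2
    · rw [← S.nu_le_iff, S.nu_nu]; exact hw.1
  refine ⟨S.nu_lt h.lt, ?_, ?_, ?_⟩
  · exact fun a ha b hb hab => S.nu_lt (h.mono (mem hb) (mem ha) (S.nu_lt hab))
  · intro w hw
    simp only [S.nu_nu] at hw
    obtain ⟨a, ha, hw'⟩ := h.surj (show S.nu w ∈ Icc (f u) (f v) by
      constructor
      · rw [← S.nu_le_iff, S.nu_nu]; exact hw.2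
      · rw [← S.nu_le_iff, S.nu_nu]; exact hw.1)
    refine ⟨S.nu a, ⟨S.nu_le_iff.2 ha.2, S.nu_le_iff.2 ha.1⟩, ?_⟩
    simp [hw', S.nu_nu]
  · obtain ⟨K, hK, hk⟩ := h.equiv
    refine ⟨K, hK, fun k hkK => ⟨?_, ?_, fun w hw => ?_⟩⟩
    · rw [← S.nu_smul, (hk k hkK).2.1]
    · rw [← S.nu_smul, (hk k hkK).1]
    · rw [S.nu_smul, (hk k hkK).2.2 _ (mem hw), S.nu_smul]

/-- Where `f w` differs from `w`, iterating `f` produces infinitely many elements definable over `w`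
(`iter_up`, `iter_down`). -/
theorem eq_of_self_map (h : S.IsoOn f u v) (hu : u ≤ f u) (hv : f v ≤ v) :
    ∀ w ∈ Icc u v, f w = w := by
  intro w hw
  have maps : ∀ w ∈ Icc u v, f w ∈ Icc u v := fun w hw =>
    ⟨hu.trans (h.mapsTo hw).1, (h.mapsTo hw).2.trans hv⟩
  obtain ⟨K, hK, hk⟩ := h.equiv
  rcases (h.cmp hw (maps w hw)).lt_or_eq_or_gt with h1 | h1 | h1
  · exact (S.iter_up hK (U := {w | w ∈ Icc u v ∧ w < f w}) (Φ := f) ⟨w, hw, h1⟩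
      (fun a ha => ⟨maps a ha.1, h.mono ha.1 (maps a ha.1) ha.2⟩) (fun a ha => ha.2)
      (fun k hkK a ha hka => by rw [← (hk k hkK).2.2 a ha.1, hka])).elim
  · exact h1.symm
  · exact (S.iter_down hK (U := {w | w ∈ Icc u v ∧ f w < w}) (Φ := f) ⟨w, hw, h1⟩
      (fun a ha => ⟨maps a ha.1, h.mono (maps a ha.1) ha.1 ha.2⟩) (fun a ha => ha.2)
      (fun k hkK a ha hka => by rw [← (hk k hkK).2.2 a ha.1, hka])).elim

theorem id (h : u < v) : S.IsoOn (fun w => w) u v :=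
  ⟨h, strictMonoOn_id, surjOn_id _, _, S.op_top_stab₂ u v, fun _ hk =>
    ⟨hk.1, hk.2, fun _ _ => rfl⟩⟩

end IsoOn

/-- `[y, t]` is a copy of `[x, z]`. -/
def Copy (S : OrdSys G Ω) (x z y t : Ω) : Prop := ∃ f, S.IsoOn f x z ∧ f x = y ∧ f z = t

theorem Copy.lt (h : S.Copy x z y t) : y < t := by
  obtain ⟨f, hf, rfl, rfl⟩ := h
  exact hf.map_lt

/-- If one copy is contained in the other, going to the inner copy and coming back from the outer
one maps `[x, z]` into itself, so this map is the identity. Consequently copies of a fixed interval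
in one order are ordered in the same way by their left ends and by their right ends. -/
theorem Copy.le_right {y' t' : Ω} (h : S.Copy x z y t) (h' : S.Copy x z y' t') (hy : y ≤ y')
    (ht : t' ≤ t) : y = y' ∧ t = t' := by
  obtain ⟨f, hf, rfl, rfl⟩ := h
  obtain ⟨f', hf', rfl, rfl⟩ := h'
  obtain ⟨g, hg, hg1, hg2⟩ := hf.exists_inv
  have hh := hf'.comp (hg.restrict hy hf'.map_lt ht)
  have mx : f' x ∈ Icc (f x) (f z) := ⟨hy, hf'.map_lt.le.trans ht⟩
  have mz : f' z ∈ Icc (f x) (f z) := ⟨hy.trans hf'.map_lt.le, ht⟩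
  have key := hh.eq_of_self_map (hg2 _ mx).2.1 (hg2 _ mz).2.2
  constructor
  · have := key x hh.left_mem
    rw [← (hg2 _ mx).1, this]
  · have := key z hh.right_mem
    rw [← (hg2 _ mz).1, this]

theorem Copy.cmp_right {y' t' : Ω} (h : S.Copy x z y t) (h' : S.Copy x z y' t')
    (hy : Cmp y y') : Cmp t t' :=
  S.cmp_trans h.lt.cmp.symm (S.cmp_trans hy h'.lt.cmp)

theorem Copy.mono {y' t' : Ω} (h : S.Copy x z y t) (h' : S.Copy x z y' t') (hy : y < y') :
    t < t' := by
  rcases (h.cmp_right h' hy.cmp).lt_or_le with h1 | h1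
  · exact h1
  · exact absurd (h.le_right h' hy.le h1).1 hy.ne

theorem Copy.smul (h : S.Copy x z y t) {k : G} (hx : k • x = x) (hz : k • z = z) :
    S.Copy x z (k • y) (k • t) := by
  obtain ⟨f, hf, rfl, rfl⟩ := h
  have hx' : k⁻¹ • x = x := by rw [inv_smul_eq_iff, hx]
  have hz' : k⁻¹ • z = z := by rw [inv_smul_eq_iff, hz]
  have := hf.conj k
  rw [hx, hz] at this
  exact ⟨_, this, by simp [hx'], by simp [hz']⟩

/-- A copy of an interval is recognizable over the end points `x` and `z`. If some copy in the order
of `x` contained no fixed element of `K`, consider all such copies, called good, and let `Φ u` be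
the supremum of the right ends of the good copies that start before `u`. In the fixed-point-free
zone around the given copy, `Φ` is defined, commutes with the stabilizers, satisfies `u < Φ u` and
stays in the zone; `iter_up` rules this out. -/
theorem exists_fixed_of_copy (hK : S.Op K) (hx : ∀ k ∈ K, k • x = x)
    (hz : ∀ k ∈ K, k • z = z) {y₀ t₀ : Ω} (hc : S.Copy x z y₀ t₀) (hxy : Cmp x y₀) :
    ∃ s ∈ Icc y₀ t₀, ∀ k ∈ K, k • s = s := by
  by_contra hno
  have hno : ∀ s, (∀ k ∈ K, k • s = s) → y₀ ≤ s → s ≤ t₀ → False :=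
    fun s h1 h2 h3 => hno ⟨s, ⟨h2, h3⟩, h1⟩
  let Fx (s : Ω) : Prop := ∀ k ∈ K, k • s = s
  let Good (y t : Ω) : Prop := S.Copy x z y t ∧ ∀ s, Fx s → y ≤ s → s ≤ t → False
  have Good_smul : ∀ k ∈ K, ∀ y t, Good y t → Good (k • y) (k • t) := by
    rintro k hk y t ⟨h1, h2⟩
    refine ⟨h1.smul (hx k hk) (hz k hk), fun s hs h3 h4 => h2 s hs ?_ ?_⟩
    · rwa [← S.smul_le_iff k, hs k hk]
    · rwa [← S.smul_le_iff k, hs k hk]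
  have good₀ : Good y₀ t₀ := ⟨hc, hno⟩
  obtain ⟨x₀, hx₀, hx₀t⟩ := S.dense hc.lt
  obtain ⟨x₁, hx₁, hx₁t⟩ := S.dense hx₀t
  have hKfib : K ≤ S.fib x₀ := fun k hk => by
    rw [← S.fib_congr (S.cmp_trans hxy hx₀.cmp), S.mem_fib, hx k hk]
    exact Cmp.refl x
  let R : Set Ω := {u | x₀ ≤ u ∧ ∀ s, Fx s → x₀ ≤ s → s ≤ u → False}
  -- Lying inside a good copy is a `K`-invariant convex condition. If it stopped before `u`, then
  -- `rel_sup` would give a fixed element between `x₀` and `u`.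
  have claim1 : ∀ u ∈ R, ∃ y t, Good y t ∧ y < u ∧ u < t := by
    intro u hu
    let E (a b : Ω) : Prop := ∀ w, a ≤ w → w ≤ b → ∃ y t, Good y t ∧ y < w ∧ w < t
    have hE : ConvRel K E := by
      refine ⟨fun k hk a b _ h w h1 h2 => ?_, fun {a b c} h1 h2 h3 h4 w h5 h6 => ?_,
        fun h1 h2 h3 w h4 h5 => h3 w h4 (h5.trans h2),
        fun h1 h2 h3 w h4 h5 => h3 w (h1.trans h4) h5⟩
      · obtain ⟨y, t, h3, h4, h5⟩ := h (k⁻¹ • w) (by rwa [← S.smul_le_iff k, smul_inv_smul])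
          (by rwa [← S.smul_le_iff k, smul_inv_smul])
        refine ⟨k • y, k • t, Good_smul k hk y t h3, ?_, ?_⟩
        · rwa [← S.smul_lt_iff k, smul_inv_smul] at h4
        · rwa [← S.smul_lt_iff k, smul_inv_smul] at h5
      · rcases S.cmp_trans h5.cmp.symm h1.cmp with h7 | h7
        · exact h3 w h5 h7
        · exact h4 w h7 h6
    by_contra hn
    rcases hu.1.lt_or_eq with h1 | h1
    · obtain ⟨s, hs, h2, h3⟩ := S.rel_sup hK hE hKfib hx₁
        (fun w h2 h3 => ⟨y₀, t₀, good₀, hx₀.trans_le h2, h3.trans_lt hx₁t⟩) h1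
        (fun h => hn (h u h1.le le_rfl))
      exact hu.2 s hs (hx₁.le.trans h2) h3
    · exact hn ⟨y₀, t₀, good₀, h1 ▸ hx₀, h1 ▸ hx₀t⟩
  have claim2 : ∀ u ∈ R, ∃ y t, Good y t ∧ u < y ∧ y ∈ R := by
    intro u hu
    by_contra hn
    let B : Set Ω := {y | Cmp x₀ y ∧ (∃ t, Good y t) ∧ (∀ s, Fx s → y ≤ s → s ≤ x₀ → False) ∧
      ∀ s, Fx s → x₀ ≤ s → s ≤ y → False}
    have hy₀ : y₀ ∈ B := ⟨hx₀.cmp.symm, ⟨t₀, good₀⟩,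
      fun s hs h1 h2 => hno s hs h1 (h2.trans hx₀t.le),
      fun s hs h1 h2 => hno s hs (hx₀.le.trans h1) (h2.trans hc.lt.le)⟩
    have hb : ∀ y ∈ B, y ≤ u := by
      rintro y ⟨h0, ⟨t, ht⟩, h1, h2⟩
      rcases (S.cmp_trans hu.1.cmp.symm h0).lt_or_le with h3 | h3
      · exact absurd ⟨y, t, ht, h3, hu.1.trans h3.le, h2⟩ hn
      · exact h3
    have hinv : ∀ k ∈ K, ∀ y ∈ B, k • y ∈ B := by
      rintro k hk y ⟨h0, ⟨t, ht⟩, h1, h2⟩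
      refine ⟨S.fib_smul_cmp (hKfib hk) h0, ⟨k • t, Good_smul k hk y t ht⟩,
        fun s hs h3 h4 => h1 s hs ?_ h4, fun s hs h3 h4 => h2 s hs h3 ?_⟩
      · rwa [← S.smul_le_iff k, hs k hk]
      · rwa [← S.smul_le_iff k, hs k hk]
    obtain ⟨s, hs⟩ := S.exists_lub ⟨y₀, hy₀⟩ ⟨u, hb⟩ ⟨K, hK, hinv⟩
    have hsK : Fx s := fun k hk => S.smul_isLUB hs hinv hk
    rcases S.cmp_trans hx₀.cmp.symm (hs.1 hy₀).cmp with h | h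
    · exact hu.2 s hsK h (hs.2 hb)
    · exact hno s hsK (hs.1 hy₀) (h.trans hx₀t.le)
  let A (u : Ω) : Set Ω := {t | ∃ y, Good y t ∧ y < u}
  have hA : ∀ u ∈ R, ∃ s, IsLUB (A u) s := by
    intro u hu
    obtain ⟨y, t, h1, h2, h3⟩ := claim1 u hu
    obtain ⟨y₁, t₁, h4, h5, h6⟩ := claim2 u hu
    refine S.exists_lub ⟨t, y, h1, h2⟩ ⟨t₁, ?_⟩ ⟨K ⊓ stabilizer G u, S.op_inf hK (S.op_stab u), ?_⟩
    · rintro t' ⟨y', h7, h8⟩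
      exact (h7.1.mono h4.1 (h8.trans h5)).le
    · rintro k ⟨hk, hku⟩ t' ⟨y', h7, h8⟩
      refine ⟨k • y', Good_smul k hk _ _ h7, ?_⟩
      have := S.smul_lt k h8
      rwa [mem_stabilizer_iff.1 hku] at this
  choose! Φ hΦ using hA
  refine S.iter_up hK (U := R) (Φ := Φ) ⟨x₀, le_rfl, fun s hs h1 h2 =>
    hno s hs (hx₀.le.trans h1) (h2.trans hx₀t.le)⟩ ?_ ?_ ?_
  · intro u hu
    obtain ⟨y, t, h1, h2, h3⟩ := claim1 u hu
    obtain ⟨y₁, t₁, h4, h5, h6⟩ := claim2 u hu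
    refine ⟨hu.1.trans (h3.le.trans ((hΦ u hu).1 ⟨y, h1, h2⟩)), fun s hs h7 h8 => ?_⟩
    have h9 : s ≤ t₁ := h8.trans ((hΦ u hu).2 (by
      rintro t' ⟨y', h7, h8⟩
      exact (h7.1.mono h4.1 (h8.trans h5)).le))
    rcases S.cmp_trans h9.cmp h4.1.lt.cmp.symm with h | h
    · exact h6.2 s hs h7 h
    · exact h4.2 s hs h h9
  · intro u hu
    obtain ⟨y, t, h1, h2, h3⟩ := claim1 u hu
    exact h3.trans_le ((hΦ u hu).1 ⟨y, h1, h2⟩)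
  · intro k hk u hu hku
    refine S.smul_isLUB (K := K ⊓ stabilizer G u) (hΦ u hu) ?_ ⟨hk, hku⟩
    rintro k ⟨hk, hku⟩ t' ⟨y', h7, h8⟩
    refine ⟨k • y', Good_smul k hk _ _ h7, ?_⟩
    have := S.smul_lt k h8
    rwa [mem_stabilizer_iff.1 hku] at this

/-- `x` and `y` are related by a definable isomorphism of open intervals. -/
def Eqv (S : OrdSys G Ω) (x y : Ω) : Prop :=
  ∃ (u v : Ω) (f : Ω → Ω), u < x ∧ x < v ∧ S.IsoOn f u v ∧ f x = y

theorem IsoOn.eqv (h : S.IsoOn f u v) (h1 : u < x) (h2 : x < v) : S.Eqv x (f x) :=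
  ⟨u, v, f, h1, h2, h, rfl⟩

namespace Eqv

theorem refl (S : OrdSys G Ω) (x : Ω) : S.Eqv x x := by
  obtain ⟨u, hu⟩ := S.exists_lt x
  obtain ⟨v, hv⟩ := S.exists_gt x
  exact ⟨u, v, _, hu, hv, IsoOn.id (hu.trans hv), rfl⟩

theorem symm (h : S.Eqv x y) : S.Eqv y x := by
  obtain ⟨u, v, f, hu, hv, hf, rfl⟩ := h
  obtain ⟨g, hg, hg1, -⟩ := hf.exists_inv
  have hx : x ∈ Icc u v := ⟨hu.le, hv.le⟩
  exact ⟨f u, f v, g, hf.mono hf.left_mem hx hu, hf.mono hx hf.right_mem hv, hg, hg1 x hx⟩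

theorem trans (h : S.Eqv x y) (h' : S.Eqv y z) : S.Eqv x z := by
  obtain ⟨u, v, f, hu, hv, hf, rfl⟩ := h
  obtain ⟨u', v', g, hu', hv', hg, rfl⟩ := h'
  have hx : x ∈ Icc u v := ⟨hu.le, hv.le⟩
  obtain ⟨a, ha, ha1, ha2⟩ := S.dense_two' (hf.mono hf.left_mem hx hu) hu'
  obtain ⟨b, hb, hb1, hb2⟩ := S.dense_two (hf.mono hx hf.right_mem hv) hv'
  obtain ⟨a', ha', rfl⟩ := hf.surj ⟨ha1.le, (ha.trans (hb.trans hb1)).le⟩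
  obtain ⟨b', hb', rfl⟩ := hf.surj ⟨(ha1.trans (ha.trans hb)).le, hb1.le⟩
  have h1 := (hf.lt_iff ha' hx).1 ha
  have h2 := (hf.lt_iff hx hb').1 hb
  exact ⟨a', b', _, h1, h2, (hf.restrict ha'.1 (h1.trans h2) hb'.2).comp
    (hg.restrict ha2.le (ha.trans hb) hb2.le), rfl⟩

theorem smul (h : S.Eqv x y) (γ : G) : S.Eqv (γ • x) (γ • y) := by
  obtain ⟨u, v, f, hu, hv, hf, rfl⟩ := h
  exact ⟨_, _, _, S.smul_lt γ hu, S.smul_lt γ hv, hf.conj γ, by simp⟩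

theorem nu (h : S.Eqv x y) : S.Eqv (S.nu x) (S.nu y) := by
  obtain ⟨u, v, f, hu, hv, hf, rfl⟩ := h
  exact ⟨_, _, _, S.nu_lt hv, S.nu_lt hu, hf.nu, by simp [S.nu_nu]⟩

end Eqv

/-- Induction on the number of copies. Take `w` and its image `f w` under a local isomorphism, with
`w < f w`, and a right neighbourhood `[w, b₂]` of `w` that ends before `f w`. The copies given by
induction inside `[w, b₂]` all lie below the image of their model `[x, z]`, which is one more copy.
-/
theorem exists_copies (x₀ : Ω)
    (h : ∀ u v, Cmp x₀ u → u < v → ∃ w w', u ≤ w ∧ w < w' ∧ w' ≤ v ∧ S.Eqv w w') (n : ℕ) :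
    ∀ u v, Cmp x₀ u → u < v → ∃ x z, u ≤ x ∧ x < z ∧ z ≤ v ∧ ∃ Y : Finset (Ω × Ω), Y.card = n ∧
      (∀ p ∈ Y, S.Copy x z p.1 p.2 ∧ u ≤ p.1 ∧ p.2 ≤ v) ∧
      ∀ p ∈ Y, ∀ q ∈ Y, p ≠ q → p.2 < q.1 ∨ q.2 < p.1 := by
  classical
  induction n with
  | zero => exact fun u v _ huv => ⟨u, v, le_rfl, huv, le_rfl, ∅, rfl, by simp, by simp⟩
  | succ n ih =>
    intro u v hu huv
    obtain ⟨v₀, h1, h2⟩ := S.dense huv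
    obtain ⟨w, w', h3, h4, h5, a, b, f, ha, hb, hf, rfl⟩ := h u v₀ hu h1
    have hw : w ∈ Icc a b := ⟨ha.le, hb.le⟩
    obtain ⟨c, hc, hcv, hcb⟩ := S.dense_two (h5.trans_lt h2) (hf.mono hw hf.right_mem hb)
    obtain ⟨b₁, hb₁, rfl⟩ := hf.surj ⟨((hf.mapsTo hw).1.trans hc.le), hcb.le⟩
    obtain ⟨b₂, h6, h7, h8⟩ := S.dense_two ((hf.lt_iff hw hb₁).1 hc) h4
    have hb₂ : b₂ ∈ Icc a b := ⟨ha.le.trans h6.le, h7.le.trans hb₁.2⟩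
    obtain ⟨x, z, hx, hxz, hz, Y, hY, hY1, hY2⟩ := ih w b₂ (S.cmp_trans hu h3.cmp) h6
    have hxm : x ∈ Icc a b := ⟨ha.le.trans hx, hxz.le.trans (hz.trans hb₂.2)⟩
    have hzm : z ∈ Icc a b := ⟨ha.le.trans (hx.trans hxz.le), hz.trans hb₂.2⟩
    have hlt : ∀ p ∈ Y, p.2 < f x := fun p hp =>
      (hY1 p hp).2.2.trans_lt (h8.trans_le ((hf.le_iff hw hxm).2 hx))
    have hni : (f x, f z) ∉ Y := fun hmem =>
      (hlt _ hmem).not_gt (hY1 _ hmem).1.lt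
    have hv2 : b₂ ≤ v := h8.le.trans (h5.trans h2.le)
    refine ⟨x, z, h3.trans hx, hxz, hz.trans hv2, insert (f x, f z) Y, ?_, ?_, ?_⟩
    · rw [Finset.card_insert_of_notMem hni, hY]
    · intro p hp
      rcases Finset.mem_insert.1 hp with rfl | hp
      · refine ⟨⟨f, hf.restrict hxm.1 hxz hzm.2, rfl, rfl⟩, ?_, ?_⟩
        · exact (h3.trans h4.le).trans ((hf.le_iff hw hxm).2 hx)
        · exact ((hf.le_iff hzm hb₂).2 hz).trans (((hf.le_iff hb₂ hb₁).2 h7.le).trans hcv.le)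
      · exact ⟨(hY1 p hp).1, h3.trans (hY1 p hp).2.1, (hY1 p hp).2.2.trans hv2⟩
    · intro p hp q hq hne
      rcases Finset.mem_insert.1 hp with rfl | hp' <;> rcases Finset.mem_insert.1 hq with rfl | hq'
      · exact absurd rfl hne
      · exact Or.inr (hlt q hq')
      · exact Or.inl (hlt p hp')
      · exact hY2 p hp' q hq' hne

/-- Otherwise there are N + 1 disjoint copies of some `[x, z]`, with N from `pt_bound`. Choose
points `p < q` inside `[x, z]`. By `exists_fixed_of_copy`, each copy of `[p, q]` contains an element
fixed by the stabilizer of `p` and `q`, and these N + 1 elements are distinct. -/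
theorem exists_locally_injective (x₀ : Ω) :
    ∃ u v, Cmp x₀ u ∧ u < v ∧ ∀ w w', u ≤ w → w < w' → w' ≤ v → ¬ S.Eqv w w' := by
  classical
  by_contra hn
  have h : ∀ u v, Cmp x₀ u → u < v → ∃ w w', u ≤ w ∧ w < w' ∧ w' ≤ v ∧ S.Eqv w w' := by
    intro u v h1 h2
    by_contra h3
    exact hn ⟨u, v, h1, h2, fun w w' h4 h5 h6 h7 => h3 ⟨w, w', h4, h5, h6, h7⟩⟩
  obtain ⟨N, hN⟩ := S.pt_bound x₀
  obtain ⟨v₀, hv₀⟩ := S.exists_gt x₀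
  obtain ⟨x, z, hx, hxz, hz, Y, hY, hY1, hY2⟩ :=
    exists_copies x₀ h (N + 1) x₀ v₀ (Cmp.refl _) hv₀
  obtain ⟨p, hp, hp1, hp2⟩ := S.pt_dense hxz
  obtain ⟨q, hq, hq1, hq2⟩ := S.pt_dense hp2
  have cp : Cmp x₀ p := (hx.trans hp1.le).cmp
  have cq : Cmp x₀ q := (hx.trans (hp1.trans hq1).le).cmp
  let K := stabilizer G p ⊓ stabilizer G q
  have ex : ∀ r ∈ Y, ∃ s, r.1 ≤ s ∧ s ≤ r.2 ∧ ∀ k ∈ K, k • s = s := by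
    intro r hr
    obtain ⟨f, hf, h1, h2⟩ := (hY1 r hr).1
    have hr' := hf.restrict hp1.le hq1 hq2.le
    have pm : p ∈ Icc x z := ⟨hp1.le, hp2.le⟩
    have qm : q ∈ Icc x z := ⟨(hp1.trans hq1).le, hq2.le⟩
    obtain ⟨s, hs, hsK⟩ := exists_fixed_of_copy (K := K) (S.op_top_stab₂ p q) (fun k hk => hk.1)
      (fun k hk => hk.2) ⟨f, hr', rfl, rfl⟩ (by
        refine S.cmp_trans cp.symm (S.cmp_trans (hY1 r hr).2.1.cmp ?_)
        rw [← h1]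
        exact (hf.mapsTo pm).1.cmp)
    exact ⟨s, h1 ▸ (hf.mapsTo pm).1.trans hs.1, h2 ▸ hs.2.trans (hf.mapsTo qm).2, hsK⟩
  have : Nonempty Ω := ⟨x₀⟩
  choose! s hs1 hs2 hs3 using ex
  have hfin : {z | Cmp x₀ z ∧ ∀ g : G, g • p = p → g • q = q → g • z = z}.Finite :=
    (S.fix_fin (S.op_top_stab₂ p q) x₀).subset fun z hz => ⟨hz.1, fun k hk => hz.2 k hk.1 hk.2⟩
  have hcard := Set.ncard_le_ncard (s := s '' (Y : Set (Ω × Ω))) (by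
    rintro _ ⟨r, hr, rfl⟩
    exact ⟨S.cmp_trans (hY1 r hr).2.1.cmp (hs1 r hr).cmp, fun g h1 h2 => hs3 r hr g ⟨h1, h2⟩⟩) hfin
  rw [Set.InjOn.ncard_image, Set.ncard_coe_finset, hY] at hcard
  · have := hN p hp q hq cp cq
    omega
  · intro r hr r' hr' he
    by_contra hne
    rcases hY2 r hr r' hr' hne with h1 | h1
    · exact absurd he (((hs2 r hr).trans_lt h1).trans_le (hs1 r' hr')).ne
    · exact absurd he (((hs2 r' hr').trans_lt h1).trans_le (hs1 r hr)).ne'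

/-- A minimal order has no partial definable order-isomorphisms between intervals apart from the
identity. -/
theorem Eqv.eq_of_cmp (h : S.Eqv x y) (hc : Cmp x y) : x = y := by
  classical
  let Inj (u v : Ω) : Prop := ∀ w w', u ≤ w → w < w' → w' ≤ v → ¬ S.Eqv w w'
  have Inj_smul : ∀ (g : G) {u v}, Inj u v → Inj (g • u) (g • v) := by
    intro g u v h w w' h1 h2 h3 h4
    have := h4.smul g⁻¹
    refine h _ _ ?_ (S.smul_lt g⁻¹ h2) ?_ this
    · rwa [← S.smul_le_iff g, smul_inv_smul]
    · rwa [← S.smul_le_iff g, smul_inv_smul]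
  have Inj_mono : ∀ {u v u' v'}, u ≤ u' → v' ≤ v → Inj u v → Inj u' v' :=
    fun h1 h2 h w w' h3 h4 h5 => h w w' (h1.trans h3) h4 (h5.trans h2)
  have key : ∀ {x y}, S.Eqv x y → ¬ x < y := by
    intro x y h hxy
    -- Injectivity near every element between `a` and `b` is a convex relation; it holds on one
    -- interval, so `rel_total` spreads it over the order.
    have loc : ∀ w, Cmp x w → ∃ u v, u < w ∧ w < v ∧ Inj u v := by
      obtain ⟨u₀, v₀, h0, huv, hinj⟩ := exists_locally_injective (S := S) x
      obtain ⟨a, ha, ha'⟩ := S.dense huv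
      obtain ⟨b, hb, hb'⟩ := S.dense ha'
      let E (a b : Ω) : Prop := ∀ w, a ≤ w → w ≤ b → ∃ u v, u < w ∧ w < v ∧ Inj u v
      have hE : ConvRel (S.fib a) E := by
        refine ⟨fun k hk a b _ h w h1 h2 => ?_, fun {a b c} h1 h2 h3 h4 w h5 h6 => ?_,
          fun h1 h2 h3 w h4 h5 => h3 w h4 (h5.trans h2),
          fun h1 h2 h3 w h4 h5 => h3 w (h1.trans h4) h5⟩
        · obtain ⟨y, t, h4, h5, h3⟩ := h (k⁻¹ • w) (by rwa [← S.smul_le_iff k, smul_inv_smul])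
            (by rwa [← S.smul_le_iff k, smul_inv_smul])
          refine ⟨k • y, k • t, ?_, ?_, Inj_smul k h3⟩
          · rwa [← S.smul_lt_iff k, smul_inv_smul] at h4
          · rwa [← S.smul_lt_iff k, smul_inv_smul] at h5
        · rcases S.cmp_trans h5.cmp.symm h1.cmp with h7 | h7
          · exact h3 w h5 h7
          · exact h4 w h7 h6
      intro w hw
      obtain ⟨w', hw'⟩ := S.exists_gt w
      exact S.rel_total hE hb (fun c h1 h2 => ⟨u₀, v₀, ha.trans_le h1, h2.trans_lt hb', hinj⟩)
        (S.cmp_trans (S.cmp_trans ha.cmp.symm h0.symm) hw) hw' w le_rfl hw'.le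
    let B : Set Ω := {u | Cmp x u ∧ ∃ v, u < v ∧ ¬ Inj u v}
    -- `B` is an invariant initial segment of the order, and it contains `x` because of the pair `x
    -- < y`. An element outside it would bound it and give a definable cut.
    have allB : ∀ u, Cmp x u → u ∈ B := by
      intro u hu
      by_contra hn
      refine S.no_invariant_cut (x := x) (A := B)
        ⟨x, Cmp.refl x, y, hxy, fun h' => h' x y le_rfl hxy le_rfl h⟩ ⟨u, ?_⟩ ?_ (fun a ha => ha.1)
      · rintro b ⟨h1, v, h2, h3⟩
        rcases (S.cmp_trans hu.symm h1).lt_or_le with h4 | h4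
        · exact absurd ⟨hu, v, h4.trans h2, fun h5 => h3 (Inj_mono h4.le le_rfl h5)⟩ hn
        · exact h4
      · rintro k hk b ⟨h1, v, h2, h3⟩
        refine ⟨S.fib_smul_cmp hk h1, k • v, S.smul_lt k h2, fun h4 => h3 ?_⟩
        simpa using Inj_smul k⁻¹ h4
    let A (u : Ω) : Set Ω := {v | u < v ∧ Inj u v}
    have A_ne : ∀ u, Cmp x u → (A u).Nonempty := by
      intro u hu
      obtain ⟨a, b, h1, h2, h3⟩ := loc u hu
      exact ⟨b, h2, Inj_mono h1.le le_rfl h3⟩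
    have A_smul : ∀ (k : G) {u v}, v ∈ A u → k • v ∈ A (k • u) := by
      rintro k u v ⟨h1, h2⟩
      exact ⟨S.smul_lt k h1, Inj_smul k h2⟩
    have hA : ∀ u, Cmp x u → ∃ s, IsLUB (A u) s := by
      intro u hu
      obtain ⟨-, v, h1, h2⟩ := allB u hu
      refine S.exists_lub (A_ne u hu) ⟨v, ?_⟩ ⟨stabilizer G u, S.op_stab u, fun k hk a ha => ?_⟩
      · rintro b ⟨h3, h4⟩
        rcases (S.cmp_trans h1.cmp.symm h3.cmp).lt_or_le with h5 | h5
        · exact absurd (Inj_mono le_rfl h5.le h4) h2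
        · exact h5
      · simpa [mem_stabilizer_iff.1 hk] using A_smul k ha
    -- `r u` is the end of the longest interval from `u` on which distinct elements are
    -- inequivalent. It is a definable map with `u < r u`, so it can be iterated, against `iter_up`.
    choose! r hr using hA
    have hlt : ∀ u, Cmp x u → u < r u := by
      intro u hu
      obtain ⟨v, hv⟩ := A_ne u hu
      exact hv.1.trans_le ((hr u hu).1 hv)
    refine S.iter_up (S.op_stab x) (U := {u | Cmp x u}) (Φ := r) ⟨x, Cmp.refl x⟩
      (fun u hu => S.cmp_trans hu (hlt u hu).cmp) hlt ?_
    intro k hk u hu hku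
    refine S.smul_isLUB (K := stabilizer G u) (hr u hu) (fun k hk a ha => ?_) hku
    simpa [mem_stabilizer_iff.1 hk] using A_smul k ha
  rcases hc.lt_or_eq_or_gt with h1 | h1 | h1
  · exact absurd h1 (key h)
  · exact h1
  · exact absurd h1 (key h.symm)

end OrdSys

end DefOrd

/-! ### Matching of intervals; increasing maps agree somewhere with `Eqv` -/

namespace DefOrd

open MulAction Set

namespace OrdSys

variable {G Ω : Type*} [Group G] [MulAction G Ω] [PartialOrder Ω]
  {S : OrdSys G Ω} {K : Subgroup G} {x y z w u v t : Ω} {x' y' z' w' u' v' t' : Ω} {f g : Ω → Ω}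

theorem Eqv.unique (h : S.Eqv x y) (h' : S.Eqv x z) (hc : Cmp y z) : y = z :=
  (h.symm.trans h').eq_of_cmp hc

theorem Eqv.unique' (h : S.Eqv x z) (h' : S.Eqv y z) (hc : Cmp x y) : x = y :=
  (h.trans h'.symm).eq_of_cmp hc

/-- The relation `Eqv` induces an isomorphism between `[x, z]` and `[x', z']`. -/
structure Match (S : OrdSys G Ω) (x z x' z' : Ω) : Prop where
  le : x ≤ z
  le' : x' ≤ z'
  fwd : ∀ w, x ≤ w → w ≤ z → ∃ w', x' ≤ w' ∧ w' ≤ z' ∧ S.Eqv w w'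
  bwd : ∀ w', x' ≤ w' → w' ≤ z' → ∃ w, x ≤ w ∧ w ≤ z ∧ S.Eqv w w'
  mono : ∀ {a b a' b'}, x ≤ a → b ≤ z → Cmp x' a' → Cmp x' b' → S.Eqv a a' → S.Eqv b b' →
    a < b → a' < b'

namespace Match

theorem left (h : S.Match x z x' z') : S.Eqv x x' := by
  obtain ⟨w', h1, h2, h3⟩ := h.fwd x le_rfl h.le
  rcases h1.lt_or_eq with h4 | h4
  · obtain ⟨w, h5, h6, h7⟩ := h.bwd x' le_rfl h.le'
    rcases h5.lt_or_eq with h8 | h8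
    · exact absurd (h.mono le_rfl h6 h1.cmp (Cmp.refl _) h3 h7 h8) h4.not_gt
    · exact h8 ▸ h7
  · exact h4 ▸ h3

theorem right (h : S.Match x z x' z') : S.Eqv z z' := by
  obtain ⟨w', h1, h2, h3⟩ := h.fwd z h.le le_rfl
  rcases h2.lt_or_eq with h4 | h4
  · obtain ⟨w, h5, h6, h7⟩ := h.bwd z' h.le' le_rfl
    rcases h6.lt_or_eq with h8 | h8
    · exact absurd (h.mono h5 le_rfl h.le'.cmp h1.cmp h7 h3 h8) h4.not_gt
    · exact h8 ▸ h7
  · exact h4 ▸ h3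

theorem mem (h : S.Match x z x' z') (h1 : x ≤ w) (h2 : w ≤ z) (h3 : S.Eqv w w')
    (h4 : Cmp x' w') : x' ≤ w' ∧ w' ≤ z' := by
  obtain ⟨v, h5, h6, h7⟩ := h.fwd w h1 h2
  rw [h3.unique h7 (S.cmp_trans h4.symm h5.cmp)]
  exact ⟨h5, h6⟩

theorem mem' (h : S.Match x z x' z') (h1 : x' ≤ w') (h2 : w' ≤ z') (h3 : S.Eqv w w')
    (h4 : Cmp x w) : x ≤ w ∧ w ≤ z := by
  obtain ⟨v, h5, h6, h7⟩ := h.bwd w' h1 h2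
  rw [h3.unique' h7 (S.cmp_trans h4.symm h5.cmp)]
  exact ⟨h5, h6⟩

theorem symm (h : S.Match x z x' z') : S.Match x' z' x z := by
  refine ⟨h.le', h.le, fun w h1 h2 => ?_, fun w h1 h2 => ?_, ?_⟩
  · obtain ⟨v, h3, h4, h5⟩ := h.bwd w h1 h2
    exact ⟨v, h3, h4, h5.symm⟩
  · obtain ⟨v, h3, h4, h5⟩ := h.fwd w h1 h2
    exact ⟨v, h3, h4, h5.symm⟩
  · intro a b a' b' ha hb ha' hb' hea heb hab
    have h1 := h.mem' ha (hab.le.trans hb) hea.symm ha'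
    have h2 := h.mem' (ha.trans hab.le) hb heb.symm hb'
    rcases (S.cmp_trans ha'.symm hb').lt_or_eq_or_gt with h3 | h3 | h3
    · exact h3
    · subst h3
      exact absurd (hea.unique' heb hab.cmp) hab.ne
    · exact absurd (h.mono h2.1 h1.2 (ha.trans hab.le).cmp ha.cmp heb.symm hea.symm h3) hab.not_gt

theorem sub (h : S.Match x z x' z') {a b a' b' : Ω} (ha : x ≤ a) (hab : a ≤ b) (hb : b ≤ z)
    (hca : Cmp x' a') (hcb : Cmp x' b') (hea : S.Eqv a a') (heb : S.Eqv b b') :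
    S.Match a b a' b' := by
  have key : ∀ {x z x' z' a b a' b' c c' : Ω}, S.Match x z x' z' → x ≤ a → b ≤ z → Cmp x' a' →
      Cmp x' b' → S.Eqv a a' → S.Eqv b b' → Cmp x' c' → a ≤ c → c ≤ b → S.Eqv c c' →
      a' ≤ c' ∧ c' ≤ b' := by
    intro x z x' z' a b a' b' c c' h ha hb hca hcb hea heb hcc h1 h2 h3
    constructor
    · rcases h1.lt_or_eq with h4 | h4
      · exact (h.mono ha (h2.trans hb) hca hcc hea h3 h4).le
      · subst h4
        exact (hea.unique h3 (S.cmp_trans hca.symm hcc)).le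
    · rcases h2.lt_or_eq with h4 | h4
      · exact (h.mono (ha.trans h1) hb hcc hcb h3 heb h4).le
      · subst h4
        exact (h3.unique heb (S.cmp_trans hcc.symm hcb)).le
  have h1 := h.mem ha (hab.trans hb) hea hca
  have h2 := h.mem (ha.trans hab) hb heb hcb
  refine ⟨hab, (key h ha hb hca hcb hea heb hcb hab le_rfl heb).1, ?_, ?_, ?_⟩
  · intro w h3 h4
    obtain ⟨w', h5, h6, h7⟩ := h.fwd w (ha.trans h3) (h4.trans hb)
    have := key h ha hb hca hcb hea heb h5.cmp h3 h4 h7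
    exact ⟨w', this.1, this.2, h7⟩
  · intro w' h3 h4
    obtain ⟨w, h5, h6, h7⟩ := h.bwd w' (h1.1.trans h3) (h4.trans h2.2)
    have := key h.symm h1.1 h2.2 ha.cmp (ha.trans hab).cmp hea.symm heb.symm h5.cmp h3 h4 h7.symm
    exact ⟨w, this.1, this.2, h7⟩
  · intro c d c' d' h3 h4 h5 h6 h7 h8 h9
    exact h.mono (ha.trans h3) (h4.trans hb) (S.cmp_trans hca h5) (S.cmp_trans hca h6) h7 h8 h9

theorem split (h : S.Match x z x' z') (h1 : x ≤ w) (h2 : w ≤ z) :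
    ∃ w', S.Match x w x' w' ∧ S.Match w z w' z' := by
  obtain ⟨w', h3, h4, h5⟩ := h.fwd w h1 h2
  exact ⟨w', h.sub le_rfl h1 h2 (Cmp.refl _) h3.cmp h.left h5,
    h.sub h1 h2 le_rfl h3.cmp h.le'.cmp h5 h.right⟩

theorem trans (h : S.Match x z x' z') {x'' z'' : Ω} (h' : S.Match x' z' x'' z'') :
    S.Match x z x'' z'' := by
  refine ⟨h.le, h'.le', fun w h1 h2 => ?_, fun w h1 h2 => ?_, ?_⟩
  · obtain ⟨w', h3, h4, h5⟩ := h.fwd w h1 h2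
    obtain ⟨w'', h6, h7, h8⟩ := h'.fwd w' h3 h4
    exact ⟨w'', h6, h7, h5.trans h8⟩
  · obtain ⟨w', h3, h4, h5⟩ := h'.bwd w h1 h2
    obtain ⟨w'', h6, h7, h8⟩ := h.bwd w' h3 h4
    exact ⟨w'', h6, h7, h8.trans h5⟩
  · intro a b a'' b'' h1 h2 h3 h4 h5 h6 h7
    obtain ⟨a', h8, h9, h10⟩ := h.fwd a h1 (h7.le.trans h2)
    obtain ⟨b', h11, h12, h13⟩ := h.fwd b (h1.trans h7.le) h2
    exact h'.mono h8 h12 h3 h4 (h10.symm.trans h5) (h13.symm.trans h6)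
      (h.mono h1 h2 h8.cmp h11.cmp h10 h13 h7)

theorem concat (h : S.Match x y x' y') (h' : S.Match y z y' z') : S.Match x z x' z' := by
  refine ⟨h.le.trans h'.le, h.le'.trans h'.le', fun w h1 h2 => ?_, fun w h1 h2 => ?_, ?_⟩
  · rcases S.cmp_trans h1.cmp.symm h.le.cmp with h3 | h3
    · obtain ⟨w', h4, h5, h6⟩ := h.fwd w h1 h3
      exact ⟨w', h4, h5.trans h'.le', h6⟩
    · obtain ⟨w', h4, h5, h6⟩ := h'.fwd w h3 h2
      exact ⟨w', h.le'.trans h4, h5, h6⟩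
  · rcases S.cmp_trans h1.cmp.symm h.le'.cmp with h3 | h3
    · obtain ⟨w', h4, h5, h6⟩ := h.bwd w h1 h3
      exact ⟨w', h4, h5.trans h'.le, h6⟩
    · obtain ⟨w', h4, h5, h6⟩ := h'.bwd w h3 h2
      exact ⟨w', h.le.trans h4, h5, h6⟩
  · intro a b a' b' h1 h2 h3 h4 h5 h6 h7
    have h4' := S.cmp_trans h.le'.cmp.symm h4
    have h3' := S.cmp_trans h.le'.cmp.symm h3
    rcases (S.cmp_trans (h1.trans h7.le).cmp.symm h.le.cmp) with h8 | h8
    · exact h.mono h1 h8 h3 h4 h5 h6 h7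
    · rcases (S.cmp_trans h7.cmp h8.cmp.symm).lt_or_le with h9 | h9
      · have h10 : a' < y' := h.mono h1 le_rfl h3 h.le'.cmp h5 h.right h9
        exact h10.trans_le (h'.mem h8 h2 h6 h4').1
      · exact h'.mono h9 h2 h3' h4' h5 h6 h7

theorem smul (h : S.Match x z x' z') (k : G) : S.Match (k • x) (k • z) (k • x') (k • z') := by
  have le_inv : ∀ {a b : Ω}, k • a ≤ b → a ≤ k⁻¹ • b := fun h => by
    rwa [← S.smul_le_iff k, smul_inv_smul]
  have inv_le : ∀ {a b : Ω}, a ≤ k • b → k⁻¹ • a ≤ b := fun h => by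
    rwa [← S.smul_le_iff k, smul_inv_smul]
  refine ⟨(S.smul_le_iff k).2 h.le, (S.smul_le_iff k).2 h.le', fun w h1 h2 => ?_,
    fun w h1 h2 => ?_, ?_⟩
  · obtain ⟨w', h4, h5, h6⟩ := h.fwd (k⁻¹ • w) (le_inv h1) (inv_le h2)
    exact ⟨k • w', (S.smul_le_iff k).2 h4, (S.smul_le_iff k).2 h5, by simpa using h6.smul k⟩
  · obtain ⟨w', h4, h5, h6⟩ := h.bwd (k⁻¹ • w) (le_inv h1) (inv_le h2)
    exact ⟨k • w', (S.smul_le_iff k).2 h4, (S.smul_le_iff k).2 h5, by simpa using h6.smul k⟩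
  · intro a b a' b' h1 h2 h3 h4 h5 h6 h7
    rw [← S.smul_lt_iff k⁻¹]
    refine h.mono (le_inv h1) (inv_le h2) ?_ ?_ (h5.smul _) (h6.smul _) (S.smul_lt _ h7)
    · rw [← S.smul_cmp k, smul_inv_smul]; exact h3
    · rw [← S.smul_cmp k, smul_inv_smul]; exact h4

theorem of_eqv (h : S.Eqv x x') : S.Match x x x' x' := by
  refine ⟨le_rfl, le_rfl, fun w h1 h2 => ?_, fun w h1 h2 => ?_, ?_⟩
  · obtain rfl := le_antisymm h1 h2
    exact ⟨x', le_rfl, le_rfl, h⟩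
  · obtain rfl := le_antisymm h1 h2
    exact ⟨x, le_rfl, le_rfl, h⟩
  · intro a b a' b' h1 h2 h3 h4 h5 h6 h7
    exact absurd (h7.trans_le h2) h1.not_gt

end Match

/-- The strict inequalities leave a neighbourhood around each element of `[x, z]`, as `Eqv`
requires. By rigidity, `f w` is the only element of the order of `f x` that is equivalent to `w`. -/
theorem IsoOn.match (h : S.IsoOn f u v) (hx : u < x) (hz : z < v) (hxz : x ≤ z) :
    S.Match x z (f x) (f z) := by
  have hxm : x ∈ Icc u v := ⟨hx.le, hxz.trans hz.le⟩
  have hzm : z ∈ Icc u v := ⟨hx.le.trans hxz, hz.le⟩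
  have mem : ∀ {w}, x ≤ w → w ≤ z → w ∈ Icc u v := fun h1 h2 => ⟨hx.le.trans h1, h2.trans hz.le⟩
  have eqv : ∀ {w}, x ≤ w → w ≤ z → S.Eqv w (f w) := fun h1 h2 =>
    h.eqv (hx.trans_le h1) (h2.trans_lt hz)
  refine ⟨hxz, (h.le_iff hxm hzm).2 hxz, fun w h1 h2 => ?_, fun w h1 h2 => ?_, ?_⟩
  · exact ⟨f w, (h.le_iff hxm (mem h1 h2)).2 h1, (h.le_iff (mem h1 h2) hzm).2 h2, eqv h1 h2⟩
  · obtain ⟨a, ha, rfl⟩ := h.surj ⟨(h.mapsTo hxm).1.trans h1, h2.trans (h.mapsTo hzm).2⟩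
    have h3 := (h.le_iff hxm ha).1 h1
    have h4 := (h.le_iff ha hzm).1 h2
    exact ⟨a, h3, h4, eqv h3 h4⟩
  · intro a b a' b' h1 h2 h3 h4 h5 h6 h7
    have am := mem h1 (h7.le.trans h2)
    have bm := mem (h1.trans h7.le) h2
    have ca : Cmp (f a) a' := S.cmp_trans ((h.le_iff hxm am).2 h1).cmp.symm h3
    have cb : Cmp (f b) b' := S.cmp_trans ((h.le_iff hxm bm).2 (h1.trans h7.le)).cmp.symm h4
    rw [← (eqv h1 (h7.le.trans h2)).unique h5 ca, ← (eqv (h1.trans h7.le) h2).unique h6 cb]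
    exact h.mono am bm h7

theorem Eqv.exists_match (h : S.Eqv x x') : ∃ u v u' v', u < x ∧ x < v ∧ u' < x' ∧ x' < v' ∧
    S.Match u v u' v' := by
  obtain ⟨u, v, f, hu, hv, hf, rfl⟩ := h
  obtain ⟨a, ha, ha'⟩ := S.dense hu
  obtain ⟨b, hb, hb'⟩ := S.dense hv
  have hx : x ∈ Icc u v := ⟨hu.le, hv.le⟩
  exact ⟨a, b, f a, f b, ha', hb, hf.mono ⟨ha.le, (ha'.trans hv).le⟩ hx ha',
    hf.mono hx ⟨(hu.trans hb).le, hb'.le⟩ hb, hf.match ha hb' (ha'.trans hb).le⟩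

theorem Eqv.exists_match_right (h : S.Eqv x x') : ∃ v v', x < v ∧ x' < v' ∧ S.Match x v x' v' := by
  obtain ⟨u, v, u', v', h1, h2, h3, h4, h5⟩ := h.exists_match
  exact ⟨v, v', h2, h4, h5.sub h1.le h2.le le_rfl h3.cmp (h3.trans h4).cmp h h5.right⟩

/-- A minimal order is not locally isomorphic to its reverse. -/
theorem not_eqv_nu (hc : Cmp x y) : ¬ S.Eqv x (S.nu y) := by
  intro h
  let P (w : Ω) : Prop := ∃ w', Cmp w w' ∧ S.Eqv w (S.nu w')
  have uniq : ∀ {w a b}, Cmp w a → Cmp w b → S.Eqv w (S.nu a) → S.Eqv w (S.nu b) → a = b := by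
    intro w a b ha hb h1 h2
    rw [← S.nu_inj]
    exact h1.unique h2 (S.nu_cmp.2 (S.cmp_trans ha.symm hb))
  obtain ⟨u, v, u', v', h1, h2, h3, h4, hm⟩ := h.exists_match
  -- The property holds on an interval around `x`, hence everywhere by `rel_total`. The resulting
  -- map `ρ` of the order to itself is invariant because its value is unique.
  have allP : ∀ w, Cmp x w → P w := by
    let E (a b : Ω) : Prop := ∀ w, a ≤ w → w ≤ b → P w
    have hE : ConvRel (S.fib u) E := by
      refine ⟨fun k hk a b _ h w h1 h2 => ?_, fun {a b c} h1 h2 h3 h4 w h5 h6 => ?_,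
        fun h1 h2 h3 w h4 h5 => h3 w h4 (h5.trans h2),
        fun h1 h2 h3 w h4 h5 => h3 w (h1.trans h4) h5⟩
      · obtain ⟨w', h3, h4⟩ := h (k⁻¹ • w) (by rwa [← S.smul_le_iff k, smul_inv_smul])
            (by rwa [← S.smul_le_iff k, smul_inv_smul])
        refine ⟨k • w', ?_, ?_⟩
        · rwa [← S.smul_cmp k, smul_inv_smul] at h3
        · simpa [S.nu_smul] using h4.smul k
      · rcases S.cmp_trans h5.cmp.symm h1.cmp with h7 | h7
        · exact h3 w h5 h7
        · exact h4 w h7 h6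
    intro w hw
    obtain ⟨w', hw'⟩ := S.exists_gt w
    refine S.rel_total hE (h1.trans h2) (fun c h5 h6 => ?_) (S.cmp_trans h1.cmp hw) hw' w le_rfl
      hw'.le
    obtain ⟨c', h7, h8, h9⟩ := hm.fwd c h5 h6
    refine ⟨S.nu c', ?_, by rwa [S.nu_nu]⟩
    rw [← S.nu_cmp, S.nu_nu]
    refine S.cmp_trans ?_ (S.cmp_trans h3.cmp.symm h7.cmp)
    rw [S.nu_cmp]
    exact S.cmp_trans h5.cmp.symm (S.cmp_trans h1.cmp hc)
  have : Nonempty Ω := ⟨x⟩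
  choose! ρ hρ1 hρ2 using allP
  have ρ_smul : ∀ k ∈ S.fib x, ∀ w, Cmp x w → ρ (k • w) = k • ρ w := by
    intro k hk w hw
    have hkw := S.fib_smul_cmp hk hw
    refine uniq (hρ1 _ hkw) ((S.smul_cmp k).2 (hρ1 w hw)) (hρ2 _ hkw) ?_
    rw [S.nu_smul]
    exact (hρ2 w hw).smul k
  -- Near `x` this follows from the match with the reversed order; being strictly decreasing is
  -- again a convex relation.
  have anti : ∀ a b, Cmp x a → a < b → ρ b < ρ a := by
    let E (a b : Ω) : Prop := Cmp x a → ∀ w w', a ≤ w → w < w' → w' ≤ b → ρ w' < ρ w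
    have hE : ConvRel (S.fib u) E := by
      refine ⟨fun k hk a b _ h hxa w w' h5 h6 h7 => ?_,
        fun {a b c} h1 h2 h3 h4 hxa w w' h5 h6 h7 => ?_,
        fun h1 h2 h3 h0 w w' h4 h5 h6 => h3 h0 w w' h4 h5 (h6.trans h2),
        fun h1 h2 h3 h0 w w' h4 h5 h6 =>
          h3 (S.cmp_trans h0 h1.cmp.symm) w w' (h1.trans h4) h5 h6⟩
      · have hkx : k⁻¹ ∈ S.fib x := by
          rw [S.fib_congr h1.cmp.symm]; exact (S.fib u).inv_mem hk
        have hxw := S.cmp_trans hxa h5.cmp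
        have hxw' := S.cmp_trans hxw h6.cmp
        have := h (by simpa using S.fib_smul_cmp hkx hxa) (k⁻¹ • w) (k⁻¹ • w')
          (by rwa [← S.smul_le_iff k, smul_inv_smul]) (S.smul_lt _ h6)
            (by rwa [← S.smul_le_iff k, smul_inv_smul])
        rwa [ρ_smul _ hkx _ hxw, ρ_smul _ hkx _ hxw', S.smul_lt_iff] at this
      · have hxb := S.cmp_trans hxa h1.cmp
        rcases (S.cmp_trans (h5.cmp.symm) h1.cmp).lt_or_le with h8 | h8
        · rcases (S.cmp_trans (h5.trans h6.le).cmp.symm h1.cmp).lt_or_le with h9 | h9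
          · exact h3 hxa w w' h5 h6 h9.le
          · have h10 := h3 hxa w b h5 h8 le_rfl
            rcases h9.lt_or_eq with h11 | h11
            · exact (h4 hxb b w' le_rfl h11 h7).trans h10
            · rwa [← h11]
        · exact h4 hxb w w' h8 h6 h7
    intro a b ha hab
    refine S.rel_total hE (h1.trans h2) (fun _ w w' h5 h6 h7 => ?_) (S.cmp_trans h1.cmp ha) hab
      ha a b le_rfl hab le_rfl
    have hxw := S.cmp_trans h1.cmp.symm h5.cmp
    have hxw' := S.cmp_trans hxw h6.cmp
    have hcc : ∀ {w}, Cmp x w → Cmp u' (S.nu (ρ w)) := fun {w} hw => by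
      refine S.cmp_trans h3.cmp ?_
      rw [S.nu_cmp]
      exact S.cmp_trans hc.symm (S.cmp_trans hw (hρ1 w hw))
    have := hm.mono h5 h7 (hcc hxw) (hcc hxw') (hρ2 w hxw) (hρ2 w' hxw') h6
    rwa [S.nu_lt_iff] at this
  have hxρ := hρ1 x (Cmp.refl x)
  obtain ⟨a, ha1, ha2⟩ := S.exists_lt_both hxρ
  have haA : a < ρ a := ha2.trans (anti a x ha1.cmp.symm ha1)
  -- For a decreasing map, the elements below their image form a bounded initial segment, which is
  -- invariant since `ρ` is.
  refine S.no_invariant_cut (x := x) (A := {w | Cmp x w ∧ w < ρ w}) ⟨a, ha1.cmp.symm, haA⟩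
    ⟨ρ a, ?_⟩ ?_ (fun a ha => ha.1)
  · rintro b ⟨hb, hbρ⟩
    rcases (S.cmp_trans (S.cmp_trans haA.cmp.symm ha1.cmp) hb).lt_or_le with h5 | h5
    · exact absurd ((anti a b ha1.cmp.symm (haA.trans h5)).trans h5) hbρ.not_gt
    · exact h5
  · rintro k hk b ⟨hb, hbρ⟩
    exact ⟨S.fib_smul_cmp hk hb, by rw [ρ_smul k hk b hb]; exact S.smul_lt k hbρ⟩

theorem avoid_finite (S : OrdSys G Ω) {B : Set Ω} (hB : B.Finite) :
    ∀ {u v : Ω}, u < v → ∃ v₁, u < v₁ ∧ v₁ ≤ v ∧ ∀ b ∈ B, u < b → ¬ b ≤ v₁ := by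
  induction B, hB using Set.Finite.induction_on with
  | empty => exact fun {u v} h => ⟨v, h, le_rfl, by simp⟩
  | @insert b B _ _ ih =>
    intro u v huv
    obtain ⟨v₁, h1, h2, h3⟩ := ih huv
    by_cases hb : u < b
    · obtain ⟨w, h4, h5, h6⟩ := S.dense_two h1 hb
      refine ⟨w, h4, h5.le.trans h2, fun c hc huc hcw => ?_⟩
      rcases hc with rfl | hc
      · exact absurd h6 hcw.not_gt
      · exact h3 c hc huc (hcw.trans h5.le)
    · refine ⟨v₁, h1, h2, fun c hc huc hcw => ?_⟩
      rcases hc with rfl | hc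
      · exact hb huc
      · exact h3 c hc huc hcw

/-- A strictly increasing definable map between minimal orders is given by `Eqv` somewhere. -/
theorem exists_eqv_of_strictMono (hK : S.Op K) {A : Set Ω} {q : Ω → Ω} {lo hi : Ω} (huv : u < v)
    (hd : ∀ a b, u ≤ a → a < b → b ≤ v → ∃ c ∈ A, a < c ∧ c < b)
    (hm : ∀ a ∈ A, ∀ b ∈ A, u < a → a < b → b < v → q a < q b)
    (he : ∀ k ∈ K, ∀ a ∈ A, u < a → a < v → k • u = u → k • v = v →
      k • a ∈ A ∧ q (k • a) = k • q a)
    (hb : ∀ a ∈ A, u < a → a < v → lo ≤ q a ∧ q a ≤ hi) :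
    ∃ w w', u < w ∧ w < v ∧ S.Eqv w w' ∧ (∀ a ∈ A, u < a → a < w → q a < w') ∧
      ∀ a ∈ A, w < a → a < v → w' < q a := by
  let K' := K ⊓ (stabilizer G u ⊓ stabilizer G v)
  have hK' : S.Op K' := S.op_inf hK (S.op_top_stab₂ u v)
  let A' := {a | a ∈ A ∧ u < a ∧ a < v}
  have hd' : ∀ {a b}, u ≤ a → a < b → b ≤ v → ∃ c ∈ A', a < c ∧ c < b := by
    intro a b h1 h2 h3
    obtain ⟨c, hc, h4, h5⟩ := hd a b h1 h2 h3
    exact ⟨c, ⟨hc, h1.trans_lt h4, h5.trans_le h3⟩, h4, h5⟩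
  have hm' : ∀ {a b}, a ∈ A' → b ∈ A' → a < b → q a < q b :=
    fun ha hb hab => hm _ ha.1 _ hb.1 ha.2.1 hab hb.2.2
  have he' : ∀ k ∈ K', ∀ a ∈ A', k • a ∈ A' ∧ q (k • a) = k • q a := by
    rintro k ⟨hk, hku, hkv⟩ a ⟨ha, h1, h2⟩
    obtain ⟨h3, h4⟩ := he k hk a ha h1 h2 hku hkv
    refine ⟨⟨h3, ?_, ?_⟩, h4⟩
    · rw [← mem_stabilizer_iff.1 hku]; exact S.smul_lt k h1
    · rw [← mem_stabilizer_iff.1 hkv]; exact S.smul_lt k h2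
  have hb' : ∀ {a}, a ∈ A' → lo ≤ q a ∧ q a ≤ hi := fun ha => hb _ ha.1 ha.2.1 ha.2.2
  obtain ⟨a₀, ha₀, -, -⟩ := hd' le_rfl huv le_rfl
  have hfib : K' ≤ S.fib lo := by
    intro k hk
    obtain ⟨h1, h2⟩ := he' k hk a₀ ha₀
    have h3 := (hb' h1).1.cmp
    rw [h2] at h3
    exact S.cmp_trans h3 ((S.smul_cmp k).2 (hb' ha₀).1.cmp.symm)
  -- `J c` is the convex set of the values that an increasing extension of `q` may take at `c`.
  -- These sets are disjoint for distinct `c`, so by `rank` only finitely many have more than one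
  -- element. On an interval that avoids the corresponding `c`, the map from `c` to the element of
  -- `J c` is a definable isomorphism.
  let J (c : Ω) : Set Ω := {j | Cmp lo j ∧ (∀ a ∈ A', a < c → q a < j) ∧ ∀ a ∈ A', c < a → j < q a}
  have J_smul : ∀ k ∈ K', ∀ {c j}, j ∈ J c → k • j ∈ J (k • c) := by
    rintro k hk c j ⟨h0, h1, h2⟩
    refine ⟨S.fib_smul_cmp (hfib hk) h0, fun a ha h3 => ?_, fun a ha h3 => ?_⟩
    · obtain ⟨h6, h7⟩ := he' k⁻¹ (K'.inv_mem hk) a ha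
      have := h1 _ h6 (by rwa [← S.smul_lt_iff k, smul_inv_smul])
      rwa [h7, ← S.smul_lt_iff k, smul_inv_smul] at this
    · obtain ⟨h6, h7⟩ := he' k⁻¹ (K'.inv_mem hk) a ha
      have := h2 _ h6 (by rwa [← S.smul_lt_iff k, smul_inv_smul])
      rwa [h7, ← S.smul_lt_iff k, smul_inv_smul] at this
  have J_lt : ∀ {c c' j j'}, u ≤ c → c < c' → c' ≤ v → j ∈ J c → j' ∈ J c' → j < j' := by
    intro c c' j j' h1 h2 h3 h4 h5
    obtain ⟨a, ha, h6, h7⟩ := hd' h1 h2 h3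
    exact (h4.2.2 a ha h6).trans (h5.2.1 a ha h7)
  have J_ne : ∀ c, u < c → c < v → ∃ j, j ∈ J c := by
    intro c h1 h2
    obtain ⟨a₁, ha₁, h3, h4⟩ := hd' le_rfl h1 h2.le
    obtain ⟨s, hs⟩ := S.exists_lub (A := q '' {a | a ∈ A' ∧ a < c}) ⟨_, a₁, ⟨ha₁, h4⟩, rfl⟩
      ⟨hi, by rintro _ ⟨a, ⟨ha, -⟩, rfl⟩; exact (hb' ha).2⟩
      ⟨K' ⊓ stabilizer G c, S.op_inf hK' (S.op_stab c), by
        rintro k ⟨hk, hkc⟩ _ ⟨a, ⟨ha, hac⟩, rfl⟩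
        obtain ⟨h5, h6⟩ := he' k hk a ha
        refine ⟨k • a, ⟨h5, ?_⟩, h6⟩
        rw [← mem_stabilizer_iff.1 hkc]
        exact S.smul_lt k hac⟩
    refine ⟨s, S.cmp_trans (hb' ha₁).1.cmp (hs.1 ⟨a₁, ⟨ha₁, h4⟩, rfl⟩).cmp,
      fun a ha hac => ?_, fun a ha hca => ?_⟩
    · obtain ⟨b, hb, h5, h6⟩ := hd' ha.2.1.le hac h2.le
      exact (hm' ha hb h5).trans_le (hs.1 ⟨b, ⟨hb, h6⟩, rfl⟩)
    · obtain ⟨b, hb, h5, h6⟩ := hd' h1.le hca ha.2.2.le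
      refine lt_of_le_of_lt (hs.2 ?_) (hm' hb ha h6)
      rintro _ ⟨a', ⟨ha', h7⟩, rfl⟩
      exact (hm' ha' hb (h7.trans h5)).le
  have K_mem : ∀ k ∈ K', ∀ {c}, u < c → c < v → u < k • c ∧ k • c < v := by
    rintro k ⟨-, hku, hkv⟩ c h1 h2
    constructor
    · rw [← mem_stabilizer_iff.1 hku]; exact S.smul_lt k h1
    · rw [← mem_stabilizer_iff.1 hkv]; exact S.smul_lt k h2
  let Bad : Set Ω := {c | u < c ∧ c < v ∧ ∃ j ∈ J c, ∃ j' ∈ J c, j < j'}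
  have Bad_fin : Bad.Finite := by
    have hfin : (J '' Bad).Finite := by
      refine S.rank hK' lo _ ?_ ?_ ?_ ?_ ?_
      · rintro _ ⟨c, -, rfl⟩ j hj
        exact hj.1
      · rintro _ ⟨c, hc, rfl⟩
        exact hc.2.2
      · rintro _ ⟨c, hc, rfl⟩
        refine ⟨fun i hi j hj l hl => ⟨S.cmp_trans hi.1 hl.1.cmp, fun a ha h => ?_, fun a ha h => ?_⟩⟩
        · exact (hi.2.1 a ha h).trans_le hl.1
        · exact hl.2.trans_lt (hj.2.2 a ha h)
      · rintro _ ⟨c, hc, rfl⟩ _ ⟨c', hc', rfl⟩ hne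
        rw [Function.onFun, id, id, Set.disjoint_left]
        intro j hj hj'
        rcases (S.cmp_trans hc.1.cmp.symm hc'.1.cmp).lt_or_eq_or_gt with h | h | h
        · exact lt_irrefl _ (J_lt hc.1.le h hc'.2.1.le hj hj')
        · exact hne (by rw [h])
        · exact lt_irrefl _ (J_lt hc'.1.le h hc.2.1.le hj' hj)
      · rintro k hk _ ⟨c, ⟨h1, h2, j, hj, j', hj', hlt⟩, rfl⟩
        refine ⟨k • c, ⟨(K_mem k hk h1 h2).1, (K_mem k hk h1 h2).2, _, J_smul k hk hj, _,
          J_smul k hk hj', S.smul_lt k hlt⟩, ?_⟩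
        ext i
        constructor
        · intro hi
          refine ⟨k⁻¹ • i, ?_, by simp⟩
          simpa using J_smul k⁻¹ (K'.inv_mem hk) hi
        · rintro ⟨i, hi, rfl⟩
          exact J_smul k hk hi
    refine hfin.of_finite_image ?_
    intro c hc c' hc' h
    obtain ⟨j, hj, -⟩ := hc.2.2
    have hj' : j ∈ J c' := by rw [← h]; exact hj
    rcases (S.cmp_trans hc.1.cmp.symm hc'.1.cmp).lt_or_eq_or_gt with h | h | h
    · exact absurd (J_lt hc.1.le h hc'.2.1.le hj hj') (lt_irrefl _)
    · exact h
    · exact absurd (J_lt hc'.1.le h hc.2.1.le hj' hj) (lt_irrefl _)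
  obtain ⟨v₁, h1, h2, h3⟩ := S.avoid_finite Bad_fin huv
  obtain ⟨v₂, h4, h5⟩ := S.dense h1
  obtain ⟨u₂, h6, h7⟩ := S.dense h4
  have hv₂ : v₂ < v := h5.trans_le h2
  have J_unique : ∀ {c j j'}, u < c → c ≤ v₂ → j ∈ J c → j' ∈ J c → j = j' := by
    intro c j j' hc1 hc2 hj hj'
    rcases (S.cmp_trans hj.1.symm hj'.1).lt_or_eq_or_gt with h | h | h
    · exact absurd (hc2.trans h5.le) (h3 c ⟨hc1, hc2.trans_lt hv₂, j, hj, j', hj', h⟩ hc1)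
    · exact h
    · exact absurd (hc2.trans h5.le) (h3 c ⟨hc1, hc2.trans_lt hv₂, j', hj', j, hj, h⟩ hc1)
  have : Nonempty Ω := ⟨u⟩
  choose! F hF using J_ne
  have hF' : ∀ {c}, u₂ ≤ c → c ≤ v₂ → F c ∈ J c := fun hc1 hc2 =>
    hF _ (h6.trans_le hc1) (hc2.trans_lt hv₂)
  have iso : S.IsoOn F u₂ v₂ := by
    refine ⟨h7, ?_, ?_, ?_⟩
    · intro a ha b hb hab
      exact J_lt (h6.le.trans ha.1) hab (hb.2.trans hv₂.le) (hF' ha.1 ha.2) (hF' hb.1 hb.2)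
    -- The preimage of `j` is the supremum `s` of all `c` with `F c ≤ j`: the inequalities that
    -- define `J s` hold for `j`, and `J s` has one element.
    · intro j hj
      obtain ⟨s, hs⟩ := S.exists_lub (A := {c | u₂ ≤ c ∧ c ≤ v₂ ∧ F c ≤ j})
        ⟨u₂, le_rfl, h7.le, hj.1⟩ ⟨v₂, fun c hc => hc.2.1⟩
        ⟨K' ⊓ stabilizer G j ⊓ (stabilizer G u₂ ⊓ stabilizer G v₂),
          S.op_inf (S.op_inf hK' (S.op_stab j)) (S.op_top_stab₂ _ _), by
          rintro k ⟨⟨hk, hkj⟩, hku, hkv⟩ c ⟨hc1, hc2, hc3⟩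
          have h8 := (S.smul_le_iff k).2 hc1
          have h9 := (S.smul_le_iff k).2 hc2
          rw [mem_stabilizer_iff.1 hku] at h8
          rw [mem_stabilizer_iff.1 hkv] at h9
          refine ⟨h8, h9, ?_⟩
          rw [J_unique (h6.trans_le h8) h9 (hF' h8 h9) (J_smul k hk (hF' hc1 hc2))]
          rw [← mem_stabilizer_iff.1 hkj]
          exact (S.smul_le_iff k).2 hc3⟩
      have hs1 : u₂ ≤ s := hs.1 ⟨le_rfl, h7.le, hj.1⟩
      have hs2 : s ≤ v₂ := hs.2 fun c hc => hc.2.1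
      refine ⟨s, ⟨hs1, hs2⟩, J_unique (h6.trans_le hs1) hs2 (hF' hs1 hs2) ⟨?_, ?_, ?_⟩⟩
      · exact S.cmp_trans (hF' le_rfl h7.le).1 hj.1.cmp
      · intro a ha has
        by_contra hn
        have hub : a ∈ upperBounds {c | u₂ ≤ c ∧ c ≤ v₂ ∧ F c ≤ j} := by
          rintro c ⟨hc1, hc2, hc3⟩
          rcases (S.cmp_trans has.cmp (S.cmp_trans hs1.cmp.symm hc1.cmp)).lt_or_le with h8 | h8
          · exact absurd (((hF' hc1 hc2).2.1 a ha h8).trans_le hc3) hn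
          · exact h8
        exact absurd has (hs.2 hub).not_gt
      · intro a ha hsa
        rcases hs2.lt_or_eq with h8 | h8
        · obtain ⟨c, hc1, hc2, hc3⟩ := S.dense_two hsa h8
          have hc0 := hs1.trans hc1.le
          have h9 := (hF' hc0 hc3.le).2.2 a ha hc2
          have h10 : ¬ F c ≤ j := fun h => absurd hc1 (hs.1 ⟨hc0, hc3.le, h⟩).not_gt
          have : Cmp j (F c) := S.cmp_trans hj.1.cmp.symm (S.cmp_trans (hF' le_rfl h7.le).1.symm
            (hF' hc0 hc3.le).1)
          rcases this.lt_or_le with h11 | h11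
          · exact h11.trans h9
          · exact absurd h11 h10
        · exact hj.2.trans_lt ((hF' h7.le le_rfl).2.2 a ha (h8 ▸ hsa))
    · refine ⟨K' ⊓ (stabilizer G u₂ ⊓ stabilizer G v₂), S.op_inf hK' (S.op_top_stab₂ _ _), ?_⟩
      rintro k ⟨hk, hku, hkv⟩
      refine ⟨hku, hkv, fun c hc => ?_⟩
      have h8 := (S.smul_le_iff k).2 hc.1
      have h9 := (S.smul_le_iff k).2 hc.2
      rw [mem_stabilizer_iff.1 hku] at h8
      rw [mem_stabilizer_iff.1 hkv] at h9
      exact J_unique (h6.trans_le h8) h9 (hF' h8 h9) (J_smul k hk (hF' hc.1 hc.2))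
  obtain ⟨w, hw1, hw2⟩ := S.dense h7
  have hw := hF' hw1.le hw2.le
  refine ⟨w, F w, h6.trans hw1, hw2.trans hv₂, iso.eqv hw1 hw2, fun a ha h8 h9 => ?_,
    fun a ha h8 h9 => ?_⟩
  · exact hw.2.1 a ⟨ha, h8, (h9.trans hw2).trans hv₂⟩ h9
  · exact hw.2.2 a ⟨ha, (h6.trans hw1).trans h8, h9⟩ h8

end OrdSys

end DefOrd

/-! ### Gluing without branching: components are lines or circles -/

namespace DefOrd

open MulAction Set

namespace OrdSys

variable {G Ω : Type*} [Group G] [MulAction G Ω] [PartialOrder Ω]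
  {S : OrdSys G Ω} {K : Subgroup G} {x y z w u v t s : Ω} {x' y' z' w' u' v' t' s' : Ω}

theorem Match.map_lt (h : S.Match x z x' z') (hxz : x < z) : x' < z' :=
  h.mono le_rfl le_rfl (Cmp.refl _) h.le'.cmp h.left h.right hxz

theorem smul_isLUB_image (S : OrdSys G Ω) {A : Set Ω} (hs : IsLUB A s) (k : G) :
    IsLUB ((fun a => k • a) '' A) (k • s) := by
  constructor
  · rintro _ ⟨a, ha, rfl⟩
    exact (S.smul_le_iff k).2 (hs.1 ha)
  · intro b hb
    rw [← S.smul_le_iff k⁻¹, inv_smul_smul]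
    refine hs.2 fun a ha => ?_
    rw [← S.smul_le_iff k, smul_inv_smul]
    exact hb ⟨a, ha, rfl⟩

/-- The intervals `[u, s)` and `[u', s')` are identified, but `s` and `s'` are not. -/
structure Branch (S : OrdSys G Ω) (u s u' s' : Ω) : Prop where
  lt : u < s
  lt' : u' < s'
  fwd : ∀ w, u ≤ w → w < s → ∃ w', w' < s' ∧ S.Match u w u' w'
  bwd : ∀ w', u' ≤ w' → w' < s' → ∃ w, w < s ∧ S.Match u w u' w'
  not_eqv : ¬ S.Eqv s s'

/-- Two orders that agree at some point agree until one of them ends. -/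
def Hausdorff (S : OrdSys G Ω) : Prop := ∀ ⦃x x' z : Ω⦄, S.Eqv x x' → x ≤ z →
  (∃ z', S.Match x z x' z') ∨ ∀ w', x' ≤ w' → ∃ w, w < z ∧ S.Match x w x' w'

/-- Follow the two orders from `x` and `x'` as long as they agree. If agreement stops before `z` is
reached and before the order of `x'` is exhausted, then the suprema `s` and `s'` of the matched
elements on the two sides form a branch: a match cannot include `s`, since every match extends a
little further. -/
theorem hausdorff_of_not_branch (h : ∀ u s u' s', ¬ S.Branch u s u' s') : S.Hausdorff := by
  intro x x' z hx hxz
  by_contra hn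
  rw [not_or] at hn
  obtain ⟨hz, hn2⟩ := hn
  push Not at hn2
  obtain ⟨w₀, hw₀, hnw⟩ := hn2
  let Z : Set Ω := {w | w ≤ z ∧ ∃ w', S.Match x w x' w'}
  let Z' : Set Ω := {w' | ∃ w, w ≤ z ∧ S.Match x w x' w'}
  have Z_lt : ∀ w ∈ Z, w < z := by
    rintro w ⟨h1, h2⟩
    exact h1.lt_of_ne (fun h3 => hz (h3 ▸ h2))
  have Z'_le : ∀ w' ∈ Z', w' ≤ w₀ := by
    rintro w' ⟨w, h1, h2⟩
    rcases (S.cmp_trans hw₀.cmp.symm h2.le'.cmp).lt_or_le with h3 | h3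
    · obtain ⟨w₁, h4, h5⟩ := h2.symm.split hw₀ h3.le
      exact absurd h4.symm (hnw w₁ (h5.le'.trans_lt (Z_lt w ⟨h1, w', h2⟩)))
    · exact h3
  have xZ : x ∈ Z := ⟨hxz, x', Match.of_eqv hx⟩
  have stab_smul : ∀ k ∈ (stabilizer G x ⊓ stabilizer G z) ⊓ stabilizer G x', ∀ w w',
      w ≤ z → S.Match x w x' w' → k • w ≤ z ∧ S.Match x (k • w) x' (k • w') := by
    rintro k ⟨⟨h1, h2⟩, h3⟩ w w' h4 h5
    have h6 := h5.smul k
    have h7 := (S.smul_le_iff k).2 h4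
    rw [mem_stabilizer_iff.1 h1, mem_stabilizer_iff.1 h3] at h6
    rw [mem_stabilizer_iff.1 h2] at h7
    exact ⟨h7, h6⟩
  have hop : S.Op ((stabilizer G x ⊓ stabilizer G z) ⊓ stabilizer G x') :=
    S.op_inf (S.op_top_stab₂ _ _) (S.op_stab _)
  obtain ⟨s, hs⟩ := S.exists_lub (A := Z) ⟨x, xZ⟩ ⟨z, fun w hw => hw.1⟩ ⟨_, hop, by
    rintro k hk w ⟨h1, w', h2⟩
    exact ⟨(stab_smul k hk w w' h1 h2).1, _, (stab_smul k hk w w' h1 h2).2⟩⟩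
  obtain ⟨s', hs'⟩ := S.exists_lub (A := Z') ⟨x', x, hxz, Match.of_eqv hx⟩ ⟨w₀, Z'_le⟩ ⟨_, hop, by
    rintro k hk w' ⟨w, h1, h2⟩
    exact ⟨k • w, stab_smul k hk w w' h1 h2⟩⟩
  have hxs : x ≤ s := hs.1 xZ
  have hsz : s ≤ z := hs.2 fun w hw => hw.1
  have extend : ∀ {w w'}, w ≤ z → S.Match x w x' w' → ∃ c c', c ≤ z ∧ w < c ∧ w' < c' ∧
      S.Match x c x' c' := by
    intro w w' h1 h2
    obtain ⟨b, b', h3, h4, h5⟩ := h2.right.exists_match_right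
    obtain ⟨c, h6, h7, h8⟩ := S.dense_two h3 (Z_lt w ⟨h1, w', h2⟩)
    obtain ⟨c', h9, -⟩ := h5.split h6.le h7.le
    exact ⟨c, c', h8.le, h6, h9.map_lt h6, h2.concat h9⟩
  have s_not : s ∉ Z := by
    rintro ⟨h1, s₁, h2⟩
    obtain ⟨c, c', h3, h4, h5, h6⟩ := extend h1 h2
    exact absurd h4 (hs.1 ⟨h3, c', h6⟩).not_gt
  have below : ∀ w, x ≤ w → w < s → w ∈ Z := by
    intro w h1 h2
    by_contra h3
    refine absurd h2 (hs.2 ?_).not_gt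
    rintro c ⟨hc, c', hm⟩
    rcases (S.cmp_trans h1.cmp.symm hm.le.cmp).lt_or_le with h4 | h4
    · obtain ⟨w', h5, -⟩ := hm.split h1 h4.le
      exact absurd ⟨h4.le.trans hc, w', h5⟩ h3
    · exact h4
  have below' : ∀ w', x' ≤ w' → w' < s' → w' ∈ Z' := by
    intro w' h1 h2
    by_contra h3
    refine absurd h2 (hs'.2 ?_).not_gt
    rintro c' ⟨c, hc, hm⟩
    rcases (S.cmp_trans h1.cmp.symm hm.le'.cmp).lt_or_le with h4 | h4
    · obtain ⟨w, h5, h6⟩ := hm.symm.split h1 h4.le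
      exact absurd ⟨w, h6.le'.trans hc, h5.symm⟩ h3
    · exact h4
  have hxs' : x < s := hxs.lt_of_ne fun h => s_not (h ▸ xZ)
  have Z'_lt : ∀ w ∈ Z', w < s' := by
    rintro w' ⟨w, h1, h2⟩
    obtain ⟨c, c', h3, h4, h5, h6⟩ := extend h1 h2
    exact h5.trans_le (hs'.1 ⟨c, h3, h6⟩)
  refine h x s x' s' ⟨hxs', Z'_lt _ ⟨x, hxz, Match.of_eqv hx⟩, ?_, ?_, ?_⟩
  · intro w h1 h2
    obtain ⟨h3, w', h4⟩ := below w h1 h2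
    exact ⟨w', Z'_lt _ ⟨w, h3, h4⟩, h4⟩
  · intro w' h1 h2
    obtain ⟨w, h3, h4⟩ := below' w' h1 h2
    refine ⟨w, ?_, h4⟩
    obtain ⟨c, c', h5, h6, h7, h8⟩ := extend h3 h4
    exact h6.trans_le (hs.1 ⟨h5, c', h8⟩)
  · intro he
    obtain ⟨a, b, a', b', h1, h2, h3, h4, h5⟩ := he.exists_match
    obtain ⟨w, h6, h7, h8⟩ := S.dense_two' h1 hxs'
    obtain ⟨hwz, w', h9⟩ := below w h8.le h6
    have hc : Cmp a' w' := S.cmp_trans h3.cmp (S.cmp_trans (Z'_lt _ ⟨w, hwz, h9⟩).cmp.symm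
      (Cmp.refl _))
    refine s_not ⟨hsz, s', h9.concat (h5.sub h7.le h6.le h2.le hc h3.cmp h9.right he)⟩

namespace Hausdorff


theorem right (hS : S.Hausdorff) (h : S.Eqv x x') (hz : x ≤ z) (hz' : x' ≤ z') :
    (∃ t, t ≤ z ∧ S.Match x t x' z') ∨ ∃ t, t < z' ∧ S.Match x z x' t := by
  rcases hS h hz with ⟨t, ht⟩ | h1
  · rcases (S.cmp_trans hz'.cmp.symm ht.le'.cmp).lt_or_le with h2 | h2
    · obtain ⟨t', h3, h4⟩ := ht.symm.split hz' h2.le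
      exact Or.inl ⟨t', h4.le', h3.symm⟩
    · rcases h2.lt_or_eq with h3 | h3
      · exact Or.inr ⟨t, h3, ht⟩
      · exact Or.inl ⟨z, le_rfl, h3 ▸ ht⟩
  · obtain ⟨t, h2, h3⟩ := h1 z' hz'
    exact Or.inl ⟨t, h2.le, h3⟩

/-- Intervals with the same end points coincide. -/
theorem match_of_ends (hS : S.Hausdorff) (hx : S.Eqv x x') (hz : S.Eqv z z') (h : x ≤ z) (h' : x' ≤ z') :
    S.Match x z x' z' := by
  rcases hS.right hx h h' with ⟨t, h1, h2⟩ | ⟨t, h1, h2⟩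
  · rwa [h2.right.unique' hz (S.cmp_trans h2.le.cmp.symm h.cmp)] at h2
  · rwa [h2.right.unique hz (S.cmp_trans h2.le'.cmp.symm h'.cmp)] at h2

end Hausdorff

/-- Some order of the family contains both `x` and `y`, and `x < y` there. -/
def Arc (S : OrdSys G Ω) (x y : Ω) : Prop := ∃ x₁ y₁, S.Eqv x x₁ ∧ S.Eqv y y₁ ∧ x₁ < y₁

theorem Arc.of_lt (h : x < y) : S.Arc x y := ⟨x, y, Eqv.refl S x, Eqv.refl S y, h⟩

theorem Arc.congr (h : S.Arc x y) (hx : S.Eqv x x') (hy : S.Eqv y y') : S.Arc x' y' := by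
  obtain ⟨x₁, y₁, h1, h2, h3⟩ := h
  exact ⟨x₁, y₁, hx.symm.trans h1, hy.symm.trans h2, h3⟩

theorem Arc.smul (h : S.Arc x y) (k : G) : S.Arc (k • x) (k • y) := by
  obtain ⟨x₁, y₁, h1, h2, h3⟩ := h
  exact ⟨_, _, h1.smul k, h2.smul k, S.smul_lt k h3⟩

theorem Arc.nu (h : S.Arc x y) : S.Arc (S.nu y) (S.nu x) := by
  obtain ⟨x₁, y₁, h1, h2, h3⟩ := h
  exact ⟨_, _, h2.nu, h1.nu, S.nu_lt h3⟩

theorem arc_nu_iff : S.Arc (S.nu y) (S.nu x) ↔ S.Arc x y :=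
  ⟨fun h => by simpa [S.nu_nu] using h.nu, Arc.nu⟩

theorem Arc.not_eqv (h : S.Arc x y) : ¬ S.Eqv x y := by
  obtain ⟨x₁, y₁, h1, h2, h3⟩ := h
  exact fun h4 => h3.ne ((h1.symm.trans (h4.trans h2)).eq_of_cmp h3.cmp)

/-- All points that can be reached from `w'` can be reached from `w` through `w'`. -/
def Reach (S : OrdSys G Ω) (w w' : Ω) : Prop := ∀ y z, S.Eqv w' y → y < z →
  ∃ x₁ y₁ z₁, S.Eqv w x₁ ∧ S.Eqv w' y₁ ∧ S.Eqv z z₁ ∧ x₁ ≤ y₁ ∧ y₁ < z₁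

/-- With `rel_total`, this yields the dichotomy on which `arc_trans` is based: `Reach` holds for all
pairs `a < b` of an order or for none. -/
theorem Hausdorff.convRel_reach (hS : S.Hausdorff) (x : Ω) : ConvRel (S.fib x) S.Reach := by
  refine ⟨fun k _ w w' _ h y z h1 h2 => ?_, fun {a b c} hab hbc h1 h2 y z h3 h4 => ?_,
    fun {a b c} hab hbc h y z h3 h4 => ?_, fun {a b c} hab hbc h y z h3 h4 => ?_⟩
  · have h3 := h1.smul k⁻¹
    rw [inv_smul_smul] at h3
    obtain ⟨x₁, y₁, z₁, h4, h5, h6, h7, h8⟩ := h _ _ h3 (S.smul_lt k⁻¹ h2)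
    refine ⟨k • x₁, k • y₁, k • z₁, h4.smul k, h5.smul k, ?_, (S.smul_le_iff k).2 h7,
      S.smul_lt k h8⟩
    simpa using h6.smul k
  · obtain ⟨x₁, y₁, z₁, h5, h6, h7, h8, h9⟩ := h2 y z h3 h4
    obtain ⟨x₂, y₂, z₂, g5, g6, g7, g8, g9⟩ := h1 x₁ z₁ h5 (h8.trans_lt h9)
    obtain ⟨c₁, m1, m2⟩ := (hS.match_of_ends (h5.symm.trans g6) g7 (h8.trans h9.le) g9.le).split h8 h9.le
    exact ⟨x₂, c₁, z₂, g5, h6.trans m1.right, h7.trans g7, g8.trans m1.le', m2.map_lt h9⟩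
  · rcases hS.right h3 hbc h4.le with ⟨t, h5, h6⟩ | ⟨t, h5, h6⟩
    · exact ⟨a, b, t, Eqv.refl S a, Eqv.refl S b, h6.right.symm, hab, h6.symm.map_lt h4⟩
    · obtain ⟨x₁, y₁, z₁, g1, g2, g3, g4, g5⟩ := h t z h6.right h5
      obtain ⟨b₁, m1, m2⟩ := (hS.match_of_ends g1 g2 (hab.trans hbc) g4).split hab hbc
      exact ⟨x₁, b₁, z₁, g1, m1.right, g3, m1.le', m2.le'.trans_lt g5⟩
  · obtain ⟨x₁, y₁, z₁, g1, g2, g3, g4, g5⟩ := h y z h3 h4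
    obtain ⟨b₁, m1, m2⟩ := (hS.match_of_ends g1 g2 (hab.trans hbc) g4).split hab hbc
    exact ⟨b₁, y₁, z₁, m1.right, g2, g3, m2.le', g5⟩

/-- If `x < y` and `y < z` (in different orders), then the union of both intervals is an interval,
or else it wraps around. -/
theorem Hausdorff.arc_trans (hS : S.Hausdorff) (hxy : x < y) (hy : S.Eqv y y') (hyz : y' < z) :
    S.Arc x z ∨ ∃ x', y' ≤ x' ∧ x' ≤ z ∧ S.Eqv x x' := by
  by_cases htot : ∃ a b, Cmp x a ∧ a < b ∧ S.Reach a b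
  · obtain ⟨a, b, h1, h2, h3⟩ := htot
    have hE := hS.convRel_reach a
    obtain ⟨x₁, y₁, z₁, g1, g2, g3, g4, g5⟩ := S.rel_total hE h2 h3 h1.symm hxy y' z hy hyz
    exact Or.inl ⟨x₁, z₁, g1, g3, g4.trans_lt g5⟩
  by_contra hn
  rw [not_or] at hn
  obtain ⟨hn1, hn2⟩ := hn
  -- `R w` is the part of `[y', z]` that is reached from `w` through `y`. For `w ≤ x` it is an
  -- initial segment without last element that omits `z`, and `q w` is its supremum.
  let R (w : Ω) : Set Ω := {v | y' ≤ v ∧ v ≤ z ∧ ∃ x₁ y₂ z₂, S.Eqv w x₁ ∧ S.Eqv y y₂ ∧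
    S.Eqv v z₂ ∧ x₁ < y₂ ∧ y₂ ≤ z₂}
  have R_ne : ∀ w, w ≤ x → y' ∈ R w := fun w hw =>
    ⟨le_rfl, hyz.le, w, y, y, Eqv.refl S w, Eqv.refl S y, hy.symm, hw.trans_lt hxy, le_rfl⟩
  have z_not : ∀ w, w ≤ x → z ∉ R w := by
    rintro w hw ⟨-, -, x₁, y₂, z₂, h1, h2, h3, h4, h5⟩
    obtain ⟨x₂, m1, m2⟩ := (hS.match_of_ends h1 h2 (hw.trans hxy.le) h4.le).split hw hxy.le
    exact hn1 ⟨x₂, z₂, m1.right, h3, (m2.map_lt hxy).trans_le h5⟩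
  have R_mono : ∀ {w w'}, w ≤ w' → w' ≤ x → R w ⊆ R w' := by
    rintro w w' hw hw' v ⟨h0, h0', x₁, y₂, z₂, h1, h2, h3, h4, h5⟩
    have h6 := hw'.trans_lt hxy
    obtain ⟨x₂, m1, m2⟩ := (hS.match_of_ends h1 h2 (hw.trans h6.le) h4.le).split hw h6.le
    exact ⟨h0, h0', x₂, y₂, z₂, m1.right, h2, h3, m2.map_lt h6, h5⟩
  have R_init : ∀ {w v v'}, v ∈ R w → y' ≤ v' → v' ≤ v → v' ∈ R w := by
    rintro w v v' ⟨h0, h0', x₁, y₂, z₂, h1, h2, h3, h4, h5⟩ h6 h7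
    obtain ⟨v₂, m1, m2⟩ := (hS.match_of_ends (hy.symm.trans h2) h3 h0 h5).split h6 h7
    exact ⟨h6, h7.trans h0', x₁, y₂, v₂, h1, h2, m1.right, h4, m1.le'⟩
  have R_ext : ∀ {w v}, w ≤ x → v ∈ R w → ∃ v₁ ∈ R w, v < v₁ := by
    intro w v hw hv
    have hvz : v < z := hv.2.1.lt_of_ne fun h => z_not w hw (h ▸ hv)
    obtain ⟨h0, h0', x₁, y₂, z₂, h1, h2, h3, h4, h5⟩ := hv
    obtain ⟨b, b', h6, h7, h8⟩ := h3.exists_match_right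
    obtain ⟨c, h9, h10, h11⟩ := S.dense_two h6 hvz
    obtain ⟨c', m1, -⟩ := h8.split h9.le h10.le
    exact ⟨c, ⟨h0.trans h9.le, h11.le, x₁, y₂, c', h1, h2, m1.right, h4, h5.trans m1.le'⟩, h9⟩
  let K := (stabilizer G y ⊓ stabilizer G y') ⊓ stabilizer G z
  have hK : S.Op K := S.op_inf (S.op_top_stab₂ _ _) (S.op_stab _)
  have R_smul : ∀ k ∈ K, ∀ {w v}, v ∈ R w → k • v ∈ R (k • w) := by
    rintro k ⟨⟨k1, k2⟩, k3⟩ w v ⟨h0, h0', x₁, y₂, z₂, h1, h2, h3, h4, h5⟩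
    have g0 := (S.smul_le_iff k).2 h0
    have g1 := (S.smul_le_iff k).2 h0'
    have g2 := h2.smul k
    rw [mem_stabilizer_iff.1 k2] at g0
    rw [mem_stabilizer_iff.1 k3] at g1
    rw [mem_stabilizer_iff.1 k1] at g2
    exact ⟨g0, g1, k • x₁, k • y₂, k • z₂, h1.smul k, g2, h3.smul k, S.smul_lt k h4,
      (S.smul_le_iff k).2 h5⟩
  have R_image : ∀ k ∈ K, ∀ w, R (k • w) = (fun v => k • v) '' R w := by
    intro k hk w
    ext v
    constructor
    · intro hv
      refine ⟨k⁻¹ • v, ?_, by simp⟩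
      simpa using R_smul k⁻¹ (K.inv_mem hk) hv
    · rintro ⟨v, hv, rfl⟩
      exact R_smul k hk hv
  have hq : ∀ w, w ≤ x → ∃ s, IsLUB (R w) s := by
    intro w hw
    refine S.exists_lub ⟨y', R_ne w hw⟩ ⟨z, fun v hv => hv.2.1⟩
      ⟨K ⊓ stabilizer G w, S.op_inf hK (S.op_stab w), ?_⟩
    rintro k ⟨hk, hkw⟩ v hv
    have := R_smul k hk hv
    rwa [mem_stabilizer_iff.1 hkw] at this
  have : Nonempty Ω := ⟨x⟩
  choose! q hq using hq
  -- If `q w = q w'`, then everything that is reached from `w'` is reached from `w` through `w'`.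
  -- This is an instance of `Reach`, and there is none by assumption.
  have strict : ∀ {w w'}, w < w' → w' ≤ x → q w < q w' := by
    intro w w' hw hw'
    have hwx := hw.le.trans hw'
    have hle : q w ≤ q w' := (hq w hwx).2 fun v hv => (hq w' hw').1 (R_mono hw.le hw' hv)
    refine hle.lt_of_ne fun heq => htot ⟨w, w', (hw.le.trans hw').cmp.symm, hw, ?_⟩
    have hsub : R w' ⊆ R w := by
      intro v hv
      by_contra hnv
      obtain ⟨v₁, hv₁, hlt⟩ := R_ext hw' hv
      have : v < q w := by rw [heq]; exact hlt.trans_le ((hq w' hw').1 hv₁)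
      refine absurd this ((hq w hwx).2 ?_).not_gt
      intro v₂ hv₂
      rcases (S.cmp_trans hv.1.cmp.symm hv₂.1.cmp).lt_or_le with h | h
      · exact absurd (R_init hv₂ hv.1 h.le) hnv
      · exact h
    have hwy := hw'.trans_lt hxy
    intro y₁ t h1 h2
    rcases hS.right h1 hwy.le h2.le with ⟨t', h3, h4⟩ | ⟨y₇, h3, h4⟩
    · exact ⟨w, w', t', Eqv.refl S w, Eqv.refl S w', h4.right.symm, hw.le, h4.symm.map_lt h2⟩
    · have h5 := h4.map_lt hwy
      rcases hS.right (hy.symm.trans h4.right) hyz.le h3.le with ⟨t', h6, h7⟩ | ⟨z₇, h6, h7⟩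
      · obtain ⟨-, -, x₁, y₂, t₂, g1, g2, g3, g4, g5⟩ := hsub
          (show t' ∈ R w' from ⟨h7.le, h6, y₁, y₇, t, h1, h4.right, h7.right, h5, h7.le'⟩)
        obtain ⟨w₁, m1, m2⟩ := (hS.match_of_ends g1 g2 (hw.le.trans hwy.le) g4.le).split hw.le hwy.le
        exact ⟨x₁, w₁, t₂, g1, m1.right, h7.right.symm.trans g3, m1.le',
          (m2.map_lt hwy).trans_le g5⟩
      · exact absurd ⟨hyz.le, le_rfl, y₁, y₇, z₇, h1, h4.right, h7.right, h5, h7.le'⟩ (z_not w' hw')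
  -- By rigidity at most one element equivalent to `z` lies below `x`; the interval from `u` to `x`
  -- is chosen to avoid it.
  obtain ⟨u, hux, hu⟩ : ∃ u, u < x ∧ ∀ z₁, z₁ < x → S.Eqv z z₁ → z₁ ≤ u := by
    by_cases hz : ∃ z₁, z₁ < x ∧ S.Eqv z z₁
    · obtain ⟨z₁, h1, h2⟩ := hz
      exact ⟨z₁, h1, fun z₂ h3 h4 => (h4.unique h2 (S.cmp_trans h3.cmp h1.cmp.symm)).le⟩
    · obtain ⟨u, hu⟩ := S.exists_lt x
      exact ⟨u, hu, fun z₁ h1 h2 => absurd ⟨z₁, h1, h2⟩ hz⟩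
  obtain ⟨w, w', h1, h2, h3, h4, h5⟩ := S.exists_eqv_of_strictMono hK (A := Set.univ) (q := q)
    (lo := y') (hi := z) hux
    (fun a b _ hab _ => by
      obtain ⟨c, hc⟩ := S.dense hab
      exact ⟨c, trivial, hc⟩)
    (fun a _ b _ _ hab hb => strict hab hb.le)
    (fun k hk a _ _ ha _ hkx => by
      refine ⟨trivial, (hq (k • a) ?_).unique ?_⟩
      · rw [← hkx]; exact (S.smul_le_iff k).2 ha.le
      · rw [R_image k hk]
        exact S.smul_isLUB_image (hq a ha.le) k)
    (fun a _ _ ha => ⟨(hq a ha.le).1 (R_ne a ha.le), (hq a ha.le).2 fun v hv => hv.2.1⟩)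
  obtain ⟨a, ha1, ha2⟩ := S.dense h1
  obtain ⟨b, hb1, hb2⟩ := S.dense h2
  have hyw : y' < w' := ((hq a (ha2.trans h2).le).1 (R_ne a (ha2.trans h2).le)).trans_lt
    (h4 a trivial ha1 ha2)
  have hwz : w' < z := (h5 b trivial hb1 hb2).trans_le ((hq b hb2.le).2 fun v hv => hv.2.1)
  -- The map `q` has produced `w` between `u` and `x`, equivalent to some `w'` between `y'` and `z`.
  -- Follow both orders upwards from there. If `z` is met on the side of `w`, it is met at or after
  -- `x` by the choice of `u`, so `x` has a copy in `[y', z]`: the wrap-around. If `y` is met first,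
  -- then it has a copy above `y'`, against rigidity.
  rcases hS.right h3 (h2.trans hxy).le hwz.le with ⟨z₁, g1, g2⟩ | ⟨y₉, g1, g2⟩
  · rcases (S.cmp_trans g2.le.cmp.symm h2.cmp).lt_or_le with h6 | h6
    · exact absurd (g2.le.trans (hu z₁ h6 g2.right.symm)) h1.not_ge
    · obtain ⟨x₁, m1, m2⟩ := g2.split h2.le h6
      exact hn2 ⟨x₁, hyw.le.trans m1.le', m2.le', m1.right⟩
  · have := g2.right.unique hy (S.cmp_trans g2.le'.cmp.symm hyw.cmp.symm)
    exact absurd (hyw.trans_le g2.le') (by rw [this]; exact lt_irrefl _)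

/-- `x` and `y` are in the same connected component. -/
def Comp (S : OrdSys G Ω) (x y : Ω) : Prop := S.Eqv x y ∨ S.Arc x y ∨ S.Arc y x

theorem Comp.symm (h : S.Comp x y) : S.Comp y x := by
  rcases h with h | h | h
  · exact Or.inl h.symm
  · exact Or.inr (Or.inr h)
  · exact Or.inr (Or.inl h)

theorem Comp.of_cmp (S : OrdSys G Ω) (h : Cmp x y) : S.Comp x y := by
  rcases h.lt_or_eq_or_gt with h | h | h
  · exact Or.inr (Or.inl (Arc.of_lt h))
  · exact Or.inl (h ▸ Eqv.refl S x)
  · exact Or.inr (Or.inr (Arc.of_lt h))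

theorem Comp.smul (h : S.Comp x y) (k : G) : S.Comp (k • x) (k • y) :=
  h.imp (fun h => h.smul k) (Or.imp (fun h => h.smul k) fun h => h.smul k)

theorem Comp.nu (h : S.Comp x y) : S.Comp (S.nu x) (S.nu y) :=
  h.imp (fun h => h.nu) fun h => h.symm.imp (fun h => h.nu) fun h => h.nu

namespace Hausdorff

theorem arc_trans_or_eqv (hS : S.Hausdorff) (h : S.Arc x y) (h' : S.Arc y z) :
    S.Arc x z ∨ S.Eqv x z := by
  obtain ⟨x₁, y₁, h1, h2, h3⟩ := h
  obtain ⟨y₂, z₂, h4, h5, h6⟩ := h'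
  rcases hS.arc_trans h3 (h2.symm.trans h4) h6 with h7 | ⟨x', h7, h8, h9⟩
  · exact Or.inl (h7.congr h1.symm h5.symm)
  · rcases h8.lt_or_eq with h10 | h10
    · exact Or.inl ⟨x', z₂, h1.trans h9, h5, h10⟩
    · exact Or.inr (h1.trans (h9.trans (h10 ▸ h5.symm)))

/-- Of two arcs leaving the same point, the shorter is an initial part of the longer. -/
theorem comp_of_arc_left (hS : S.Hausdorff) (h : S.Arc y x) (h' : S.Arc y z) : S.Comp x z := by
  obtain ⟨y₁, x₁, h1, h2, h3⟩ := h
  obtain ⟨y₂, z₂, h4, h5, h6⟩ := h'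
  rcases hS.right (h1.symm.trans h4) h3.le h6.le with ⟨t, h7, h8⟩ | ⟨t, h7, h8⟩
  · rcases h7.lt_or_eq with h9 | h9
    · exact Or.inr (Or.inr ⟨t, x₁, h5.trans h8.right.symm, h2, h9⟩)
    · exact Or.inl (h2.trans (h9 ▸ h8.right.trans h5.symm))
  · exact Or.inr (Or.inl ⟨t, z₂, h2.trans h8.right, h5, h7⟩)

theorem comp_of_arc_right (hS : S.Hausdorff) (h : S.Arc x y) (h' : S.Arc z y) : S.Comp x z := by
  have := (hS.comp_of_arc_left h.nu h'.nu).nu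
  rwa [S.nu_nu, S.nu_nu] at this

theorem comp_trans (hS : S.Hausdorff) (h : S.Comp x y) (h' : S.Comp y z) : S.Comp x z := by
  rcases h with h | h | h
  · rcases h' with h' | h' | h'
    · exact Or.inl (h.trans h')
    · exact Or.inr (Or.inl (h'.congr h.symm (Eqv.refl S z)))
    · exact Or.inr (Or.inr (h'.congr (Eqv.refl S z) h.symm))
  · rcases h' with h' | h' | h'
    · exact Or.inr (Or.inl (h.congr (Eqv.refl S x) h'))
    · rcases hS.arc_trans_or_eqv h h' with h | h
      · exact Or.inr (Or.inl h)
      · exact Or.inl h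
    · exact hS.comp_of_arc_right h h'
  · rcases h' with h' | h' | h'
    · exact Or.inr (Or.inr (h.congr h' (Eqv.refl S x)))
    · exact hS.comp_of_arc_left h h'
    · rcases hS.arc_trans_or_eqv h' h with h | h
      · exact Or.inr (Or.inr h)
      · exact Or.inl h.symm

/-- Leave `x` towards `z` and `y`. If `y` is met no later than `z`, continue from `z` to `x`. If `y`
comes after `z`, compare from `z` the ways to `x` and to `y`: meeting `x` first would put two copies
of `x` in one order, so `y` is met on the way to `x`. -/
theorem arc_symm_aux (hS : S.Hausdorff) (h : S.Arc x z) (h' : S.Arc z x) (hp : S.Arc x y) :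
    S.Arc y x := by
  have hne := hp.not_eqv
  obtain ⟨x₁, z₁, h1, h2, h3⟩ := h
  obtain ⟨x₂, y₂, h4, h5, h6⟩ := hp
  rcases hS.right (h1.symm.trans h4) h3.le h6.le with ⟨t, h7, h8⟩ | ⟨t, h7, h8⟩
  · have hyt := h5.trans h8.right.symm
    rcases h7.lt_or_eq with h9 | h9
    · rcases hS.arc_trans_or_eqv ⟨t, z₁, hyt, h2, h9⟩ h' with h10 | h10
      · exact h10
      · exact absurd h10.symm hne
    · exact h'.congr (h2.trans (h9 ▸ hyt.symm)) (Eqv.refl S x)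
  · obtain ⟨z₃, x₃, g1, g2, g3⟩ := h'
    rcases hS.right ((h2.trans h8.right).symm.trans g1) h7.le g3.le with ⟨s, m1, m2⟩ | ⟨s, m1, m2⟩
    · exfalso
      have : s = x₂ := ((g2.trans m2.right.symm).symm.trans h4).eq_of_cmp
        (S.cmp_trans m2.le.cmp.symm h8.le'.cmp.symm)
      exact absurd (h8.map_lt h3) (this ▸ m2.le).not_gt
    · exact ⟨s, x₃, h5.trans m2.right, g2, m1⟩

/-- The component of `x` is a circle as soon as it contains a circle. -/
theorem arc_of_circular (hS : S.Hausdorff) (h : S.Arc x z) (h' : S.Arc z x) (hu : S.Comp x u)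
    (hv : S.Comp x v) (hne : ¬ S.Eqv u v) : S.Arc u v := by
  have key : ∀ {p}, S.Comp x p → ¬ S.Eqv x p → S.Arc x p ∧ S.Arc p x := by
    intro p hp hnp
    have h1 : S.Arc x p → S.Arc p x := hS.arc_symm_aux h h'
    have h2 : S.Arc p x → S.Arc x p := fun h2 =>
      arc_nu_iff.1 (hS.arc_symm_aux h'.nu h.nu h2.nu)
    rcases hp with hp | hp | hp
    · exact absurd hp hnp
    · exact ⟨hp, h1 hp⟩
    · exact ⟨h2 hp, hp⟩
  by_cases hxu : S.Eqv x u
  · have hxv : ¬ S.Eqv x v := fun h => hne (hxu.symm.trans h)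
    exact (key hv hxv).1.congr hxu (Eqv.refl S v)
  · by_cases hxv : S.Eqv x v
    · exact (key hu hxu).2.congr (Eqv.refl S u) hxv
    · rcases hS.arc_trans_or_eqv (key hu hxu).2 (key hv hxv).1 with h | h
      · exact h
      · exact absurd h hne

end Hausdorff

/-- Some order of the family contains `x`, `y`, `z`, in this order. -/
def Cyc (S : OrdSys G Ω) (x y z : Ω) : Prop :=
  ∃ x₁ y₁ z₁, S.Eqv x x₁ ∧ S.Eqv y y₁ ∧ S.Eqv z z₁ ∧ x₁ < y₁ ∧ y₁ < z₁

theorem Cyc.arcs (h : S.Cyc x y z) : S.Arc x y ∧ S.Arc y z ∧ S.Arc x z := by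
  obtain ⟨x₁, y₁, z₁, h1, h2, h3, h4, h5⟩ := h
  exact ⟨⟨_, _, h1, h2, h4⟩, ⟨_, _, h2, h3, h5⟩, ⟨_, _, h1, h3, h4.trans h5⟩⟩

namespace Hausdorff

/-- On leaving `y`, the point `z` is met before `x`: the order that contains `x < y < z` would
otherwise contain a second copy of `x` above `y`. -/
theorem cyc_rotate (hS : S.Hausdorff) (h : S.Cyc x y z) (h' : S.Arc y x) : S.Cyc y z x := by
  obtain ⟨x₁, y₁, z₁, h1, h2, h3, h4, h5⟩ := h
  obtain ⟨y₂, x₂, g1, g2, g3⟩ := h'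
  rcases hS.right (h2.symm.trans g1) h5.le g3.le with ⟨t, h7, h8⟩ | ⟨t, h7, h8⟩
  · exfalso
    have : t = x₁ := (h8.right.trans (g2.symm.trans h1)).eq_of_cmp
      (S.cmp_trans h8.le.cmp.symm h4.cmp.symm)
    exact absurd h4 (this ▸ h8.le).not_gt
  · exact ⟨y₂, t, x₂, g1, h3.trans h8.right, g2, h8.map_lt h5, h7⟩

theorem cyc_asymm (hS : S.Hausdorff) (h : S.Cyc x y z) : ¬ S.Cyc x z y := by
  obtain ⟨x₁, y₁, z₁, h1, h2, h3, h4, h5⟩ := h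
  rintro ⟨x₂, z₂, y₂, g1, g2, g3, g4, g5⟩
  obtain ⟨z₃, m1, m2⟩ := (hS.match_of_ends (g1.symm.trans h1) (g3.symm.trans h2) (g4.trans g5).le h4.le).split
    g4.le g5.le
  have : z₃ = z₁ := (m1.right.symm.trans (g2.symm.trans h3)).eq_of_cmp
    (S.cmp_trans m2.le'.cmp h5.cmp)
  exact absurd h5 (this ▸ m2.le').not_gt

theorem cyc_total (hS : S.Hausdorff) (h : S.Arc x y) (h' : S.Arc x z) (hne : ¬ S.Eqv y z) :
    S.Cyc x y z ∨ S.Cyc x z y := by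
  obtain ⟨x₁, y₁, h1, h2, h3⟩ := h
  obtain ⟨x₂, z₂, h4, h5, h6⟩ := h'
  rcases hS.right (h1.symm.trans h4) h3.le h6.le with ⟨t, h7, h8⟩ | ⟨t, h7, h8⟩
  · rcases h7.lt_or_eq with h9 | h9
    · exact Or.inr ⟨x₁, t, y₁, h1, h5.trans h8.right.symm, h2, h8.symm.map_lt h6, h9⟩
    · exact absurd (h2.trans (h9 ▸ h8.right.trans h5.symm)) hne
  · exact Or.inl ⟨x₂, t, z₂, h4, h2.trans h8.right, h5, h8.map_lt h3, h7⟩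

theorem cyc_trans (hS : S.Hausdorff) (h : S.Cyc x y z) (h' : S.Cyc x z w) : S.Cyc x y w := by
  obtain ⟨x₁, y₁, z₁, h1, h2, h3, h4, h5⟩ := h
  obtain ⟨x₂, z₂, w₂, g1, g2, g3, g4, g5⟩ := h'
  obtain ⟨y₂, m1, m2⟩ := (hS.match_of_ends (h1.symm.trans g1) (h3.symm.trans g2) (h4.trans h5).le
    g4.le).split h4.le h5.le
  exact ⟨x₂, y₂, w₂, g1, h2.trans m1.right, g3, m1.map_lt h4, (m2.map_lt h5).trans g5⟩

theorem cyc_of_arc (hS : S.Hausdorff) (h : S.Cyc x y z) (h1 : S.Eqv x x') (h2 : S.Eqv z z')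
    (hlt : x' < z') : ∃ y', S.Eqv y y' ∧ x' < y' ∧ y' < z' := by
  obtain ⟨x₁, y₁, z₁, g1, g2, g3, g4, g5⟩ := h
  obtain ⟨y₂, m1, m2⟩ := (hS.match_of_ends (g1.symm.trans h1) (g3.symm.trans h2) (g4.trans g5).le
    hlt.le).split g4.le g5.le
  exact ⟨y₂, g2.trans m1.right, m1.map_lt g4, m2.map_lt g5⟩

end Hausdorff

end OrdSys

end DefOrd

/-! ### Definable cuts of an invariant family of linear orders -/

namespace DefOrd

open MulAction Set

namespace LinOrdOn

variable {X : Type u} {V : LinOrdOn X} {x y z : X}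

theorem le_refl' (V : LinOrdOn X) (hx : x ∈ V.carrier) : V.le x x := V.linear.refl ⟨x, hx⟩

theorem le_trans' (V : LinOrdOn X) (hx : x ∈ V.carrier) (hy : y ∈ V.carrier) (hz : z ∈ V.carrier)
    (h : V.le x y) (h' : V.le y z) : V.le x z := V.linear.trans ⟨x, hx⟩ ⟨y, hy⟩ ⟨z, hz⟩ h h'

theorem le_antisymm' (V : LinOrdOn X) (hx : x ∈ V.carrier) (hy : y ∈ V.carrier)
    (h : V.le x y) (h' : V.le y x) : x = y :=
  congrArg Subtype.val (V.linear.antisymm ⟨x, hx⟩ ⟨y, hy⟩ h h')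

theorem le_total' (V : LinOrdOn X) (hx : x ∈ V.carrier) (hy : y ∈ V.carrier) :
    V.le x y ∨ V.le y x := V.linear.total ⟨x, hx⟩ ⟨y, hy⟩

theorem lt_or_le (V : LinOrdOn X) (hx : x ∈ V.carrier) (hy : y ∈ V.carrier) :
    V.lt x y ∨ V.le y x := by
  rcases V.le_total' hx hy with h | h
  · by_cases he : x = y
    · exact Or.inr (he ▸ V.le_refl' hx)
    · exact Or.inl ⟨h, he⟩
  · exact Or.inr h

theorem not_lt_of_le (V : LinOrdOn X) (hx : x ∈ V.carrier) (hy : y ∈ V.carrier) (h : V.le y x) :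
    ¬ V.lt x y := fun h' => h'.2 (V.le_antisymm' hx hy h'.1 h)

theorem lt_of_lt_of_le' (V : LinOrdOn X) (hx : x ∈ V.carrier) (hy : y ∈ V.carrier)
    (hz : z ∈ V.carrier) (h : V.lt x y) (h' : V.le y z) : V.lt x z :=
  ⟨V.le_trans' hx hy hz h.1 h', fun he => h.2 (V.le_antisymm' hx hy h.1 (he ▸ h'))⟩

theorem lt_of_le_of_lt' (V : LinOrdOn X) (hx : x ∈ V.carrier) (hy : y ∈ V.carrier)
    (hz : z ∈ V.carrier) (h : V.le x y) (h' : V.lt y z) : V.lt x z :=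
  ⟨V.le_trans' hx hy hz h h'.1, fun he => h'.2 (V.le_antisymm' hy hz h'.1 (he ▸ h))⟩

theorem IsCut.lt_of_mem_of_not_mem {I : Set X} (h : V.IsCut I) (hx : x ∈ I) (hy : y ∈ V.carrier)
    (hyI : y ∉ I) : V.lt x y := by
  rcases V.lt_or_le (h.1 hx) hy with h1 | h1
  · exact h1
  · exact absurd (h.2.2.2.1 x hx y hy h1) hyI

theorem IsCut.total {I J : Set X} (hI : V.IsCut I) (hJ : V.IsCut J) : I ⊆ J ∨ J ⊆ I := by
  by_contra h
  rw [not_or, not_subset, not_subset] at h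
  obtain ⟨⟨x, hx, hx'⟩, y, hy, hy'⟩ := h
  have h1 := hI.lt_of_mem_of_not_mem hx (hJ.1 hy) hy'
  exact V.not_lt_of_le (hI.1 hx) (hJ.1 hy) (hJ.lt_of_mem_of_not_mem hy (hI.1 hx) hx').1 h1

/-- The initial segment below `p`. -/
def below (V : LinOrdOn X) (p : X) : Set X := {x | x ∈ V.carrier ∧ V.lt x p}

theorem DenseNoEnds.isCut_below (h : V.DenseNoEnds) (hx : x ∈ V.carrier) : V.IsCut (V.below x) := by
  refine ⟨fun y hy => hy.1, ?_, fun he => ?_, fun y hy z hz hzy => ?_, fun y hy => ?_⟩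
  · obtain ⟨y, hy, hlt⟩ := h.2.2.1 x hx
    exact ⟨y, hy, hlt⟩
  · exact (he ▸ hx : x ∈ V.below x).2.2 rfl
  · exact ⟨hz, V.lt_of_le_of_lt' hz hy.1 hx hzy hy.2⟩
  · obtain ⟨z, hz, h1, h2⟩ := h.2.1 y hy.1 x hx hy.2
    exact ⟨z, ⟨hz, h2⟩, h1⟩

theorem below_subset (V : LinOrdOn X) (hx : x ∈ V.carrier) (hy : y ∈ V.carrier) (h : V.le x y) :
    V.below x ⊆ V.below y := fun _ hz => ⟨hz.1, V.lt_of_lt_of_le' hz.1 hx hy hz.2 h⟩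

theorem le_of_below_subset (V : LinOrdOn X) (hx : x ∈ V.carrier) (hy : y ∈ V.carrier)
    (h : V.below x ⊆ V.below y) : V.le x y := by
  rcases V.lt_or_le hy hx with h1 | h1
  · exact absurd rfl (h ⟨hy, h1⟩).2.2
  · exact h1

end LinOrdOn

section

variable {L : FirstOrder.Language.{v, w}} {M : Type u} [L.Structure M]
  {D X : Type u} [Interp L M D] [Interp L M X] {V : D → LinOrdOn X}

theorem Fixes.inv {s : Finset M} {g : autGroup L M} (h : Fixes s g) : Fixes s g⁻¹ := fun m hm => by
  rw [InvMemClass.coe_inv, Equiv.Perm.inv_eq_iff_eq]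
  exact (h m hm).symm

theorem Fixes.mono {s t : Finset M} {g : autGroup L M} (h : Fixes t g) (hst : s ⊆ t) : Fixes s g :=
  fun m hm => h m (hst hm)

theorem Fixes.conj [DecidableEq M] {s : Finset M} (g : autGroup L M) {k : autGroup L M}
    (h : Fixes (s.image g.1) k) : Fixes s (g⁻¹ * k * g) := fun m hm => by
  have := h _ (Finset.mem_image_of_mem _ hm)
  simp [this]

/-- The family `V` is invariant under automorphisms. -/
structure InvFamily (L : FirstOrder.Language.{v, w}) (M : Type u) [L.Structure M]
    [Interp L M D] [Interp L M X] (V : D → LinOrdOn X) : Prop where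
  mem : ∀ (g : autGroup L M) {a x}, x ∈ (V a).carrier → act g x ∈ (V (act g a)).carrier
  le : ∀ (g : autGroup L M) {a x y}, x ∈ (V a).carrier → y ∈ (V a).carrier → (V a).le x y →
    (V (act g a)).le (act g x) (act g y)

theorem ZeroDefLinFamily.inv [Countable M] (hM : OmegaCategorical L M)
    (h : ZeroDefLinFamily L M V) : InvFamily L M V := by
  refine ⟨fun g a x hx => ?_, fun g a x y hx hy hxy => ?_⟩
  · have := (zeroDef_iff hM).1 h.1 g (a, x) hx
    rwa [act_prod] at this
  · have := (zeroDef_iff hM).1 h.2 g (a, x, y) ⟨hx, hy, hxy⟩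
    simp only [act_prod] at this
    exact this.2.2

namespace InvFamily

variable (hV : InvFamily L M V) {a : D} {x y : X} {I : Set X}

theorem mem_of_act (hV : InvFamily L M V) (g : autGroup L M) (h : act g x ∈ (V (act g a)).carrier) :
    x ∈ (V a).carrier := by
  have := hV.mem g⁻¹ h
  simpa using this

theorem lt (hV : InvFamily L M V) (g : autGroup L M) (hx : x ∈ (V a).carrier)
    (hy : y ∈ (V a).carrier) (h : (V a).lt x y) : (V (act g a)).lt (act g x) (act g y) :=
  ⟨hV.le g hx hy h.1, fun he => h.2 (act_injective g he)⟩

theorem image_below (hV : InvFamily L M V) (g : autGroup L M) (hx : x ∈ (V a).carrier) :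
    act g '' (V a).below x = (V (act g a)).below (act g x) := by
  ext y
  constructor
  · rintro ⟨y, hy, rfl⟩
    exact ⟨hV.mem g hy.1, hV.lt g hy.1 hx hy.2⟩
  · intro hy
    refine ⟨act g⁻¹ y, ⟨?_, ?_⟩, by simp⟩
    · simpa using hV.mem g⁻¹ hy.1
    · simpa using hV.lt g⁻¹ hy.1 (hV.mem g hx) hy.2

theorem isCut_image (hV : InvFamily L M V) (g : autGroup L M) (h : (V a).IsCut I) :
    (V (act g a)).IsCut (act g '' I) := by
  obtain ⟨h1, h2, h3, h4, h5⟩ := h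
  refine ⟨?_, h2.image _, fun he => h3 ?_, ?_, ?_⟩
  · rintro _ ⟨x, hx, rfl⟩
    exact hV.mem g (h1 hx)
  · refine h1.antisymm fun x hx => ?_
    have := hV.mem g hx
    rw [← he] at this
    obtain ⟨y, hy, hyx⟩ := this
    rwa [← act_injective g hyx]
  · rintro _ ⟨x, hx, rfl⟩ y hy hyx
    refine ⟨act g⁻¹ y, h4 x hx _ ?_ ?_, by simp⟩
    · simpa using hV.mem g⁻¹ hy
    · simpa using hV.le g⁻¹ hy (hV.mem g (h1 hx)) hyx
  · rintro _ ⟨x, hx, rfl⟩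
    obtain ⟨y, hy, hxy⟩ := h5 x hx
    exact ⟨_, ⟨y, hy, rfl⟩, hV.lt g (h1 hx) (h1 hy) hxy⟩

end InvFamily

/-- A definable cut in one of the members of the family. -/
@[ext] structure DefCut (hV : InvFamily L M V) where
  idx : D
  seg : Set X
  isCut : (V idx).IsCut seg
  supp : ∃ s : Finset M, ∀ g : autGroup L M, Fixes s g → ∀ x ∈ seg, act g x ∈ seg

namespace DefCut

variable {hV : InvFamily L M V} {c d : DefCut hV}

instance : PartialOrder (DefCut hV) where
  le c d := c.idx = d.idx ∧ c.seg ⊆ d.seg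
  le_refl c := ⟨rfl, Subset.rfl⟩
  le_trans c d e h h' := ⟨h.1.trans h'.1, h.2.trans h'.2⟩
  le_antisymm c d h h' := DefCut.ext h.1 (h.2.antisymm h'.2)

theorem lt_iff_exists : c < d ↔ c.idx = d.idx ∧ ∃ x ∈ d.seg, x ∉ c.seg := by
  constructor
  · intro h
    refine ⟨h.le.1, ?_⟩
    by_contra hn
    push Not at hn
    exact h.not_ge ⟨h.le.1.symm, hn⟩
  · rintro ⟨h1, x, hx, hx'⟩
    refine lt_of_le_not_ge ⟨h1, ?_⟩ fun h => hx' (h.2 hx)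
    rcases c.isCut.total (h1 ▸ d.isCut) with h | h
    · exact h
    · exact absurd (h hx) hx'

theorem cmp_iff : Cmp c d ↔ c.idx = d.idx := by
  constructor
  · rintro (h | h)
    · exact h.1
    · exact h.1.symm
  · intro h
    rcases c.isCut.total (h ▸ d.isCut) with h1 | h1
    · exact Or.inl ⟨h, h1⟩
    · exact Or.inr ⟨h.symm, h1⟩

noncomputable instance : MulAction (autGroup L M) (DefCut hV) where
  smul g c := ⟨act g c.idx, act g '' c.seg, hV.isCut_image g c.isCut, by
    classical
    obtain ⟨s, hs⟩ := c.supp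
    refine ⟨s.image g.1, ?_⟩
    rintro k hk _ ⟨x, hx, rfl⟩
    refine ⟨act (g⁻¹ * k * g) x, hs _ (Fixes.conj g hk) x hx, ?_⟩
    simp [act_mul]⟩
  one_smul c := DefCut.ext (act_one _) (by
    change act (1 : autGroup L M) '' c.seg = c.seg
    simp)
  mul_smul g h c := DefCut.ext (act_mul _ _ _) (by
    change act (g * h) '' c.seg = act g '' (act h '' c.seg)
    rw [image_image]
    simp only [act_mul])

theorem smul_idx (g : autGroup L M) : (g • c).idx = act g c.idx := rfl

theorem smul_seg (g : autGroup L M) : (g • c).seg = act g '' c.seg := rfl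

theorem smul_le (g : autGroup L M) (h : c ≤ d) : g • c ≤ g • d :=
  ⟨congrArg (act g) h.1, image_mono h.2⟩

theorem mem_smul_seg {g : autGroup L M} {x : X} : x ∈ (g • c).seg ↔ act g⁻¹ x ∈ c.seg := by
  rw [smul_seg]
  constructor
  · rintro ⟨y, hy, rfl⟩
    simpa using hy
  · exact fun h => ⟨_, h, by simp⟩

theorem smul_eq_of (g : autGroup L M) (h : act g c.idx = c.idx) (h1 : ∀ x ∈ c.seg, act g x ∈ c.seg)
    (h2 : ∀ x ∈ c.seg, act g⁻¹ x ∈ c.seg) : g • c = c := by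
  refine DefCut.ext h (Subset.antisymm ?_ fun x hx => ?_)
  · rintro _ ⟨x, hx, rfl⟩
    exact h1 x hx
  · exact mem_smul_seg.2 (h2 x hx)

variable (c) in
theorem exists_stab : ∃ s : Finset M, ∀ g : autGroup L M, Fixes s g → g • c = c := by
  classical
  obtain ⟨s, hs⟩ := c.supp
  obtain ⟨t, ht⟩ := exists_support L M c.idx
  exact ⟨s ∪ t, fun g hg => smul_eq_of g (ht g (hg.mono Finset.subset_union_right))
    (hs g (hg.mono Finset.subset_union_left)) (hs g⁻¹ (hg.inv.mono Finset.subset_union_left))⟩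

end DefCut

end

end DefOrd

/-! ### Completeness and finiteness properties of the definable cuts -/

namespace DefOrd

open MulAction Set

section

variable {L : FirstOrder.Language.{v, w}} {M : Type u} [L.Structure M]
  {D X : Type u} [Interp L M D] [Interp L M X] {V : D → LinOrdOn X}

namespace DefCut

variable {hV : InvFamily L M V} {c d : DefCut hV} {a : D} {x y : X}

/-- The cut of a point. -/
def pt (hV : InvFamily L M V) (hd : (V a).DenseNoEnds) (hx : x ∈ (V a).carrier) : DefCut hV where
  idx := a
  seg := (V a).below x
  isCut := hd.isCut_below hx
  supp := by
    classical
    obtain ⟨s, hs⟩ := exists_support L M a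
    obtain ⟨t, ht⟩ := exists_support L M x
    refine ⟨s ∪ t, fun g hg y hy => ?_⟩
    have := mem_image_of_mem (act g) hy
    rwa [hV.image_below g hx, hs g (hg.mono Finset.subset_union_left),
      ht g (hg.mono Finset.subset_union_right)] at this

theorem pt_le_pt (hd : (V a).DenseNoEnds) (hx : x ∈ (V a).carrier) (hy : y ∈ (V a).carrier) :
    pt hV hd hx ≤ pt hV hd hy ↔ (V a).le x y :=
  ⟨fun h => (V a).le_of_below_subset hx hy h.2, fun h => ⟨rfl, (V a).below_subset hx hy h⟩⟩

/-- The cuts of the points. -/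
def points (hV : InvFamily L M V) : Set (DefCut hV) :=
  {c | ∃ x ∈ (V c.idx).carrier, c.seg = (V c.idx).below x}

theorem pt_mem_points (hd : (V a).DenseNoEnds) (hx : x ∈ (V a).carrier) :
    pt hV hd hx ∈ points hV := ⟨x, hx, rfl⟩

theorem smul_pt (hd : ∀ a, (V a).DenseNoEnds) (g : autGroup L M) (hx : x ∈ (V a).carrier) :
    g • pt hV (hd a) hx = pt hV (hd (act g a)) (hV.mem g hx) :=
  DefCut.ext rfl (hV.image_below g hx)

theorem smul_mem_points (g : autGroup L M) (hc : c ∈ points hV) : g • c ∈ points hV := by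
  obtain ⟨x, hx, h⟩ := hc
  refine ⟨act g x, hV.mem g hx, ?_⟩
  rw [smul_seg, h]
  exact hV.image_below g hx

theorem exists_pt_between (hd : ∀ a, (V a).DenseNoEnds) (h : c < d) :
    ∃ x, ∃ hx : x ∈ (V c.idx).carrier, c < pt hV (hd c.idx) hx ∧ pt hV (hd c.idx) hx < d := by
  obtain ⟨h1, x, hx, hxc⟩ := lt_iff_exists.1 h
  have hd' : (V c.idx).IsCut d.seg := h1 ▸ d.isCut
  obtain ⟨y, hy, hxy⟩ := hd'.2.2.2.2 x hx
  refine ⟨y, hd'.1 hy, lt_iff_exists.2 ⟨rfl, x, ⟨hd'.1 hx, hxy⟩, hxc⟩,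
    lt_iff_exists.2 ⟨h1, y, hy, fun h => h.2.2 rfl⟩⟩

theorem exists_pt_gt (hd : ∀ a, (V a).DenseNoEnds) (c : DefCut hV) :
    ∃ x, ∃ hx : x ∈ (V c.idx).carrier, c < pt hV (hd c.idx) hx := by
  obtain ⟨x, hx, hxc⟩ := not_subset.1 (fun h => c.isCut.2.2.1 (c.isCut.1.antisymm h))
  obtain ⟨y, hy, hxy⟩ := (hd c.idx).2.2.2 x hx
  exact ⟨y, hy, lt_iff_exists.2 ⟨rfl, x, ⟨hx, hxy⟩, hxc⟩⟩

theorem exists_pt_lt (hd : ∀ a, (V a).DenseNoEnds) (c : DefCut hV) :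
    ∃ x, ∃ hx : x ∈ (V c.idx).carrier, pt hV (hd c.idx) hx < c := by
  obtain ⟨x, hx⟩ := c.isCut.2.1
  exact ⟨x, c.isCut.1 hx, lt_iff_exists.2 ⟨rfl, x, hx, fun h => h.2.2 rfl⟩⟩

theorem exists_isLUB {A : Set (DefCut hV)} (hA : A.Nonempty) (hb : BddAbove A)
    (hs : ∃ s : Finset M, ∀ g : autGroup L M, Fixes s g → ∀ c ∈ A, g • c ∈ A) : ∃ c, IsLUB A c := by
  obtain ⟨b, hb⟩ := hb
  obtain ⟨c, hc⟩ := hA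
  have hidx : ∀ d ∈ A, d.idx = b.idx := fun d hd => (hb hd).1
  refine ⟨⟨b.idx, ⋃ d ∈ A, d.seg, ⟨?_, ?_, ?_, ?_, ?_⟩, ?_⟩, ?_, ?_⟩
  · exact iUnion₂_subset fun d hd => (hb hd).2.trans b.isCut.1
  · obtain ⟨x, hx⟩ := c.isCut.2.1
    exact ⟨x, mem_biUnion hc hx⟩
  · intro he
    refine b.isCut.2.2.1 (b.isCut.1.antisymm ?_)
    rw [← he]
    exact iUnion₂_subset fun d hd => (hb hd).2
  · intro x hx y hy hyx
    obtain ⟨d, hd, hxd⟩ := mem_iUnion₂.1 hx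
    refine mem_biUnion hd (d.isCut.2.2.2.1 x hxd y ?_ ?_)
    · rwa [hidx d hd]
    · rwa [hidx d hd]
  · intro x hx
    obtain ⟨d, hd, hxd⟩ := mem_iUnion₂.1 hx
    obtain ⟨y, hy, hxy⟩ := d.isCut.2.2.2.2 x hxd
    rw [hidx d hd] at hxy
    exact ⟨y, mem_biUnion hd hy, hxy⟩
  · obtain ⟨s, hs⟩ := hs
    refine ⟨s, fun g hg x hx => ?_⟩
    obtain ⟨d, hd, hxd⟩ := mem_iUnion₂.1 hx
    exact mem_biUnion (hs g hg d hd) (mem_image_of_mem _ hxd)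
  · intro d hd
    exact ⟨hidx d hd, subset_biUnion_of_mem (u := fun d : DefCut hV => d.seg) hd⟩
  · intro e he
    exact ⟨(hidx c hc).symm.trans (he hc).1, iUnion₂_subset fun d hd => (he hd).2⟩

theorem exists_isGLB (hd : ∀ a, (V a).DenseNoEnds) {A : Set (DefCut hV)} (hA : A.Nonempty)
    (hb : BddBelow A)
    (hs : ∃ s : Finset M, ∀ g : autGroup L M, Fixes s g → ∀ c ∈ A, g • c ∈ A) : ∃ c, IsGLB A c := by
  classical
  obtain ⟨b, hb⟩ := hb
  obtain ⟨c, hc⟩ := hA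
  have hidx : ∀ d ∈ A, d.idx = b.idx := fun d hd => (hb hd).1.symm
  -- The intersection of cuts may have a last element, which a cut must not have; only the elements
  -- with a larger one in the intersection are kept. Infima are needed because they are the suprema
  -- of the reversed orders.
  let J : Set X := {x | x ∈ (V b.idx).carrier ∧ ∃ y ∈ (V b.idx).carrier, (V b.idx).lt x y ∧
    ∀ d ∈ A, y ∈ d.seg}
  have J_sub : ∀ d ∈ A, J ⊆ d.seg := by
    rintro d hdA x ⟨hx, y, hy, hxy, h⟩
    refine d.isCut.2.2.2.1 y (h d hdA) x ?_ ?_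
    · rwa [hidx d hdA]
    · rw [hidx d hdA]; exact hxy.1
  have sub_J : ∀ e ∈ lowerBounds A, e.seg ⊆ J := by
    intro e he x hx
    have hidx' : e.idx = b.idx := (he hc).1.trans (hidx c hc)
    obtain ⟨y, hy, hxy⟩ := e.isCut.2.2.2.2 x hx
    have h1 := e.isCut.1 hx
    have h2 := e.isCut.1 hy
    rw [hidx'] at hxy h1 h2
    exact ⟨h1, y, h2, hxy, fun d hd => (he hd).2 hy⟩
  refine ⟨⟨b.idx, J, ⟨fun x hx => hx.1, ?_, ?_, ?_, ?_⟩, ?_⟩, ?_, ?_⟩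
  · exact b.isCut.2.1.mono (sub_J b hb)
  · intro he
    have := c.isCut.2.2.1
    rw [hidx c hc, ← he] at this
    refine this (Subset.antisymm ?_ (J_sub c hc))
    rw [he, ← hidx c hc]
    exact c.isCut.1
  · rintro x ⟨hx, y, hy, hxy, h⟩ z hz hzx
    exact ⟨hz, y, hy, (V b.idx).lt_of_le_of_lt' hz hx hy hzx hxy, h⟩
  · rintro x ⟨hx, y, hy, hxy, h⟩
    obtain ⟨z, hz, h1, h2⟩ := (hd b.idx).2.1 x hx y hy hxy
    exact ⟨z, ⟨hz, y, hy, h2, h⟩, h1⟩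
  · obtain ⟨s, hs⟩ := hs
    obtain ⟨t, ht⟩ := exists_support L M b.idx
    refine ⟨s ∪ t, ?_⟩
    rintro g hg x ⟨hx, y, hy, hxy, h⟩
    have hgb := ht g (hg.mono Finset.subset_union_right)
    have hgs := hg.mono (Finset.subset_union_left (s₁ := s) (s₂ := t))
    have h1 := hV.mem g hx
    have h2 := hV.mem g hy
    have h3 := hV.lt g hx hy hxy
    rw [hgb] at h1 h2 h3
    refine ⟨h1, _, h2, h3, fun d hd => ?_⟩
    have := h _ (hs g⁻¹ hgs.inv d hd)
    rw [mem_smul_seg] at this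
    simpa using this
  · exact fun d hd => ⟨(hidx d hd).symm, J_sub d hd⟩
  · exact fun e he => ⟨(he hc).1.trans (hidx c hc), sub_J e he⟩

/-- The segment of a fixed cut is a union of orbits of the pointwise stabilizer of `s`, so it is
determined by the representatives it contains, out of finitely many. -/
theorem finite_fixed [Countable M] (hM : OmegaCategorical L M) (a : D) (s : Finset M) :
    {c : DefCut hV | c.idx = a ∧ ∀ g : autGroup L M, Fixes s g → g • c = c}.Finite := by
  obtain ⟨T, hT, h⟩ := hM.finite_orbits X s
  refine Set.Finite.of_finite_image (f := fun c : DefCut hV => T ∩ c.seg)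
    (hT.finite_subsets.subset ?_) ?_
  · rintro _ ⟨c, -, rfl⟩
    exact inter_subset_left
  · have key : ∀ {c d : DefCut hV}, (∀ g : autGroup L M, Fixes s g → g • c = c) →
        (∀ g : autGroup L M, Fixes s g → g • d = d) → T ∩ c.seg = T ∩ d.seg →
        c.seg ⊆ d.seg := by
      intro c d hc hd he x hx
      obtain ⟨t, ht, g, hg, rfl⟩ := h x
      have h1 : t ∈ c.seg := by
        rw [← hc g hg, mem_smul_seg] at hx
        simpa using hx
      have h2 : t ∈ T ∩ d.seg := he ▸ ⟨ht, h1⟩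
      rw [← hd g hg]
      exact mem_image_of_mem _ h2.2
    rintro c ⟨hc, hc'⟩ d ⟨hd, hd'⟩ he
    exact DefCut.ext (hc.trans hd.symm) ((key hc' hd' he).antisymm (key hd' hc' he.symm))

/-- If the stabilizer of the index fixed the cut, its segment would be definable over the index,
hence dense; but it has no element above the cut. -/
theorem exists_smul_ne [Countable M] (hM : OmegaCategorical L M)
    (hw : ∀ a, (V a).WeaklyTransitive L M a) (c : DefCut hV) :
    ∃ g : autGroup L M, act g c.idx = c.idx ∧ g • c ≠ c := by
  by_contra hn
  push Not at hn
  have hdef : DefOver L M c.idx c.seg := by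
    rw [defOver_iff hM]
    intro g hg x hx
    rw [← hn g hg]
    exact mem_image_of_mem _ hx
  have := (hw c.idx).2 _ c.isCut.1 hdef c.isCut.2.1
  obtain ⟨x, hx, hlt⟩ := exists_pt_gt (fun a => (hw a).1) c
  obtain ⟨y, hy, hxy⟩ := (hw c.idx).1.2.2.2 x hx
  obtain ⟨z, hz, h1, h2⟩ := this x hx y hy hxy
  exact (V c.idx).not_lt_of_le (c.isCut.1 hz) hx h1.1 ((hlt.le).2 hz).2

/-- The traces of the convex sets on the points, completed by singletons, are the classes of a
definable convex equivalence relation on `V a`. The traces are infinite because there are points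
between any two cuts. -/
theorem finite_of_topRankOne [Countable M] (hM : OmegaCategorical L M)
    (hd : ∀ a, (V a).DenseNoEnds) (hr : (V a).TopRankOne L M) (s : Finset M)
    (C : Set (Set (DefCut hV)))
    (hC : ∀ c ∈ C, ∀ y ∈ c, y.idx = a) (hne : ∀ c ∈ C, ∃ y ∈ c, ∃ z ∈ c, y < z)
    (hconv : ∀ c ∈ C, c.OrdConnected) (hdisj : C.PairwiseDisjoint id)
    (hinv : ∀ g : autGroup L M, Fixes s g → ∀ c ∈ C, (fun y => g • y) '' c ∈ C) : C.Finite := by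
  classical
  by_contra hinf
  have eq_of : ∀ {c c' y}, c ∈ C → c' ∈ C → y ∈ c → y ∈ c' → c = c' := by
    intro c c' y hc hc' h h'
    by_contra hn
    exact Set.disjoint_left.1 (hdisj hc hc' hn) h h'
  let P (c : Set (DefCut hV)) : Set X := {x | ∃ hx : x ∈ (V a).carrier, pt hV (hd a) hx ∈ c}
  have P_inf : ∀ c ∈ C, (P c).Infinite := by
    intro c hc
    obtain ⟨y, hy, z, hz, hyz⟩ := hne c hc
    have hya := hC c hc y hy
    have step : ∀ n : ℕ, ∀ y, y.idx = a → y < z → ∃ F : Finset X, F.card = n ∧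
        ∀ x ∈ F, ∃ hx : x ∈ (V a).carrier, y < pt hV (hd a) hx ∧ pt hV (hd a) hx < z := by
      intro n
      induction n with
      | zero => exact fun y _ _ => ⟨∅, rfl, by simp⟩
      | succ n ih =>
        intro y hya hyz
        obtain ⟨x, hx, h1, h2⟩ := exists_pt_between hd hyz
        subst hya
        obtain ⟨F, hF, hF'⟩ := ih (pt hV (hd y.idx) hx) rfl h2
        have hxF : x ∉ F := fun h => by
          obtain ⟨hx', h3, -⟩ := hF' x h
          exact lt_irrefl _ h3
        refine ⟨insert x F, by rw [Finset.card_insert_of_notMem hxF, hF], fun w hw => ?_⟩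
        rcases Finset.mem_insert.1 hw with rfl | hw
        · exact ⟨hx, h1, h2⟩
        · obtain ⟨hw', h3, h4⟩ := hF' w hw
          exact ⟨hw', h1.trans h3, h4⟩
    intro hfin
    obtain ⟨F, hF, hF'⟩ := step (hfin.toFinset.card + 1) y hya hyz
    have : F ⊆ hfin.toFinset := by
      intro x hx
      obtain ⟨hx', h1, h2⟩ := hF' x hx
      rw [hfin.mem_toFinset]
      exact ⟨hx', (hconv c hc).out hy hz ⟨h1.le, h2.le⟩⟩
    have := Finset.card_le_card this
    omega
  let E : Set (X × X) := {p | p.1 ∈ (V a).carrier ∧ p.2 ∈ (V a).carrier ∧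
    (p.1 = p.2 ∨ ∃ c ∈ C, p.1 ∈ P c ∧ p.2 ∈ P c)}
  have fiber_E : ∀ c ∈ C, ∀ x ∈ P c, fiber E x = P c := by
    intro c hc x hx
    ext y
    constructor
    · rintro ⟨h1, h2, h3 | ⟨c', hc', h3, h4⟩⟩
      · simp only at h3
        exact h3 ▸ hx
      · obtain ⟨h5, h6⟩ := hx
        obtain ⟨h7, h8⟩ := h3
        rw [eq_of hc hc' h6 h8]
        exact h4
    · intro hy
      exact ⟨hx.1, hy.1, Or.inr ⟨c, hc, hx, hy⟩⟩
  refine hr ⟨E, ?_, fun p hp => ⟨hp.1, hp.2.1⟩, ⟨?_, ?_, ?_⟩, ?_, ?_⟩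
  · rw [paramDef_iff hM]
    obtain ⟨t, ht⟩ := exists_support L M a
    have P_act : ∀ g : autGroup L M, Fixes (s ∪ t) g → ∀ {c x}, x ∈ P c →
        act g x ∈ P ((fun y => g • y) '' c) := by
      rintro g hg c x ⟨hx, hx'⟩
      have hga := ht g (hg.mono Finset.subset_union_right)
      have h1 := hV.mem g hx
      have h2 := mem_image_of_mem (fun y => g • y) hx'
      simp only [smul_pt] at h2
      have : ∀ b, ∀ _ : b = a, ∀ h1 : act g x ∈ (V b).carrier,
          pt hV (hd b) h1 ∈ (fun y => g • y) '' c → act g x ∈ P ((fun y => g • y) '' c) := by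
        rintro b rfl h1 h2
        exact ⟨h1, h2⟩
      exact this _ hga _ h2
    refine ⟨s ∪ t, ?_⟩
    rintro g hg ⟨x, y⟩ ⟨hx, hy, h⟩
    have hga := ht g (hg.mono Finset.subset_union_right)
    rw [act_prod]
    have h1 := hV.mem g hx
    have h2 := hV.mem g hy
    rw [hga] at h1 h2
    refine ⟨h1, h2, ?_⟩
    rcases h with h | ⟨c, hc, h3, h4⟩
    · exact Or.inl (congrArg (act g) h)
    · exact Or.inr ⟨_, hinv g (hg.mono Finset.subset_union_left) c hc, P_act g hg h3, P_act g hg h4⟩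
  · exact fun x => ⟨x.2, x.2, Or.inl rfl⟩
  · rintro x y ⟨h1, h2, h3⟩
    exact ⟨h2, h1, h3.imp Eq.symm fun ⟨c, hc, h4, h5⟩ => ⟨c, hc, h5, h4⟩⟩
  · rintro x y z ⟨h1, h2, h3⟩ ⟨h4, h5, h6⟩
    refine ⟨h1, h5, ?_⟩
    rcases h3 with h3 | ⟨c, hc, h7, h8⟩
    · rcases h6 with h6 | h6
      · exact Or.inl (h3.trans h6)
      · exact Or.inr (by simpa only [show (x : X) = y from h3] using h6)
    · rcases h6 with h6 | ⟨c', hc', h9, h10⟩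
      · exact Or.inr ⟨c, hc, h7, by simpa only [← show (y : X) = z from h6] using h8⟩
      · refine Or.inr ⟨c, hc, h7, ?_⟩
        obtain ⟨h11, h12⟩ := h8
        obtain ⟨h13, h14⟩ := h9
        rw [eq_of hc hc' h12 h14]
        exact h10
  · rintro x hx y hy z hz hxz hzy ⟨-, -, h3 | ⟨c, hc, ⟨h4, h5⟩, h6, h7⟩⟩
    · refine ⟨hx, hz, Or.inl ((V a).le_antisymm' hx hz hxz ?_)⟩
      rwa [show x = y from h3]
    · exact ⟨hx, hz, Or.inr ⟨c, hc, ⟨h4, h5⟩, hz, (hconv c hc).out h5 h7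
        ⟨(pt_le_pt _ _ _).2 hxz, (pt_le_pt _ _ _).2 hzy⟩⟩⟩
  · have hinj : InjOn P C := by
      intro c hc c' hc' he
      obtain ⟨x, hx, hx'⟩ := (P_inf c hc).nonempty
      have : x ∈ P c' := he ▸ ⟨hx, hx'⟩
      obtain ⟨h1, h2⟩ := this
      exact eq_of hc hc' hx' h2
    refine (Set.Infinite.image hinj hinf).mono ?_
    rintro _ ⟨c, hc, rfl⟩
    obtain ⟨x, hx⟩ := (P_inf c hc).nonempty
    exact ⟨P_inf c hc, x, hx.1, (fiber_E c hc x hx).symm⟩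

/-- The source of the uniform bound `pt_bound`: finitely many orbits of pairs remain after fixing a
support of `a`. -/
theorem finite_pairs [Countable M] (hM : OmegaCategorical L M) (hd : ∀ a, (V a).DenseNoEnds)
    (a : D) : ∃ T : Set (DefCut hV × DefCut hV), T.Finite ∧ ∀ c ∈ points hV, ∀ d ∈ points hV,
      c.idx = a → d.idx = a → ∃ t ∈ T, ∃ g : autGroup L M, act g a = a ∧ t.1 ∈ points hV ∧
        t.2 ∈ points hV ∧ t.1.idx = a ∧ t.2.idx = a ∧ g • t.1 = c ∧ g • t.2 = d := by
  classical
  obtain ⟨s, hs⟩ := exists_support L M a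
  obtain ⟨T, hT, h⟩ := hM.finite_orbits (X × X) s
  let f (p : X × X) : Set (DefCut hV × DefCut hV) :=
    {t | ∃ (h1 : p.1 ∈ (V a).carrier) (h2 : p.2 ∈ (V a).carrier),
      t = (pt hV (hd a) h1, pt hV (hd a) h2)}
  refine ⟨⋃ p ∈ T, f p, hT.biUnion fun p _ => Set.Subsingleton.finite ?_, ?_⟩
  · rintro _ ⟨h1, h2, rfl⟩ _ ⟨h3, h4, rfl⟩
    rfl
  · intro c hc d hd' hca hda
    obtain ⟨x, hx, hxc⟩ := hc
    obtain ⟨y, hy, hyd⟩ := hd'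
    obtain ⟨⟨x', y'⟩, hp, g, hg, he⟩ := h (x, y)
    rw [act_prod, Prod.mk.injEq] at he
    obtain ⟨h1, h2⟩ := he
    simp only at h1 h2
    have hga := hs g hg
    have hx' : x' ∈ (V a).carrier := hV.mem_of_act g (by rw [h1, hga, ← hca]; exact hx)
    have hy' : y' ∈ (V a).carrier := hV.mem_of_act g (by rw [h2, hga, ← hda]; exact hy)
    refine ⟨(pt hV (hd a) hx', pt hV (hd a) hy'), mem_biUnion hp ⟨hx', hy', rfl⟩, g, hga,
      pt_mem_points (hd a) hx',
      pt_mem_points (hd a) hy', rfl, rfl, ?_, ?_⟩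
    · rw [smul_pt]
      exact DefCut.ext (hga.trans hca.symm) (by rw [hxc, hca, ← h1]; simp only [pt, hga])
    · rw [smul_pt]
      exact DefCut.ext (hga.trans hda.symm) (by rw [hyd, hda, ← h2]; simp only [pt, hga])

end DefCut

end

end DefOrd

/-! ### Adding the reversed orders; the system attached to the family -/

namespace DefOrd

open MulAction Set

/-- The disjoint union of `C` and of its reverse. -/
@[ext] structure Signed (C : Type*) where
  val : C
  pos : Bool

namespace Signed

variable {C : Type*} {x y z : Signed C}

instance {G : Type*} [Group G] [MulAction G C] : MulAction G (Signed C) where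
  smul g x := ⟨g • x.val, x.pos⟩
  one_smul _ := Signed.ext (one_smul _ _) rfl
  mul_smul _ _ _ := Signed.ext (mul_smul _ _ _) rfl

theorem smul_val {G : Type*} [Group G] [MulAction G C] (g : G) : (g • x).val = g • x.val := rfl

variable [PartialOrder C]

instance : PartialOrder (Signed C) where
  le x y := x.pos = y.pos ∧ (x.pos = true → x.val ≤ y.val) ∧ (x.pos = false → y.val ≤ x.val)
  le_refl x := ⟨rfl, fun _ => le_rfl, fun _ => le_rfl⟩
  le_trans x y z h h' := ⟨h.1.trans h'.1, fun h1 => (h.2.1 h1).trans (h'.2.1 (h.1 ▸ h1)),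
    fun h1 => (h'.2.2 (h.1 ▸ h1)).trans (h.2.2 h1)⟩
  le_antisymm x y h h' := by
    refine Signed.ext ?_ h.1
    rcases hx : x.pos with _ | _
    · exact le_antisymm (h'.2.2 (h.1 ▸ hx)) (h.2.2 hx)
    · exact le_antisymm (h.2.1 hx) (h'.2.1 (h.1 ▸ hx))

theorem pos_le {c d : C} : (⟨c, true⟩ : Signed C) ≤ ⟨d, true⟩ ↔ c ≤ d :=
  ⟨fun h => h.2.1 rfl, fun h => ⟨rfl, fun _ => h, fun h => by simp at h⟩⟩

theorem neg_le {c d : C} : (⟨c, false⟩ : Signed C) ≤ ⟨d, false⟩ ↔ d ≤ c :=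
  ⟨fun h => h.2.2 rfl, fun h => ⟨rfl, fun h => by simp at h, fun _ => h⟩⟩

theorem pos_lt {c d : C} : (⟨c, true⟩ : Signed C) < ⟨d, true⟩ ↔ c < d := by
  rw [lt_iff_le_not_ge, lt_iff_le_not_ge, pos_le, pos_le]

theorem neg_lt {c d : C} : (⟨c, false⟩ : Signed C) < ⟨d, false⟩ ↔ d < c := by
  rw [lt_iff_le_not_ge, lt_iff_le_not_ge, neg_le, neg_le]

theorem cmp_iff : Cmp x y ↔ x.pos = y.pos ∧ Cmp x.val y.val := by
  obtain ⟨c, _ | _⟩ := x <;> obtain ⟨d, _ | _⟩ := y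
  · simp [Cmp, neg_le, or_comm]
  · simp only [Bool.false_eq_true, false_and, iff_false]
    rintro (h | h) <;> simpa using h.1
  · simp only [Bool.true_eq_false, false_and, iff_false]
    rintro (h | h) <;> simpa using h.1
  · simp [Cmp, pos_le]

/-- The reversal. -/
def nu (x : Signed C) : Signed C := ⟨x.val, !x.pos⟩

theorem nu_lt (h : x < y) : y.nu < x.nu := by
  obtain ⟨c, _ | _⟩ := x <;> obtain ⟨d, _ | _⟩ := y
  · exact pos_lt.2 (neg_lt.1 h)
  · simpa using h.le.1
  · simpa using h.le.1
  · exact neg_lt.2 (pos_lt.1 h)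

theorem isLUB_pos {A : Set (Signed C)} {c : C} (hA : ∀ x ∈ A, x.pos = true) (hne : A.Nonempty)
    (h : IsLUB (Signed.val '' A) c) : IsLUB A ⟨c, true⟩ := by
  constructor
  · rintro ⟨d, b⟩ hd
    obtain rfl : b = true := hA _ hd
    exact pos_le.2 (h.1 ⟨_, hd, rfl⟩)
  · rintro ⟨e, b⟩ he
    obtain ⟨x, hx⟩ := hne
    obtain rfl : b = true := (he hx).1.symm.trans (hA x hx)
    refine pos_le.2 (h.2 ?_)
    rintro _ ⟨y, hy, rfl⟩
    exact (he hy).2.1 (hA y hy)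

theorem isLUB_neg {A : Set (Signed C)} {c : C} (hA : ∀ x ∈ A, x.pos = false) (hne : A.Nonempty)
    (h : IsGLB (Signed.val '' A) c) : IsLUB A ⟨c, false⟩ := by
  constructor
  · rintro ⟨d, b⟩ hd
    obtain rfl : b = false := hA _ hd
    exact neg_le.2 (h.1 ⟨_, hd, rfl⟩)
  · rintro ⟨e, b⟩ he
    obtain ⟨x, hx⟩ := hne
    obtain rfl : b = false := (he hx).1.symm.trans (hA x hx)
    refine neg_le.2 (h.2 ?_)
    rintro _ ⟨y, hy, rfl⟩
    exact (he hy).2.2 (hA y hy)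

end Signed

section

variable {L : FirstOrder.Language.{v, w}} {M : Type u} [L.Structure M]
  {D X : Type u} [Interp L M D] [Interp L M X] {V : D → LinOrdOn X}

/-- A subgroup is open if it contains the pointwise stabilizer of a finite set. -/
def OpenSub (K : Subgroup (autGroup L M)) : Prop := ∃ s : Finset M, ∀ g, Fixes s g → g ∈ K

variable (hV : InvFamily L M V)

theorem InvFamily.openSub_stab (x : Signed (DefCut hV)) : OpenSub (stabilizer (autGroup L M) x) := by
  obtain ⟨s, hs⟩ := x.val.exists_stab
  exact ⟨s, fun g hg => Signed.ext (hs g hg) rfl⟩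

/-- The definable completions of the members of the family and of their reverses. -/
noncomputable def InvFamily.ordSys [Countable M] (hM : OmegaCategorical L M)
    (hm : ∀ a, (V a).Minimal L M a) :
    OrdSys (autGroup L M) (Signed (DefCut hV)) :=
  have hd : ∀ a, (V a).DenseNoEnds := fun a => (hm a).1.1
  have fix_fin : ∀ {K : Subgroup (autGroup L M)}, OpenSub K → ∀ x : Signed (DefCut hV),
      {y | Cmp x y ∧ ∀ k ∈ K, k • y = y}.Finite := by
    rintro K ⟨s, hs⟩ x
    refine Set.Finite.of_finite_image (f := Signed.val)
      ((DefCut.finite_fixed hM x.val.idx s).subset ?_) ?_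
    · rintro _ ⟨y, ⟨h1, h2⟩, rfl⟩
      exact ⟨(DefCut.cmp_iff.1 (Signed.cmp_iff.1 h1).2).symm,
        fun g hg => congrArg Signed.val (h2 g (hs g hg))⟩
    · rintro y ⟨h1, -⟩ z ⟨h2, -⟩ h
      exact Signed.ext h ((Signed.cmp_iff.1 h1).1.symm.trans (Signed.cmp_iff.1 h2).1)
  { Op := OpenSub
    op_mono := fun h ⟨s, hs⟩ => ⟨s, fun g hg => h (hs g hg)⟩
    op_inf := by
      classical
      rintro K H ⟨s, hs⟩ ⟨t, ht⟩
      exact ⟨s ∪ t, fun g hg => ⟨hs g (hg.mono Finset.subset_union_left),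
        ht g (hg.mono Finset.subset_union_right)⟩⟩
    op_conj := by
      classical
      rintro g K ⟨s, hs⟩
      refine ⟨K.comap (MulAut.conj g⁻¹).toMonoidHom, ⟨s.image g.1, fun k hk => ?_⟩, fun k hk => ?_⟩
      · have := hs _ (Fixes.conj g hk)
        simpa [Subgroup.mem_comap] using this
      · simpa [Subgroup.mem_comap] using hk
    op_stab := hV.openSub_stab
    nu := Signed.nu
    nu_nu := fun x => by simp [Signed.nu]
    nu_lt := Signed.nu_lt
    nu_smul := fun g x => rfl
    smul_lt := by
      have key : ∀ (g : autGroup L M) (x y : Signed (DefCut hV)), x ≤ y → g • x ≤ g • y :=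
        fun g x y h => ⟨h.1, fun h1 => DefCut.smul_le g (h.2.1 h1),
          fun h1 => DefCut.smul_le g (h.2.2 h1)⟩
      intro g x y h
      refine (key g x y h.le).lt_of_ne fun he => h.ne ?_
      exact smul_left_cancel g he
    cmp_trans := by
      intro x y z h h'
      rw [Signed.cmp_iff, DefCut.cmp_iff] at *
      exact ⟨h.1.trans h'.1, h.2.trans h'.2⟩
    dense := by
      rintro ⟨c, _ | _⟩ ⟨d, _ | _⟩ h
      · obtain ⟨x, hx, h1, h2⟩ := DefCut.exists_pt_between hd (Signed.neg_lt.1 h)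
        exact ⟨⟨_, false⟩, Signed.neg_lt.2 h2, Signed.neg_lt.2 h1⟩
      · exact absurd h.le.1 (by simp)
      · exact absurd h.le.1 (by simp)
      · obtain ⟨x, hx, h1, h2⟩ := DefCut.exists_pt_between hd (Signed.pos_lt.1 h)
        exact ⟨⟨_, true⟩, Signed.pos_lt.2 h1, Signed.pos_lt.2 h2⟩
    exists_lt := by
      rintro ⟨c, _ | _⟩
      · obtain ⟨x, hx, h⟩ := DefCut.exists_pt_gt hd c
        exact ⟨⟨_, false⟩, Signed.neg_lt.2 h⟩
      · obtain ⟨x, hx, h⟩ := DefCut.exists_pt_lt hd c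
        exact ⟨⟨_, true⟩, Signed.pos_lt.2 h⟩
    exists_lub := by
      rintro A hne ⟨b, hb⟩ ⟨K, ⟨s, hs⟩, hA⟩
      have hinv : ∃ s : Finset M, ∀ g : autGroup L M, Fixes s g →
          ∀ c ∈ Signed.val '' A, g • c ∈ Signed.val '' A := by
        refine ⟨s, ?_⟩
        rintro g hg _ ⟨x, hx, rfl⟩
        exact ⟨_, hA g (hs g hg) x hx, rfl⟩
      obtain ⟨b, _ | _⟩ := b
      · obtain ⟨c, hc⟩ := DefCut.exists_isGLB hd (hne.image Signed.val)
          ⟨b, by rintro _ ⟨x, hx, rfl⟩; exact (hb hx).2.2 (hb hx).1⟩ hinv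
        exact ⟨_, Signed.isLUB_neg (fun x hx => (hb hx).1) hne hc⟩
      · obtain ⟨c, hc⟩ := DefCut.exists_isLUB (hne.image Signed.val)
          ⟨b, by rintro _ ⟨x, hx, rfl⟩; exact (hb hx).2.1 (hb hx).1⟩ hinv
        exact ⟨_, Signed.isLUB_pos (fun x hx => (hb hx).1) hne hc⟩
    fix_fin := fix_fin
    rank := by
      rintro K ⟨s, hs⟩ x C hC hne hconv hdisj hinv
      have pos_eq : ∀ c ∈ C, ∀ y ∈ c, y.pos = x.pos := fun c hc y hy =>
        (Signed.cmp_iff.1 (hC c hc y hy)).1.symm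
      have mem_of : ∀ {c d : Set (Signed (DefCut hV))} {y : DefCut hV}, c ∈ C →
          y ∈ Signed.val '' c → (⟨y, x.pos⟩ : Signed (DefCut hV)) ∈ c := by
        rintro c d _ hc ⟨y, hy, rfl⟩
        rw [← pos_eq c hc y hy]
        exact hy
      have hinj : InjOn (fun c : Set (Signed (DefCut hV)) => Signed.val '' c) C := by
        have key : ∀ c ∈ C, ∀ c' ∈ C, Signed.val '' c = Signed.val '' c' → c ⊆ c' := by
          intro c hc c' hc' he y hy
          have : y.val ∈ Signed.val '' c' := he ▸ mem_image_of_mem _ hy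
          have := mem_of (d := c) hc' this
          rwa [← pos_eq c hc y hy] at this
        exact fun c hc c' hc' he => (key c hc c' hc' he).antisymm (key c' hc' c hc he.symm)
      refine Set.Finite.of_finite_image (DefCut.finite_of_topRankOne hM hd (a := x.val.idx) (hm _).2 s
        _ ?_ ?_ ?_ ?_ ?_) hinj
      · rintro _ ⟨c, hc, rfl⟩ _ ⟨y, hy, rfl⟩
        exact (DefCut.cmp_iff.1 (Signed.cmp_iff.1 (hC c hc y hy)).2).symm
      · rintro _ ⟨c, hc, rfl⟩
        obtain ⟨y, hy, z, hz, hyz⟩ := hne c hc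
        obtain ⟨y, _ | _⟩ := y <;> obtain ⟨z, _ | _⟩ := z
        · exact ⟨_, mem_image_of_mem _ hz, _, mem_image_of_mem _ hy, Signed.neg_lt.1 hyz⟩
        · exact absurd hyz.le.1 (by simp)
        · exact absurd hyz.le.1 (by simp)
        · exact ⟨_, mem_image_of_mem _ hy, _, mem_image_of_mem _ hz, Signed.pos_lt.1 hyz⟩
      · rintro _ ⟨c, hc, rfl⟩
        refine ⟨fun y hy z hz w hw => ?_⟩
        have h1 := mem_of (d := c) hc hy
        have h2 := mem_of (d := c) hc hz
        refine ⟨⟨w, x.pos⟩, ?_, rfl⟩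
        rcases hp : x.pos with _ | _
        · rw [hp] at h1 h2
          exact (hconv c hc).out h2 h1 ⟨Signed.neg_le.2 hw.2, Signed.neg_le.2 hw.1⟩
        · rw [hp] at h1 h2
          exact (hconv c hc).out h1 h2 ⟨Signed.pos_le.2 hw.1, Signed.pos_le.2 hw.2⟩
      · rintro _ ⟨c, hc, rfl⟩ _ ⟨c', hc', rfl⟩ hn
        rw [Function.onFun, id, id, Set.disjoint_left]
        intro y hy hy'
        exact Set.disjoint_left.1 (hdisj hc hc' (fun he => hn (by rw [he])))
          (mem_of (d := c) hc hy) (mem_of (d := c) hc' hy')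
      · rintro g hg _ ⟨c, hc, rfl⟩
        refine ⟨_, hinv g (hs g hg) c hc, ?_⟩
        simp only [image_image]
        rfl
    nofix := by
      intro x
      obtain ⟨g, h1, h2⟩ := DefCut.exists_smul_ne hM (fun a => (hm a).1) x.val
      exact ⟨g, Signed.cmp_iff.2 ⟨rfl, DefCut.cmp_iff.2 h1.symm⟩,
        fun h => h2 (congrArg Signed.val h)⟩
    Pt := {x | x.val ∈ DefCut.points hV}
    pt_smul := fun g x hx => DefCut.smul_mem_points g hx
    pt_nu := fun x hx => hx
    pt_dense := by
      rintro ⟨c, _ | _⟩ ⟨d, _ | _⟩ h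
      · obtain ⟨x, hx, h1, h2⟩ := DefCut.exists_pt_between hd (Signed.neg_lt.1 h)
        exact ⟨⟨DefCut.pt hV (hd _) hx, false⟩, DefCut.pt_mem_points (hd _) hx, Signed.neg_lt.2 h2, Signed.neg_lt.2 h1⟩
      · exact absurd h.le.1 (by simp)
      · exact absurd h.le.1 (by simp)
      · obtain ⟨x, hx, h1, h2⟩ := DefCut.exists_pt_between hd (Signed.pos_lt.1 h)
        exact ⟨⟨DefCut.pt hV (hd _) hx, true⟩, DefCut.pt_mem_points (hd _) hx, Signed.pos_lt.2 h1, Signed.pos_lt.2 h2⟩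
    pt_bound := by
      intro x
      obtain ⟨T, hT, h⟩ := DefCut.finite_pairs (hV := hV) hM hd x.val.idx
      let Z (p : DefCut hV × DefCut hV) : Set (Signed (DefCut hV)) :=
        {z | Cmp x z ∧ ∀ g : autGroup L M, g • p.1 = p.1 → g • p.2 = p.2 → g • z = z}
      -- The elements fixed by the stabilizer of g • t are the translates by g of those fixed by the
      -- stabilizer of t, so their number can be computed at a representative.
      obtain ⟨N, hN⟩ := (hT.image fun p => (Z p).ncard).bddAbove
      refine ⟨N, fun y hy z hz hxy hxz => ?_⟩
      obtain ⟨t, ht, g, hg, -, -, -, -, h1, h2⟩ := h y.val hy z.val hz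
        (DefCut.cmp_iff.1 (Signed.cmp_iff.1 hxy).2).symm
        (DefCut.cmp_iff.1 (Signed.cmp_iff.1 hxz).2).symm
      have hfin : (Z t).Finite := by
        obtain ⟨s₁, hs₁⟩ := t.1.exists_stab
        obtain ⟨s₂, hs₂⟩ := t.2.exists_stab
        classical
        refine (fix_fin (K := stabilizer _ t.1 ⊓ stabilizer _ t.2) ⟨s₁ ∪ s₂, fun g hg =>
          ⟨hs₁ g (hg.mono Finset.subset_union_left), hs₂ g (hg.mono Finset.subset_union_right)⟩⟩
          x).subset ?_
        exact fun z hz => ⟨hz.1, fun k hk => hz.2 k hk.1 hk.2⟩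
      refine le_trans ?_ (hN ⟨t, ht, rfl⟩)
      change _ ≤ (Z t).ncard
      rw [← Set.ncard_image_of_injective (Z t) (MulAction.injective g)]
      refine Set.ncard_le_ncard ?_ (hfin.image _)
      rintro w ⟨hw, hw'⟩
      refine ⟨g⁻¹ • w, ⟨?_, fun k hk1 hk2 => ?_⟩, by simp⟩
      · rw [Signed.cmp_iff, DefCut.cmp_iff] at hw ⊢
        refine ⟨hw.1, ?_⟩
        rw [Signed.smul_val, DefCut.smul_idx, ← hw.2]
        nth_rewrite 2 [← hg]
        simp
      · have := hw' (g * k * g⁻¹) ?_ ?_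
        · rw [mul_smul, mul_smul] at this
          rwa [← eq_inv_smul_iff] at this
        · refine Signed.ext ?_ rfl
          rw [Signed.smul_val, ← h1]
          simp [mul_smul, hk1]
        · refine Signed.ext ?_ rfl
          rw [Signed.smul_val, ← h2]
          simp [mul_smul, hk2] }

end

end DefOrd

/-! ### The rank hypothesis excludes branching -/

namespace DefOrd

open MulAction Set

namespace OrdSys

variable {G Ω : Type*} [Group G] [MulAction G Ω] [PartialOrder Ω]
  {S : OrdSys G Ω} {K : Subgroup G} {x y z w u v t s : Ω} {x' y' z' w' u' v' t' s' : Ω}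

namespace Branch

theorem symm (h : S.Branch u s u' s') : S.Branch u' s' u s :=
  ⟨h.lt', h.lt, fun w h1 h2 => by
    obtain ⟨w', h3, h4⟩ := h.bwd w h1 h2
    exact ⟨w', h3, h4.symm⟩, fun w h1 h2 => by
    obtain ⟨w', h3, h4⟩ := h.fwd w h1 h2
    exact ⟨w', h3, h4.symm⟩, fun he => h.not_eqv he.symm⟩

theorem smul (h : S.Branch u s u' s') (k : G) : S.Branch (k • u) (k • s) (k • u') (k • s') := by
  have key : ∀ {u s u' s'}, S.Branch u s u' s' → ∀ w, k • u ≤ w → w < k • s →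
      ∃ w', w' < k • s' ∧ S.Match (k • u) w (k • u') w' := by
    intro u s u' s' h w h1 h2
    obtain ⟨w', h3, h4⟩ := h.fwd (k⁻¹ • w) (by rwa [← S.smul_le_iff k, smul_inv_smul])
      (by rwa [← S.smul_lt_iff k, smul_inv_smul])
    have := h4.smul k
    rw [smul_inv_smul] at this
    exact ⟨k • w', S.smul_lt k h3, this⟩
  refine ⟨S.smul_lt k h.lt, S.smul_lt k h.lt', key h, fun w h1 h2 => ?_, fun he => h.not_eqv ?_⟩
  · obtain ⟨w', h3, h4⟩ := key h.symm w h1 h2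
    exact ⟨w', h3, h4.symm⟩
  · simpa using he.smul k⁻¹

theorem eqv (h : S.Branch u s u' s') : S.Eqv u u' := by
  obtain ⟨w', -, h1⟩ := h.fwd u le_rfl h.lt
  exact h1.left

theorem exists_of_mem (h : S.Branch u s u' s') (h1 : u ≤ w) (h2 : w < s) :
    ∃ w', S.Branch w s w' s' := by
  obtain ⟨w', h3, h4⟩ := h.fwd w h1 h2
  refine ⟨w', h2, h3, fun a ha ha' => ?_, fun a ha ha' => ?_, h.not_eqv⟩
  · obtain ⟨a', h5, h6⟩ := h.fwd a (h1.trans ha) ha'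
    exact ⟨a', h5, h6.sub h1 ha le_rfl h4.le'.cmp h6.le'.cmp h4.right h6.right⟩
  · obtain ⟨b, h5, h6⟩ := h.bwd a (h4.le'.trans ha) ha'
    exact ⟨b, h5, (h6.symm.sub h4.le' ha le_rfl h1.cmp h6.le.cmp h4.right.symm h6.right.symm).symm⟩

/-- An order that agrees with the second branch up to or past the branching cut leaves the first
branch at the same cut `s`. This nests the families in the induction on the rank. -/
theorem extend (h : S.Branch u s u' s') (hv : s' ≤ v) (hm : S.Match u' v x y) :
    ∃ z, S.Branch u s x z := by
  obtain ⟨z, h1, h2⟩ := hm.split h.lt'.le hv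
  refine ⟨z, h.lt, h1.map_lt h.lt', fun w h3 h4 => ?_, fun w h3 h4 => ?_, fun he =>
    h.not_eqv (he.trans h1.right.symm)⟩
  · obtain ⟨w', h5, h6⟩ := h.fwd w h3 h4
    obtain ⟨w'', h7, h8⟩ := h1.split h6.le' h5.le
    exact ⟨w'', h8.map_lt h5, h6.trans h7⟩
  · obtain ⟨w', h5, h6⟩ := h1.symm.split h3 h4.le
    obtain ⟨w'', h7, h8⟩ := h.bwd w' h5.le' (h6.map_lt h4)
    exact ⟨w'', h7, h8.trans h5.symm⟩

/-- If `s < t`, the second branching identifies `s` with some element of the order of `x'`. Wherever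
this element lies with respect to `s'`, rigidity or `not_eqv` is violated. -/
theorem unique (h : S.Branch x s x' s') (h' : S.Branch x t x' t') : s = t := by
  have key : ∀ {s t s' t'}, S.Branch x s x' s' → S.Branch x t x' t' → ¬ s < t := by
    intro s t s' t' h h' hst
    obtain ⟨a, -, h1⟩ := h'.fwd s h.lt.le hst
    rcases (S.cmp_trans h1.le'.cmp.symm h.lt'.cmp).lt_or_le with h2 | h2
    · obtain ⟨w, h3, h4⟩ := h.bwd a h1.le' h2
      exact h3.ne (h4.right.unique' h1.right (S.cmp_trans h4.le.cmp.symm h1.le.cmp))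
    · obtain ⟨w, h3, h4⟩ := h1.symm.split h.lt'.le h2
      rcases h4.le'.lt_or_eq with h5 | h5
      · obtain ⟨b, h6, h7⟩ := h.fwd w h3.le' h5
        exact h6.ne (h7.right.unique h3.right.symm (S.cmp_trans h7.le'.cmp.symm h3.le.cmp))
      · exact h.not_eqv (h5 ▸ h3.right.symm)
  rcases (S.cmp_trans h.lt.cmp.symm h'.lt.cmp).lt_or_eq_or_gt with h1 | h1 | h1
  · exact absurd h1 (key h h')
  · exact h1
  · exact absurd h1 (key h' h)

/-- If there is a branching point at all, then there are branching points everywhere. -/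
theorem exists_gt (h : S.Branch u s u' s') (hx : Cmp u x) (hv : Cmp u v) :
    ∃ t x' t', v < t ∧ S.Branch x t x' t' := by
  -- `Q y` consists of the cuts at which some order branches off when followed from `y`; it is
  -- non-empty for all `y` by `rel_total`. If `Q x` were bounded, then all the `Q y` would be, since
  -- the `y` with bounded `Q y` form an invariant initial segment. Then the map from `y` to the
  -- supremum of `Q y` would be definable and strictly above the identity, against `iter_up`.
  let Q (y : Ω) : Set Ω := {t | ∃ y' t', S.Branch y t y' t'}
  have Q_smul : ∀ (g : G) {y t}, t ∈ Q y → g • t ∈ Q (g • y) := by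
    rintro g y t ⟨y', t', h1⟩
    exact ⟨_, _, h1.smul g⟩
  have Q_ne : ∀ y, Cmp u y → (Q y).Nonempty := by
    let E (a b : Ω) : Prop := ∀ w, a ≤ w → w ≤ b → (Q w).Nonempty
    have hE : ConvRel (S.fib u) E := by
      refine ⟨fun k _ a b _ h1 w h2 h3 => ?_, fun {a b c} h1 h2 h3 h4 w h5 h6 => ?_,
        fun {a b c} h1 h2 h3 w h4 h5 => h3 w h4 (h5.trans h2),
        fun {a b c} h1 h2 h3 w h4 h5 => h3 w (h1.trans h4) h5⟩
      · obtain ⟨t, ht⟩ := h1 (k⁻¹ • w) (by rwa [← S.smul_le_iff k, smul_inv_smul])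
          (by rwa [← S.smul_le_iff k, smul_inv_smul])
        have := Q_smul k ht
        rw [smul_inv_smul] at this
        exact ⟨_, this⟩
      · rcases S.cmp_trans h5.cmp.symm h1.cmp with h7 | h7
        · exact h3 w h5 h7
        · exact h4 w h7 h6
    intro y hy
    obtain ⟨a, h1, h2⟩ := S.dense h.lt
    obtain ⟨b, hb⟩ := S.exists_gt y
    refine S.rel_total hE h1 (fun w h3 h4 => ?_) hy hb y le_rfl hb.le
    obtain ⟨w', hw⟩ := h.exists_of_mem h3 (h4.trans_lt h2)
    exact ⟨s, w', s', hw⟩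
  have Q_cmp : ∀ {y t}, t ∈ Q y → y < t := fun ⟨_, _, h1⟩ => h1.lt
  have Q_mono : ∀ {y z t}, y ≤ z → z < t → t ∈ Q y → t ∈ Q z := by
    rintro y z t h1 h2 ⟨y', t', h3⟩
    obtain ⟨z', h4⟩ := h3.exists_of_mem h1 h2
    exact ⟨z', t', h4⟩
  by_contra hn
  push Not at hn
  have hbx : BddAbove (Q x) := by
    refine ⟨v, ?_⟩
    rintro t ⟨x', t', h1⟩
    rcases (S.cmp_trans hv.symm (S.cmp_trans hx h1.lt.cmp)).lt_or_le with h2 | h2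
    · exact absurd h1 (hn t x' t' h2)
    · exact h2
  let U : Set Ω := {y | Cmp u y ∧ BddAbove (Q y)}
  have U_down : ∀ {y z}, z ∈ U → y ≤ z → y ∈ U := by
    rintro y z ⟨h1, b, hb⟩ h2
    refine ⟨S.cmp_trans h1 h2.cmp.symm, ?_⟩
    obtain ⟨t, ht⟩ := Q_ne z h1
    have hzb : z ≤ b := (Q_cmp ht).le.trans (hb ht)
    refine ⟨b, fun t ht => ?_⟩
    rcases (S.cmp_trans h2.cmp.symm (Q_cmp ht).cmp).lt_or_le with h3 | h3
    · exact hb (Q_mono h2 h3 ht)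
    · exact h3.trans hzb
  have U_smul : ∀ k ∈ S.fib u, ∀ y ∈ U, k • y ∈ U := by
    rintro k hk y ⟨h1, b, hb⟩
    refine ⟨S.fib_smul_cmp hk h1, k • b, fun t ht => ?_⟩
    have := Q_smul k⁻¹ ht
    rw [inv_smul_smul] at this
    have := (S.smul_le_iff k).2 (hb this)
    rwa [smul_inv_smul] at this
  have U_all : ∀ y, Cmp u y → y ∈ U := by
    intro y hy
    by_contra hyU
    refine S.no_invariant_cut (x := u) (A := U) ⟨x, hx, hbx⟩ ⟨y, fun z hz => ?_⟩ U_smul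
      fun z hz => hz.1
    rcases S.cmp_trans hz.1.symm hy with h1 | h1
    · exact h1
    · exact absurd (U_down hz h1) hyU
  have hψ : ∀ y, Cmp u y → ∃ q, IsLUB (Q y) q := by
    intro y hy
    refine S.exists_lub (Q_ne y hy) (U_all y hy).2 ⟨_, S.op_stab y, fun k hk t ht => ?_⟩
    have := Q_smul k ht
    rwa [mem_stabilizer_iff.1 hk] at this
  have : Nonempty Ω := ⟨x⟩
  choose! ψ hψ using hψ
  have lt_ψ : ∀ y, Cmp u y → y < ψ y := by
    intro y hy
    obtain ⟨t, ht⟩ := Q_ne y hy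
    exact (Q_cmp ht).trans_le ((hψ y hy).1 ht)
  refine S.iter_up (S.op_fib u) (U := {y | Cmp u y}) (Φ := ψ) ⟨u, Cmp.refl u⟩
    (fun y hy => S.cmp_trans hy (lt_ψ y hy).cmp) lt_ψ fun k hk y hy hky => ?_
  refine S.smul_isLUB (K := stabilizer G y) (hψ y hy) (fun k hk t ht => ?_)
    (mem_stabilizer_iff.2 hky)
  have := Q_smul k ht
  rwa [mem_stabilizer_iff.1 hk] at this

end Branch

/-- An orbit contained in one component is a point or is infinite. -/
theorem smul_eq_of_finite_orbit (S : OrdSys G Ω) (hc : K ≤ S.fib x)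
    (hf : {y | ∃ k ∈ K, y = k • x}.Finite) {k : G} (hk : k ∈ K) : k • x = x := by
  have key : ∀ k ∈ K, ¬ x < k • x := by
    intro k hk hlt
    refine (Set.infinite_range_of_injective (f := fun n : ℕ => k ^ n • x)
      (StrictMono.injective (strictMono_nat_of_lt_succ fun n => ?_))) (hf.subset ?_)
    · rw [pow_succ, mul_smul]
      exact S.smul_lt _ hlt
    · rintro _ ⟨n, rfl⟩
      exact ⟨_, K.pow_mem hk n, rfl⟩
  rcases Cmp.lt_or_eq_or_gt (hc hk) with h | h | h
  · exact absurd h (key k hk)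
  · exact h.symm
  · refine absurd ?_ (key k⁻¹ (K.inv_mem hk))
    rwa [← S.smul_lt_iff k, smul_inv_smul]

end OrdSys

section

variable {L : FirstOrder.Language.{v, w}} {M : Type u} [L.Structure M]
  {D X : Type u} [Interp L M D] [Interp L M X] {V : D → LinOrdOn X}

theorem RankGE.mono {α : Ordinal.{0}} {A B : Set D} (h : RankGE L M α A) (hAB : A ⊆ B) :
    RankGE L M α B := by
  induction h generalizing B with
  | zero => exact .zero B
  | one A h => exact .one B (h.mono hAB)
  | succ A α hα E T R hT hR hinf hsub k hk hr _ =>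
    exact .succ B α hα E T R hT hR hinf (fun t ht => (hsub t ht).trans hAB) k hk hr
  | limit A α hα _ ih => exact .limit B α hα fun β hβ => ih β hβ hAB

theorem nontrivial_of_smul_ne {Ω : Type*} [MulAction (autGroup L M) Ω] {g : autGroup L M} {x : Ω}
    (h : g • x ≠ x) : Nontrivial M := by
  by_contra hn
  rw [not_nontrivial_iff_subsingleton] at hn
  have : g = 1 := Subtype.ext (Equiv.ext fun m => Subsingleton.elim _ _)
  exact h (by rw [this, one_smul])

namespace InvFamily

variable (hV : InvFamily L M V) [Countable M] (hM : OmegaCategorical L M)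
  (hm : ∀ a, (V a).Minimal L M a)

theorem cmp_of_idx {x y : Signed (DefCut hV)} (h : x.val.idx = y.val.idx) :
    Cmp x y ∨ Cmp x ((hV.ordSys hM hm).nu y) := by
  rcases hp : x.pos with _ | _ <;> rcases hq : y.pos with _ | _
  · exact Or.inl (Signed.cmp_iff.2 ⟨hp.trans hq.symm, DefCut.cmp_iff.2 h⟩)
  · exact Or.inr (Signed.cmp_iff.2 ⟨by simp [ordSys, Signed.nu, hp, hq], DefCut.cmp_iff.2 h⟩)
  · exact Or.inr (Signed.cmp_iff.2 ⟨by simp [ordSys, Signed.nu, hp, hq], DefCut.cmp_iff.2 h⟩)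
  · exact Or.inl (Signed.cmp_iff.2 ⟨hp.trans hq.symm, DefCut.cmp_iff.2 h⟩)

/-- The orders of the family that contain the interval `[x, v]`. -/
def covering (x v : Signed (DefCut hV)) : Set D :=
  {c | ∃ x' v', x'.val.idx = c ∧ (hV.ordSys hM hm).Match x v x' v'}

/-- The orders of the family that agree with that of `x` between `x` and `s`, but not beyond. -/
def branching (x s : Signed (DefCut hV)) : Set D :=
  {c | ∃ x' s', x'.val.idx = c ∧ (hV.ordSys hM hm).Branch x s x' s'}

variable {x v s t : Signed (DefCut hV)}

theorem branching_subset (hxv : x ≤ v) (hvs : v < s) :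
    hV.branching hM hm x s ⊆ hV.covering hM hm x v := by
  rintro c ⟨x', s', h1, h2⟩
  obtain ⟨v', -, h3⟩ := h2.fwd v hxv hvs
  exact ⟨x', v', h1, h3⟩

/-- An index could a priori occur through its order and through the reverse of it; `not_eqv_nu`
excludes that, and `Branch.unique` settles the rest. -/
theorem branching_inj {c : D} (hs : c ∈ hV.branching hM hm x s) (ht : c ∈ hV.branching hM hm x t) :
    s = t := by
  obtain ⟨x₁, s₁, h1, h2⟩ := hs
  obtain ⟨x₂, t₂, h3, h4⟩ := ht
  have he := h2.eqv.symm.trans h4.eqv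
  rcases hV.cmp_of_idx hM hm (h1.trans h3.symm) with h | h
  · obtain rfl := he.eq_of_cmp h
    exact h2.unique h4
  · refine absurd ?_ (OrdSys.not_eqv_nu (S := hV.ordSys hM hm) h)
    rw [(hV.ordSys hM hm).nu_nu]
    exact he

theorem smul_mem_branching {c : D} (g : autGroup L M) (hc : c ∈ hV.branching hM hm x s) :
    act g c ∈ hV.branching hM hm (g • x) (g • s) := by
  obtain ⟨x₁, s₁, rfl, h2⟩ := hc
  exact ⟨_, _, rfl, OrdSys.Branch.smul (S := hV.ordSys hM hm) h2 g⟩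

/-- Induction on α. Above `v` there are infinitely many cuts at which orders branch off from `x`,
and the sets of orders branching off at distinct cuts are disjoint. Only finitely many of the cuts
are fixed by the stabilizer `K` of `x` and `v`, so one of them has an infinite orbit under `K`; the
orbit indexes a definable 2-inconsistent family of subsets of `covering x v`. Each member contains
the set of all orders that cover an interval of a branching order going past the branching cut
(`Branch.extend`), and the induction hypothesis applies to that interval by `Branch.symm`. -/
theorem rankGE_covering (α : Ordinal.{0}) : ∀ (x v : Signed (DefCut hV)), x < v →
    (∃ u s u' s', Cmp x u ∧ (hV.ordSys hM hm).Branch u s u' s') →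
    RankGE L M α (hV.covering hM hm x v) := by
  have hinf : ∀ (x v : Signed (DefCut hV)), x < v →
      (∃ u s u' s', Cmp x u ∧ (hV.ordSys hM hm).Branch u s u' s') →
      {s | v < s ∧ (hV.branching hM hm x s).Nonempty}.Infinite := by
    rintro x v hxv ⟨u, s, u', s', hu, hB⟩ hfin
    have hcov : ∀ w, Cmp x w → ∃ t, w < t ∧ (hV.branching hM hm x t).Nonempty := by
      intro w hw
      obtain ⟨t, x', t', h1, h2⟩ := hB.exists_gt hu.symm ((hV.ordSys hM hm).cmp_trans hu.symm hw)
      exact ⟨t, h1, _, x', t', rfl, h2⟩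
    obtain ⟨t, ht, hne⟩ := hcov v hxv.cmp
    obtain ⟨m, hm1, hm2⟩ := hfin.exists_le_maximal (show t ∈ _ from ⟨ht, hne⟩)
    obtain ⟨t', ht', hne'⟩ := hcov m (hxv.trans hm2.1.1).cmp
    exact (hm2.2 ⟨hm2.1.1.trans ht', hne'⟩ ht'.le).not_gt ht'
  induction α using Ordinal.limitRecOn with
  | zero => exact fun _ _ _ _ => .zero _
  | limit α hα ih => exact fun x v h1 h2 => .limit _ _ hα fun β hβ => ih β hβ x v h1 h2
  | add_one α ih =>
    intro x v hxv hB
    classical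
    have hT := hinf x v hxv hB
    -- The rule for successors needs 1 ≤ α, so rank at least 1 is obtained separately, from the
    -- infinity of the set.
    rcases eq_or_ne α 0 with rfl | hα
    · have h1 : RankGE L M 1 (hV.covering hM hm x v) := by
        refine .one _ fun hfin => ?_
        have hch : ∀ s : {s | v < s ∧ (hV.branching hM hm x s).Nonempty}, ∃ c,
            c ∈ hV.branching hM hm x s := fun s => s.2.2
        choose f hf using hch
        have hinj : Function.Injective f := fun s t h => Subtype.ext
          (hV.branching_inj hM hm (hf s) (h ▸ hf t))
        have := hT.to_subtype
        refine Set.infinite_range_of_injective hinj (hfin.subset ?_)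
        rintro _ ⟨s, rfl⟩
        exact hV.branching_subset hM hm hxv.le s.2.1 (hf s)
      simpa using h1
    · let K := stabilizer (autGroup L M) x ⊓ stabilizer (autGroup L M) v
      have hK := (hV.ordSys hM hm).op_top_stab₂ x v
      have hnf : ∃ s, v < s ∧ (hV.branching hM hm x s).Nonempty ∧ ∃ k ∈ K, k • s ≠ s := by
        by_contra hn
        push Not at hn
        refine hT (((hV.ordSys hM hm).fix_fin hK v).subset ?_)
        exact fun s hs => ⟨hs.1.cmp, fun k hk => hn s hs.1 hs.2 k hk⟩
      obtain ⟨s, hvs, hne, k₀, hk₀, hks⟩ := hnf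
      have := nontrivial_of_smul_ne hks
      -- The parameters of the family have to form an interpretable set; the full orbit of `s` under
      -- G is one, and `T` is the suborbit under `K`.
      obtain ⟨hI, hact⟩ := exists_interp hM (Y := orbit (autGroup L M) s) {⟨s, mem_orbit_self s⟩}
        (finite_singleton _) (by
          rintro ⟨_, g, rfl⟩
          exact ⟨_, rfl, g, rfl⟩) (by
          rintro ⟨y, hy⟩
          obtain ⟨t, ht⟩ := y.val.exists_stab
          exact ⟨t, fun g hg => Subtype.ext (Signed.ext (ht g hg) rfl)⟩)
      let T : Set (orbit (autGroup L M) s) := {e | ∃ k ∈ K, (e : Signed (DefCut hV)) = k • s}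
      let R : Set (orbit (autGroup L M) s × D) := {p | p.2 ∈ hV.branching hM hm x p.1}
      have hTv : ∀ e ∈ T, v < (e : Signed (DefCut hV)) := by
        rintro e ⟨k, hk, he⟩
        have := (hV.ordSys hM hm).smul_lt k hvs
        rw [mem_stabilizer_iff.1 hk.2] at this
        rwa [he]
      obtain ⟨t, ht⟩ := hK
      refine .succ _ α (Order.one_le_iff_ne_zero.2 hα) (orbit (autGroup L M) s) T R ?_ ?_ ?_
        (fun e he => hV.branching_subset hM hm hxv.le (hTv e he)) 2 ?_ ?_
      · refine (paramDef_iff hM).2 ⟨t, ?_⟩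
        rintro g hg e ⟨k, hk, he⟩
        refine ⟨g * k, K.mul_mem (ht g hg) hk, ?_⟩
        rw [hact, orbit.coe_smul, he, mul_smul]
      · refine (paramDef_iff hM).2 ⟨t, ?_⟩
        rintro g hg ⟨e, c⟩ he
        have := hV.smul_mem_branching hM hm g he
        rw [mem_stabilizer_iff.1 (ht g hg).1] at this
        rw [act_prod]
        change act g c ∈ hV.branching hM hm x ((act g e : orbit _ s) : Signed (DefCut hV))
        rw [hact, orbit.coe_smul]
        exact this
      · intro hfin
        refine hks ((hV.ordSys hM hm).smul_eq_of_finite_orbit (K := K) ?_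
          ((hfin.image Subtype.val).subset ?_) hk₀)
        · rintro k ⟨-, hk⟩
          have := (hV.ordSys hM hm).smul_lt k hvs
          rw [mem_stabilizer_iff.1 hk] at this
          exact (hV.ordSys hM hm).cmp_trans hvs.cmp.symm this.cmp
        · rintro _ ⟨k, hk, rfl⟩
          exact ⟨⟨k • s, k, rfl⟩, ⟨k, hk, rfl⟩, rfl⟩
      · intro F hF hcard
        obtain ⟨e, e', hee, rfl⟩ := Finset.card_eq_two.1 hcard
        rw [Set.eq_empty_iff_forall_notMem]
        intro c hc
        rw [mem_iInter₂] at hc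
        exact hee (Subtype.ext (hV.branching_inj hM hm (hc e (by simp)) (hc e' (by simp))))
      · rintro e ⟨k, hk, he⟩
        obtain ⟨c, hc⟩ := hne
        have h1 := hV.smul_mem_branching hM hm k hc
        rw [← he, mem_stabilizer_iff.1 hk.1] at h1
        obtain ⟨x', s', h2, h3⟩ := h1
        obtain ⟨v', hv'⟩ := (hV.ordSys hM hm).exists_gt s'
        refine (ih x' v' (h3.lt'.trans hv') ⟨_, _, _, _, Cmp.refl _, h3.symm⟩).mono ?_
        rintro d ⟨y, z, h4, h5⟩
        obtain ⟨z', h6⟩ := h3.extend hv'.le h5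
        exact ⟨y, z', h4, h6⟩

theorem hausdorff (hD : Ranked L M (Set.univ : Set D)) : (hV.ordSys hM hm).Hausdorff := by
  refine OrdSys.hausdorff_of_not_branch fun u s u' s' h => ?_
  obtain ⟨α, hα⟩ := hD
  exact hα ((hV.rankGE_covering hM hm α u s h.lt ⟨_, _, _, _, Cmp.refl _, h⟩).mono
    (subset_univ _))

end InvFamily

end

end DefOrd

/-! ### Linear orders that are locally represented in the system -/

namespace DefOrd

open MulAction Set

namespace OrdSys

/-- The linear order `V` is locally a suborder of one of the orders of the system; the relation
`r p x` says that `x` represents `p`. -/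
def Chartable {Ω : Type*} [PartialOrder Ω] {P : Type u}
    (V : LinOrdOn P) (r : P → Ω → Prop) : Prop :=
  ∀ p ∈ V.carrier, ∀ q ∈ V.carrier, V.lt p q → ∃ x y, x < y ∧ r p x ∧ r q y ∧
    (∀ z ∈ V.carrier, V.le p z → V.le z q → ∃ w, x ≤ w ∧ w ≤ y ∧ r z w) ∧
    ∀ z ∈ V.carrier, ∀ z' ∈ V.carrier, ∀ w w', x ≤ w → w < w' → w' ≤ y → r z w → r z' w' →
      V.lt z z'

variable {G Ω : Type*} [Group G] [MulAction G Ω] [PartialOrder Ω]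
  {S : OrdSys G Ω} {K : Subgroup G} {x y z w u v t s : Ω}
  {P : Type u} {V : LinOrdOn P} {r : P → Ω → Prop}

theorem Chartable.restrict (h : Chartable V r) {A : Set P} (hA : A ⊆ V.carrier) :
    Chartable (V.restrict A hA) r := by
  intro p hp q hq hpq
  obtain ⟨x, y, h1, h2, h3, h4, h5⟩ := h p (hA hp) q (hA hq) hpq
  exact ⟨x, y, h1, h2, h3, fun z hz => h4 z (hA hz), fun z hz z' hz' => h5 z (hA hz) z' (hA hz')⟩

theorem Chartable.reverse (S : OrdSys G Ω) (h : Chartable V r) :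
    Chartable V.reverse fun p x => r p (S.nu x) := by
  intro p hp q hq hpq
  obtain ⟨x, y, h1, h2, h3, h4, h5⟩ := h q hq p hp ⟨hpq.1, hpq.2.symm⟩
  refine ⟨S.nu y, S.nu x, S.nu_lt h1, by simpa only [S.nu_nu], by simpa only [S.nu_nu],
    ?_, ?_⟩
  · intro z hz h6 h7
    obtain ⟨w, h8, h9, h10⟩ := h4 z hz h7 h6
    exact ⟨S.nu w, S.nu_le_iff.2 h9, S.nu_le_iff.2 h8, by simpa only [S.nu_nu]⟩
  · intro z hz z' hz' w w' h6 h7 h8 h9 h10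
    have := h5 z' hz' z hz (S.nu w') (S.nu w) (by rwa [← S.nu_le_iff, S.nu_nu]) (S.nu_lt h7)
      (by rwa [← S.nu_le_iff, S.nu_nu]) h10 h9
    exact ⟨this.1, this.2.symm⟩

variable [MulAction G P]

/-- Representation of the elements of `P` by elements of `Ω`. -/
structure IsRep (r : P → Ω → Prop) : Prop where
  unique : ∀ {p q x}, r p x → r q x → p = q
  smul : ∀ (g : G) {p x}, r p x → r (g • p) (g • x)

theorem IsRep.nu (S : OrdSys G Ω) (h : IsRep (G := G) r) :
    IsRep (G := G) fun p x => r p (S.nu x) :=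
  ⟨fun h1 h2 => h.unique h1 h2, fun g p x h1 => by rw [S.nu_smul]; exact h.smul g h1⟩

/-- A definable convex equivalence relation has finitely many non-trivial classes. -/
theorem Chartable.finite_classes (S : OrdSys G Ω) (h : Chartable V r)
    (hr : IsRep (G := G) r) (hK : S.Op K) (hV : ∀ k ∈ K, ∀ p ∈ V.carrier, k • p ∈ V.carrier)
    (hle : ∀ k ∈ K, ∀ p ∈ V.carrier, ∀ q ∈ V.carrier, V.le p q → V.le (k • p) (k • q))
    (T : Set (P × P)) (hT : T.Finite) (horb : ∀ p, ∃ t ∈ T, ∃ k ∈ K, k • t = p)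
    (E : P → P → Prop) (hE : ∀ k ∈ K, ∀ p ∈ V.carrier, ∀ q ∈ V.carrier, E p q → E (k • p) (k • q))
    (symm : ∀ p ∈ V.carrier, ∀ q ∈ V.carrier, E p q → E q p)
    (trans : ∀ p ∈ V.carrier, ∀ q ∈ V.carrier, ∀ s ∈ V.carrier, E p q → E q s → E p s)
    (conv : ∀ p ∈ V.carrier, ∀ q ∈ V.carrier, ∀ s ∈ V.carrier, V.le p s → V.le s q → E p q →
      E p s) :
    {C : Set P | C.Nontrivial ∧ ∃ p ∈ V.carrier, C = {q | q ∈ V.carrier ∧ E p q}}.Finite := by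
  classical
  set 𝒞 := {C : Set P | C.Nontrivial ∧ ∃ p ∈ V.carrier, C = {q | q ∈ V.carrier ∧ E p q}} with h𝒞
  have sub : ∀ C ∈ 𝒞, C ⊆ V.carrier := by
    rintro C ⟨-, p, hp, rfl⟩ q hq
    exact hq.1
  have rel : ∀ C ∈ 𝒞, ∀ c ∈ C, ∀ c' ∈ C, E c c' := by
    rintro C ⟨-, p, hp, rfl⟩ c hc c' hc'
    exact trans c hc.1 p hp c' hc'.1 (symm p hp c hc.1 hc.2) hc'.2
  have eq_of : ∀ C ∈ 𝒞, ∀ C' ∈ 𝒞, ∀ c ∈ C, ∀ c' ∈ C', E c c' → C = C' := by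
    have key : ∀ C ∈ 𝒞, ∀ C' ∈ 𝒞, ∀ c ∈ C, ∀ c' ∈ C', E c c' → C ⊆ C' := by
      rintro C hC C' hC' c hc c' hc' he d hd
      have hcV := sub C hC hc
      have hdV := sub C hC hd
      have hcV' := sub C' hC' hc'
      have h1 : E c' d := trans c' hcV' c hcV d hdV (symm c hcV c' hcV' he) (rel C hC c hc d hd)
      obtain ⟨-, p, hp, rfl⟩ := hC'
      exact ⟨hdV, trans p hp c' hcV' d hdV hc'.2 h1⟩
    intro C hC C' hC' c hc c' hc' he
    exact (key C hC C' hC' c hc c' hc' he).antisymm (key C' hC' C hC c' hc' c hc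
      (symm c (sub C hC hc) c' (sub C' hC' hc') he))
  have smul_mem : ∀ k ∈ K, ∀ C ∈ 𝒞, (fun p => k • p) '' C ∈ 𝒞 := by
    rintro k hk C ⟨hC, p, hp, rfl⟩
    refine ⟨hC.image (MulAction.injective k), k • p, hV k hk p hp, ?_⟩
    ext q
    constructor
    · rintro ⟨q, hq, rfl⟩
      exact ⟨hV k hk q hq.1, hE k hk p hp q hq.1 hq.2⟩
    · rintro ⟨h1, h2⟩
      refine ⟨k⁻¹ • q, ⟨hV k⁻¹ (K.inv_mem hk) q h1, ?_⟩, by simp⟩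
      simpa using hE k⁻¹ (K.inv_mem hk) _ (hV k hk p hp) q h1 h2
  have hlt : ∀ k ∈ K, ∀ p ∈ V.carrier, ∀ q ∈ V.carrier, V.lt p q → V.lt (k • p) (k • q) :=
    fun k hk p hp q hq h1 => ⟨hle k hk p hp q hq h1.1, fun he => h1.2 (smul_left_cancel k he)⟩
  -- The non-trivial classes that lie strictly between the two components of `t`. They are finite in
  -- number by `rank`, and the number is bounded independently of `t` because pairs have finitely
  -- many orbits. An interval where it is maximal contains all classes that are bounded on both
  -- sides.
  let Φ (t : P × P) : Set (Set P) := {C | C ∈ 𝒞 ∧ ∀ c ∈ C, V.lt t.1 c ∧ V.lt c t.2}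
  have Φ_fin : ∀ p ∈ V.carrier, ∀ q ∈ V.carrier, V.lt p q → (Φ (p, q)).Finite := by
    intro p hp q hq hpq
    obtain ⟨x, y, hxy, hpx, hqy, hex, hcomp⟩ := h p hp q hq hpq
    -- The convex hull, in the chart `[x, y]`, of the representatives of `C`. Convexity of the
    -- classes makes the hulls of distinct classes disjoint.
    let H (C : Set P) : Set Ω := {w | ∃ c ∈ C, ∃ c' ∈ C, ∃ z z', r c z ∧ r c' z' ∧ x ≤ z ∧ z ≤ w ∧
      w ≤ z' ∧ z' ≤ y}
    have le_of : ∀ {c c' z z'}, c ∈ V.carrier → c' ∈ V.carrier → x ≤ z → z ≤ z' → z' ≤ y →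
        r c z → r c' z' → V.le c c' := by
      intro c c' z z' hc hc' h1 h2 h3 h4 h5
      rcases h2.lt_or_eq with h6 | rfl
      · exact (hcomp c hc c' hc' z z' h1 h6 h3 h4 h5).1
      · rw [hr.unique h4 h5]
        exact V.le_refl' hc'
    have H_eq : ∀ C ∈ Φ (p, q), ∀ C' ∈ Φ (p, q), ∀ w, w ∈ H C → w ∈ H C' → C = C' := by
      have key : ∀ {C C' c₁ c₂ c₁' : _} {z₁ z₂ z₁' w : Ω}, C ∈ 𝒞 → C' ∈ 𝒞 → c₁ ∈ C → c₂ ∈ C →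
          c₁' ∈ C' → r c₁ z₁ → r c₂ z₂ → r c₁' z₁' → x ≤ z₁ → z₁ ≤ z₁' → z₁' ≤ w → w ≤ z₂ →
          z₂ ≤ y → C = C' := by
        intro C C' c₁ c₂ c₁' z₁ z₂ z₁' w hC hC' h1 h2 h3 h4 h5 h6 h7 h8 h9 h10 h11
        refine eq_of C hC C' hC' c₁ h1 c₁' h3 ?_
        refine conv c₁ (sub C hC h1) c₂ (sub C hC h2) c₁' (sub C' hC' h3) ?_ ?_
          (rel C hC c₁ h1 c₂ h2)
        · exact le_of (sub C hC h1) (sub C' hC' h3) h7 h8 (h9.trans (h10.trans h11)) h4 h6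
        · exact le_of (sub C' hC' h3) (sub C hC h2) (h7.trans h8) (h9.trans h10) h11 h6 h5
      rintro C hC C' hC' w ⟨c₁, h1, c₂, h2, z₁, z₂, h3, h4, h5, h6, h7, h8⟩
        ⟨d₁, g1, d₂, g2, y₁, y₂, g3, g4, g5, g6, g7, g8⟩
      rcases S.cmp_trans h5.cmp.symm g5.cmp with h9 | h9
      · exact key hC.1 hC'.1 h1 h2 g1 h3 h4 g3 h5 h9 g6 h7 h8
      · exact (key hC'.1 hC.1 g1 g2 h1 g3 g4 h3 g5 h9 h6 g7 g8).symm
    have H_mem : ∀ C ∈ Φ (p, q), ∀ c ∈ C, ∃ z, x ≤ z ∧ z ≤ y ∧ r c z ∧ z ∈ H C := by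
      intro C hC c hc
      obtain ⟨z, h1, h2, h3⟩ := hex c (sub C hC.1 hc) (hC.2 c hc).1.1 (hC.2 c hc).2.1
      exact ⟨z, h1, h2, h3, c, hc, c, hc, z, z, h3, h3, h1, le_rfl, le_rfl, h2⟩
    have Hinj : InjOn H (Φ (p, q)) := by
      intro C hC C' hC' he
      obtain ⟨c, hc⟩ := hC.1.1.nonempty
      obtain ⟨z, -, -, -, hz⟩ := H_mem C hC c hc
      exact H_eq C hC C' hC' z hz (he ▸ hz)
    have hop : S.Op (K ⊓ (stabilizer G x ⊓ stabilizer G y)) := S.op_inf hK (S.op_top_stab₂ x y)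
    refine Set.Finite.of_finite_image (S.rank hop x _ ?_ ?_ ?_ ?_ ?_) Hinj
    · rintro _ ⟨C, hC, rfl⟩ w ⟨c, -, c', -, z, z', -, -, h1, h2, -, -⟩
      exact (h1.trans h2).cmp
    · rintro _ ⟨C, hC, rfl⟩
      obtain ⟨c, hc, c', hc', hne⟩ := hC.1.1
      obtain ⟨z, h1, h2, h3, h4⟩ := H_mem C hC c hc
      obtain ⟨z', h1', h2', h3', h4'⟩ := H_mem C hC c' hc'
      rcases (S.cmp_trans h1.cmp.symm h1'.cmp).lt_or_eq_or_gt with h5 | h5 | h5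
      · exact ⟨z, h4, z', h4', h5⟩
      · exact absurd (hr.unique h3 (h5 ▸ h3')) hne
      · exact ⟨z', h4', z, h4, h5⟩
    · rintro _ ⟨C, hC, rfl⟩
      refine ⟨?_⟩
      rintro a ⟨c₁, h1, c₂, h2, z₁, z₂, h3, h4, h5, h6, h7, h8⟩ b
        ⟨d₁, g1, d₂, g2, y₁, y₂, g3, g4, g5, g6, g7, g8⟩ w hw
      exact ⟨c₁, h1, d₂, g2, z₁, y₂, h3, g4, h5, h6.trans hw.1, hw.2.trans g7, g8⟩
    · rintro _ ⟨C, hC, rfl⟩ _ ⟨C', hC', rfl⟩ hne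
      rw [Function.onFun, id, id, Set.disjoint_left]
      intro w hw hw'
      exact hne (by rw [H_eq C hC C' hC' w hw hw'])
    · rintro k ⟨hk, hkx, hky⟩ _ ⟨C, hC, rfl⟩
      replace hkx : k • x = x := hkx
      replace hky : k • y = y := hky
      have hkp : k • p = p := by
        have := hr.smul k hpx
        rw [hkx] at this
        exact hr.unique this hpx
      have hkq : k • q = q := by
        have := hr.smul k hqy
        rw [hky] at this
        exact hr.unique this hqy
      have H_smul : ∀ k : G, k • x = x → k • y = y → ∀ (C : Set P) w, w ∈ H C →
          k • w ∈ H ((fun p => k • p) '' C) := by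
        rintro k hkx hky C w ⟨c₁, h1, c₂, h2, z₁, z₂, h3, h4, h5, h6, h7, h8⟩
        have h5' := (S.smul_le_iff k).2 h5
        have h8' := (S.smul_le_iff k).2 h8
        rw [hkx] at h5'
        rw [hky] at h8'
        exact ⟨_, mem_image_of_mem _ h1, _, mem_image_of_mem _ h2, _, _, hr.smul k h3,
          hr.smul k h4, h5', (S.smul_le_iff k).2 h6, (S.smul_le_iff k).2 h7, h8'⟩
      refine ⟨(fun p => k • p) '' C, ⟨smul_mem k hk C hC.1, ?_⟩, ?_⟩
      · rintro _ ⟨c, hc, rfl⟩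
        have h1 := hlt k hk p hp c (sub C hC.1 hc) (hC.2 c hc).1
        have h2 := hlt k hk c (sub C hC.1 hc) q hq (hC.2 c hc).2
        rw [hkp] at h1
        rw [hkq] at h2
        exact ⟨h1, h2⟩
      · ext w
        constructor
        · intro hw
          refine ⟨k⁻¹ • w, ?_, by simp⟩
          have := H_smul k⁻¹ (by rw [inv_smul_eq_iff, hkx]) (by rw [inv_smul_eq_iff, hky]) _ w hw
          simpa [image_image] using this
        · rintro ⟨w, hw, rfl⟩
          exact H_smul k hkx hky C w hw
  have Φ_smul : ∀ k ∈ K, ∀ t : P × P, t.1 ∈ V.carrier → t.2 ∈ V.carrier →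
      Φ (k • t) = (fun C => (fun p => k • p) '' C) '' Φ t := by
    have key : ∀ k ∈ K, ∀ t : P × P, t.1 ∈ V.carrier → t.2 ∈ V.carrier → ∀ C ∈ Φ t,
        (fun p => k • p) '' C ∈ Φ (k • t) := by
      rintro k hk t h1 h2 C ⟨hC, hC'⟩
      refine ⟨smul_mem k hk C hC, ?_⟩
      rintro _ ⟨c, hc, rfl⟩
      exact ⟨hlt k hk _ h1 c (sub C hC hc) (hC' c hc).1, hlt k hk c (sub C hC hc) _ h2 (hC' c hc).2⟩
    intro k hk t h1 h2
    ext C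
    constructor
    · intro hC
      have := key k⁻¹ (K.inv_mem hk) (k • t) (hV k hk _ h1) (hV k hk _ h2) C hC
      rw [inv_smul_smul] at this
      exact ⟨_, this, by simp [image_image]⟩
    · rintro ⟨C, hC, rfl⟩
      exact key k hk t h1 h2 C hC
  have bound : ∃ N, ∀ p ∈ V.carrier, ∀ q ∈ V.carrier, (Φ (p, q)).ncard ≤ N := by
    obtain ⟨N, hN⟩ := (hT.image fun t => (Φ t).ncard).bddAbove
    refine ⟨N, fun p hp q hq => ?_⟩
    obtain ⟨t, ht, k, hk, he⟩ := horb (p, q)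
    have h1 : t.1 ∈ V.carrier := by
      have := hV k⁻¹ (K.inv_mem hk) p hp
      rwa [show p = k • t.1 from congrArg Prod.fst he.symm, inv_smul_smul] at this
    have h2 : t.2 ∈ V.carrier := by
      have := hV k⁻¹ (K.inv_mem hk) q hq
      rwa [show q = k • t.2 from congrArg Prod.snd he.symm, inv_smul_smul] at this
    rw [← he, Φ_smul k hk t h1 h2, Set.ncard_image_of_injective]
    · exact hN ⟨t, ht, rfl⟩
    · exact (MulAction.injective k).image_injective
  have Φ_union : {C | ∃ p ∈ V.carrier, ∃ q ∈ V.carrier, V.lt p q ∧ C ∈ Φ (p, q)}.Finite := by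
    by_cases hne : ∃ p ∈ V.carrier, ∃ q ∈ V.carrier, V.lt p q
    swap
    · push Not at hne
      refine Set.finite_empty.subset ?_
      rintro C ⟨p, hp, q, hq, hpq, -⟩
      exact hne p hp q hq hpq
    obtain ⟨N, hN⟩ := bound
    let A : Set ℕ := {n | ∃ p ∈ V.carrier, ∃ q ∈ V.carrier, V.lt p q ∧ n = (Φ (p, q)).ncard}
    have hA : A.Nonempty := by
      obtain ⟨p, hp, q, hq, hpq⟩ := hne
      exact ⟨_, p, hp, q, hq, hpq, rfl⟩
    have hAb : BddAbove A := ⟨N, by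
      rintro _ ⟨p, hp, q, hq, -, rfl⟩
      exact hN p hp q hq⟩
    obtain ⟨p, hp, q, hq, hpq, he⟩ := Nat.sSup_mem hA hAb
    refine (Φ_fin p hp q hq hpq).subset ?_
    rintro C ⟨p', hp', q', hq', hpq', hC⟩
    obtain ⟨p₁, hp₁, hpp, hpp'⟩ : ∃ p₁ ∈ V.carrier, V.le p₁ p ∧ V.le p₁ p' := by
      rcases V.le_total' hp hp' with h1 | h1
      · exact ⟨p, hp, V.le_refl' hp, h1⟩
      · exact ⟨p', hp', h1, V.le_refl' hp'⟩
    obtain ⟨q₁, hq₁, hqq, hqq'⟩ : ∃ q₁ ∈ V.carrier, V.le q q₁ ∧ V.le q' q₁ := by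
      rcases V.le_total' hq hq' with h1 | h1
      · exact ⟨q', hq', h1, V.le_refl' hq'⟩
      · exact ⟨q, hq, V.le_refl' hq, h1⟩
    have hlt₁ : V.lt p₁ q₁ :=
      V.lt_of_lt_of_le' hp₁ hq hq₁ (V.lt_of_le_of_lt' hp₁ hp hq hpp hpq) hqq
    have mono : ∀ {p q}, p ∈ V.carrier → q ∈ V.carrier → V.le p₁ p → V.le q q₁ →
        Φ (p, q) ⊆ Φ (p₁, q₁) := by
      rintro p q hp hq h1 h2 C ⟨hC, hC'⟩
      refine ⟨hC, fun c hc => ⟨?_, ?_⟩⟩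
      · exact V.lt_of_le_of_lt' hp₁ hp (sub C hC hc) h1 (hC' c hc).1
      · exact V.lt_of_lt_of_le' (sub C hC hc) hq hq₁ (hC' c hc).2 h2
    have heq := Set.eq_of_subset_of_ncard_le (mono hp hq hpp hqq)
      (he ▸ le_csSup hAb ⟨p₁, hp₁, q₁, hq₁, hlt₁, rfl⟩) (Φ_fin p₁ hp₁ q₁ hq₁ hlt₁)
    rw [heq]
    exact mono hp' hq' hpp' hqq' hC
  have lt_class : ∀ C ∈ 𝒞, ∀ C' ∈ 𝒞, ∀ c ∈ C, ∀ c' ∈ C', C ≠ C' → V.lt c c' →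
      (∀ d ∈ C', V.lt c d) ∧ ∀ d ∈ C, V.lt d c' := by
    intro C hC C' hC' c hc c' hc' hne h1
    have hcV := sub C hC hc
    have hcV' := sub C' hC' hc'
    constructor
    · intro d hd
      have hdV := sub C' hC' hd
      rcases V.lt_or_le hcV hdV with h2 | h2
      · exact h2
      · exact absurd (eq_of C' hC' C hC d hd c hc
          (conv d hdV c' hcV' c hcV h2 h1.1 (rel C' hC' d hd c' hc'))).symm hne
    · intro d hd
      have hdV := sub C hC hd
      rcases V.lt_or_le hdV hcV' with h2 | h2
      · exact h2
      · exact absurd (eq_of C hC C' hC' c hc c' hc'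
          (conv c hcV d hdV c' hcV' h1.1 h2 (rel C hC c hc d hd))) hne
  -- The remaining classes have no element of `V` strictly below all their elements, or none
  -- strictly above. There is at most one of each kind, since of two distinct classes one is
  -- entirely below the other.
  have low : {C | C ∈ 𝒞 ∧ ∀ p ∈ V.carrier, ∃ c ∈ C, ¬ V.lt p c}.Finite := by
    refine Set.Subsingleton.finite ?_
    rintro C ⟨hC, h1⟩ C' ⟨hC', h1'⟩
    by_contra hne
    obtain ⟨c, hc⟩ := hC.1.nonempty
    obtain ⟨c', hc'⟩ := hC'.1.nonempty
    rcases V.lt_or_le (sub C hC hc) (sub C' hC' hc') with h2 | h2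
    · obtain ⟨d, hd, hd'⟩ := h1' c (sub C hC hc)
      exact hd' ((lt_class C hC C' hC' c hc c' hc' hne h2).1 d hd)
    · have h3 : V.lt c' c := ⟨h2, fun he => hne (eq_of C hC C' hC' c hc c' hc' (by
        rw [he]; exact rel C hC c hc c hc))⟩
      obtain ⟨d, hd, hd'⟩ := h1 c' (sub C' hC' hc')
      exact hd' ((lt_class C' hC' C hC c' hc' c hc (Ne.symm hne) h3).1 d hd)
  have high : {C | C ∈ 𝒞 ∧ ∀ p ∈ V.carrier, ∃ c ∈ C, ¬ V.lt c p}.Finite := by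
    refine Set.Subsingleton.finite ?_
    rintro C ⟨hC, h1⟩ C' ⟨hC', h1'⟩
    by_contra hne
    obtain ⟨c, hc⟩ := hC.1.nonempty
    obtain ⟨c', hc'⟩ := hC'.1.nonempty
    rcases V.lt_or_le (sub C hC hc) (sub C' hC' hc') with h2 | h2
    · obtain ⟨d, hd, hd'⟩ := h1 c' (sub C' hC' hc')
      exact hd' ((lt_class C hC C' hC' c hc c' hc' hne h2).2 d hd)
    · have h3 : V.lt c' c := ⟨h2, fun he => hne (eq_of C hC C' hC' c hc c' hc' (by
        rw [he]; exact rel C hC c hc c hc))⟩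
      obtain ⟨d, hd, hd'⟩ := h1' c (sub C hC hc)
      exact hd' ((lt_class C' hC' C hC c' hc' c hc (Ne.symm hne) h3).2 d hd)
  refine ((Φ_union.union low).union high).subset fun C hC => ?_
  by_cases hl : ∃ p ∈ V.carrier, ∀ c ∈ C, V.lt p c
  · by_cases hh : ∃ q ∈ V.carrier, ∀ c ∈ C, V.lt c q
    · obtain ⟨p, hp, h1⟩ := hl
      obtain ⟨q, hq, h2⟩ := hh
      obtain ⟨c, hc⟩ := hC.1.nonempty
      refine Or.inl (Or.inl ⟨p, hp, q, hq, ?_, hC, fun c hc => ⟨h1 c hc, h2 c hc⟩⟩)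
      exact V.lt_of_lt_of_le' hp (sub C hC hc) hq (h1 c hc) (h2 c hc).1
    · push Not at hh
      exact Or.inr ⟨hC, hh⟩
  · push Not at hl
    exact Or.inl (Or.inr ⟨hC, hl⟩)

end OrdSys

end DefOrd

/-! ### Dense definable sets and maps to the completion of a chartable order -/

namespace DefOrd

open MulAction Set

namespace OrdSys

variable {G Ω : Type*} [Group G] [MulAction G Ω] [PartialOrder Ω]
  {S : OrdSys G Ω} {K : Subgroup G} {x y z w u v t s : Ω}
  {P : Type u} {V : LinOrdOn P} {r : P → Ω → Prop}

/-- An infinite definable set is dense in some interval. -/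
theorem exists_dense_interval (S : OrdSys G Ω) (hK : S.Op K) {A : Set Ω} (hA : A.Infinite)
    (hx : ∀ a ∈ A, Cmp x a) (hinv : ∀ k ∈ K, ∀ a ∈ A, k • a ∈ A) :
    ∃ a ∈ A, ∃ a' ∈ A, a < a' ∧ ∀ b c, a ≤ b → b < c → c ≤ a' → ∃ d ∈ A, b < d ∧ d < c := by
  classical
  -- The gap of `A` around `w`: the elements that are separated from `w` by no element of `A`, end
  -- points included. It is empty when `w` belongs to `A`. Gaps with more than one element are
  -- finitely many by `rank`.
  let cls (w : Ω) : Set Ω := {z | Cmp w z ∧ ∀ a ∈ A, ¬ (w ≤ a ∧ a ≤ z) ∧ ¬ (z ≤ a ∧ a ≤ w)}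
  have cls_symm : ∀ {w z}, z ∈ cls w → w ∈ cls z :=
    fun h => ⟨h.1.symm, fun a ha => ⟨(h.2 a ha).2, (h.2 a ha).1⟩⟩
  have cls_trans : ∀ {w z z'}, z ∈ cls w → z' ∈ cls z → z' ∈ cls w := by
    intro w z z' h h'
    refine ⟨S.cmp_trans h.1 h'.1, fun a ha => ⟨fun h1 => ?_, fun h1 => ?_⟩⟩
    · rcases S.cmp_trans h1.1.cmp.symm h.1 with h2 | h2
      · exact (h.2 a ha).1 ⟨h1.1, h2⟩
      · exact (h'.2 a ha).1 ⟨h2, h1.2⟩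
    · rcases S.cmp_trans h1.2.cmp h.1 with h2 | h2
      · exact (h'.2 a ha).2 ⟨h1.1, h2⟩
      · exact (h.2 a ha).2 ⟨h2, h1.2⟩
  have cls_smul : ∀ k ∈ K, ∀ {w z}, z ∈ cls w → k • z ∈ cls (k • w) := by
    intro k hk w z h
    refine ⟨(S.smul_cmp k).2 h.1, fun a ha => ?_⟩
    have := h.2 _ (hinv k⁻¹ (K.inv_mem hk) a ha)
    have e1 : ∀ b, b ≤ k⁻¹ • a ↔ k • b ≤ a := fun b => by rw [← S.smul_le_iff k, smul_inv_smul]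
    have e2 : ∀ b, k⁻¹ • a ≤ b ↔ a ≤ k • b := fun b => by rw [← S.smul_le_iff k, smul_inv_smul]
    rwa [e1, e1, e2, e2] at this
  have cls_eq : ∀ {w z}, z ∈ cls w → cls w = cls z := by
    intro w z h
    ext v
    exact ⟨fun h1 => cls_trans (cls_symm h) h1, fun h1 => cls_trans h h1⟩
  let C : Set (Set Ω) := {c | ∃ w z, Cmp x w ∧ w < z ∧ z ∈ cls w ∧ c = cls w}
  have mem_self : ∀ {w z}, z ∈ cls w → w ∈ cls w := fun h => cls_trans h (cls_symm h)
  have hop : S.Op (K ⊓ S.fib x) := S.op_inf hK (S.op_fib x)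
  have hC : C.Finite := by
    refine S.rank hop x C ?_ ?_ ?_ ?_ ?_
    · rintro _ ⟨w, z, h1, h2, h3, rfl⟩ v hv
      exact S.cmp_trans h1 hv.1
    · rintro _ ⟨w, z, h1, h2, h3, rfl⟩
      exact ⟨w, mem_self h3, z, h3, h2⟩
    · rintro _ ⟨w, z, h1, h2, h3, rfl⟩
      refine ⟨fun a ha b hb c hc => ?_⟩
      have h4 := cls_trans (cls_symm ha) hb
      refine cls_trans ha ⟨hc.1.cmp, fun d hd => ⟨fun h5 => ?_, fun h5 => ?_⟩⟩
      · exact (h4.2 d hd).1 ⟨h5.1, h5.2.trans hc.2⟩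
      · exact (h4.2 d hd).1 ⟨hc.1.trans h5.1, h5.2.trans (hc.1.trans hc.2)⟩
    · rintro _ ⟨w, z, h1, h2, h3, rfl⟩ _ ⟨w', z', h1', h2', h3', rfl⟩ hne
      rw [Function.onFun, id, id, Set.disjoint_left]
      intro v hv hv'
      exact hne ((cls_eq hv).trans (cls_eq hv').symm)
    · rintro k ⟨hk, hk'⟩ _ ⟨w, z, h1, h2, h3, rfl⟩
      refine ⟨k • w, k • z, S.fib_smul_cmp hk' h1, S.smul_lt k h2, cls_smul k hk h3, ?_⟩
      ext v
      constructor
      · rintro ⟨v, hv, rfl⟩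
        exact cls_smul k hk hv
      · intro hv
        refine ⟨k⁻¹ • v, ?_, by simp⟩
        simpa using cls_smul k⁻¹ (K.inv_mem hk) hv
  have hch : ∀ c : Set Ω, ∃ b, c ∈ C → b ∈ c := by
    intro c
    by_cases hc : c ∈ C
    · obtain ⟨w, z, -, -, h3, rfl⟩ := hc
      exact ⟨z, fun _ => h3⟩
    · exact ⟨x, fun h => absurd h hc⟩
  choose b hb using hch
  -- An element `b c` is marked in each gap `c`. By the pigeonhole principle, two elements of `A`
  -- have the same marked elements below them; so no gap lies between them, and `A` is dense there.
  obtain ⟨a, ha, a', ha', hne, he⟩ := hA.exists_ne_map_eq_of_mapsTo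
    (f := fun a => {c | c ∈ C ∧ b c < a}) (t := {D | D ⊆ C}) (fun a _ c hc => hc.1)
    hC.finite_subsets
  have main : ∀ a ∈ A, ∀ a' ∈ A, {c | c ∈ C ∧ b c < a} = {c | c ∈ C ∧ b c < a'} → a < a' →
      ∀ b c, a ≤ b → b < c → c ≤ a' → ∃ d ∈ A, b < d ∧ d < c := by
    intro a ha a' ha' he hlt v v' h1 h2 h3
    by_contra hn
    push Not at hn
    obtain ⟨w, hw, hw'⟩ := S.dense h2
    obtain ⟨z, hz, hz'⟩ := S.dense hw'
    have hzw : z ∈ cls w := by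
      refine ⟨hz.cmp, fun d hd => ⟨fun h4 => ?_, fun h4 => ?_⟩⟩
      · exact hn d hd (hw.trans_le h4.1) (h4.2.trans_lt hz')
      · exact absurd (h4.1.trans h4.2) hz.not_ge
    have hcC : cls w ∈ C := ⟨w, z, S.cmp_trans (hx a ha) (h1.trans hw.le).cmp, hz, hzw, rfl⟩
    have hbw := hb _ hcC
    have haw : a < w := h1.trans_lt hw
    have hwa' : w < a' := (hw'.trans_le h3)
    have h4 : ¬ b (cls w) < a := fun h => (hbw.2 a ha).2 ⟨h.le, haw.le⟩
    have h5 : ¬ b (cls w) < a' := fun h => h4 (by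
      have : cls w ∈ {c | c ∈ C ∧ b c < a'} := ⟨hcC, h⟩
      rw [← he] at this
      exact this.2)
    rcases (S.cmp_trans hbw.1.symm hwa'.cmp).lt_or_le with h6 | h6
    · exact h5 h6
    · exact (hbw.2 a' ha').1 ⟨hwa'.le, h6⟩
  rcases (S.cmp_trans (hx a ha).symm (hx a' ha')).lt_or_eq_or_gt with h | h | h
  · exact ⟨a, ha, a', ha', h, main a ha a' ha' he h⟩
  · exact absurd h hne
  · exact ⟨a', ha', a, ha, h, main a' ha' a ha he.symm h⟩

variable [MulAction G P]

/-- A strictly increasing definable map from a dense subset of an interval to the completion of a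
chartable order is, somewhere, given by the identification of points. -/
theorem exists_eqv_of_cuts (S : OrdSys G Ω) (hV : Chartable V r) (hr : IsRep (G := G) r)
    (hK : S.Op K) {A : Set Ω} {f : Ω → Set P} (huv : u < v)
    (hd : ∀ a b, u ≤ a → a < b → b ≤ v → ∃ c ∈ A, a < c ∧ c < b)
    (hf : ∀ a ∈ A, u < a → a < v → V.IsCut (f a))
    (hm : ∀ a ∈ A, ∀ b ∈ A, u < a → a < b → b < v → f a ⊂ f b)
    (he : ∀ k ∈ K, ∀ a ∈ A, u < a → a < v → k • u = u → k • v = v →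
      k • a ∈ A ∧ f (k • a) = (fun p => k • p) '' f a) :
    ∃ w w', u < w ∧ w < v ∧ S.Eqv w w' ∧ ∃ q ∈ V.carrier, ∃ y, r q y ∧ Cmp y w' := by
  -- Four parameters confine the cuts to one chart: for `a` between `a₂` and `a₃`, the cut `f a`
  -- contains `b₀`, taken from `f a₂` but not `f a₁`, and omits `b₂`, taken from `f a₄` but not `f
  -- a₃`.
  obtain ⟨a₁, ha₁, h1, h1v⟩ := hd u v le_rfl huv le_rfl
  obtain ⟨a₂, ha₂, h2, h2v⟩ := hd a₁ v h1.le h1v le_rfl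
  obtain ⟨a₃, ha₃, h3, h3v⟩ := hd a₂ v (h1.trans h2).le h2v le_rfl
  obtain ⟨a₄, ha₄, h4, h4v⟩ := hd a₃ v (h1.trans (h2.trans h3)).le h3v le_rfl
  obtain ⟨b₀, hb₀, hb₀'⟩ := Set.exists_of_ssubset (hm a₁ ha₁ a₂ ha₂ h1 h2 h2v)
  obtain ⟨b₂, hb₂, hb₂'⟩ := Set.exists_of_ssubset (hm a₃ ha₃ a₄ ha₄ (h1.trans (h2.trans h3)) h4 h4v)
  have u2 : u < a₂ := h1.trans h2
  have hc2 := hf a₂ ha₂ u2 h2v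
  have hc3 := hf a₃ ha₃ (u2.trans h3) h3v
  have hc4 := hf a₄ ha₄ (u2.trans (h3.trans h4)) h4v
  have mid : ∀ {a}, a ∈ A → a₂ < a → a < a₃ → V.IsCut (f a) ∧ b₀ ∈ f a ∧ b₂ ∉ f a := by
    intro a ha h5 h6
    refine ⟨hf a ha (u2.trans h5) (h6.trans h3v), (hm _ ha₂ _ ha u2 h5 (h6.trans h3v)).1 hb₀,
      fun h => hb₂' ((hm _ ha _ ha₃ (u2.trans h5) h6 h3v).1 h)⟩
  have hb₀V := hc2.1 hb₀
  have hb₂V := hc4.1 hb₂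
  obtain ⟨y₀, y₂, hy, hr₀, hr₂, hex, hcomp⟩ := hV b₀ hb₀V b₂ hb₂V
    (hc3.lt_of_mem_of_not_mem ((hm _ ha₂ _ ha₃ u2 h3 h3v).1 hb₀) hb₂V hb₂')
  -- The part of `f a` visible in the chart. Its supremum `q a` turns `f` into a map to Ω, and `q`
  -- is strictly increasing because the cuts have no last element.
  let Y (a : Ω) : Set Ω := {z | y₀ ≤ z ∧ z ≤ y₂ ∧ ∃ b ∈ f a, r b z}
  let K' := K ⊓ (stabilizer G u ⊓ stabilizer G v) ⊓ (stabilizer G y₀ ⊓ stabilizer G y₂)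
  have hK' : S.Op K' := S.op_inf (S.op_inf hK (S.op_top_stab₂ u v)) (S.op_top_stab₂ y₀ y₂)
  have Y_smul : ∀ k ∈ K', ∀ a ∈ A, u < a → a < v → ∀ z ∈ Y a, k • z ∈ Y (k • a) := by
    rintro k ⟨⟨hk, hku, hkv⟩, hk0, hk2⟩ a ha hua hav z ⟨h5, h6, b, h7, h8⟩
    have h5' := (S.smul_le_iff k).2 h5
    have h6' := (S.smul_le_iff k).2 h6
    rw [show k • y₀ = y₀ from hk0] at h5'
    rw [show k • y₂ = y₂ from hk2] at h6'
    refine ⟨h5', h6', k • b, ?_, hr.smul k h8⟩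
    rw [(he k hk a ha hua hav hku hkv).2]
    exact mem_image_of_mem _ h7
  have Y_image : ∀ k ∈ K', ∀ a ∈ A, u < a → a < v → Y (k • a) = (fun z => k • z) '' Y a := by
    intro k hk a ha hua hav
    ext z
    constructor
    · intro hz
      refine ⟨k⁻¹ • z, ?_, by simp⟩
      have h7 := hk
      obtain ⟨⟨hk', hku, hkv⟩, -⟩ := h7
      have h5 := S.smul_lt k hua
      have h6 := S.smul_lt k hav
      rw [show k • u = u from hku] at h5
      rw [show k • v = v from hkv] at h6
      have := Y_smul k⁻¹ (K'.inv_mem hk) (k • a) (he k hk' a ha hua hav hku hkv).1 h5 h6 z hz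
      rwa [inv_smul_smul] at this
    · rintro ⟨z, hz, rfl⟩
      exact Y_smul k hk a ha hua hav z hz
  have hq : ∀ a, a ∈ A ∧ a₂ < a ∧ a < a₃ → ∃ q, IsLUB (Y a) q := by
    rintro a ⟨ha, h5, h6⟩
    refine S.exists_lub ⟨y₀, le_rfl, hy.le, b₀, (mid ha h5 h6).2.1, hr₀⟩ ⟨y₂, fun z hz => hz.2.1⟩
      ⟨K' ⊓ stabilizer G a, S.op_inf hK' (S.op_stab a), ?_⟩
    rintro k ⟨hk, hka⟩ z hz
    have := Y_smul k hk a ha (u2.trans h5) (h6.trans h3v) z hz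
    rwa [show k • a = a from hka] at this
  have : Nonempty Ω := ⟨u⟩
  choose! q hq using hq
  have rep : ∀ {b}, b ∈ V.carrier → V.le b₀ b → V.le b b₂ → ∃ z, y₀ ≤ z ∧ z ≤ y₂ ∧ r b z :=
    fun hb h5 h6 => hex _ hb h5 h6
  have strict : ∀ a ∈ A, ∀ a' ∈ A, a₂ < a → a < a' → a' < a₃ → q a < q a' := by
    intro a ha a' ha' h5 h6 h7
    obtain ⟨hc, hb0, hb2⟩ := mid ha h5 (h6.trans h7)
    obtain ⟨hc', hb0', hb2'⟩ := mid ha' (h5.trans h6) h7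
    obtain ⟨b, hb, hb'⟩ := Set.exists_of_ssubset (hm a ha a' ha' (u2.trans h5) h6 (h7.trans h3v))
    obtain ⟨d, hd, hbd⟩ := hc'.2.2.2.2 b hb
    have hbV := hc'.1 hb
    have hdV := hc'.1 hd
    have hb0b := hc.lt_of_mem_of_not_mem hb0 hbV hb'
    have hb0d := V.lt_of_lt_of_le' hb₀V hbV hdV hb0b hbd.1
    have hbb2 := hc'.lt_of_mem_of_not_mem hb hb₂V hb2'
    have hdb2 := hc'.lt_of_mem_of_not_mem hd hb₂V hb2'
    obtain ⟨z, hz1, hz2, hrz⟩ := rep hbV hb0b.1 hbb2.1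
    obtain ⟨z', hz1', hz2', hrz'⟩ := rep hdV hb0d.1 hdb2.1
    have lt_of : ∀ {c c' z z'}, c ∈ V.carrier → c' ∈ V.carrier → V.lt c c' → r c z → r c' z' →
        y₀ ≤ z → z ≤ y₂ → y₀ ≤ z' → z' ≤ y₂ → z < z' := by
      intro c c' z z' h1 h2 h3 h4 h5 h6 h7 h8 h9
      rcases (S.cmp_trans h6.cmp.symm h8.cmp).lt_or_eq_or_gt with h | h | h
      · exact h
      · exact absurd (hr.unique h4 (h ▸ h5)) h3.2
      · exact absurd h3 (V.not_lt_of_le h1 h2 (hcomp c' h2 c h1 z' z h8 h h7 h5 h4).1)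
    have h8 : q a ≤ z := by
      refine (hq a ⟨ha, h5, h6.trans h7⟩).2 ?_
      rintro z₁ ⟨g1, g2, b₁, g3, g4⟩
      exact (lt_of (hc.1 g3) hbV (hc.lt_of_mem_of_not_mem g3 hbV hb') g4 hrz g1 g2 hz1 hz2).le
    exact (h8.trans_lt (lt_of hbV hdV hbd hrz hrz' hz1 hz2 hz1' hz2')).trans_le
      ((hq a' ⟨ha', h5.trans h6, h7⟩).1 ⟨hz1', hz2', d, hd, hrz'⟩)
  have bd : ∀ a ∈ A, a₂ < a → a < a₃ → y₀ ≤ q a ∧ q a ≤ y₂ := fun a ha h5 h6 =>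
    ⟨(hq a ⟨ha, h5, h6⟩).1 ⟨le_rfl, hy.le, b₀, (mid ha h5 h6).2.1, hr₀⟩,
      (hq a ⟨ha, h5, h6⟩).2 fun z hz => hz.2.1⟩
  have hd' : ∀ a b, a₂ ≤ a → a < b → b ≤ a₃ → ∃ c ∈ A, a < c ∧ c < b := fun a b h5 h6 h7 =>
    hd a b (u2.le.trans h5) h6 (h7.trans h3v.le)
  obtain ⟨w, w', h5, h6, h7, h8, -⟩ := S.exists_eqv_of_strictMono hK' (q := q) h3 hd' strict
    (fun k hk a ha h5 h6 hk2 hk3 => by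
      have hua := u2.trans h5
      have hav := h6.trans h3v
      have h7 := he k hk.1.1 a ha hua hav hk.1.2.1 hk.1.2.2
      refine ⟨h7.1, ?_⟩
      have h8 := S.smul_lt k h5
      have h9 := S.smul_lt k h6
      rw [hk2] at h8
      rw [hk3] at h9
      refine (hq (k • a) ⟨h7.1, h8, h9⟩).unique ?_
      rw [Y_image k hk a ha hua hav]
      exact S.smul_isLUB_image (hq a ⟨ha, h5, h6⟩) k) bd
  obtain ⟨a, ha, h9, h10⟩ := hd' a₂ w le_rfl h5 h6.le
  exact ⟨w, w', u2.trans h5, h6.trans h3v, h7, b₀, hb₀V, y₀, hr₀,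
    ((bd a ha h9 (h10.trans h6)).1.trans_lt (h8 a ha h9 h10)).cmp⟩

/-- A non-empty set of points of a component, invariant under the stabilizer of the component, is
dense. -/
theorem exists_mem_of_invariant (S : OrdSys G Ω) {A : Set Ω} (hcl : ∀ a ∈ A, ∀ b, S.Eqv a b → b ∈ A)
    (hinv : ∀ g : G, S.Comp x (g • x) → ∀ a ∈ A, g • a ∈ A) (hS : S.Hausdorff) (hz : z ∈ A)
    (hc : S.Comp x z) (hxy : x < y) : ∃ w ∈ A, x < w ∧ w < y := by
  -- Avoiding `A` on an interval is a convex relation, invariant under the stabilizer of the order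
  -- since that group preserves the component. If it held on one interval of the order of `z`, it
  -- would hold at `z` itself, by `rel_total`.
  have dense : ∀ {z u v}, z ∈ A → S.Comp x z → Cmp z u → u < v → ∃ w ∈ A, u < w ∧ w < v := by
    intro z u v hz hxz hzu huv
    by_contra hn
    push Not at hn
    obtain ⟨u₁, h1, h2⟩ := S.dense huv
    obtain ⟨v₁, h3, h4⟩ := S.dense h2
    let E (a b : Ω) : Prop := ∀ w, a ≤ w → w ≤ b → w ∉ A
    have hE : ConvRel (S.fib u₁) E := by
      refine ⟨fun k hk a b _ h w h5 h6 hw => ?_, fun {a b c} h5 h6 h7 h8 w h9 h10 => ?_,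
        fun {a b c} h5 h6 h7 w h8 h9 => h7 w h8 (h9.trans h6),
        fun {a b c} h5 h6 h7 w h8 h9 => h7 w (h5.trans h8) h9⟩
      · have hcz : Cmp z u₁ := S.cmp_trans hzu h1.cmp
        have hk' : Cmp z (k • z) := by
          rw [← S.fib_congr hcz] at hk
          exact hk
        have hcomp : S.Comp x (k • x) :=
          hS.comp_trans hxz (hS.comp_trans (Comp.of_cmp S hk') (hxz.symm.smul k))
        have hkx : S.Comp x (k⁻¹ • x) := by
          have := hcomp.symm.smul k⁻¹
          rwa [inv_smul_smul] at this
        exact h (k⁻¹ • w) (by rwa [← S.smul_le_iff k, smul_inv_smul])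
          (by rwa [← S.smul_le_iff k, smul_inv_smul]) (hinv k⁻¹ hkx w hw)
      · rcases S.cmp_trans h9.cmp.symm h5.cmp with h | h
        · exact h7 w h9 h
        · exact h8 w h h10
    obtain ⟨z', hz'⟩ := S.exists_gt z
    exact S.rel_total hE h3 (fun w h5 h6 h7 => hn w h7 (h1.trans_le h5) (h6.trans_lt h4))
      (S.cmp_trans hzu h1.cmp).symm hz' z le_rfl hz'.le hz
  suffices ∃ z' ∈ A, Cmp x z' by
    obtain ⟨z', h1, h2⟩ := this
    exact dense h1 (Comp.of_cmp S h2) h2.symm hxy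
  -- If `A` meets an order that contains a copy `x₁` of `x`, it is dense in that order, hence meets
  -- the interval next to `x₁` that is matched with an interval next to `x`.
  have transfer : ∀ {x₁ z₁}, S.Eqv x x₁ → z₁ ∈ A → Cmp x₁ z₁ → ∃ z' ∈ A, Cmp x z' := by
    intro x₁ z₁ h1 h2 h3
    obtain ⟨v, v', h4, h5, h6⟩ := h1.exists_match_right
    obtain ⟨w, hw, h7, h8⟩ := dense h2
      (hS.comp_trans (Or.inl h1) (Comp.of_cmp S h3)) h3.symm h5
    obtain ⟨w', h9, -⟩ := h6.symm.split h7.le h8.le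
    exact ⟨w', hcl w hw w' h9.right, h9.le'.cmp⟩
  rcases hc with h | ⟨x₁, z₁, h1, h2, h3⟩ | ⟨z₁, x₁, h1, h2, h3⟩
  · exact ⟨x, hcl z hz x h.symm, Cmp.refl x⟩
  · exact transfer h1 (hcl z hz z₁ h2) h3.cmp
  · exact transfer h2 (hcl z hz z₁ h1) h3.cmp.symm

end OrdSys

end DefOrd

/-! ### Intertwined chartable orders share a point -/

namespace DefOrd

open MulAction Set

namespace OrdSys

variable {G Ω : Type*} [Group G] [MulAction G Ω] [PartialOrder Ω]
  {S : OrdSys G Ω} {K : Subgroup G}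
  {P : Type u} {V V' : LinOrdOn P} {r r' : P → Ω → Prop} [MulAction G P]

/-- If the representatives were finitely many, take the least one above `x`: density of `V` gives a
point between `p` and the point it represents, and this point is represented strictly in between. -/
theorem Chartable.infinite_of_lt (S : OrdSys G Ω) (hr : IsRep (G := G) r)
    (hd : V.DenseNoEnds) {p q : P} {x y : Ω} (hp : p ∈ V.carrier) (hq : q ∈ V.carrier)
    (hxy : x < y) (hpx : r p x) (hqy : r q y)
    (hex : ∀ z ∈ V.carrier, V.le p z → V.le z q → ∃ w, x ≤ w ∧ w ≤ y ∧ r z w)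
    (hcomp : ∀ z ∈ V.carrier, ∀ z' ∈ V.carrier, ∀ w w', x ≤ w → w < w' → w' ≤ y → r z w → r z' w' →
      V.lt z z') :
    {w | x ≤ w ∧ w ≤ y ∧ ∃ z ∈ V.carrier, r z w}.Infinite := by
  intro hfin
  have hfin' : {w | x < w ∧ w ≤ y ∧ ∃ z ∈ V.carrier, r z w}.Finite :=
    hfin.subset fun w hw => ⟨hw.1.le, hw.2⟩
  obtain ⟨m, hm1, hm2⟩ := hfin'.exists_le_minimal
    (show y ∈ _ from ⟨hxy, le_rfl, q, hq, hqy⟩)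
  obtain ⟨⟨h1, h2, z, hz, hzm⟩, h3⟩ := hm2
  have hpz := hcomp p hp z hz x m le_rfl h1 h2 hpx hzm
  have hzq : V.le z q := by
    rcases h2.lt_or_eq with h4 | h4
    · exact (hcomp z hz q hq m y h1.le h4 le_rfl hzm hqy).1
    · rw [hr.unique hzm (h4 ▸ hqy)]
      exact V.le_refl' hq
  obtain ⟨s, hs, h4, h5⟩ := hd.2.1 p hp z hz hpz
  obtain ⟨w, h6, h7, h8⟩ := hex s hs h4.1 (V.le_trans' hs hz hq h5.1 hzq)
  have h9 : x < w := h6.lt_of_ne fun he => h4.2 (hr.unique hpx (he ▸ h8))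
  rcases (S.cmp_trans h6.cmp.symm h1.cmp).lt_or_eq_or_gt with h10 | h10 | h10
  · exact (h3 ⟨h9, h7, s, hs, h8⟩ h10.le).not_gt h10
  · exact h5.2 (hr.unique h8 (h10 ▸ hzm))
  · exact V.not_lt_of_le hs hz (hcomp z hz s hs m w h1.le h10 h7 hzm h8).1 h5

/-- If two chartable weakly transitive orders are intertwined, then they have a point in common. -/
theorem exists_eqv_of_intertwined (S : OrdSys G Ω) (hV : Chartable V r) (hr : IsRep (G := G) r)
    (hV' : Chartable V' r') (hr' : IsRep (G := G) r') (hK : S.Op K)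
    (hd : V.DenseNoEnds) (hd' : V'.DenseNoEnds)
    (hc : ∀ k ∈ K, ∀ p ∈ V.carrier, k • p ∈ V.carrier)
    (hle : ∀ k ∈ K, ∀ p ∈ V.carrier, ∀ q ∈ V.carrier, V.le p q → V.le (k • p) (k • q))
    (hw : ∀ Z ⊆ V.carrier, (∀ k ∈ K, ∀ z ∈ Z, k • z ∈ Z) → Z.Nonempty → V.DenseSubset Z)
    (hw' : ∀ Z ⊆ V'.carrier, (∀ k ∈ K, ∀ z ∈ Z, k • z ∈ Z) → Z.Nonempty → V'.DenseSubset Z)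
    (T : Set (P × P)) (hT : T.Finite) (horb : ∀ p, ∃ t ∈ T, ∃ k ∈ K, k • t = p)
    {f : P → Set P} (hf : ∀ p ∈ V.carrier, V'.IsCut (f p))
    (hfm : ∀ p ∈ V.carrier, ∀ q ∈ V.carrier, V.le p q → f p ⊆ f q)
    (hfe : ∀ k ∈ K, ∀ p ∈ V.carrier, f (k • p) = (fun b => k • b) '' f p) :
    ∃ w w', S.Eqv w w' ∧ (∃ p ∈ V.carrier, ∃ x, r p x ∧ Cmp x w) ∧
      ∃ q ∈ V'.carrier, ∃ y, r' q y ∧ Cmp y w' := by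
  classical
  -- Having the same image is a definable convex relation, with finitely many non-trivial classes.
  -- If there is one, the last of them is invariant, hence dense in `V` by weak transitivity, and
  -- `f` is constant. Its value is then an invariant cut of `V'`, which cannot be dense in `V'`.
  have hinj : ∀ p ∈ V.carrier, ∀ q ∈ V.carrier, p ≠ q → f p ≠ f q := by
    by_contra hn
    push Not at hn
    obtain ⟨p, hp, q, hq, hpq, he⟩ := hn
    have hfin := hV.finite_classes S hr hK hc hle T hT horb (fun p q => f p = f q)
      (fun k hk p hp q hq h => by rw [hfe k hk p hp, hfe k hk q hq, h])
      (fun p _ q _ h => h.symm) (fun p _ q _ s _ h h' => h.trans h')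
      (fun p hp q hq s hs h1 h2 h3 => (hfm p hp s hs h1).antisymm (h3 ▸ hfm s hs q hq h2))
    let Z : Set P := {p | p ∈ V.carrier ∧ ∃ q ∈ V.carrier, p ≠ q ∧ f p = f q}
    have hZ : (f '' Z).Finite := by
      refine Set.Finite.of_finite_image (f := fun j => {q | q ∈ V.carrier ∧ j = f q})
        (hfin.subset ?_) ?_
      · rintro _ ⟨_, ⟨p, ⟨hp, q, hq, hpq, he⟩, rfl⟩, rfl⟩
        exact ⟨⟨p, ⟨hp, rfl⟩, q, ⟨hq, he⟩, hpq⟩, p, hp, rfl⟩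
      · rintro _ ⟨p, ⟨hp, -⟩, rfl⟩ j - hj
        have : p ∈ {q | q ∈ V.carrier ∧ f p = f q} := ⟨hp, rfl⟩
        simp only at hj
        rw [hj] at this
        exact this.2.symm
    obtain ⟨j, -, ⟨z₀, hz₀, rfl⟩, hmax⟩ := hZ.exists_le_maximal
      (mem_image_of_mem f (show p ∈ Z from ⟨hp, q, hq, hpq, he⟩))
    have hmax' : ∀ z ∈ Z, f z ⊆ f z₀ := by
      intro z hz
      rcases (hf z hz.1).total (hf z₀ hz₀.1) with h | h
      · exact h
      · exact hmax (mem_image_of_mem f hz) h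
    have Z_smul : ∀ k ∈ K, ∀ z ∈ Z, k • z ∈ Z := by
      rintro k hk z ⟨hz, q, hq, h1, h2⟩
      refine ⟨hc k hk z hz, k • q, hc k hk q hq, fun h => h1 (smul_left_cancel k h), ?_⟩
      rw [hfe k hk z hz, hfe k hk q hq, h2]
    let Z' : Set P := {z | z ∈ Z ∧ ∀ z' ∈ Z, f z' ⊆ f z}
    have hdense : V.DenseSubset Z' := by
      refine hw Z' (fun z hz => hz.1.1) ?_ ⟨z₀, hz₀, hmax'⟩
      rintro k hk z ⟨hz, hz'⟩
      refine ⟨Z_smul k hk z hz, fun s hs => ?_⟩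
      have h1 := hz' _ (Z_smul k⁻¹ (K.inv_mem hk) s hs)
      have h2 := image_mono (f := fun b => k • b) h1
      rw [← hfe k hk z hz.1, ← hfe k hk _ (hc k⁻¹ (K.inv_mem hk) s hs.1), smul_inv_smul] at h2
      exact h2
    have hconst : ∀ p ∈ V.carrier, f p = f z₀ := by
      intro p hp
      obtain ⟨p₀, hp₀, h1⟩ := hd.2.2.1 p hp
      obtain ⟨p₁, hp₁, h2⟩ := hd.2.2.2 p hp
      obtain ⟨z, hz, h3, h4⟩ := hdense p₀ hp₀ p hp h1
      obtain ⟨z', hz', h5, h6⟩ := hdense p hp p₁ hp₁ h2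
      exact ((hfm p hp z' hz'.1.1 h5.1).trans (hmax' z' hz'.1)).antisymm
        ((hz.2 z₀ hz₀).trans (hfm z hz.1.1 p hp h4.1))
    have hcut := hf z₀ hz₀.1
    have hJ := hw' (f z₀) hcut.1 (fun k hk b hb => by
      rw [← hconst _ (hc k hk z₀ hz₀.1), hfe k hk z₀ hz₀.1]
      exact mem_image_of_mem _ hb) hcut.2.1
    obtain ⟨b, hb, hbn⟩ := not_subset.1 (fun h => hcut.2.2.1 (hcut.1.antisymm h))
    obtain ⟨b', hb', hlt⟩ := hd'.2.2.2 b hb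
    obtain ⟨c, hcJ, h1, h2⟩ := hJ b hb b' hb' hlt
    exact hbn (hcut.2.2.2.1 c hcJ b hb h1.1)
  obtain ⟨p, hp⟩ := hd.1
  obtain ⟨q, hq, hpq⟩ := hd.2.2.2 p hp
  obtain ⟨x, y, hxy, hpx, hqy, hex, hcomp⟩ := hV p hp q hq hpq
  -- The map is transported to the chart: `A` consists of the representatives of points, it is
  -- infinite and therefore dense in some interval, and `exists_eqv_of_cuts` applies to `f` read on
  -- `A`.
  let A : Set Ω := {w | x ≤ w ∧ w ≤ y ∧ ∃ z ∈ V.carrier, r z w}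
  have hA : A.Infinite := Chartable.infinite_of_lt S hr hd hp hq hxy hpx hqy hex hcomp
  let K' := K ⊓ (stabilizer G x ⊓ stabilizer G y)
  have hK' : S.Op K' := S.op_inf hK (S.op_top_stab₂ x y)
  have A_smul : ∀ k ∈ K', ∀ a ∈ A, k • a ∈ A := by
    rintro k ⟨hk, hkx, hky⟩ a ⟨h1, h2, z, hz, h3⟩
    have h1' := (S.smul_le_iff k).2 h1
    have h2' := (S.smul_le_iff k).2 h2
    rw [show k • x = x from hkx] at h1'
    rw [show k • y = y from hky] at h2'
    exact ⟨h1', h2', k • z, hc k hk z hz, hr.smul k h3⟩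
  obtain ⟨a, ha, a', ha', haa, hdense⟩ := S.exists_dense_interval hK' hA (fun a ha => ha.1.cmp)
    A_smul
  let F (w : Ω) : Set P := {b | ∃ p ∈ V.carrier, r p w ∧ b ∈ f p}
  have F_eq : ∀ {p w}, p ∈ V.carrier → r p w → F w = f p := by
    intro p w hp hpw
    ext b
    constructor
    · rintro ⟨p', -, h1, h2⟩
      rwa [hr.unique hpw h1]
    · exact fun hb => ⟨p, hp, hpw, hb⟩
  obtain ⟨w, w', h1, h2, h3, h4⟩ := S.exists_eqv_of_cuts hV' hr' hK' haa (A := A) (f := F) hdense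
    (fun c hc _ _ => by
      obtain ⟨-, -, z, hz, h⟩ := hc
      rw [F_eq hz h]
      exact hf z hz)
    (fun c hc d hd _ hcd _ => by
      obtain ⟨hxc, -, z, hz, h⟩ := hc
      obtain ⟨-, hdy, z', hz', h'⟩ := hd
      rw [F_eq hz h, F_eq hz' h']
      have hlt := hcomp z hz z' hz' c d hxc hcd hdy h h'
      exact (hfm z hz z' hz' hlt.1).ssubset_of_ne (hinj z hz z' hz' hlt.2))
    (fun k hk c hcA _ _ _ _ => by
      refine ⟨A_smul k hk c hcA, ?_⟩
      obtain ⟨-, -, z, hz, h⟩ := hcA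
      rw [F_eq hz h, F_eq (hc k hk.1 z hz) (hr.smul k h), hfe k hk.1 z hz])
  exact ⟨w, w', h3, ⟨p, hp, x, hpx, (ha.1.trans h1.le).cmp⟩, h4⟩

end OrdSys

end DefOrd

/-! ### The glued set, its components and their orders -/

namespace DefOrd

open MulAction Set

namespace OrdSys

variable {G : Type*} {Ω : Type u} [Group G] [MulAction G Ω] [PartialOrder Ω]
  {S : OrdSys G Ω} {K : Subgroup G} {x y z w : Ω}

/-- The elements that are identified with a point of some order. -/
def Pts (S : OrdSys G Ω) : Set Ω := {x | ∃ y ∈ S.Pt, S.Eqv x y}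

theorem pts_of_eqv (hx : x ∈ S.Pts) (h : S.Eqv x y) : y ∈ S.Pts := by
  obtain ⟨z, hz, h1⟩ := hx
  exact ⟨z, hz, h.symm.trans h1⟩

theorem pt_subset_pts : S.Pt ⊆ S.Pts := fun x hx => ⟨x, hx, Eqv.refl S x⟩

theorem smul_mem_pts (g : G) (hx : x ∈ S.Pts) : g • x ∈ S.Pts := by
  obtain ⟨y, hy, h⟩ := hx
  exact ⟨g • y, S.pt_smul g y hy, h.smul g⟩

theorem nu_mem_pts (hx : x ∈ S.Pts) : S.nu x ∈ S.Pts := by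
  obtain ⟨y, hy, h⟩ := hx
  exact ⟨S.nu y, S.pt_nu y hy, h.nu⟩

theorem exists_pts_between (S : OrdSys G Ω) (h : x < y) : ∃ z ∈ S.Pts, x < z ∧ z < y := by
  obtain ⟨z, hz, h1⟩ := S.pt_dense h
  exact ⟨z, pt_subset_pts hz, h1⟩

/-- The identification of points of different orders. -/
def eqvSetoid (S : OrdSys G Ω) : Setoid S.Pts where
  r x y := S.Eqv x y
  iseqv := ⟨fun x => Eqv.refl S x, fun h => h.symm, fun h h' => h.trans h'⟩

/-- The set obtained from the orders of the system by gluing them together. -/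
def Glued (S : OrdSys G Ω) : Type u := Quotient S.eqvSetoid

instance : MulAction G S.Glued where
  smul g := Quotient.map' (fun x : S.Pts => ⟨g • (x : Ω), smul_mem_pts g x.2⟩)
    fun _ _ h => Eqv.smul h g
  one_smul p := by
    induction p using Quotient.inductionOn'
    exact congrArg _ (Subtype.ext (one_smul G _))
  mul_smul g h p := by
    induction p using Quotient.inductionOn'
    exact congrArg _ (Subtype.ext (mul_smul g h _))

/-- `x` represents `p`. -/
def Rep (p : S.Glued) (x : Ω) : Prop := ∃ hx : x ∈ S.Pts, Quotient.mk S.eqvSetoid ⟨x, hx⟩ = p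

variable {p q s t : S.Glued}

theorem exists_of_mem_pts (h : x ∈ S.Pts) : ∃ p : S.Glued, Rep p x := ⟨_, h, rfl⟩

theorem exists_rep (p : S.Glued) : ∃ x ∈ S.Pt, Rep p x := by
  obtain ⟨⟨x, hx⟩, rfl⟩ := Quotient.exists_rep p
  obtain ⟨y, hy, h⟩ := hx
  exact ⟨y, hy, pt_subset_pts hy, Quotient.sound h.symm⟩

theorem Rep.eqv (h : Rep p x) (h' : Rep p y) : S.Eqv x y := by
  obtain ⟨hx, rfl⟩ := h
  obtain ⟨hy, h1⟩ := h'
  exact (Quotient.exact h1).symm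

theorem Rep.congr (h : Rep p x) (h' : S.Eqv x y) : Rep p y := by
  obtain ⟨hx, rfl⟩ := h
  exact ⟨pts_of_eqv hx h', Quotient.sound h'.symm⟩

theorem Rep.eq_iff (h : Rep p x) (h' : Rep q y) : p = q ↔ S.Eqv x y := by
  constructor
  · rintro rfl
    exact h.eqv h'
  · intro h1
    obtain ⟨hx, rfl⟩ := h
    obtain ⟨hy, rfl⟩ := h'
    exact Quotient.sound h1

theorem Rep.unique (h : Rep p x) (h' : Rep q x) : p = q := (h.eq_iff h').2 (Eqv.refl S x)

theorem Rep.smul (g : G) (h : Rep p x) : Rep (g • p) (g • x) := by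
  obtain ⟨hx, rfl⟩ := h
  exact ⟨smul_mem_pts g hx, rfl⟩

theorem isRep (S : OrdSys G Ω) : IsRep (G := G) (Rep (S := S)) :=
  ⟨fun h h' => h.unique h', fun g _ _ h => h.smul g⟩

/-- The reversal. -/
def gnu (S : OrdSys G Ω) : S.Glued → S.Glued :=
  Quotient.map' (fun x : S.Pts => ⟨S.nu x, nu_mem_pts x.2⟩) fun _ _ h => Eqv.nu h

theorem Rep.nu (h : Rep p x) : Rep (S.gnu p) (S.nu x) := by
  obtain ⟨hx, rfl⟩ := h
  exact ⟨nu_mem_pts hx, rfl⟩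

theorem gnu_gnu (p : S.Glued) : S.gnu (S.gnu p) = p := by
  obtain ⟨x, -, hx⟩ := exists_rep p
  have := hx.nu.nu
  rw [S.nu_nu] at this
  exact this.unique hx

theorem rep_gnu_iff : Rep (S.gnu p) x ↔ Rep p (S.nu x) := by
  constructor
  · intro h
    have := h.nu
    rwa [gnu_gnu] at this
  · intro h
    have := h.nu
    rwa [S.nu_nu] at this

theorem gnu_smul (g : G) (p : S.Glued) : S.gnu (g • p) = g • S.gnu p := by
  obtain ⟨x, -, hx⟩ := exists_rep p
  have := (hx.smul g).nu
  rw [S.nu_smul] at this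
  exact this.unique (hx.nu.smul g)

/-- Being connected. -/
def compSetoid (hS : S.Hausdorff) : Setoid S.Pts where
  r x y := S.Comp x y
  iseqv := ⟨fun x => Or.inl (Eqv.refl S x), fun h => h.symm, fun h h' => hS.comp_trans h h'⟩

/-- The connected components. -/
def Component (hS : S.Hausdorff) : Type u := Quotient (compSetoid hS)

variable {hS : S.Hausdorff}

instance : MulAction G (Component hS) where
  smul g := Quotient.map' (fun x : S.Pts => ⟨g • (x : Ω), smul_mem_pts g x.2⟩)
    fun _ _ h => Comp.smul h g
  one_smul p := by
    induction p using Quotient.inductionOn'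
    exact congrArg _ (Subtype.ext (one_smul G _))
  mul_smul g h p := by
    induction p using Quotient.inductionOn'
    exact congrArg _ (Subtype.ext (mul_smul g h _))

/-- The component of a point. -/
def compOf (hS : S.Hausdorff) : S.Glued → Component hS :=
  Quotient.map' id fun _ _ h => Or.inl h

theorem compOf_eq_iff (h : Rep p x) (h' : Rep q y) : compOf hS p = compOf hS q ↔ S.Comp x y := by
  obtain ⟨hx, rfl⟩ := h
  obtain ⟨hy, rfl⟩ := h'
  exact ⟨fun h => Quotient.exact h, fun h => Quotient.sound h⟩

theorem exists_compOf (e : Component hS) : ∃ p, compOf hS p = e := by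
  obtain ⟨x, rfl⟩ := Quotient.exists_rep e
  exact ⟨Quotient.mk _ x, rfl⟩

theorem compOf_smul (g : G) (p : S.Glued) : compOf hS (g • p) = g • compOf hS p := by
  induction p using Quotient.inductionOn'
  rfl

/-- The reversal of the components. -/
def cnu (hS : S.Hausdorff) : Component hS → Component hS :=
  Quotient.map' (fun x : S.Pts => ⟨S.nu x, nu_mem_pts x.2⟩) fun _ _ h => Comp.nu h

theorem compOf_gnu (p : S.Glued) : compOf hS (S.gnu p) = cnu hS (compOf hS p) := by
  induction p using Quotient.inductionOn'
  rfl

/-- Some order of the system contains `p < q`. -/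
def GArc (p q : S.Glued) : Prop := ∃ x y, Rep p x ∧ Rep q y ∧ x < y

/-- Some order of the system contains `p < q < s`. -/
def GCyc (p q s : S.Glued) : Prop := ∃ x y z, Rep p x ∧ Rep q y ∧ Rep s z ∧ x < y ∧ y < z

theorem Rep.arc_iff (h : Rep p x) (h' : Rep q y) : GArc p q ↔ S.Arc x y := by
  constructor
  · rintro ⟨x', y', h1, h2, h3⟩
    exact ⟨x', y', h.eqv h1, h'.eqv h2, h3⟩
  · rintro ⟨x', y', h1, h2, h3⟩
    exact ⟨x', y', h.congr h1, h'.congr h2, h3⟩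

theorem Rep.cyc_iff (h : Rep p x) (h' : Rep q y) (h'' : Rep s z) : GCyc p q s ↔ S.Cyc x y z := by
  constructor
  · rintro ⟨x', y', z', h1, h2, h3, h4, h5⟩
    exact ⟨x', y', z', h.eqv h1, h'.eqv h2, h''.eqv h3, h4, h5⟩
  · rintro ⟨x', y', z', h1, h2, h3, h4, h5⟩
    exact ⟨x', y', z', h.congr h1, h'.congr h2, h''.congr h3, h4, h5⟩

theorem GArc.ne (h : GArc p q) : p ≠ q := by
  obtain ⟨x, y, h1, h2, h3⟩ := h
  rw [Ne, h1.eq_iff h2]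
  exact (Arc.of_lt h3).not_eqv

theorem GArc.smul (g : G) (h : GArc p q) : GArc (g • p) (g • q) := by
  obtain ⟨x, y, h1, h2, h3⟩ := h
  exact ⟨_, _, h1.smul g, h2.smul g, S.smul_lt g h3⟩

theorem GArc.gnu (h : GArc p q) : GArc (S.gnu q) (S.gnu p) := by
  obtain ⟨x, y, h1, h2, h3⟩ := h
  exact ⟨_, _, h2.nu, h1.nu, S.nu_lt h3⟩

theorem GCyc.smul (g : G) (h : GCyc p q s) : GCyc (g • p) (g • q) (g • s) := by
  obtain ⟨x, y, z, h1, h2, h3, h4, h5⟩ := h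
  exact ⟨_, _, _, h1.smul g, h2.smul g, h3.smul g, S.smul_lt g h4, S.smul_lt g h5⟩

theorem GCyc.gnu (h : GCyc p q s) : GCyc (S.gnu s) (S.gnu q) (S.gnu p) := by
  obtain ⟨x, y, z, h1, h2, h3, h4, h5⟩ := h
  exact ⟨_, _, _, h3.nu, h2.nu, h1.nu, S.nu_lt h5, S.nu_lt h4⟩

theorem GCyc.arcs (h : GCyc p q s) : GArc p q ∧ GArc q s ∧ GArc p s := by
  obtain ⟨x, y, z, h1, h2, h3, h4, h5⟩ := h
  exact ⟨⟨_, _, h1, h2, h4⟩, ⟨_, _, h2, h3, h5⟩, ⟨_, _, h1, h3, h4.trans h5⟩⟩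

theorem GCyc.ne (h : GCyc p q s) : p ≠ q ∧ q ≠ s ∧ p ≠ s :=
  ⟨h.arcs.1.ne, h.arcs.2.1.ne, h.arcs.2.2.ne⟩

theorem GArc.compOf_eq (h : GArc p q) : compOf hS p = compOf hS q := by
  obtain ⟨x, y, h1, h2, h3⟩ := h
  exact (compOf_eq_iff h1 h2).2 (Comp.of_cmp S h3.cmp)

/-- The component `e` is a circle. -/
def IsCircle (e : Component hS) : Prop := ∃ p q, compOf hS p = e ∧ GArc p q ∧ GArc q p

theorem IsCircle.smul {e : Component hS} (g : G) (h : IsCircle e) : IsCircle (g • e) := by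
  obtain ⟨p, q, rfl, h1, h2⟩ := h
  exact ⟨g • p, g • q, compOf_smul g p, h1.smul g, h2.smul g⟩

theorem IsCircle.cnu {e : Component hS} (h : IsCircle e) : IsCircle (cnu hS e) := by
  obtain ⟨p, q, rfl, h1, h2⟩ := h
  exact ⟨S.gnu p, S.gnu q, compOf_gnu p, h2.gnu, h1.gnu⟩

variable {e : Component hS}

theorem IsCircle.arc (h : IsCircle e) (hp : compOf hS p = e) (hq : compOf hS q = e) (hne : p ≠ q) :
    GArc p q := by
  obtain ⟨a, b, rfl, h1, h2⟩ := h
  obtain ⟨x, -, hx⟩ := exists_rep a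
  obtain ⟨z, -, hz⟩ := exists_rep b
  obtain ⟨u, -, hu⟩ := exists_rep p
  obtain ⟨v, -, hv⟩ := exists_rep q
  rw [hu.arc_iff hv]
  rw [hx.arc_iff hz] at h1
  rw [hz.arc_iff hx] at h2
  rw [Ne, hu.eq_iff hv] at hne
  exact hS.arc_of_circular h1 h2 ((compOf_eq_iff hx hu).1 hp.symm)
    ((compOf_eq_iff hx hv).1 hq.symm) hne

/-- Transitivity can only fail by closing up, with `s` equal to `p`, and then the component is a
circle. -/
theorem garc_trans (he : ¬ IsCircle e) (hp : compOf hS p = e) (h : GArc p q) (h' : GArc q s) :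
    GArc p s := by
  obtain ⟨x, -, hx⟩ := exists_rep p
  obtain ⟨y, -, hy⟩ := exists_rep q
  obtain ⟨z, -, hz⟩ := exists_rep s
  rcases hS.arc_trans_or_eqv ((hx.arc_iff hy).1 h) ((hy.arc_iff hz).1 h') with h1 | h1
  · exact (hx.arc_iff hz).2 h1
  · exact absurd ⟨p, q, hp, h, by rwa [(hx.eq_iff hz).2 h1]⟩ he

theorem garc_total (hp : compOf hS p = e) (hq : compOf hS q = e) :
    p = q ∨ GArc p q ∨ GArc q p := by
  obtain ⟨x, -, hx⟩ := exists_rep p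
  obtain ⟨y, -, hy⟩ := exists_rep q
  rw [hx.eq_iff hy, hx.arc_iff hy, hy.arc_iff hx]
  exact (compOf_eq_iff hx hy).1 (hp.trans hq.symm)

/-- The order of a component that is not a circle. -/
def linComp (e : Component hS) (he : ¬ IsCircle e) : LinOrdOn S.Glued where
  carrier := {p | compOf hS p = e}
  le p q := p = q ∨ GArc p q
  linear :=
    { refl := fun p => Or.inl rfl
      trans := by
        rintro ⟨p, hp⟩ ⟨q, hq⟩ ⟨s, hs⟩ (rfl | h) (rfl | h')
        · exact Or.inl rfl
        · exact Or.inr h'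
        · exact Or.inr h
        · exact Or.inr (garc_trans he hp h h')
      antisymm := by
        rintro ⟨p, hp⟩ ⟨q, hq⟩ (h | h) (h' | h')
        · exact Subtype.ext h
        · exact Subtype.ext h
        · exact Subtype.ext h'.symm
        · exact absurd ⟨p, q, hp, h, h'⟩ he
      total := by
        rintro ⟨p, hp⟩ ⟨q, hq⟩
        rcases garc_total hp hq with h | h | h
        · exact Or.inl (Or.inl h)
        · exact Or.inl (Or.inr h)
        · exact Or.inr (Or.inr h) }

theorem linComp_lt {he : ¬ IsCircle e} : (linComp e he).lt p q ↔ GArc p q :=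
  ⟨fun h => h.1.resolve_left h.2, fun h => ⟨Or.inr h, h.ne⟩⟩

theorem GCyc.rotate (he : IsCircle e) (hp : compOf hS p = e) (h : GCyc p q s) : GCyc q s p := by
  have h1 := he.arc (h.arcs.1.compOf_eq.symm.trans hp) hp h.ne.1.symm
  obtain ⟨x, -, hx⟩ := exists_rep p
  obtain ⟨y, -, hy⟩ := exists_rep q
  obtain ⟨z, -, hz⟩ := exists_rep s
  rw [hx.cyc_iff hy hz] at h
  rw [hy.cyc_iff hz hx]
  exact hS.cyc_rotate h ((hy.arc_iff hx).1 h1)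

theorem GCyc.asymm (hS : S.Hausdorff) (h : GCyc p q s) : ¬ GCyc p s q := by
  obtain ⟨x, -, hx⟩ := exists_rep p
  obtain ⟨y, -, hy⟩ := exists_rep q
  obtain ⟨z, -, hz⟩ := exists_rep s
  rw [hx.cyc_iff hy hz] at h
  rw [hx.cyc_iff hz hy]
  exact hS.cyc_asymm h

theorem GCyc.trans (hS : S.Hausdorff) (h : GCyc p q s) (h' : GCyc p s t) : GCyc p q t := by
  obtain ⟨x, -, hx⟩ := exists_rep p
  obtain ⟨y, -, hy⟩ := exists_rep q
  obtain ⟨z, -, hz⟩ := exists_rep s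
  obtain ⟨w, -, hw⟩ := exists_rep t
  rw [hx.cyc_iff hy hz] at h
  rw [hx.cyc_iff hz hw] at h'
  rw [hx.cyc_iff hy hw]
  exact hS.cyc_trans h h'

theorem gcyc_total (he : IsCircle e) (hp : compOf hS p = e) (hq : compOf hS q = e)
    (hs : compOf hS s = e) (h1 : p ≠ q) (h2 : q ≠ s) (h3 : p ≠ s) : GCyc p q s ∨ GCyc p s q := by
  have h4 := he.arc hp hq h1
  have h5 := he.arc hp hs h3
  obtain ⟨x, -, hx⟩ := exists_rep p
  obtain ⟨y, -, hy⟩ := exists_rep q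
  obtain ⟨z, -, hz⟩ := exists_rep s
  rw [hx.cyc_iff hy hz, hx.cyc_iff hz hy]
  rw [hx.arc_iff hy] at h4
  rw [hx.arc_iff hz] at h5
  rw [Ne, hy.eq_iff hz] at h2
  exact hS.cyc_total h4 h5 h2

/-- The (reflexive) circular order. -/
def GBtw (p q s : S.Glued) : Prop := p = q ∨ q = s ∨ p = s ∨ GCyc p q s

/-- The order of a component that is a circle. -/
def circComp (e : Component hS) (he : IsCircle e) : CircOrdOn S.Glued where
  carrier := {p | compOf hS p = e}
  btw := GBtw
  circular := by
    have cyc_of : ∀ {p q s : S.Glued}, GBtw p q s ∧ ¬ GBtw s q p → GCyc p q s := by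
      rintro p q s ⟨h | h | h | h, h'⟩
      · exact absurd (Or.inr (Or.inl h.symm)) h'
      · exact absurd (Or.inl h.symm) h'
      · exact absurd (Or.inr (Or.inr (Or.inl h.symm))) h'
      · exact h
    have not_of : ∀ {p q s : S.Glued}, compOf hS p = e → compOf hS s = e → GCyc p q s →
        ¬ GBtw s q p := by
      rintro p q s hp hs h (h1 | h1 | h1 | h1)
      · exact h.ne.2.1 h1.symm
      · exact h.ne.1 h1.symm
      · exact h.ne.2.2 h1.symm
      · exact h.asymm hS ((h1.rotate he hs).rotate he (h.arcs.1.compOf_eq.symm.trans hp))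
    refine ⟨{ btw := fun p q s => GBtw (p : S.Glued) q s, btw_refl := ?_, btw_cyclic_left := ?_,
              sbtw_trans_left := ?_, btw_antisymm := ?_, btw_total := ?_ }, fun _ _ _ => Iff.rfl⟩
    · exact fun _ => Or.inl rfl
    · rintro ⟨p, hp⟩ ⟨q, hq⟩ ⟨s, hs⟩ (h | h | h | h)
      · exact Or.inr (Or.inr (Or.inl h.symm))
      · exact Or.inl h
      · exact Or.inr (Or.inl h.symm)
      · exact Or.inr (Or.inr (Or.inr (h.rotate he hp)))
    · rintro ⟨p, hp⟩ ⟨q, hq⟩ ⟨s, hs⟩ ⟨t, ht⟩ h h'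
      have h1 : GCyc p q s := cyc_of h
      have h2 : GCyc q t s := cyc_of h'
      have h3 := (h1.rotate he hp).rotate he hq
      have h4 := (h2.rotate he hq).rotate he ht
      have h5 := (h3.trans hS h4).rotate he hs
      exact ⟨Or.inr (Or.inr (Or.inr h5)), not_of hp hs h5⟩
    · rintro ⟨p, hp⟩ ⟨q, hq⟩ ⟨s, hs⟩ (h | h | h | h) h'
      · exact Or.inl (Subtype.ext h)
      · exact Or.inr (Or.inl (Subtype.ext h))
      · exact Or.inr (Or.inr (Subtype.ext h.symm))
      · exact absurd h' (not_of hp hs h)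
    · rintro ⟨p, hp⟩ ⟨q, hq⟩ ⟨s, hs⟩
      by_cases h1 : p = q
      · exact Or.inl (Or.inl h1)
      by_cases h2 : q = s
      · exact Or.inl (Or.inr (Or.inl h2))
      by_cases h3 : p = s
      · exact Or.inl (Or.inr (Or.inr (Or.inl h3)))
      rcases gcyc_total he hp hq hs h1 h2 h3 with h | h
      · exact Or.inl (Or.inr (Or.inr (Or.inr h)))
      · exact Or.inr (Or.inr (Or.inr (Or.inr ((h.rotate he hp)))))

theorem circComp_lt {he : IsCircle e} :
    (circComp e he).lt p q s ↔ compOf hS p = e ∧ GCyc p q s := by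
  constructor
  · rintro ⟨hp, -, -, h1, h2, h3, h4⟩
    exact ⟨hp, ((h4.resolve_left h1).resolve_left h2).resolve_left h3⟩
  · rintro ⟨hp, h⟩
    refine ⟨hp, h.arcs.1.compOf_eq.symm.trans hp, h.arcs.2.2.compOf_eq.symm.trans hp, h.ne.1, h.ne.2.1,
      h.ne.2.2, Or.inr (Or.inr (Or.inr h))⟩

open Classical in
/-- The order of a component. -/
noncomputable def compOrd (e : Component hS) : LinOrCircOn S.Glued :=
  if he : IsCircle e then .circular (circComp e he) else .linear (linComp e he)

theorem compOrd_circ (he : IsCircle e) : compOrd e = .circular (circComp e he) := dif_pos he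

theorem compOrd_lin (he : ¬ IsCircle e) : compOrd e = .linear (linComp e he) := dif_neg he

end OrdSys

end DefOrd

/-! ### Charts and density of the glued orders -/

namespace DefOrd

open MulAction Set

namespace OrdSys

variable {G : Type*} {Ω : Type u} [Group G] [MulAction G Ω] [PartialOrder Ω]
  {S : OrdSys G Ω} {K : Subgroup G} {x y z w : Ω} {p q s t : S.Glued} {hS : S.Hausdorff}
  {e : Component hS}

theorem exists_rep_between (S : OrdSys G Ω) (h : x < y) :
    ∃ (p : S.Glued) (z : Ω), Rep p z ∧ x < z ∧ z < y := by
  obtain ⟨z, hz, h1⟩ := S.exists_pts_between h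
  obtain ⟨p, hp⟩ := exists_of_mem_pts hz
  exact ⟨p, z, hp, h1⟩

theorem GArc.exists_between (h : GArc p q) : ∃ s, GCyc p s q := by
  obtain ⟨x, y, h1, h2, h3⟩ := h
  obtain ⟨s, z, hz, h4, h5⟩ := S.exists_rep_between h3
  exact ⟨s, x, z, y, h1, hz, h2, h4, h5⟩

theorem exists_garc_right (p : S.Glued) : ∃ q, GArc p q := by
  obtain ⟨x, -, hx⟩ := exists_rep p
  obtain ⟨y, hy⟩ := S.exists_gt x
  obtain ⟨q, z, hz, h, -⟩ := S.exists_rep_between hy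
  exact ⟨q, x, z, hx, hz, h⟩

theorem exists_garc_left (p : S.Glued) : ∃ q, GArc q p := by
  obtain ⟨x, -, hx⟩ := exists_rep p
  obtain ⟨y, hy⟩ := S.exists_lt x
  obtain ⟨q, z, hz, -, h⟩ := S.exists_rep_between hy
  exact ⟨q, z, x, hz, hx, h⟩

theorem GCyc.compOf_eq (h : GCyc p q s) : compOf hS q = compOf hS p ∧ compOf hS s = compOf hS p :=
  ⟨h.arcs.1.compOf_eq.symm, h.arcs.2.2.compOf_eq.symm⟩

/-- The points between `p` and `s` are represented in any order of the system that contains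
`p < s`. -/
theorem GCyc.exists_rep (hS : S.Hausdorff) (h : GCyc p q s) (hp : Rep p x) (hs : Rep s z)
    (hlt : x < z) : ∃ y, Rep q y ∧ x < y ∧ y < z := by
  obtain ⟨y, -, hy⟩ := OrdSys.exists_rep q
  obtain ⟨y', h1, h2⟩ := hS.cyc_of_arc ((hp.cyc_iff hy hs).1 h) (Eqv.refl S x) (Eqv.refl S z) hlt
  exact ⟨y', hy.congr h1, h2⟩

/-- The three points have to be found in a single order of the system. Some order contains `p < s`;
if `q` came after `s`, then `q < s < q` would make the component a circle. -/
theorem gcyc_of_arcs (he : ¬ IsCircle e) (hp : compOf hS p = e) (h : GArc p q) (h' : GArc q s) :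
    GCyc p q s := by
  have h1 := garc_trans he hp h h'
  obtain ⟨x, -, hx⟩ := OrdSys.exists_rep p
  obtain ⟨y, -, hy⟩ := OrdSys.exists_rep q
  obtain ⟨z, -, hz⟩ := OrdSys.exists_rep s
  rcases hS.cyc_total ((hx.arc_iff hy).1 h) ((hx.arc_iff hz).1 h1)
    (fun h2 => h'.ne ((hy.eq_iff hz).2 h2)) with h2 | h2
  · exact (hx.cyc_iff hy hz).2 h2
  · exact absurd ⟨q, s, h.compOf_eq.symm.trans hp, h', ((hx.cyc_iff hz hy).2 h2).arcs.2.1⟩ he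

theorem linComp_chartable (he : ¬ IsCircle e) : Chartable (linComp e he) (Rep (S := S)) := by
  intro p hp q hq hpq
  obtain ⟨x, y, h1, h2, h3⟩ := linComp_lt.1 hpq
  refine ⟨x, y, h3, h1, h2, ?_, fun z _ z' _ w w' _ h4 _ h5 h6 => linComp_lt.2 ⟨w, w', h5, h6, h4⟩⟩
  rintro z - (rfl | h4) (rfl | h5)
  · exact absurd rfl hpq.2
  · exact ⟨x, le_rfl, h3.le, h1⟩
  · exact ⟨y, h3.le, le_rfl, h2⟩
  · obtain ⟨w, h6, h7, h8⟩ := (gcyc_of_arcs he hp h4 h5).exists_rep hS h1 h2 h3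
    exact ⟨w, h7.le, h8.le, h6⟩

theorem linComp_denseNoEnds (he : ¬ IsCircle e) : (linComp e he).DenseNoEnds := by
  refine ⟨exists_compOf e, fun p hp q _ h => ?_, fun p hp => ?_, fun p hp => ?_⟩
  · obtain ⟨s, hs⟩ := (linComp_lt.1 h).exists_between
    exact ⟨s, hs.compOf_eq.1.trans hp, linComp_lt.2 hs.arcs.1, linComp_lt.2 hs.arcs.2.1⟩
  · obtain ⟨q, hq⟩ := exists_garc_left p
    exact ⟨q, hq.compOf_eq.trans hp, linComp_lt.2 hq⟩
  · obtain ⟨q, hq⟩ := exists_garc_right p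
    exact ⟨q, hq.compOf_eq.symm.trans hp, linComp_lt.2 hq⟩

theorem smul_eq_of_comp (hp : compOf hS p = e) (hx : Rep p x) {g : G} (h : S.Comp x (g • x)) :
    g • e = e := by
  rw [← hp, ← compOf_smul]
  exact ((compOf_eq_iff hx (hx.smul g)).2 h).symm

/-- A non-empty invariant set of points of a component is dense. -/
theorem GArc.exists_mem {Z : Set S.Glued} (hinv : ∀ g : G, g • e = e → ∀ p ∈ Z, g • p ∈ Z)
    (hs : s ∈ Z) (hse : compOf hS s = e) (hp : compOf hS p = e) (h : GArc p q) :
    ∃ t ∈ Z, GCyc p t q := by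
  obtain ⟨x, y, hx, hy, hxy⟩ := h
  obtain ⟨z, -, hz⟩ := OrdSys.exists_rep s
  obtain ⟨w, ⟨t, ht, hw⟩, h1, h2⟩ := S.exists_mem_of_invariant (A := {w | ∃ t ∈ Z, Rep t w})
    (fun a ⟨t, ht, ha⟩ b hab => ⟨t, ht, ha.congr hab⟩)
    (fun g hg a ⟨t, ht, ha⟩ => ⟨g • t, hinv g (smul_eq_of_comp hp hx hg) t ht, ha.smul g⟩)
    hS ⟨s, hs, hz⟩ ((compOf_eq_iff hx hz).1 (hp.trans hse.symm)) hxy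
  exact ⟨t, ht, x, w, y, hx, hw, hy, h1, h2⟩

theorem linComp_denseSubset (he : ¬ IsCircle e) {Z : Set S.Glued}
    (hsub : Z ⊆ (linComp e he).carrier) (hinv : ∀ g : G, g • e = e → ∀ p ∈ Z, g • p ∈ Z)
    (hne : Z.Nonempty) : (linComp e he).DenseSubset Z := by
  obtain ⟨s, hs⟩ := hne
  intro p hp q _ h
  obtain ⟨t, ht, h1⟩ := (linComp_lt.1 h).exists_mem hinv hs (hsub hs) hp
  exact ⟨t, ht, linComp_lt.2 h1.arcs.1, linComp_lt.2 h1.arcs.2.1⟩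

section Circle

variable {he : IsCircle e}

theorem mem_interval : p ∈ ((circComp e he).interval s t).carrier ↔ compOf hS s = e ∧ GCyc s p t :=
  circComp_lt

theorem interval_le (hp : p ∈ ((circComp e he).interval s t).carrier)
    (hq : q ∈ ((circComp e he).interval s t).carrier) :
    ((circComp e he).interval s t).le p q ↔ p = q ∨ GCyc s p q := by
  rw [mem_interval] at hp hq
  constructor
  · rintro (h | h | h | h)
    · exact absurd h hp.2.ne.1
    · exact Or.inl h
    · exact absurd h hq.2.ne.1
    · exact Or.inr h
  · rintro (h | h)
    · exact Or.inr (Or.inl h)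
    · exact Or.inr (Or.inr (Or.inr h))

theorem interval_lt (hp : p ∈ ((circComp e he).interval s t).carrier)
    (hq : q ∈ ((circComp e he).interval s t).carrier) :
    ((circComp e he).interval s t).lt p q ↔ GCyc s p q :=
  ⟨fun h => ((interval_le hp hq).1 h.1).resolve_left h.2,
    fun h => ⟨(interval_le hp hq).2 (Or.inr h), h.ne.2.1⟩⟩

theorem interval_chartable : Chartable ((circComp e he).interval s t) (Rep (S := S)) := by
  intro p hp q hq hpq
  have h0 := (interval_lt hp hq).1 hpq
  obtain ⟨x₀, x, y, hx₀, hx, hy, h1, h2⟩ := h0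
  refine ⟨x, y, h2, hx, hy, ?_, fun z hz z' hz' w w' h3 h4 _ h5 h6 =>
    (interval_lt hz hz').2 ⟨x₀, w, w', hx₀, h5, h6, h1.trans_le h3, h4⟩⟩
  intro z hz h3 h4
  rcases (interval_le hp hz).1 h3 with rfl | h3
  · exact ⟨x, le_rfl, h2.le, hx⟩
  rcases (interval_le hz hq).1 h4 with rfl | h4
  · exact ⟨y, h2.le, le_rfl, hy⟩
  obtain ⟨w, hw, h5, h6⟩ := h4.exists_rep hS hx₀ hy (h1.trans h2)
  rcases (S.cmp_trans h5.cmp.symm h1.cmp).lt_or_le with h7 | h7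
  · exact absurd ⟨x₀, w, x, hx₀, hw, hx, h5, h7⟩ (h3.asymm hS)
  · exact ⟨w, h7, h6.le, hw⟩

theorem interval_denseNoEnds (hs : compOf hS s = e) (ht : compOf hS t = e) (hne : s ≠ t) :
    ((circComp e he).interval s t).DenseNoEnds := by
  have key : ∀ {a b}, GCyc s a t → GCyc s b t → GCyc s a b →
      ((circComp e he).interval s t).lt a b := fun ha hb h =>
    (interval_lt (mem_interval.2 ⟨hs, ha⟩) (mem_interval.2 ⟨hs, hb⟩)).2 h
  refine ⟨?_, fun p hp q hq h => ?_, fun p hp => ?_, fun p hp => ?_⟩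
  · obtain ⟨p, hp⟩ := (he.arc hs ht hne).exists_between
    exact ⟨p, mem_interval.2 ⟨hs, hp⟩⟩
  · obtain ⟨x, y, z, hx, hy, hz, h1, h2⟩ := (interval_lt hp hq).1 h
    obtain ⟨a, w, hw, h3, h4⟩ := S.exists_rep_between h2
    have h5 : GCyc s a q := ⟨x, w, z, hx, hw, hz, h1.trans h3, h4⟩
    have h6 := h5.trans hS (mem_interval.1 hq).2
    exact ⟨a, mem_interval.2 ⟨hs, h6⟩, key (mem_interval.1 hp).2 h6
      ⟨x, y, w, hx, hy, hw, h1, h3⟩, key h6 (mem_interval.1 hq).2 h5⟩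
  · obtain ⟨x, y, z, hx, hy, hz, h1, h2⟩ := (mem_interval.1 hp).2
    obtain ⟨a, w, hw, h3, h4⟩ := S.exists_rep_between h1
    have h6 : GCyc s a t := ⟨x, w, z, hx, hw, hz, h3, h4.trans h2⟩
    exact ⟨a, mem_interval.2 ⟨hs, h6⟩, key h6 (mem_interval.1 hp).2 ⟨x, w, y, hx, hw, hy, h3, h4⟩⟩
  · obtain ⟨x, y, z, hx, hy, hz, h1, h2⟩ := (mem_interval.1 hp).2
    obtain ⟨a, w, hw, h3, h4⟩ := S.exists_rep_between h2
    have h6 : GCyc s a t := ⟨x, w, z, hx, hw, hz, h1.trans h3, h4⟩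
    exact ⟨a, mem_interval.2 ⟨hs, h6⟩, key (mem_interval.1 hp).2 h6 ⟨x, y, w, hx, hy, hw, h1, h3⟩⟩

theorem circComp_arc_nonempty (hs : compOf hS s = e) (ht : compOf hS t = e) (hne : s ≠ t) :
    ((circComp e he).arc s t).Nonempty := (interval_denseNoEnds hs ht hne).1

end Circle

end OrdSys

end DefOrd

/-! ### Locations of cuts in a circle -/

namespace DefOrd

open MulAction Set

namespace OrdSys

variable {G : Type*} {Ω : Type u} [Group G] [MulAction G Ω] [PartialOrder Ω]
  {S : OrdSys G Ω} {K : Subgroup G} {x y z w v v' : Ω} {p q s t : S.Glued} {hS : S.Hausdorff}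
  {e : Component hS} {he : IsCircle e} {I J : Set S.Glued}

theorem arc_subset_iff (hp : compOf hS p = e) :
    (circComp e he).arc p q ⊆ I ↔ ∀ s, GCyc p s q → s ∈ I :=
  ⟨fun h _ hs => h (circComp_lt.2 ⟨hp, hs⟩), fun h _ hs => h _ (circComp_lt.1 hs).2⟩

theorem ltOn_iff (hp : compOf hS p = e) :
    (circComp e he).ltOn I p q ↔ p ≠ q ∧ ∀ s, GCyc p s q → s ∈ I := by
  rw [CircOrdOn.ltOn, arc_subset_iff hp]

theorem convex_cases (hI : (circComp e he).Convex I) (hp : p ∈ I) (hq : q ∈ I) (hne : p ≠ q) :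
    (∀ s, GCyc p s q → s ∈ I) ∨ ∀ s, GCyc q s p → s ∈ I := by
  rw [← arc_subset_iff (he := he) (hI.1 hp), ← arc_subset_iff (he := he) (hI.1 hq)]
  exact hI.2 p hp q hq hne

/-- The convex set `I` ends at `v`. -/
def Loc (I : Set S.Glued) (v : Ω) : Prop :=
  ∃ x y, x < v ∧ v < y ∧ (∀ p w, Rep p w → x < w → w < v → p ∈ I) ∧
    ∀ p w, Rep p w → v ≤ w → w < y → p ∉ I

theorem Loc.congr (h : Loc I v) (h' : S.Eqv v v') : Loc I v' := by
  obtain ⟨x, y, h1, h2, h3, h4⟩ := h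
  obtain ⟨a, b, a', b', g1, g2, g3, g4, g5⟩ := h'.exists_match
  obtain ⟨v'', m1, m2⟩ := g5.split g1.le g2.le
  obtain rfl : v'' = v' := m1.right.unique h' (S.cmp_trans m1.le'.cmp.symm g3.cmp)
  obtain ⟨c, c1, c2, c3⟩ := S.dense_two' h1 g1
  obtain ⟨d, d1, d2, d3⟩ := S.dense_two h2 g2
  obtain ⟨c', -, n1⟩ := m1.split c3.le c1.le
  obtain ⟨d', n2, -⟩ := m2.split d1.le d3.le
  refine ⟨c', d', n1.map_lt c1, n2.map_lt d1, fun p w hw h5 h6 => ?_, fun p w hw h5 h6 => ?_⟩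
  · obtain ⟨z, k1, k2⟩ := n1.symm.split h5.le h6.le
    exact h3 p z (hw.congr k1.right) (c2.trans (k1.map_lt h5)) (k2.map_lt h6)
  · obtain ⟨z, k1, k2⟩ := n2.symm.split h5 h6.le
    exact h4 p z (hw.congr k1.right) k1.le' ((k2.map_lt h6).trans d2)

theorem Loc.smul (g : G) (h : Loc I v) : Loc ((fun p => g • p) '' I) (g • v) := by
  obtain ⟨x, y, h1, h2, h3, h4⟩ := h
  refine ⟨g • x, g • y, S.smul_lt g h1, S.smul_lt g h2, fun p w hw h5 h6 => ?_,
    fun p w hw h5 h6 => ?_⟩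
  · refine ⟨g⁻¹ • p, h3 _ (g⁻¹ • w) (hw.smul _) ?_ ?_, by simp⟩
    · rwa [← S.smul_lt_iff g, smul_inv_smul]
    · rwa [← S.smul_lt_iff g, smul_inv_smul]
  · rintro ⟨q, hq, rfl⟩
    have := hw.smul g⁻¹
    rw [inv_smul_smul] at this
    refine h4 _ (g⁻¹ • w) this ?_ ?_ hq
    · rwa [← S.smul_le_iff g, smul_inv_smul]
    · rwa [← S.smul_lt_iff g, smul_inv_smul]

theorem Loc.exists_rep (h : Loc I v) : ∃ p ∈ I, ∃ w, Rep p w ∧ w < v := by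
  obtain ⟨x, y, h1, h2, h3, h4⟩ := h
  obtain ⟨p, w, hw, h5, h6⟩ := S.exists_rep_between h1
  exact ⟨p, h3 p w hw h5 h6, w, hw, h6⟩

theorem Loc.comp (hI : I ⊆ (circComp e he).carrier) (h : Loc I v) (hp : compOf hS p = e)
    (hx : Rep p x) : S.Comp v x := by
  obtain ⟨q, hq, w, hw, h1⟩ := h.exists_rep
  exact hS.comp_trans (Comp.of_cmp S h1.cmp.symm)
    ((compOf_eq_iff (hS := hS) hw hx).1 ((hI hq).trans hp.symm))

theorem Loc.comp' (hI : I ⊆ (circComp e he).carrier) (hJ : J ⊆ (circComp e he).carrier)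
    (h : Loc I v) (h' : Loc J v') : S.Comp v v' := by
  obtain ⟨q, hq, w, hw, h1⟩ := h'.exists_rep
  exact hS.comp_trans (h.comp hI (hJ hq) hw) (Comp.of_cmp S h1.cmp)

theorem IsCircle.arc' (he : IsCircle e) (hp : compOf hS p = e) (hx : Rep p x) (hv : S.Comp v x)
    (hc : S.Comp v v') (hne : ¬ S.Eqv v v') : S.Arc v v' := by
  obtain ⟨a, b, rfl, h1, h2⟩ := he
  obtain ⟨y, -, hy⟩ := OrdSys.exists_rep a
  obtain ⟨z, -, hz⟩ := OrdSys.exists_rep b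
  have h3 : S.Comp y v := hS.comp_trans ((compOf_eq_iff hy hx).1 hp.symm) hv.symm
  exact hS.arc_of_circular ((hy.arc_iff hz).1 h1) ((hz.arc_iff hy).1 h2) h3
    (hS.comp_trans h3 hc) hne

theorem Loc.arc (hI : I ⊆ (circComp e he).carrier) (hJ : J ⊆ (circComp e he).carrier)
    (h : Loc I v) (h' : Loc J v') (hne : ¬ S.Eqv v v') : S.Arc v v' := by
  obtain ⟨q, hq, w, hw, h1⟩ := h.exists_rep
  exact he.arc' (hI hq) hw (Comp.of_cmp S h1.cmp.symm) (h.comp' hI hJ h') hne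

/-- In a circle, two inequivalent locations occur one after the other in some order. Points just
before each of them are in `I` and points just after are not, so each of the two arcs between the
former points leaves `I`, against convexity. -/
theorem Loc.unique (hI : (circComp e he).Convex I) (h : Loc I v) (h' : Loc I v') : S.Eqv v v' := by
  by_contra hne
  obtain ⟨a, b, g1, g2, hab⟩ := h.arc hI.1 hI.1 h' hne
  obtain ⟨x, y, h1, h2, h3, h4⟩ := h.congr g1
  obtain ⟨x', y', h1', h2', h3', h4'⟩ := h'.congr g2
  obtain ⟨y₁, k1, k2, k3⟩ := S.dense_two h2 hab
  obtain ⟨r, wr, hr, r1, r2⟩ := S.exists_rep_between k1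
  obtain ⟨c, c1, c2, c3⟩ := S.dense_two' (r2.trans k3) h1'
  obtain ⟨p, wp, hp, p1, p2⟩ := S.exists_rep_between h1
  obtain ⟨p', wp', hp', p1', p2'⟩ := S.exists_rep_between c1
  obtain ⟨r', wr', hr', r1', r2'⟩ := S.exists_rep_between h2'
  have i1 := h3 p wp hp p1 p2
  have i2 := h3' p' wp' hp' (c3.trans p1') p2'
  have i3 := h4 r wr hr r1.le (r2.trans k2)
  have i4 := h4' r' wr' hr' r1'.le r2'
  have c1 : GCyc p r p' := ⟨wp, wr, wp', hp, hr, hp', p2.trans r1, c2.trans p1'⟩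
  have c2 : GCyc p p' r' := ⟨wp, wp', wr', hp, hp', hr', (p2.trans r1).trans (c2.trans p1'),
    p2'.trans r1'⟩
  rcases convex_cases hI i1 i2 c1.ne.2.2 with h | h
  · exact i3 (h r c1)
  · exact i4 (h r' (c2.rotate he (hI.1 i1)))

theorem gcyc_of_not (he : IsCircle e) (hp : compOf hS p = e) (hq : compOf hS q = e)
    (hs : compOf hS s = e) (h1 : p ≠ q) (h2 : q ≠ s) (h3 : p ≠ s) (hn : ¬ GCyc p s q) :
    GCyc p q s := (gcyc_total he hp hq hs h1 h2 h3).resolve_right hn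

/-- Every definable cut has a location. -/
theorem exists_loc (hI : (circComp e he).IsCutRep I) (hK : S.Op K)
    (hinv : ∀ k ∈ K, ∀ p ∈ I, k • p ∈ I) : ∃ v, Loc I v := by
  obtain ⟨hc, ⟨p, hp⟩, hinf, hlast⟩ := hI
  have hpe := hc.1 hp
  -- Two points outside `I` are used in order to get a strict inequality: the part of `[x, z]`
  -- contained in `I` is bounded by the representative of `c`, so its supremum is below `z`.
  obtain ⟨c, hcI, b, hbI, hcyc⟩ : ∃ c ∉ I, ∃ b ∉ I, GCyc p c b := by
    obtain ⟨b₁, hb₁, b₂, hb₂, hne⟩ := hinf.nontrivial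
    have n1 : p ≠ b₁ := fun h => hb₁.2 (h ▸ hp)
    have n2 : p ≠ b₂ := fun h => hb₂.2 (h ▸ hp)
    rcases gcyc_total he hpe hb₁.1 hb₂.1 n1 hne n2 with h | h
    · exact ⟨b₁, hb₁.2, b₂, hb₂.2, h⟩
    · exact ⟨b₂, hb₂.2, b₁, hb₁.2, h⟩
  obtain ⟨x, zc, z, hx, hzc, hz, hxc, hcz⟩ := hcyc
  let A : Set Ω := {w | x ≤ w ∧ w ≤ z ∧ ∀ (q : S.Glued) y, Rep q y → x ≤ y → y ≤ w → q ∈ I}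
  have hxA : x ∈ A := by
    refine ⟨le_rfl, (hxc.trans hcz).le, fun q y hy h1 h2 => ?_⟩
    rwa [hy.unique (le_antisymm h1 h2 ▸ hx)]
  have lt_c : ∀ w ∈ A, w < zc := fun w hw => by
    rcases (S.cmp_trans hw.1.cmp.symm hxc.cmp).lt_or_le with h | h
    · exact h
    · exact absurd (hw.2.2 c zc hzc hxc.le h) hcI
  obtain ⟨v, hv⟩ := S.exists_lub ⟨x, hxA⟩ ⟨z, fun w hw => hw.2.1⟩
    ⟨K ⊓ (stabilizer G x ⊓ stabilizer G z), S.op_inf hK (S.op_top_stab₂ x z), by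
      rintro k ⟨hk, hkx, hkz⟩ w ⟨h1, h2, h3⟩
      have hkx : k • x = x := hkx
      have hkz : k • z = z := hkz
      refine ⟨?_, ?_, fun q y hy h4 h5 => ?_⟩
      · rw [← hkx]; exact (S.smul_le_iff k).2 h1
      · rw [← hkz]; exact (S.smul_le_iff k).2 h2
      · have := hinv k hk _ (h3 _ _ (hy.smul k⁻¹) ?_ ?_)
        · rwa [smul_inv_smul] at this
        · rwa [← S.smul_le_iff k, smul_inv_smul, hkx]
        · rwa [← S.smul_le_iff k, smul_inv_smul]⟩
  -- This is where the absence of a last element is used: `A` contains no representative of a point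
  -- as its greatest element.
  have ext : ∀ (w : Ω) (q : S.Glued), w ∈ A → Rep q w → ∃ w' ∈ A, w < w' := by
    intro w q hwA hw
    have hq := hwA.2.2 q w hw hwA.1 le_rfl
    obtain ⟨y, hy, hlt⟩ := hlast q hq
    rw [ltOn_iff (hc.1 hq)] at hlt
    have hwz := (lt_c w hwA).trans hcz
    have h1 : GCyc q y b := by
      refine gcyc_of_not he (hc.1 hq) (hc.1 hy) ?_ hlt.1 (fun h => hbI (h ▸ hy))
        (fun h => hbI (h ▸ hq)) fun h => hbI (hlt.2 b h)
      exact GArc.compOf_eq (hS := hS) ⟨x, z, hx, hz, hxc.trans hcz⟩ ▸ hpe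
    obtain ⟨w', hw', h2, h3⟩ := h1.exists_rep hS hw hz hwz
    refine ⟨w', ⟨hwA.1.trans h2.le, h3.le, fun r u hu h4 h5 => ?_⟩, h2⟩
    rcases (S.cmp_trans h4.cmp.symm hwA.1.cmp).lt_or_le with h6 | h6
    · exact hwA.2.2 r u hu h4 h6.le
    rcases h6.lt_or_eq with h6 | rfl
    · rcases h5.lt_or_eq with h5 | rfl
      · exact hlt.2 r ⟨w, u, w', hw, hu, hw', h6, h5⟩
      · rwa [hu.unique hw']
    · rwa [hu.unique hw]
  obtain ⟨x', hx', hxx'⟩ := ext x p hxA hx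
  have hxv := hxx'.trans_le (hv.1 hx')
  have hvz : v < z := (hv.2 fun w hw => (lt_c w hw).le).trans_lt hcz
  refine ⟨v, x, z, hxv, hvz, fun q w hw h1 h2 => ?_, fun q w hw h1 h2 hq => ?_⟩
  · obtain ⟨a, ha, hwa⟩ : ∃ a ∈ A, w ≤ a := by
      by_contra hn
      push Not at hn
      refine absurd h2 (hv.2 fun a ha => ?_).not_gt
      rcases (S.cmp_trans ha.1.cmp.symm h1.cmp) with h | h
      · exact h
      · exact absurd h (hn a ha)
    exact ha.2.2 q w hw h1.le hwa
  · have hxw := hxv.trans_le h1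
    have hcyc : GCyc p q b := ⟨x, w, z, hx, hw, hz, hxw, h2⟩
    -- For a point `q` of `I` at or after `v`, one of the arcs between `p` and `q` is in `I`. The
    -- first would put `w` in `A`, the second contains `b`.
    rcases convex_cases hc hp hq hcyc.ne.1 with h | h
    · have hwA : w ∈ A := by
        refine ⟨hxw.le, h2.le, fun r u hu h4 h5 => ?_⟩
        rcases h4.lt_or_eq with h4 | rfl
        · rcases h5.lt_or_eq with h5 | rfl
          · exact h r ⟨x, u, w, hx, hu, hw, h4, h5⟩
          · rwa [hu.unique hw]
        · rwa [hu.unique hx]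
      obtain ⟨w', hw', h6⟩ := ext w q hwA hw
      exact ((hv.1 hw').trans h1).not_gt h6
    · exact hbI (h b (hcyc.rotate he hpe))

/-- Points close to the location of `I` are after a given point of `I`. -/
theorem Loc.ltOn (hI : (circComp e he).Convex I) (h : Loc I v) (hp : p ∈ I) :
    ∃ x, x < v ∧ ∀ q w, Rep q w → x < w → w < v → q ∈ I ∧ (circComp e he).ltOn I p q := by
  obtain ⟨x, y, h1, h2, h3, h4⟩ := h
  by_cases hpx : ∃ w, Rep p w ∧ x < w ∧ w < v
  · obtain ⟨wp, hwp, h5, h6⟩ := hpx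
    refine ⟨wp, h6, fun q w hw h7 h8 => ⟨h3 q w hw (h5.trans h7) h8, ?_⟩⟩
    rw [ltOn_iff (hI.1 hp)]
    refine ⟨GArc.ne ⟨_, _, hwp, hw, h7⟩, fun r hr => ?_⟩
    obtain ⟨z, hz, h9, h10⟩ := hr.exists_rep hS hwp hw h7
    exact h3 r z hz (h5.trans h9) (h10.trans h8)
  · refine ⟨x, h1, fun q w hw h7 h8 => ⟨h3 q w hw h7 h8, ?_⟩⟩
    have hne : q ≠ p := fun h => hpx ⟨w, h ▸ hw, h7, h8⟩
    have hq := h3 q w hw h7 h8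
    rw [ltOn_iff (hI.1 hp)]
    refine ⟨hne.symm, (convex_cases hI hq hp hne).resolve_left fun h => hpx ?_⟩
    obtain ⟨r, wr, hr, h9, h10⟩ := S.exists_rep_between h2
    have hrI := h4 r wr hr h9.le h10
    have hqr : GArc q r := ⟨w, wr, hw, hr, h8.trans h9⟩
    have hc := gcyc_of_not he (hI.1 hq) (hI.1 hp) (hqr.compOf_eq.symm.trans (hI.1 hq)) hne
      (fun h => hrI (h ▸ hp)) hqr.ne fun hc => hrI (h r hc)
    obtain ⟨z, hz, h11, h12⟩ := hc.exists_rep hS hw hr (h8.trans h9)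
    refine ⟨z, hz, h7.trans h11, ?_⟩
    rcases (S.cmp_trans h12.cmp h9.cmp.symm).lt_or_le with h13 | h13
    · exact h13
    · exact absurd hp (h4 p z hz h13 (h12.trans h10))

/-- Sets that represent the same cut have the same location. -/
theorem Loc.sameCut (hI : (circComp e he).IsCutRep I) (hJ : (circComp e he).IsCutRep J)
    (hIJ : (circComp e he).SameCut I J) (h : Loc I v) : Loc J v := by
  rcases hIJ with ⟨hsub, hend⟩ | ⟨hsub, hend⟩
  · obtain ⟨x, y, h1, h2, h3, h4⟩ := h
    obtain ⟨p, wp, hp, p1, p2⟩ := S.exists_rep_between h1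
    have hpI := h3 p wp hp p1 p2
    have hpe := hI.1.1 hpI
    have hq : ∀ q w, Rep q w → v ≤ w → w < y → q ∈ J → ∀ s, GCyc q s p → s ∈ J := by
      intro q w hw h5 h6 hqJ
      have hqI := h4 q w hw h5 h6
      have hne : p ≠ q := fun h => hqI (h ▸ hpI)
      refine (convex_cases hJ.1 (hsub hpI) hqJ hne).resolve_left fun h => hqI (hend p hpI q hqJ ?_)
      exact (ltOn_iff hpe).2 ⟨hne, h⟩
    -- `I` is an end segment of `J`, so a point of `J` just after `v` must come before `I` in the
    -- order of `J`. In that case the complement of `J` lies between `v` and this point, and one of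
    -- its points stops `J` after `v`; the complement having two points, it can be taken different
    -- from `v`.
    by_cases hJy : ∃ q w, Rep q w ∧ v ≤ w ∧ w < y ∧ q ∈ J
    · obtain ⟨q, w, hw, h5, h6, hqJ⟩ := hJy
      have hb : ∀ b ∈ (circComp e he).carrier \ J, ∃ z, Rep b z ∧ v ≤ z ∧ z < w := by
        intro b hb
        have hc := gcyc_of_not he hpe hb.1 (hJ.1.1 hqJ) (fun h => hb.2 (h ▸ hsub hpI))
          (fun h => hb.2 (h ▸ hqJ)) (fun h => h4 q w hw h5 h6 (h ▸ hpI))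
          fun hc => hb.2 (hq q w hw h5 h6 hqJ b (hc.rotate he hpe))
        obtain ⟨z, hz, h7, h8⟩ := hc.exists_rep hS hp hw (p2.trans_le h5)
        refine ⟨z, hz, ?_, h8⟩
        rcases (S.cmp_trans h7.cmp.symm p2.cmp).lt_or_le with h9 | h9
        · exact absurd (hsub (h3 b z hz (p1.trans h7) h9)) hb.2
        · exact h9
      obtain ⟨b, hbJ, z, hz, h7, h8⟩ : ∃ b ∉ J, ∃ z, Rep b z ∧ v < z ∧ z < w := by
        obtain ⟨b₁, hb₁, b₂, hb₂, hne⟩ := hJ.2.2.1.nontrivial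
        obtain ⟨z₁, hz₁, h7, h8⟩ := hb b₁ hb₁
        obtain ⟨z₂, hz₂, h9, h10⟩ := hb b₂ hb₂
        rcases h7.lt_or_eq with h7 | rfl
        · exact ⟨b₁, hb₁.2, z₁, hz₁, h7, h8⟩
        · exact ⟨b₂, hb₂.2, z₂, hz₂, h9.lt_of_ne fun h => hne (hz₁.unique (h ▸ hz₂)), h10⟩
      refine ⟨x, z, h1, h7, fun q w hw h9 h10 => hsub (h3 q w hw h9 h10),
        fun q' w' hw' h9 h10 hq' => ?_⟩
      have hc : GCyc p q' b := ⟨wp, w', z, hp, hw', hz, p2.trans_le h9, h10⟩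
      exact hbJ (hq q' w' hw' h9 (h10.trans (h8.trans h6)) hq' b (hc.rotate he hpe))
    · push Not at hJy
      exact ⟨x, y, h1, h2, fun q w hw h5 h6 => hsub (h3 q w hw h5 h6), hJy⟩
  · obtain ⟨j, hj⟩ := hJ.2.1
    obtain ⟨x, h5, h6⟩ := h.ltOn hI.1 (hsub hj)
    obtain ⟨-, y, -, h2, -, h4⟩ := h
    exact ⟨x, y, h5, h2, fun q w hw h7 h8 => hend j hj q (h6 q w hw h7 h8).1 (h6 q w hw h7 h8).2,
      fun q w hw h7 h8 hq => h4 q w hw h7 h8 (hsub hq)⟩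

theorem Loc.cutAt (hI : (circComp e he).IsCutRep I) (h : Loc I x) (hp : Rep p x) :
    (circComp e he).CutAt p I := by
  obtain ⟨a, y, h1, h2, h3, h4⟩ := h
  obtain ⟨b, z, hz, h5, h6⟩ := S.exists_rep_between h1
  have hbI := h3 b z hz h5 h6
  have hbe := hI.1.1 hbI
  have hpI := h4 p x hp le_rfl h2
  have hbp : GArc b p := ⟨z, x, hz, hp, h6⟩
  refine ⟨b, hbe, hbp.ne, Or.inr ⟨fun q hq => ?_, fun q hq r hr hlt => ?_⟩⟩
  · obtain ⟨w, hw, h7, h8⟩ := (circComp_lt.1 hq).2.exists_rep hS hz hp h6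
    exact h3 q w hw (h5.trans h7) h8
  · have hq := (circComp_lt.1 hq).2
    rw [ltOn_iff (hq.compOf_eq.1.trans hbe)] at hlt
    have hpe := hbp.compOf_eq.symm.trans hbe
    refine circComp_lt.2 ⟨hbe, gcyc_of_not he hbe (hI.1.1 hr) hpe ?_ (fun h => hpI (h ▸ hr))
      hbp.ne fun h => ?_⟩
    · rintro rfl
      exact hpI (hlt.2 p (hq.rotate he hbe))
    · obtain ⟨b', p', r', hb', hp', hr', h7, h8⟩ := h
      obtain ⟨q', hq', h9, h10⟩ := hq.exists_rep hS hb' hp' h7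
      exact hpI (hlt.2 p ⟨q', p', r', hq', hp', hr', h10, h8⟩)

/-- A circular component has no algebraic cut. -/
theorem no_algebraic_cut {C T : Set (Set S.Glued)} (hC : ∀ I ∈ C, (circComp e he).IsCutRep I)
    (hop : ∀ I ∈ C, ∃ K, S.Op K ∧ ∀ k ∈ K, ∀ p ∈ I, k • p ∈ I) (hne : C.Nonempty)
    (hinv : ∀ g : G, g • e = e → ∀ I ∈ C, (fun p => g • p) '' I ∈ C) (hT : T.Finite) (hTC : T ⊆ C)
    (h : ∀ I ∈ C, ∃ J ∈ T, (circComp e he).SameCut I J) : False := by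
  obtain ⟨I, hI⟩ := hne
  obtain ⟨K, hK, hK'⟩ := hop I hI
  obtain ⟨v, hv⟩ := exists_loc (hC I hI) hK hK'
  obtain ⟨g, h1, h2⟩ := S.nofix v
  -- Translates of `v` in its order are locations of translates of `I`, which represent finitely
  -- many cuts. So the orbit of `v` is finite, hence trivial, against `nofix`.
  refine h2 (S.smul_eq_of_finite_orbit (K := S.fib v) le_rfl ?_ h1)
  have hfin : ∀ J ∈ T, {y | Cmp v y ∧ Loc J y}.Finite := fun J hJ =>
    Set.Subsingleton.finite fun y hy z hz =>
      (hy.2.unique (hC J (hTC hJ)).1 hz.2).eq_of_cmp (S.cmp_trans hy.1.symm hz.1)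
  refine (hT.biUnion hfin).subset ?_
  rintro _ ⟨k, hk, rfl⟩
  have hke : k • e = e := by
    obtain ⟨p, hp, w, hw, hwv⟩ := hv.exists_rep
    refine smul_eq_of_comp ((hC I hI).1.1 hp) hw (Comp.of_cmp S ?_)
    rwa [← S.mem_fib, S.fib_congr hwv.cmp]
  have hkI := hinv k hke I hI
  obtain ⟨J, hJ, hIJ⟩ := h _ hkI
  exact mem_biUnion hJ ⟨hk, (hv.smul k).sameCut (hC _ hkI) (hC J (hTC hJ)) hIJ⟩

/-- The circular order of cuts is the circular order of their locations. -/
theorem Loc.cyc {I₁ I₂ I₃ : Set S.Glued} {v₁ v₂ v₃ : Ω} (hI₁ : (circComp e he).Convex I₁)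
    (hI₂ : (circComp e he).Convex I₂) (hI₃ : (circComp e he).Convex I₃) (h₁ : Loc I₁ v₁)
    (h₂ : Loc I₂ v₂) (h₃ : Loc I₃ v₃) (h : (circComp e he).CutLt I₁ I₂ I₃) : S.Cyc v₁ v₂ v₃ := by
  obtain ⟨a₁, ha₁, a₂, ha₂, a₃, ha₃, hlt⟩ := h
  have ev : ∀ {u₁ u₂ u₃}, S.Eqv v₁ u₁ → S.Eqv v₂ u₂ → S.Eqv v₃ u₃ → ∃ x₁ x₂ x₃, x₁ < u₁ ∧ x₂ < u₂ ∧
      x₃ < u₃ ∧ ∀ (p₁ p₂ p₃ : S.Glued) w₁ w₂ w₃, Rep p₁ w₁ → Rep p₂ w₂ → Rep p₃ w₃ → x₁ < w₁ →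
        w₁ < u₁ → x₂ < w₂ → w₂ < u₂ → x₃ < w₃ → w₃ < u₃ → compOf hS p₁ = e ∧ GCyc p₁ p₂ p₃ := by
    intro u₁ u₂ u₃ e₁ e₂ e₃
    obtain ⟨x₁, k1, k1'⟩ := (h₁.congr e₁).ltOn hI₁ ha₁
    obtain ⟨x₂, k2, k2'⟩ := (h₂.congr e₂).ltOn hI₂ ha₂
    obtain ⟨x₃, k3, k3'⟩ := (h₃.congr e₃).ltOn hI₃ ha₃
    refine ⟨x₁, x₂, x₃, k1, k2, k3, fun p₁ p₂ p₃ w₁ w₂ w₃ r1 r2 r3 g1 g1' g2 g2' g3 g3' => ?_⟩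
    have l1 := k1' p₁ w₁ r1 g1 g1'
    have l2 := k2' p₂ w₂ r2 g2 g2'
    have l3 := k3' p₃ w₃ r3 g3 g3'
    exact circComp_lt.1 (hlt p₁ l1.1 p₂ l2.1 p₃ l3.1 l1.2 l2.2 l3.2)
  have two : ∀ {a b c : Ω}, a < c → b < c → ∃ (p q : S.Glued) (w w' : Ω), Rep p w ∧ Rep q w' ∧
      a < w ∧ w < c ∧ b < w ∧ a < w' ∧ w' < c ∧ b < w' := by
    intro a b c ha hb
    obtain ⟨d, hd, h1, h2⟩ := S.dense_two' ha hb
    obtain ⟨p, w, hw, h3, h4⟩ := S.exists_rep_between hd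
    obtain ⟨q, w', hw', h5, h6⟩ := S.exists_rep_between hd
    exact ⟨p, q, w, w', hw, hw', h1.trans h3, h4, h2.trans h3, h1.trans h5, h6, h2.trans h5⟩
  -- Near a common location, two points could exchange their roles, against the asymmetry of the
  -- circular order.
  have n12 : ¬ S.Eqv v₁ v₂ := by
    intro he12
    obtain ⟨x₁, x₂, x₃, k1, k2, k3, k⟩ := ev (Eqv.refl S v₁) he12.symm (Eqv.refl S v₃)
    obtain ⟨p, q, w, w', hw, hw', g1, g2, g3, g4, g5, g6⟩ := two k1 k2
    obtain ⟨s, ws, hs, g7, g8⟩ := S.exists_rep_between k3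
    have c1 := k p q s w w' ws hw hw' hs g1 g2 g6 g5 g7 g8
    have c2 := k q p s w' w ws hw' hw hs g4 g5 g3 g2 g7 g8
    exact c1.2.asymm hS (c2.2.rotate he c2.1)
  have n23 : ¬ S.Eqv v₂ v₃ := by
    intro he23
    obtain ⟨x₁, x₂, x₃, k1, k2, k3, k⟩ := ev (Eqv.refl S v₁) (Eqv.refl S v₂) he23.symm
    obtain ⟨p, q, w, w', hw, hw', g1, g2, g3, g4, g5, g6⟩ := two k2 k3
    obtain ⟨s, ws, hs, g7, g8⟩ := S.exists_rep_between k1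
    have c1 := k s p q ws w w' hs hw hw' g7 g8 g1 g2 g6 g5
    have c2 := k s q p ws w' w hs hw' hw g7 g8 g4 g5 g3 g2
    exact c1.2.asymm hS c2.2
  have n13 : ¬ S.Eqv v₁ v₃ := by
    intro he13
    obtain ⟨x₁, x₂, x₃, k1, k2, k3, k⟩ := ev (Eqv.refl S v₁) (Eqv.refl S v₂) he13.symm
    obtain ⟨p, q, w, w', hw, hw', g1, g2, g3, g4, g5, g6⟩ := two k1 k3
    obtain ⟨s, ws, hs, g7, g8⟩ := S.exists_rep_between k2
    have c1 := k p s q w ws w' hw hs hw' g1 g2 g7 g8 g6 g5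
    have c2 := k q s p w' ws w hw' hs hw g4 g5 g7 g8 g3 g2
    exact (c1.2.rotate he c1.1).asymm hS (c2.2.rotate he c2.1)
  refine (hS.cyc_total (h₁.arc hI₁.1 hI₂.1 h₂ n12) (h₁.arc hI₁.1 hI₃.1 h₃ n13) n23).resolve_right ?_
  rintro ⟨u₁, u₃, u₂, e1, e3, e2, l1, l2⟩
  obtain ⟨x₁, x₂, x₃, k1, k2, k3, k⟩ := ev e1 e2 e3
  obtain ⟨p, wp, hp, g1, g2⟩ := S.exists_rep_between k1
  obtain ⟨d, d1, d2, d3⟩ := S.dense_two' k3 l1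
  obtain ⟨s, ws, hs, g3, g4⟩ := S.exists_rep_between d1
  obtain ⟨d', d1', d2', d3'⟩ := S.dense_two' k2 l2
  obtain ⟨q, wq, hq, g5, g6⟩ := S.exists_rep_between d1'
  have c := k p q s wp wq ws hp hq hs g1 g2 (d2'.trans g5) g6 (d2.trans g3) g4
  exact c.2.asymm hS ⟨wp, ws, wq, hp, hs, hq, g2.trans (d3.trans g3), g4.trans (d3'.trans g5)⟩

end OrdSys

end DefOrd

namespace DefOrd

open MulAction Set

namespace OrdSys

variable {G : Type*} {Ω : Type u} [Group G] [MulAction G Ω] [PartialOrder Ω]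
  {S : OrdSys G Ω} {K : Subgroup G} {p : S.Glued} {hS : S.Hausdorff} {e : Component hS}
  {he : IsCircle e}

/-- A circular component has no non-trivial definable order-preserving map to its completion. -/
theorem no_self_intertwining (hK : S.Op K) {R : S.Glued → Set S.Glued}
    (hR : ∀ p, compOf hS p = e → (circComp e he).IsCutRep (R p))
    (hRK : ∀ k ∈ K, ∀ p, R (k • p) = (fun q => k • q) '' R p)
    (hlt : ∀ p q s, (circComp e he).lt p q s → (circComp e he).CutLt (R p) (R q) (R s))
    (hp : compOf hS p = e) : (circComp e he).CutAt p (R p) := by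
  have hloc : ∀ p, compOf hS p = e → ∃ v, Loc (R p) v := by
    intro p hp
    obtain ⟨x, -, hx⟩ := OrdSys.exists_rep p
    refine exists_loc (hR p hp) (S.op_inf hK (S.op_stab x)) ?_
    rintro k ⟨hk, hkx⟩ q hq
    have hkx : k • x = x := hkx
    have h1 : k • p = p := by
      have := hx.smul k
      rw [hkx] at this
      exact this.unique hx
    rw [← h1, hRK k hk]
    exact ⟨q, hq, rfl⟩
  have hcyc : ∀ p q s, compOf hS p = e → GCyc p q s → ∀ {a b c}, Loc (R p) a → Loc (R q) b →
      Loc (R s) c → S.Cyc a b c := fun p q s hp h a b c ha hb hc =>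
    ha.cyc (hR p hp).1 (hR q (h.compOf_eq.1.trans hp)).1 (hR s (h.compOf_eq.2.trans hp)).1 hb hc
      (hlt p q s (circComp_lt.2 ⟨hp, h⟩))
  obtain ⟨x, -, hx⟩ := OrdSys.exists_rep p
  obtain ⟨u, hu⟩ := S.exists_lt x
  obtain ⟨t, ht⟩ := S.exists_gt x
  obtain ⟨pl, a, hal, -, hax⟩ := S.exists_rep_between hu
  obtain ⟨pr, b, hbr, hxb, -⟩ := S.exists_rep_between ht
  have hple : compOf hS pl = e := (GArc.compOf_eq (hS := hS) ⟨a, x, hal, hx, hax⟩).trans hp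
  have hpre : compOf hS pr = e := (GArc.compOf_eq (hS := hS) ⟨x, b, hx, hbr, hxb⟩).symm.trans hp
  obtain ⟨vl, hvl⟩ := hloc pl hple
  obtain ⟨vr, hvr⟩ := hloc pr hpre
  obtain ⟨vp, hvp⟩ := hloc p hp
  obtain ⟨lo, hi, hlo, hhi, hlh⟩ :=
    (hcyc pl p pr hple ⟨a, x, b, hal, hx, hbr, hax, hxb⟩ hvl hvp hvr).arcs.2.2
  have hlol := hvl.congr hlo
  have hhir := hvr.congr hhi
  let A : Set Ω := {w | a < w ∧ w < b ∧ ∃ p : S.Glued, Rep p w}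
  have hAe : ∀ {w p}, a < w → Rep p w → compOf hS p = e := fun h hw =>
    (GArc.compOf_eq (hS := hS) ⟨a, _, hal, hw, h⟩).symm.trans hple
  -- The neighbours `pl` and `pr` of `p` fix a chart from `lo` to `hi` for the values: `q w` is the
  -- location, in this chart, of the image of the point that `w` represents.
  have hq : ∀ w, w ∈ A → ∃ y, lo < y ∧ y < hi ∧ ∀ p, Rep p w → Loc (R p) y := by
    rintro w ⟨h1, h2, p, hw⟩
    obtain ⟨y, hy⟩ := hloc p (hAe h1 hw)
    obtain ⟨y', h3, h4, h5⟩ := hS.cyc_of_arc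
      (hcyc pl p pr hple ⟨a, w, b, hal, hw, hbr, h1, h2⟩ hlol hy hhir) (Eqv.refl S lo)
      (Eqv.refl S hi) hlh
    exact ⟨y', h4, h5, fun p' hp' => hw.unique hp' ▸ hy.congr h3⟩
  have : Nonempty Ω := ⟨x⟩
  choose! q hq1 hq2 hq3 using hq
  have mono : ∀ w ∈ A, ∀ w' ∈ A, w < w' → q w < q w' := by
    intro w hw w' hw' hww'
    obtain ⟨h1, h2, p, hp⟩ := id hw
    obtain ⟨h1', h2', p', hp'⟩ := id hw'
    have h3 := hcyc pl p p' hple ⟨a, w, w', hal, hp, hp', h1, hww'⟩ hlol (hq3 w hw p hp)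
      (hq3 w' hw' p' hp')
    rcases (S.cmp_trans (hq1 w hw).cmp.symm (hq1 w' hw').cmp).lt_or_eq_or_gt with h | h | h
    · exact h
    · exact absurd (h ▸ Eqv.refl S _) h3.arcs.2.1.not_eqv
    · exact absurd ⟨lo, q w', q w, Eqv.refl S _, Eqv.refl S _, Eqv.refl S _, hq1 w' hw', h⟩
        (hS.cyc_asymm h3)
  -- On each subinterval, `q` jumps over an element `w'` at some `w` equivalent to it.
  have main : ∀ c d, a ≤ c → c < d → d ≤ b → ∃ w w', c < w ∧ w < d ∧ S.Eqv w w' ∧ Cmp lo w' ∧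
      (∀ z ∈ A, z < w → c < z → q z < w') ∧ ∀ z ∈ A, w < z → z < d → w' < q z := by
    intro c d hac hcd hdb
    let K' := K ⊓ (stabilizer G a ⊓ stabilizer G b) ⊓ (stabilizer G lo ⊓ stabilizer G hi)
    have hK' : S.Op K' := S.op_inf (S.op_inf hK (S.op_top_stab₂ a b)) (S.op_top_stab₂ lo hi)
    have hd : ∀ c' d', c ≤ c' → c' < d' → d' ≤ d → ∃ z ∈ A, c' < z ∧ z < d' := by
      intro c' d' h1 h2 h3
      obtain ⟨p, z, hz, h4, h5⟩ := S.exists_rep_between h2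
      exact ⟨z, ⟨hac.trans_lt (h1.trans_lt h4), h5.trans_le (h3.trans hdb), p, hz⟩, h4, h5⟩
    obtain ⟨w, w', h1, h2, h3, h4, h5⟩ := S.exists_eqv_of_strictMono hK' (A := A) (q := q)
      (lo := lo) (hi := hi) hcd hd (fun z hz z' hz' _ h _ => mono z hz z' hz' h)
      (by
        rintro k ⟨⟨hk, hka, hkb⟩, hkl, hkh⟩ z hz - - - -
        have hka : k • a = a := hka
        have hkb : k • b = b := hkb
        have hkl : k • lo = lo := hkl
        have hkh : k • hi = hi := hkh
        obtain ⟨g1, g2, p, hp⟩ := id hz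
        have hkz : k • z ∈ A := by
          refine ⟨?_, ?_, k • p, hp.smul k⟩
          · rw [← hka]; exact S.smul_lt k g1
          · rw [← hkb]; exact S.smul_lt k g2
        refine ⟨hkz, ?_⟩
        have g3 := (hq3 z hz p hp).smul k
        rw [← hRK k hk] at g3
        refine ((hq3 _ hkz _ (hp.smul k)).unique (hR _ (hAe hkz.1 (hp.smul k))).1 g3).eq_of_cmp ?_
        refine S.cmp_trans (hq1 _ hkz).cmp.symm ?_
        rw [← hkl]
        exact (S.smul_cmp k).2 (hq1 z hz).cmp)
      (fun z hz _ _ => ⟨(hq1 z hz).le, (hq2 z hz).le⟩)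
    obtain ⟨z, hz, g1, g2⟩ := hd c w le_rfl h1 h2.le
    exact ⟨w, w', h1, h2, h3, S.cmp_trans (hq1 z hz).cmp (h4 z hz g1 g2).cmp,
      fun z hz g g' => h4 z hz g' g, h5⟩
  have hxA : x ∈ A := ⟨hax, hxb, p, hx⟩
  obtain ⟨w₁, w₁', h1, h2, h3, h4, -, h5⟩ := main a x le_rfl hax hxb.le
  obtain ⟨w₂, w₂', k1, k2, k3, k4, k5, -⟩ := main x b hax.le hxb le_rfl
  have lt1 : ∀ {w w'}, w < x → (∀ z ∈ A, w < z → z < x → w' < q z) → a ≤ w → w' < q x := by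
    intro w w' hw h haw
    obtain ⟨s, z, hz, g1, g2⟩ := S.exists_rep_between hw
    have hzA : z ∈ A := ⟨haw.trans_lt g1, g2.trans hxb, s, hz⟩
    exact (h z hzA g1 g2).trans (mono z hzA x hxA g2)
  have lt2 : ∀ {w w'}, x < w → (∀ z ∈ A, z < w → x < z → q z < w') → w ≤ b → q x < w' := by
    intro w w' hw h hwb
    obtain ⟨s, z, hz, g1, g2⟩ := S.exists_rep_between hw
    have hzA : z ∈ A := ⟨hax.trans g1, g2.trans_le hwb, s, hz⟩
    exact (mono x hxA z hzA g1).trans (h z hzA g2 g1)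
  have hw1 := lt1 h2 h5 h1.le
  have hw2 := lt2 k1 k5 k2.le
  -- Such elements exist on both sides of `x`, and the intervals between them match. So `q x` is
  -- equivalent to some `y` in the interval around `x`; if `y` differed from `x`, an element given
  -- by `main` between the two would contradict the monotonicity of `q` or of the match.
  have hm := hS.match_of_ends h3 k3 (h2.trans k1).le (hw1.trans hw2).le
  have hqx : S.Eqv x (q x) := by
    obtain ⟨y, m1, m2⟩ := hm.symm.split hw1.le hw2.le
    have hy : S.Eqv y (q x) := m1.right.symm
    rcases (S.cmp_trans m1.le'.cmp.symm h2.cmp).lt_or_eq_or_gt with h | h | h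
    · obtain ⟨w, w', g1, g2, g3, g4, -, g5⟩ := main y x (h1.le.trans m1.le') h hxb.le
      have g6 := lt1 g2 g5 ((h1.le.trans m1.le').trans g1.le)
      exact absurd (hm.mono m1.le' (g2.trans k1).le (hw1.cmp) (S.cmp_trans h4.symm g4) hy g3 g1)
        g6.not_gt
    · exact h ▸ hy
    · obtain ⟨w, w', g1, g2, g3, g4, g5, -⟩ := main x y hax.le h (m2.le'.trans k2.le)
      have g6 := lt2 g1 g5 (g2.le.trans (m2.le'.trans k2.le))
      exact absurd (hm.mono (h2.trans g1).le m2.le' (S.cmp_trans h4.symm g4) hw1.cmp g3 hy g2)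
        g6.not_gt
  exact ((hq3 x hxA p hx).congr hqx.symm).cutAt (hR p hp) hx

end OrdSys

end DefOrd

/-! ### Topological rank 1 for circles -/

namespace DefOrd

open MulAction Set

namespace OrdSys

section

variable {G : Type*} {Ω : Type u} [Group G] [MulAction G Ω] [PartialOrder Ω]
  {S : OrdSys G Ω} {K : Subgroup G} {p q s : S.Glued} {hS : S.Hausdorff} {e : Component hS}
  {he : IsCircle e}

theorem IsCircle.exists_ne (he : IsCircle e) : ∃ p q : S.Glued, compOf hS p = e ∧ compOf hS q = e ∧ p ≠ q := by
  obtain ⟨p, q, h1, h2, -⟩ := he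
  exact ⟨p, q, h1, h2.compOf_eq.symm.trans h1, h2.ne⟩

theorem smul_mem_interval {k : G} (hp : k • p = p) (hq : k • q = q)
    (hs : s ∈ ((circComp e he).interval p q).carrier) :
    k • s ∈ ((circComp e he).interval p q).carrier := by
  rw [mem_interval] at hs ⊢
  have := hs.2.smul k
  rw [hp, hq] at this
  exact ⟨hs.1, this⟩

theorem smul_interval_le {k : G} {a b : S.Glued} (hp : k • p = p) (hq : k • q = q)
    (ha : a ∈ ((circComp e he).interval p q).carrier)
    (hb : b ∈ ((circComp e he).interval p q).carrier)
    (h : ((circComp e he).interval p q).le a b) :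
    ((circComp e he).interval p q).le (k • a) (k • b) := by
  rw [interval_le (smul_mem_interval hp hq ha) (smul_mem_interval hp hq hb)]
  rcases (interval_le ha hb).1 h with h | h
  · exact Or.inl (h ▸ rfl)
  · have := h.smul k
    rw [hp] at this
    exact Or.inr this

theorem exists_op_smul_eq (S : OrdSys G Ω) (p : S.Glued) : ∃ K, S.Op K ∧ ∀ k ∈ K, k • p = p := by
  obtain ⟨x, -, hx⟩ := OrdSys.exists_rep p
  refine ⟨_, S.op_stab x, fun k hk => ?_⟩
  have := hx.smul k
  rw [show k • x = x from hk] at this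
  exact this.unique hx

/-- A definable convex equivalence relation on a circle has finitely many infinite classes. -/
theorem circComp_finite_classes (hK : S.Op K)
    (horb : ∀ K, S.Op K → ∃ T : Set (S.Glued × S.Glued), T.Finite ∧
      ∀ p, ∃ t ∈ T, ∃ k ∈ K, k • t = p)
    {E : S.Glued → S.Glued → Prop} (hE : ∀ k ∈ K, ∀ p q, E p q → E (k • p) (k • q))
    (symm : ∀ {p q}, E p q → E q p) (trans : ∀ {p q s}, E p q → E q s → E p s)
    (conv : ∀ p, compOf hS p = e → (circComp e he).Convex {q | E p q}) :
    {C : Set S.Glued | C.Infinite ∧ ∃ p, compOf hS p = e ∧ C = {q | E p q}}.Finite := by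
  -- The circle is cut at two points into two intervals, which are chartable linear orders. Omitting
  -- the classes of `p` and `q` keeps the relation convex in the interval, as a class can no longer
  -- run through the complementary arc; these two classes are added at the end.
  have part : ∀ p q : S.Glued, compOf hS p = e → compOf hS q = e →
      {C : Set S.Glued | C.Nontrivial ∧ ∃ a ∈ ((circComp e he).interval p q).carrier,
        C = {b | b ∈ ((circComp e he).interval p q).carrier ∧
          (a = b ∨ E a b ∧ ¬ E a p ∧ ¬ E a q)}}.Finite := by
    intro p q hpe hqe
    obtain ⟨Kp, hKp, hp⟩ := S.exists_op_smul_eq p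
    obtain ⟨Kq, hKq, hq⟩ := S.exists_op_smul_eq q
    have hK' := S.op_inf hK (S.op_inf hKp hKq)
    obtain ⟨T, hT, hT'⟩ := horb _ hK'
    refine interval_chartable.finite_classes S S.isRep hK'
      (fun k hk a ha => smul_mem_interval (hp k hk.2.1) (hq k hk.2.2) ha)
      (fun k hk a ha b hb h => smul_interval_le (hp k hk.2.1) (hq k hk.2.2) ha hb h) T hT hT'
      (fun a b => a = b ∨ E a b ∧ ¬ E a p ∧ ¬ E a q) ?_ ?_ ?_ ?_
    · rintro k hk a - b - (h | ⟨h1, h2, h3⟩)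
      · exact Or.inl (h ▸ rfl)
      · have inv : ∀ {s}, k • s = s → E (k • a) s → E a s := by
          intro s hs h
          have := hE k⁻¹ (Subgroup.inv_mem _ hk.1) _ _ h
          rwa [inv_smul_smul, inv_smul_eq_iff.2 hs.symm] at this
        exact Or.inr ⟨hE k hk.1 a b h1, fun h => h2 (inv (hp k hk.2.1) h),
          fun h => h3 (inv (hq k hk.2.2) h)⟩
    · rintro a - b - (h | ⟨h1, h2, h3⟩)
      · exact Or.inl h.symm
      · exact Or.inr ⟨symm h1, fun h => h2 (trans h1 h), fun h => h3 (trans h1 h)⟩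
    · rintro a - b - c - (rfl | ⟨h1, h2, h3⟩) (rfl | ⟨h1', h2', h3'⟩)
      · exact Or.inl rfl
      · exact Or.inr ⟨h1', h2', h3'⟩
      · exact Or.inr ⟨h1, h2, h3⟩
      · exact Or.inr ⟨trans h1 h1', h2, h3⟩
    · rintro a ha b hb c hc hac hcb (rfl | ⟨h1, h2, h3⟩)
      · exact Or.inl (LinOrdOn.le_antisymm' _ ha hc hac hcb)
      rcases (interval_le ha hc).1 hac with h4 | h4
      · exact Or.inl h4
      rcases (interval_le hc hb).1 hcb with rfl | h5
      · exact Or.inr ⟨h1, h2, h3⟩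
      have hae : compOf hS a = e := (mem_interval.1 ha).2.compOf_eq.1.trans hpe
      have hab := h4.trans hS h5
      have haa : E a a := trans h1 (symm h1)
      refine Or.inr ⟨?_, h2, h3⟩
      rcases convex_cases (conv a hae) (show a ∈ {q | E a q} from haa) h1 hab.ne.2.1 with h | h
      · refine h c ?_
        obtain ⟨x, y, z, hx, hy, hz, g1, g2⟩ := h5
        obtain ⟨w, hw, g3, g4⟩ := h4.exists_rep hS hx hy g1
        exact ⟨w, y, z, hw, hy, hz, g4, g2⟩
      · exact absurd (h p ((hab.rotate he hpe).rotate he hae)) h2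
  obtain ⟨p, q, hp, hq, hpq⟩ := he.exists_ne
  let sat (C : Set S.Glued) : Set S.Glued := {b | ∃ a ∈ C, E a b}
  refine (((((part p q hp hq).image sat)).union ((part q p hq hp).image sat)).union
    (Set.toFinite {{b | E p b}, {b | E q b}})).subset ?_
  rintro C ⟨hC, c, hc, rfl⟩
  by_cases h1 : E c p
  · refine Or.inr (Or.inl ?_)
    ext b
    exact ⟨fun h => trans (symm h1) h, fun h => trans h1 h⟩
  by_cases h2 : E c q
  · refine Or.inr (Or.inr ?_)
    ext b
    exact ⟨fun h => trans (symm h2) h, fun h => trans h2 h⟩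
  left
  have cover : {b | E c b} ⊆ {b | E c b ∧ GCyc p b q} ∪ {b | E c b ∧ GCyc q b p} := by
    intro b hb
    have hbe : compOf hS b = e := (conv c hc).1 hb
    have n1 : p ≠ b := fun h => h1 (h ▸ hb)
    have n2 : b ≠ q := fun h => h2 (h ▸ hb)
    rcases gcyc_total he hp hbe hq n1 n2 hpq with h | h
    · exact Or.inl ⟨hb, h⟩
    · exact Or.inr ⟨hb, h.rotate he hp⟩
  have fin : ∀ p q : S.Glued, compOf hS p = e → ¬ E c p → ¬ E c q →
      {b | E c b ∧ GCyc p b q}.Infinite → {b | E c b} ∈ sat ''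
      {C : Set S.Glued | C.Nontrivial ∧ ∃ a ∈ ((circComp e he).interval p q).carrier,
        C = {b | b ∈ ((circComp e he).interval p q).carrier ∧
          (a = b ∨ E a b ∧ ¬ E a p ∧ ¬ E a q)}} := by
    intro p q hp h1 h2 hinf
    obtain ⟨a, ha⟩ := hinf.nonempty
    have e1 : {b | b ∈ ((circComp e he).interval p q).carrier ∧
          (a = b ∨ E a b ∧ ¬ E a p ∧ ¬ E a q)} = {b | E c b ∧ GCyc p b q} := by
      ext b
      simp only [Set.mem_ofPred_eq, mem_interval]
      constructor
      · rintro ⟨⟨-, h3⟩, rfl | ⟨h4, -, -⟩⟩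
        · exact ha
        · exact ⟨trans ha.1 h4, h3⟩
      · rintro ⟨h3, h4⟩
        exact ⟨⟨hp, h4⟩, Or.inr ⟨trans (symm ha.1) h3, fun h => h1 (trans ha.1 h),
          fun h => h2 (trans ha.1 h)⟩⟩
    refine ⟨_, ⟨?_, a, mem_interval.2 ⟨hp, ha.2⟩, rfl⟩, ?_⟩
    · rw [e1]; exact hinf.nontrivial
    · rw [e1]
      ext b
      exact ⟨fun ⟨d, hd, h⟩ => trans hd.1 h, fun h => ⟨a, ha, trans (symm ha.1) h⟩⟩
  by_cases h3 : {b | E c b ∧ GCyc p b q}.Infinite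
  · exact Or.inl (fin p q hp h1 h2 h3)
  · refine Or.inr (fin q p hq h2 h1 fun h4 => hC ?_)
    exact ((Set.not_infinite.1 h3).union h4).subset cover

end

end OrdSys

end DefOrd

/-! ### Definability and minimality of the components -/

namespace DefOrd

open MulAction Set

variable {L : FirstOrder.Language.{v, w}} {M : Type u} [L.Structure M]

/-- The pointwise stabilizer of `s`. -/
def fixing (L : FirstOrder.Language.{v, w}) {M : Type u} [L.Structure M] (s : Finset M) :
    Subgroup (autGroup L M) where
  carrier := {g | Fixes s g}
  one_mem' := fun _ _ => rfl
  mul_mem' := by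
    intro a b ha hb m hm
    rw [Subgroup.coe_mul, Equiv.Perm.mul_apply, hb m hm, ha m hm]
  inv_mem' := fun h => Fixes.inv h

namespace OrdSys

variable {Ω : Type u} [MulAction (autGroup L M) Ω] [PartialOrder Ω] {S : OrdSys (autGroup L M) Ω}
  {hS : S.Hausdorff} {e : Component hS}

/-- The open subgroups are those that contain the pointwise stabilizer of a finite set, and the
glued orders are interpretable. -/
structure Compatible (hS : S.Hausdorff) [Interp L M S.Glued] [Interp L M (Component hS)] :
    Prop where
  op : ∀ {K}, S.Op K ↔ OpenSub K
  glued : ∀ (g : autGroup L M) (p : S.Glued), act g p = g • p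
  comp : ∀ (g : autGroup L M) (e : Component hS), act g e = g • e

theorem isCircle_smul_iff {g : autGroup L M} : IsCircle (g • e) ↔ IsCircle e :=
  ⟨fun h => by simpa using h.smul g⁻¹, fun h => h.smul g⟩

theorem compOrd_isLin : (compOrd e).IsLin ↔ ¬ IsCircle e := by
  by_cases h : IsCircle e
  · rw [compOrd_circ h]; simp [LinOrCircOn.IsLin, h]
  · rw [compOrd_lin h]; simp [LinOrCircOn.IsLin, h]

theorem mem_compOrd {p : S.Glued} : p ∈ (compOrd e).carrier ↔ compOf hS p = e := by
  by_cases h : IsCircle e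
  · rw [compOrd_circ h]; rfl
  · rw [compOrd_lin h]; rfl

theorem compOrd_leRel {p q : S.Glued} : (compOrd e).leRel p q ↔
    ¬ IsCircle e ∧ compOf hS p = e ∧ compOf hS q = e ∧ (p = q ∨ GArc p q) := by
  by_cases h : IsCircle e
  · rw [compOrd_circ h]; simp [LinOrCircOn.leRel, h]
  · rw [compOrd_lin h]; simp only [LinOrCircOn.leRel, h, not_false_iff, true_and]; rfl

theorem compOrd_btwRel {p q s : S.Glued} : (compOrd e).btwRel p q s ↔
    IsCircle e ∧ compOf hS p = e ∧ compOf hS q = e ∧ compOf hS s = e ∧ GBtw p q s := by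
  by_cases h : IsCircle e
  · rw [compOrd_circ h]; simp only [LinOrCircOn.btwRel, h, true_and]; rfl
  · rw [compOrd_lin h]; simp [LinOrCircOn.btwRel, h]

theorem image_eq_of_inv {X : Type*} [MulAction (autGroup L M) X] {R : X → Set S.Glued}
    {g : autGroup L M} {x : X}
    (h : ∀ g' ∈ ({g, g⁻¹} : Set (autGroup L M)), ∀ x p, p ∈ R x → g' • p ∈ R (g' • x)) :
    R (g • x) = (fun p => g • p) '' R x := by
  ext p
  constructor
  · intro hp
    refine ⟨g⁻¹ • p, ?_, by simp⟩
    have := h g⁻¹ (by simp) _ _ hp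
    rwa [inv_smul_smul] at this
  · rintro ⟨q, hq, rfl⟩
    exact h g (by simp) _ _ hq

variable [Interp L M S.Glued] [Interp L M (Component hS)]

theorem Compatible.op_fixing (hC : Compatible hS) (s : Finset M) : S.Op (fixing L s) :=
  hC.op.2 ⟨s, fun _ h => h⟩

theorem Compatible.finite_orbits (hM : OmegaCategorical L M) (hC : Compatible hS)
    {K : Subgroup (autGroup L M)} (hK : S.Op K) :
    ∃ T : Set (S.Glued × S.Glued), T.Finite ∧ ∀ p, ∃ t ∈ T, ∃ k ∈ K, k • t = p := by
  obtain ⟨s, hs⟩ := hC.op.1 hK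
  obtain ⟨T, hT, h⟩ := hM.finite_orbits (S.Glued × S.Glued) s
  refine ⟨T, hT, fun p => ?_⟩
  obtain ⟨t, ht, g, hg, rfl⟩ := h p
  refine ⟨t, ht, g, hs g hg, ?_⟩
  rw [act_prod, hC.glued, hC.glued]
  rfl

variable [Countable M]

theorem zeroDefFamily_compOrd (hM : OmegaCategorical L M) (hC : Compatible hS) :
    ZeroDefFamily L M (compOrd (hS := hS)) := by
  refine ⟨(zeroDef_iff hM).2 fun g e he => ?_, (zeroDef_iff hM).2 fun g x hx => ?_,
    (zeroDef_iff hM).2 fun g x hx => ?_, (zeroDef_iff hM).2 fun g x hx => ?_⟩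
  · rw [Set.mem_ofPred_eq, compOrd_isLin] at he ⊢
    rwa [hC.comp, isCircle_smul_iff]
  · rw [Set.mem_ofPred_eq, mem_compOrd] at hx ⊢
    simp only [act_prod, hC.comp, hC.glued, compOf_smul, hx]
  · rw [Set.mem_ofPred_eq, compOrd_leRel] at hx ⊢
    simp only [act_prod, hC.comp, hC.glued, compOf_smul, isCircle_smul_iff, hx, true_and,
      not_false_iff]
    exact hx.2.2.2.imp (congrArg (g • ·)) fun h => h.smul g
  · rw [Set.mem_ofPred_eq, compOrd_btwRel] at hx ⊢
    simp only [act_prod, hC.comp, hC.glued, compOf_smul, isCircle_smul_iff, hx, true_and]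
    exact hx.2.2.2.2.imp (congrArg (g • ·)) (Or.imp (congrArg (g • ·))
      (Or.imp (congrArg (g • ·)) fun h => h.smul g))

theorem linComp_minimal (hM : OmegaCategorical L M) (hC : Compatible hS) (he : ¬ IsCircle e) : (linComp e he).Minimal L M e := by
  refine ⟨⟨linComp_denseNoEnds he, fun Z hZ hdef hne => ?_⟩, ?_⟩
  · rw [defOver_iff hM] at hdef
    refine linComp_denseSubset he hZ (fun g hg p hp => ?_) hne
    rw [← hC.glued]
    exact hdef g (by rwa [hC.comp]) p hp
  · rintro ⟨E, hE, hsub, heq, hconv, hinf⟩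
    obtain ⟨s, hs⟩ := (paramDef_iff hM).1 hE
    obtain ⟨p₀, hp₀⟩ := exists_compOf e
    -- An automorphism fixing a point of the component stabilizes the component.
    obtain ⟨K₀, hK₀, hK₀'⟩ := S.exists_op_smul_eq p₀
    have hK := S.op_inf (hC.op_fixing s) hK₀
    have hKe : ∀ k ∈ fixing L s ⊓ K₀, k • e = e := fun k hk => by
      rw [← hp₀, ← compOf_smul, hK₀' k hk.2]
    obtain ⟨T, hT, horb⟩ := hC.finite_orbits hM hK
    refine hinf (((linComp_chartable he).finite_classes S S.isRep hK (fun k hk p hp => ?_)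
      (fun k hk p hp q hq h => ?_) T hT horb (fun p q => (p, q) ∈ E)
      (fun k hk p _ q _ h => ?_) (fun p hp q hq h => ?_) (fun p hp q hq r hr h h' => ?_)
      fun p hp q hq r hr h h' => hconv p hp q hq r hr h h').subset ?_)
    · exact (compOf_smul k p).trans (by rw [show compOf hS p = e from hp, hKe k hk])
    · exact Or.imp (congrArg (k • ·)) (fun h => h.smul k) h
    · have := hs k hk.1 _ h
      rwa [act_prod, hC.glued, hC.glued] at this
    · exact heq.symm (x := ⟨p, hp⟩) (y := ⟨q, hq⟩) h
    · exact heq.trans (x := ⟨p, hp⟩) (y := ⟨q, hq⟩) (z := ⟨r, hr⟩) h h'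
    · rintro C ⟨hC, p, hp, rfl⟩
      refine ⟨hC.nontrivial, p, hp, ?_⟩
      ext q
      exact ⟨fun h => ⟨(hsub h).2, h⟩, fun h => h.2⟩

theorem circComp_minimal (hM : OmegaCategorical L M) (hC : Compatible hS) (he : IsCircle e) : (circComp e he).Minimal L M e := by
  have hne : ∀ x ∈ (circComp e he).carrier, ∀ y ∈ (circComp e he).carrier, x ≠ y →
      ((circComp e he).arc x y).Nonempty := fun x hx y hy h => circComp_arc_nonempty hx hy h
  refine ⟨⟨?_, hne, ?_⟩, ?_, ?_⟩
  · obtain ⟨p, q, hp, hq, hpq⟩ := he.exists_ne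
    have hd := interval_denseNoEnds (he := he) hp hq hpq
    obtain ⟨a, ha⟩ := hd.1
    obtain ⟨b, hb, hab⟩ := hd.2.2.2 a ha
    obtain ⟨x, y, hxy, hx, hy, hex, hcomp⟩ := interval_chartable a ha b hb hab
    refine fun hfin => Chartable.infinite_of_lt S S.isRep hd ha hb hxy hx hy hex hcomp ?_
    -- By rigidity a point has at most one representative in a given order, so infinitely many
    -- representatives require infinitely many points.
    have hsub : ∀ z : S.Glued, {w | x ≤ w ∧ Rep z w}.Finite := fun z =>
      Set.Subsingleton.finite fun w hw w' hw' =>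
        (hw.2.eqv hw'.2).eq_of_cmp (S.cmp_trans hw.1.cmp.symm hw'.1.cmp)
    refine (hfin.biUnion fun z _ => hsub z).subset ?_
    rintro w ⟨h1, -, z, hz, hw⟩
    exact mem_biUnion hz.2.1 ⟨h1, hw⟩
  · rintro ⟨Q, hQ, Z, R, hZ, hR, hZne, hcut, T, hTZ, hT, hsame⟩
    rw [defOver_iff hM] at hZ hR
    have hRg : ∀ g : autGroup L M, g • e = e → ∀ z, fiber R (act g z) = (fun p => g • p) '' fiber R z := by
      have key : ∀ g : autGroup L M, g • e = e → ∀ z p, (z, p) ∈ R → (act g z, g • p) ∈ R := by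
        intro g hg z p h
        have := hR g (by rwa [hC.comp]) _ h
        rwa [act_prod, hC.glued] at this
      intro g hg z
      ext p
      constructor
      · intro hp
        refine ⟨g⁻¹ • p, ?_, by simp⟩
        have := key g⁻¹ (inv_smul_eq_iff.2 hg.symm) _ _ hp
        rwa [act_inv_act] at this
      · rintro ⟨q, hq, rfl⟩
        exact key g hg _ _ hq
    refine no_algebraic_cut (he := he) (C := fiber R '' Z) (T := fiber R '' T) ?_ ?_
      (hZne.image _) ?_ (hT.image _) (image_mono hTZ) ?_
    · rintro _ ⟨z, hz, rfl⟩
      exact hcut z hz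
    · rintro _ ⟨z, hz, rfl⟩
      obtain ⟨s, hs⟩ := exists_support L M z
      obtain ⟨p₀, hp₀⟩ := exists_compOf e
      obtain ⟨K₀, hK₀, hK₀'⟩ := S.exists_op_smul_eq p₀
      refine ⟨_, S.op_inf (hC.op_fixing s) hK₀, fun k hk p hp => ?_⟩
      have hke : k • e = e := by rw [← hp₀, ← compOf_smul, hK₀' k hk.2]
      have := hRg k hke z
      rw [hs k hk.1] at this
      rw [this]
      exact ⟨p, hp, rfl⟩
    · rintro g hg _ ⟨z, hz, rfl⟩
      exact ⟨act g z, hZ g (by rwa [hC.comp]) z hz, hRg g hg z⟩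
    · rintro _ ⟨z, hz, rfl⟩
      obtain ⟨t, ht, h⟩ := hsame z hz
      exact ⟨_, ⟨t, ht, rfl⟩, h⟩
  · rintro ⟨E, hE, hsub, heq, hconv, hinf⟩
    obtain ⟨s, hs⟩ := (paramDef_iff hM).1 hE
    refine hinf ((circComp_finite_classes (hS := hS) (e := e) (he := he) (hC.op_fixing s)
      (fun K hK => hC.finite_orbits hM hK) (E := fun p q => (p, q) ∈ E) ?_ ?_ ?_ hconv).subset ?_)
    · intro k hk p q h
      have := hs k hk _ h
      rwa [act_prod, hC.glued, hC.glued] at this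
    · intro p q h
      exact heq.symm (x := ⟨p, (hsub h).1⟩) (y := ⟨q, (hsub h).2⟩) h
    · intro p q r h h'
      exact heq.trans (x := ⟨p, (hsub h).1⟩) (y := ⟨q, (hsub h).2⟩) (z := ⟨r, (hsub h').2⟩) h h'
    · rintro C ⟨hC, p, hp, rfl⟩
      exact ⟨hC, p, hp, rfl⟩
  · rintro ⟨R, hR, hcut, hlt, p, hp, hn⟩
    obtain ⟨s, hs⟩ := (paramDef_iff hM).1 hR
    refine hn (no_self_intertwining (hC.op_fixing s) (R := fiber R) hcut ?_ hlt hp)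
    intro k hk p
    refine image_eq_of_inv fun g hg p q h => ?_
    have hg' : Fixes s g := by
      rcases hg with rfl | rfl
      · exact hk
      · exact Fixes.inv hk
    have := hs g hg' _ h
    rwa [act_prod, hC.glued, hC.glued] at this

theorem compOrd_minimal (hM : OmegaCategorical L M) (hC : Compatible hS) (e : Component hS) : (compOrd e).Minimal L M e := by
  by_cases he : IsCircle e
  · rw [compOrd_circ he]
    exact circComp_minimal hM hC he
  · rw [compOrd_lin he]
    exact linComp_minimal hM hC he

end OrdSys

end DefOrd

/-! ### Reversal and independence of components -/

namespace DefOrd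

open MulAction Set

namespace LinOrdOn

variable {X : Type u} {V : LinOrdOn X}

theorem reverse_lt {x y : X} : V.reverse.lt x y ↔ V.lt y x :=
  ⟨fun h => ⟨h.1, h.2.symm⟩, fun h => ⟨h.1, h.2.symm⟩⟩

theorem DenseNoEnds.reverse (h : V.DenseNoEnds) : V.reverse.DenseNoEnds := by
  refine ⟨h.1, fun x hx y hy hxy => ?_, fun x hx => ?_, fun x hx => ?_⟩
  · obtain ⟨z, hz, h1, h2⟩ := h.2.1 y hy x hx (reverse_lt.1 hxy)
    exact ⟨z, hz, reverse_lt.2 h2, reverse_lt.2 h1⟩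
  · obtain ⟨y, hy, h1⟩ := h.2.2.2 x hx
    exact ⟨y, hy, reverse_lt.2 h1⟩
  · obtain ⟨y, hy, h1⟩ := h.2.2.1 x hx
    exact ⟨y, hy, reverse_lt.2 h1⟩

theorem DenseSubset.reverse {Z : Set X} (h : V.DenseSubset Z) : V.reverse.DenseSubset Z := by
  intro x hx y hy hxy
  obtain ⟨z, hz, h1, h2⟩ := h y hy x hx (reverse_lt.1 hxy)
  exact ⟨z, hz, reverse_lt.2 h2, reverse_lt.2 h1⟩

end LinOrdOn

variable {L : FirstOrder.Language.{v, w}} {M : Type u} [L.Structure M]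

/-- The stabilizer of an imaginary element. -/
noncomputable def actStab (L : FirstOrder.Language.{v, w}) (M : Type u) [L.Structure M] {X : Type*}
    [Interp L M X] (x : X) : Subgroup (autGroup L M) where
  carrier := {g | act g x = x}
  one_mem' := act_one x
  mul_mem' := by
    intro a b ha hb
    rw [Set.mem_ofPred_eq] at ha hb ⊢
    rw [act_mul, hb, ha]
  inv_mem' := by
    intro a ha
    rw [Set.mem_ofPred_eq] at ha ⊢
    conv_lhs => rw [← ha]
    exact act_inv_act a x

theorem openSub_actStab {X : Type*} [Interp L M X] (x : X) : OpenSub (actStab L M x) :=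
  exists_support L M x

namespace OrdSys

section

variable {G : Type*} {Ω : Type u} [Group G] [MulAction G Ω] [PartialOrder Ω]
  {S : OrdSys G Ω} {hS : S.Hausdorff}

theorem cnu_cnu (e : Component hS) : cnu hS (cnu hS e) = e := by
  obtain ⟨p, rfl⟩ := exists_compOf e
  rw [← compOf_gnu, ← compOf_gnu, gnu_gnu]

theorem isCircle_cnu_iff {e : Component hS} : IsCircle (cnu hS e) ↔ IsCircle e :=
  ⟨fun h => cnu_cnu e ▸ h.cnu, fun h => h.cnu⟩

theorem GBtw.smul {p q s : S.Glued} (g : G) (h : GBtw p q s) : GBtw (g • p) (g • q) (g • s) :=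
  h.imp (congrArg (g • ·)) (Or.imp (congrArg (g • ·)) (Or.imp (congrArg (g • ·)) (GCyc.smul g)))

theorem GBtw.gnu {p q s : S.Glued} (h : GBtw p q s) : GBtw (S.gnu s) (S.gnu q) (S.gnu p) := by
  rcases h with h | h | h | h
  · exact Or.inr (Or.inl (congrArg _ h.symm))
  · exact Or.inl (congrArg _ h.symm)
  · exact Or.inr (Or.inr (Or.inl (congrArg _ h.symm)))
  · exact Or.inr (Or.inr (Or.inr h.gnu))

end

variable {Ω : Type u} [MulAction (autGroup L M) Ω] [PartialOrder Ω] {S : OrdSys (autGroup L M) Ω}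
  {hS : S.Hausdorff} {e e' : Component hS} [Interp L M S.Glued] [Interp L M (Component hS)]
  [Countable M]

theorem inReversingBijection_cnu (hM : OmegaCategorical L M) (hC : Compatible hS)
    (e : Component hS) :
    LinOrCircOn.InReversingBijection L M (compOrd e) (compOrd (cnu hS e)) := by
  refine ⟨S.gnu, ⟨fun p hp => ?_, fun p _ q _ h => ?_, fun q hq => ?_⟩, ?_, ?_⟩
  · rw [mem_compOrd] at hp ⊢
    rw [compOf_gnu, hp]
  · rw [← gnu_gnu p, h, gnu_gnu]
  · rw [mem_compOrd] at hq
    refine ⟨S.gnu q, mem_compOrd.2 ?_, gnu_gnu q⟩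
    rw [compOf_gnu, hq, cnu_cnu]
  · obtain ⟨s, hs⟩ := exists_support L M e
    refine (paramDef_iff hM).2 ⟨s, ?_⟩
    rintro g hg ⟨p, q⟩ ⟨h1, h2⟩
    simp only at h1 h2
    rw [mem_compOrd] at h1
    rw [act_prod, hC.glued, hC.glued]
    refine ⟨mem_compOrd.2 ?_, ?_⟩
    · rw [compOf_smul, h1, ← hC.comp]
      exact hs g hg
    · simp only [h2, gnu_smul]
  · by_cases he : IsCircle e
    · rw [compOrd_circ he, compOrd_circ he.cnu]
      exact fun p _ q _ s _ h => GBtw.gnu h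
    · rw [compOrd_lin he, compOrd_lin (mt isCircle_cnu_iff.1 he)]
      exact fun p _ q _ h => h.imp (fun h => congrArg _ h.symm) GArc.gnu

/-- Intertwined suborders have equivalent elements by `exists_eqv_of_intertwined`, so the two
components are equal. If the intertwining is with a reversed order, the same argument in the
reversed chart shows that one component is the reverse of the other. -/
theorem independent_of_ne (hM : OmegaCategorical L M) (hC : Compatible hS) (hne : e ≠ e')
    (hne' : e' ≠ cnu hS e) {V V' : LinOrdOn S.Glued} (hV : Chartable V (Rep (S := S)))
    (hV' : Chartable V' (Rep (S := S))) (he : ∀ p ∈ V.carrier, compOf hS p = e)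
    (he' : ∀ p ∈ V'.carrier, compOf hS p = e') {C : Type u} [Interp L M C] {c : C}
    (hle : ∀ g : autGroup L M, act g c = c → ∀ p q, V.le p q → V.le (g • p) (g • q)) :
    V.Independent L M c V' := by
  rintro ⟨Q, _, b, A, hA, B, hB, -, -, defA, -, wtA, wtB, hint⟩
  have hK : S.Op (actStab L M (c, b)) := hC.op.2 (openSub_actStab _)
  have hKc : ∀ k ∈ actStab L M (c, b), act k c = c := fun k hk => by
    have : act k (c, b) = (c, b) := hk
    rw [act_prod] at this
    exact congrArg Prod.fst this
  obtain ⟨T, hT, horb⟩ := hC.finite_orbits hM hK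
  have hdef : ∀ {Z : Set S.Glued}, DefOver L M (c, b) Z ↔
      ∀ k ∈ actStab L M (c, b), ∀ z ∈ Z, k • z ∈ Z := by
    intro Z
    rw [defOver_iff hM]
    simp only [hC.glued]
    rfl
  have hR : ∀ {R : Set (S.Glued × S.Glued)}, DefOver L M (c, b) R →
      ∀ k ∈ actStab L M (c, b), ∀ p, fiber R (k • p) = (fun q => k • q) '' fiber R p := by
    intro R hR k hk p
    rw [defOver_iff hM] at hR
    refine image_eq_of_inv fun g hg p q h => ?_
    have hg' : g ∈ actStab L M (c, b) := by
      rcases hg with rfl | rfl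
      · exact hk
      · exact Subgroup.inv_mem _ hk
    have := hR g hg' _ h
    rwa [act_prod, hC.glued, hC.glued] at this
  have hwA : ∀ Z ⊆ A, (∀ k ∈ actStab L M (c, b), ∀ z ∈ Z, k • z ∈ Z) → Z.Nonempty →
      (V.restrict A hA).DenseSubset Z := fun Z hZ h hn => wtA.2 Z hZ (hdef.2 h) hn
  have hwB : ∀ Z ⊆ B, (∀ k ∈ actStab L M (c, b), ∀ z ∈ Z, k • z ∈ Z) → Z.Nonempty →
      (V'.restrict B hB).DenseSubset Z := fun Z hZ h hn => wtB.2 Z hZ (hdef.2 h) hn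
  have hleA : ∀ k ∈ actStab L M (c, b), ∀ p ∈ A, ∀ q ∈ A, V.le p q → V.le (k • p) (k • q) :=
    fun k hk p _ q _ h => hle k (hKc k hk) p q h
  have comp : ∀ {x y w w' : Ω}, Cmp x w → S.Eqv w w' → Cmp y w' → S.Comp x y := fun h h' h'' =>
    hS.comp_trans (Comp.of_cmp S h) (hS.comp_trans (Or.inl h') (Comp.of_cmp S h''.symm))
  rcases hint with ⟨R, defR, hcut, hmono⟩ | ⟨R, defR, hcut, hmono⟩
  · obtain ⟨w, w', h1, ⟨p, hp, x, hx, h2⟩, q, hq, y, hy, h3⟩ := S.exists_eqv_of_intertwined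
      (hV.restrict hA) S.isRep (hV'.restrict hB) S.isRep hK wtA.1 wtB.1 (hdef.1 defA) hleA hwA hwB
      T hT horb hcut hmono fun k hk p _ => hR defR k hk p
    refine hne ?_
    rw [← he p (hA hp), ← he' q (hB hq)]
    exact (compOf_eq_iff hx hy).2 (comp h2 h1 h3)
  · obtain ⟨w, w', h1, ⟨p, hp, x, hx, h2⟩, q, hq, y, hy, h3⟩ := S.exists_eqv_of_intertwined
      (hV.restrict hA) S.isRep ((hV'.restrict hB).reverse S) (S.isRep.nu S) hK wtA.1 wtB.1.reverse
      (hdef.1 defA) hleA hwA (fun Z hZ h hn => (hwB Z hZ h hn).reverse)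
      T hT horb hcut hmono fun k hk p _ => hR defR k hk p
    refine hne' ?_
    have : compOf hS p = compOf hS (S.gnu q) := (compOf_eq_iff hx (rep_gnu_iff.2 hy)).2 (comp h2 h1 h3)
    rw [he p (hA hp), compOf_gnu, he' q (hB hq)] at this
    rw [this, cnu_cnu]

theorem compOrd_independent (hM : OmegaCategorical L M) (hC : Compatible hS) (hne : e ≠ e')
    (hne' : e' ≠ cnu hS e) :
    LinOrCircOn.Independent L M (e, e') (compOrd e) (compOrd e') := by
  have lin : ∀ {e : Component hS} (he : ¬ IsCircle e) (g : autGroup L M) (p q : S.Glued),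
      (linComp e he).le p q → (linComp e he).le (g • p) (g • q) := fun he g p q h =>
    h.imp (congrArg (g • ·)) (GArc.smul g)
  have circ : ∀ {e : Component hS} (he : IsCircle e) {s t p : S.Glued},
      p ∈ ((circComp e he).interval s t).carrier → compOf hS p = e := fun he _ _ _ h => h.2.1
  have circ_le : ∀ {e : Component hS} (he : IsCircle e) {s t : S.Glued} {g : autGroup L M},
      g • s = s → ∀ p q, ((circComp e he).interval s t).le p q →
      ((circComp e he).interval s t).le (g • p) (g • q) := fun he s t g hg p q h => by
    have := GBtw.smul g h
    rwa [hg] at this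
  by_cases he : IsCircle e <;> by_cases he' : IsCircle e'
  · rw [compOrd_circ he, compOrd_circ he']
    intro s _ t _ _ s' _ t' _ _
    refine independent_of_ne hM hC hne hne' interval_chartable interval_chartable
      (fun p hp => circ he hp) (fun p hp => circ he' hp) fun g hg => circ_le he ?_
    rw [← hC.glued]
    simp only [act_prod, Prod.mk.injEq] at hg
    exact hg.2.1.1
  · rw [compOrd_circ he, compOrd_lin he']
    intro s _ t _ _
    refine independent_of_ne hM hC hne hne' interval_chartable (linComp_chartable he')
      (fun p hp => circ he hp) (fun p hp => hp) fun g hg => circ_le he ?_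
    rw [← hC.glued]
    simp only [act_prod, Prod.mk.injEq] at hg
    exact hg.2.1
  · rw [compOrd_lin he, compOrd_circ he']
    intro s _ t _ _
    exact independent_of_ne hM hC hne hne' (linComp_chartable he) interval_chartable
      (fun p hp => hp) (fun p hp => circ he' hp) fun g _ => lin he g
  · rw [compOrd_lin he, compOrd_lin he']
    exact independent_of_ne hM hC hne hne' (linComp_chartable he) (linComp_chartable he')
      (fun p hp => hp) (fun p hp => hp) fun g _ => lin he g

end OrdSys

end DefOrd

/-! ### Embeddings of the members of the family -/

namespace DefOrd

open MulAction Set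

namespace LinOrdOn

theorem smul_image_below {G : Type*} [Group G] {P : Type u} [MulAction G P] {V : LinOrdOn P}
    {K : Subgroup G} (hmem : ∀ k ∈ K, ∀ p ∈ V.carrier, k • p ∈ V.carrier)
    (hle : ∀ k ∈ K, ∀ p ∈ V.carrier, ∀ q ∈ V.carrier, V.le p q → V.le (k • p) (k • q)) {k : G}
    (hk : k ∈ K) {p : P} (hp : p ∈ V.carrier) :
    V.below (k • p) = (fun q => k • q) '' V.below p := by
  have key : ∀ k ∈ K, ∀ p ∈ V.carrier, ∀ q ∈ V.below p, k • q ∈ V.below (k • p) :=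
    fun k hk p hp q hq => ⟨hmem k hk q hq.1, hle k hk q hq.1 p hp hq.2.1,
      fun h => hq.2.2 (smul_left_cancel k h)⟩
  ext q
  constructor
  · intro hq
    refine ⟨k⁻¹ • q, ?_, by simp⟩
    have := key k⁻¹ (K.inv_mem hk) _ (hmem k hk p hp) q hq
    rwa [inv_smul_smul] at this
  · rintro ⟨q, hq, rfl⟩
    exact key k hk p hp q hq

theorem below_ssubset {P : Type u} (V : LinOrdOn P) {p q : P} (hp : p ∈ V.carrier)
    (hq : q ∈ V.carrier) (h : V.lt p q) : V.below p ⊂ V.below q :=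
  (V.below_subset hp hq h.1).ssubset_of_ne fun he => by
    have : p ∈ V.below q := ⟨hp, h⟩
    rw [← he] at this
    exact this.2.2 rfl

end LinOrdOn

namespace InvFamily

variable {L : FirstOrder.Language.{v, w}} {M : Type u} [L.Structure M]
  {D X : Type u} [Interp L M D] [Interp L M X] {V : D → LinOrdOn X} {hV : InvFamily L M V}
  {a : D} {x y : X} {z w : Signed (DefCut hV)}

/-- `z` is the element `x` of `V a`. -/
structure IsPt (a : D) (x : X) (z : Signed (DefCut hV)) : Prop where
  mem : x ∈ (V a).carrier
  pos : z.pos = true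
  idx : z.val.idx = a
  seg : z.val.seg = (V a).below x

theorem exists_isPt (hd : (V a).DenseNoEnds) (hx : x ∈ (V a).carrier) :
    ∃ z : Signed (DefCut hV), IsPt a x z := ⟨⟨DefCut.pt hV hd hx, true⟩, hx, rfl, rfl, rfl⟩

theorem IsPt.unique (h : IsPt a x z) (h' : IsPt a x w) : z = w :=
  Signed.ext (DefCut.ext (h.idx.trans h'.idx.symm) (h.seg.trans h'.seg.symm)) (h.pos.trans h'.pos.symm)

theorem IsPt.smul (g : autGroup L M) (h : IsPt a x z) : IsPt (act g a) (act g x) (g • z) where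
  mem := hV.mem g h.mem
  pos := h.pos
  idx := by rw [Signed.smul_val, DefCut.smul_idx, h.idx]
  seg := by rw [Signed.smul_val, DefCut.smul_seg, h.seg, hV.image_below g h.mem]

theorem IsPt.lt (h : IsPt a x z) (h' : IsPt a y w) (hxy : (V a).lt x y) : z < w := by
  have hne : z ≠ w := by
    rintro rfl
    have : x ∈ (V a).below y := ⟨h.mem, hxy⟩
    rw [← h'.seg, h.seg] at this
    exact this.2.2 rfl
  refine lt_of_le_of_ne ⟨h.pos.trans h'.pos.symm, fun _ => ⟨h.idx.trans h'.idx.symm, ?_⟩,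
    fun h0 => by simp [h.pos] at h0⟩ hne
  rw [h.seg, h'.seg]
  exact (V a).below_subset h.mem h'.mem hxy.1

theorem IsPt.lt_iff (h : IsPt a x z) (h' : IsPt a y w) : z < w ↔ (V a).lt x y := by
  refine ⟨fun hlt => ?_, h.lt h'⟩
  rcases (V a).lt_or_le h.mem h'.mem with h1 | h1
  · exact h1
  · by_cases he : y = x
    · subst he
      exact absurd hlt (h.unique h' ▸ lt_irrefl _)
    · exact absurd hlt (h'.lt h ⟨h1, he⟩).not_gt

variable [Countable M] {hM : OmegaCategorical L M} {hm : ∀ a, (V a).Minimal L M a}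

theorem IsPt.mem_pt (h : IsPt a x z) : z ∈ (hV.ordSys hM hm).Pt := by
  refine ⟨x, ?_, ?_⟩
  · rw [h.idx]; exact h.mem
  · rw [h.seg, h.idx]

theorem exists_isPt_between (hM : OmegaCategorical L M) (hm : ∀ a, (V a).Minimal L M a)
    (hp : z.pos = true) (hi : z.val.idx = a) (h : z < w) :
    ∃ x y, IsPt a x y ∧ z < y ∧ y < w := by
  subst hi
  obtain ⟨y, ⟨x, hx, hseg⟩, h1, h2⟩ := (hV.ordSys hM hm).pt_dense h
  have h3 := Signed.cmp_iff.1 h1.cmp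
  have h4 := DefCut.cmp_iff.1 h3.2
  rw [← h4] at hx hseg
  exact ⟨x, y, ⟨hx, h3.1.symm.trans hp, h4.symm, hseg⟩, h1, h2⟩

open OrdSys

variable {hS : (hV.ordSys hM hm).Hausdorff} {e : Component hS}

/-- A definable increasing map from an interval of `V a` to a chartable order in the component `e`
exists only if `V a` is in the component `e`. -/
theorem compOf_eq_of_strictMono {p : (hV.ordSys hM hm).Glued} {x₁ x₂ : X} (hx₁ : IsPt a x₁ z) (hx₂ : IsPt a x₂ w)
    (hlt : (V a).lt x₁ x₂) (hp : Rep p z) {V' : LinOrdOn (hV.ordSys hM hm).Glued}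
    (hV' : Chartable V' (Rep (S := hV.ordSys hM hm))) (hd' : V'.DenseNoEnds)
    (he : ∀ p ∈ V'.carrier, compOf hS p = e) {K : Subgroup (autGroup L M)} (hK : OpenSub K)
    (hmem : ∀ k ∈ K, ∀ p ∈ V'.carrier, k • p ∈ V'.carrier)
    (hle : ∀ k ∈ K, ∀ p ∈ V'.carrier, ∀ q ∈ V'.carrier, V'.le p q → V'.le (k • p) (k • q))
    {f : X → (hV.ordSys hM hm).Glued}
    (hf : ∀ x ∈ (V a).carrier, (V a).lt x₁ x → (V a).lt x x₂ → f x ∈ V'.carrier)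
    (hmono : ∀ x ∈ (V a).carrier, ∀ y ∈ (V a).carrier, (V a).lt x₁ x → (V a).lt x y →
      (V a).lt y x₂ → V'.lt (f x) (f y))
    (hKa : ∀ k ∈ K, act k a = a) (hKf : ∀ k ∈ K, ∀ x ∈ (V a).carrier, f (act k x) = k • f x) :
    compOf hS p = e := by
  -- Each value of `f` is replaced by the cut below it, so that `exists_eqv_of_cuts` applies.
  let F (w : Signed (DefCut hV)) : Set (hV.ordSys hM hm).Glued :=
    {b | ∃ x, IsPt a x w ∧ b ∈ V'.below (f x)}
  have inj : ∀ {x y u}, IsPt a x u → IsPt (hV := hV) a y u → x = y := by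
    intro x y u h h'
    by_contra hne
    rcases (V a).le_total' h.mem h'.mem with h1 | h1
    · exact lt_irrefl _ (h.lt h' ⟨h1, hne⟩)
    · exact lt_irrefl _ (h'.lt h ⟨h1, fun h => hne h.symm⟩)
  have hF : ∀ {x u}, IsPt a x u → F u = V'.below (f x) := by
    intro x u h
    ext b
    exact ⟨fun ⟨y, hy, hb⟩ => inj hy h ▸ hb, fun hb => ⟨x, h, hb⟩⟩
  obtain ⟨u, u', h1, h2, h3, q, hq, y, hy, h4⟩ :=
    (hV.ordSys hM hm).exists_eqv_of_cuts hV' (isRep _) (show (hV.ordSys hM hm).Op K from hK)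
      (A := {u | ∃ x, IsPt a x u}) (f := F) (hx₁.lt hx₂ hlt)
      (by
        intro b c hzb hbc _
        have h3 := Signed.cmp_iff.1 hzb.cmp
        obtain ⟨x, y, hy, h4, h5⟩ := exists_isPt_between hM hm
          (h3.1.symm.trans hx₁.pos) ((DefCut.cmp_iff.1 h3.2).symm.trans hx₁.idx) hbc
        exact ⟨y, ⟨x, hy⟩, h4, h5⟩)
      (by
        rintro u ⟨x, hx⟩ h1 h2
        rw [hF hx]
        exact hd'.isCut_below (hf x hx.mem ((hx₁.lt_iff hx).1 h1) ((hx.lt_iff hx₂).1 h2)))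
      (by
        rintro b ⟨x, hx⟩ c ⟨y, hy⟩ h1 h2 h3
        rw [hF hx, hF hy]
        exact V'.below_ssubset
          (hf x hx.mem ((hx₁.lt_iff hx).1 h1) ((hx.lt_iff hx₂).1 (h2.trans h3)))
          (hf y hy.mem ((hx₁.lt_iff hy).1 (h1.trans h2)) ((hy.lt_iff hx₂).1 h3))
          (hmono x hx.mem y hy.mem ((hx₁.lt_iff hx).1 h1) ((hx.lt_iff hy).1 h2)
            ((hy.lt_iff hx₂).1 h3)))
      (by
        rintro k hk b ⟨x, hx⟩ h1 h2 - -
        have hkx := hx.smul k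
        rw [hKa k hk] at hkx
        refine ⟨⟨_, hkx⟩, ?_⟩
        rw [hF hkx, hF hx, hKf k hk x hx.mem]
        exact LinOrdOn.smul_image_below hmem hle hk
          (hf x hx.mem ((hx₁.lt_iff hx).1 h1) ((hx.lt_iff hx₂).1 h2)))
  rw [← he q hq]
  exact (compOf_eq_iff hp hy).2 (hS.comp_trans (Comp.of_cmp _ h1.cmp)
    (hS.comp_trans (Or.inl h3) (Comp.of_cmp _ h4.symm)))

end InvFamily

end DefOrd

namespace DefOrd

open MulAction Set

namespace InvFamily

open OrdSys

variable {L : FirstOrder.Language.{v, w}} {M : Type u} [L.Structure M]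
  {D X : Type u} [Interp L M D] [Interp L M X] {V : D → LinOrdOn X} {hV : InvFamily L M V}
  [Countable M] {hM : OmegaCategorical L M} {hm : ∀ a, (V a).Minimal L M a}
  {hS : (hV.ordSys hM hm).Hausdorff}

theorem exists_isPt_rep (hM : OmegaCategorical L M) (hm : ∀ a, (V a).Minimal L M a) {a : D} {x : X}
    (hx : x ∈ (V a).carrier) :
    ∃ (z : Signed (DefCut hV)) (p : (hV.ordSys hM hm).Glued), IsPt a x z ∧ Rep p z := by
  obtain ⟨z, hz⟩ := exists_isPt (hV := hV) (hm a).1.1 hx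
  obtain ⟨p, hp⟩ := exists_of_mem_pts (pt_subset_pts (hz.mem_pt (hM := hM) (hm := hm)))
  exact ⟨z, p, hz, hp⟩

section

variable [Interp L M (hV.ordSys hM hm).Glued] [Interp L M (Component hS)]

/-- Each of the orders of the family embeds in a component, as a suborder of the order of that
component. -/
theorem exists_embeds (hC : Compatible hS) (a : D) :
    ∃ e : Component hS, LinOrCircOn.Embeds L M (V a) (compOrd e) ∧
      ∀ x z p, IsPt a x z → Rep p z → compOf hS p = e := by
  obtain ⟨x₀, hx₀⟩ := (hm a).1.1.1
  obtain ⟨z₀, p₀, hz₀, hp₀⟩ := exists_isPt_rep hM hm hx₀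
  have hcomp : ∀ x z p, IsPt a x z → Rep p z → compOf hS p = compOf hS p₀ := by
    intro x z p hz hp
    refine (compOf_eq_iff hp hp₀).2 (Comp.of_cmp _ ?_)
    rw [Signed.cmp_iff, DefCut.cmp_iff]
    exact ⟨hz.pos.trans hz₀.pos.symm, hz.idx.trans hz₀.idx.symm⟩
  have hf : ∀ x, ∃ p : (hV.ordSys hM hm).Glued, x ∈ (V a).carrier → ∃ z, IsPt a x z ∧ Rep p z := by
    intro x
    by_cases hx : x ∈ (V a).carrier
    · obtain ⟨z, p, hz, hp⟩ := exists_isPt_rep hM hm hx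
      exact ⟨p, fun _ => ⟨z, hz, hp⟩⟩
    · exact ⟨p₀, fun h => absurd h hx⟩
  choose f hf using hf
  refine ⟨compOf hS p₀, ⟨f, fun x hx => ?_, ?_, ?_⟩, hcomp⟩
  · obtain ⟨z, hz, hp⟩ := hf x hx
    exact mem_compOrd.2 (hcomp x z _ hz hp)
  · obtain ⟨s, hs⟩ := exists_support L M a
    refine (paramDef_iff hM).2 ⟨s, ?_⟩
    rintro g hg ⟨x, p⟩ ⟨hx, hp⟩
    obtain rfl : p = f x := hp
    rw [act_prod, hC.glued]
    obtain ⟨z, hz, hp⟩ := hf x hx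
    have h1 := hz.smul g
    rw [hs g hg] at h1
    obtain ⟨z', hz', hp'⟩ := hf _ h1.mem
    exact ⟨h1.mem, (hp.smul g).unique (h1.unique hz' ▸ hp')⟩
  · have lt : ∀ {x y}, x ∈ (V a).carrier → y ∈ (V a).carrier → (V a).lt x y →
        GArc (f x) (f y) := by
      intro x y hx hy h
      obtain ⟨z, hz, hp⟩ := hf x hx
      obtain ⟨z', hz', hp'⟩ := hf y hy
      exact ⟨z, z', hp, hp', hz.lt hz' h⟩
    by_cases he : IsCircle (compOf hS p₀)
    · rw [compOrd_circ he]
      intro x hx y hy t ht hxy hyt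
      obtain ⟨z, hz, hp⟩ := hf x hx
      obtain ⟨z', hz', hp'⟩ := hf y hy
      obtain ⟨z'', hz'', hp''⟩ := hf t ht
      exact circComp_lt.2 ⟨hcomp x z _ hz hp, z, z', z'', hp, hp', hp'', hz.lt hz' hxy,
        hz'.lt hz'' hyt⟩
    · rw [compOrd_lin he]
      exact fun x hx y hy h => linComp_lt.2 (lt hx hy h)

/-- An embedding is a strictly increasing map to a chartable order, so `compOf_eq_of_strictMono`
applies. For a circle, take `x₀ < x < x₂ < x₃` in `V a`: the map sends the elements between `x` and
`x₂` into the open interval from `f x₀` to `f x₃`, where it is increasing for the linear order. -/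
theorem eq_of_embeds (hC : Compatible hS) {a : D} {e : Component hS}
    (h : LinOrCircOn.Embeds L M (V a) (compOrd e)) {x : X} {z : Signed (DefCut hV)}
    {p : (hV.ordSys hM hm).Glued} (hx : IsPt a x z) (hp : Rep p z) : compOf hS p = e := by
  obtain ⟨f, hmaps, hdef, hpres⟩ := h
  obtain ⟨s, hs⟩ := (paramDef_iff hM).1 hdef
  have hK : (hV.ordSys hM hm).Op (fixing L s ⊓ (actStab L M a ⊓ actStab L M e)) :=
    (hV.ordSys hM hm).op_inf (hC.op_fixing s) ((hV.ordSys hM hm).op_inf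
      (hC.op.2 (openSub_actStab a)) (hC.op.2 (openSub_actStab e)))
  have hKf : ∀ k ∈ fixing L s ⊓ (actStab L M a ⊓ actStab L M e), ∀ x ∈ (V a).carrier,
      f (act k x) = k • f x := by
    intro k hk x hx
    have := hs k hk.1 (x, f x) ⟨hx, rfl⟩
    rw [act_prod, hC.glued] at this
    exact this.2.symm
  obtain ⟨x₂, hx₂, h1⟩ := (hm a).1.1.2.2.2 x hx.mem
  obtain ⟨z₂, p₂, hz₂, hp₂⟩ := exists_isPt_rep hM hm hx₂
  by_cases he : IsCircle e
  · rw [compOrd_circ he] at hmaps hpres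
    obtain ⟨x₀, hx₀, h0⟩ := (hm a).1.1.2.2.1 x hx.mem
    obtain ⟨x₃, hx₃, h2⟩ := (hm a).1.1.2.2.2 x₂ hx₂
    obtain ⟨K₀, hK₀, hK₀'⟩ := (hV.ordSys hM hm).exists_op_smul_eq (f x₀)
    obtain ⟨K₃, hK₃, hK₃'⟩ := (hV.ordSys hM hm).exists_op_smul_eq (f x₃)
    have tr : ∀ {b c d}, b ∈ (V a).carrier → c ∈ (V a).carrier → d ∈ (V a).carrier →
        (V a).lt b c → (V a).lt c d → (V a).lt b d :=
      fun hb hc hd h h' => (V a).lt_of_lt_of_le' hb hc hd h h'.1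
    have mem : ∀ y ∈ (V a).carrier, (V a).lt x y → (V a).lt y x₂ →
        f y ∈ ((circComp e he).interval (f x₀) (f x₃)).carrier := fun y hy h3 h4 =>
      hpres x₀ hx₀ y hy x₃ hx₃ (tr hx₀ hx.mem hy h0 h3) (tr hy hx₂ hx₃ h4 h2)
    have hne : f x₀ ≠ f x₃ := (circComp_lt.1 (hpres x₀ hx₀ x hx.mem x₃ hx₃ h0
      (tr hx.mem hx₂ hx₃ h1 h2))).2.ne.2.2
    exact compOf_eq_of_strictMono (hS := hS) (e := e) hx hz₂ h1 hp
      (V' := (circComp e he).interval (f x₀) (f x₃)) interval_chartable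
      (interval_denseNoEnds (hmaps hx₀) (hmaps hx₃) hne) (fun q hq => hq.2.1)
      (hC.op.1 ((hV.ordSys hM hm).op_inf hK ((hV.ordSys hM hm).op_inf hK₀ hK₃)))
      (fun k hk q hq => smul_mem_interval (hK₀' k hk.2.1) (hK₃' k hk.2.2) hq)
      (fun k hk q hq r hr h => smul_interval_le (hK₀' k hk.2.1) (hK₃' k hk.2.2) hq hr h) (f := f)
      mem (fun y hy t ht h3 h4 h5 => (interval_lt
          (mem y hy h3 (tr hy ht hx₂ h4 h5)) (mem t ht (tr hx.mem hy ht h3 h4) h5)).2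
        (circComp_lt.1 (hpres x₀ hx₀ y hy t ht (tr hx₀ hx.mem hy h0 h3) h4)).2)
      (fun k hk => hk.1.2.1) fun k hk => hKf k hk.1
  · rw [compOrd_lin he] at hmaps hpres
    exact compOf_eq_of_strictMono (hS := hS) (e := e) hx hz₂ h1 hp (V' := linComp e he)
      (linComp_chartable he) (linComp_denseNoEnds he) (fun q hq => hq)
      (hC.op.1 hK) (fun k hk q hq => by
        have hke : k • e = e := by rw [← hC.comp]; exact hk.2.2
        exact (compOf_smul k q).trans (by rw [show compOf hS q = e from hq, hke]))
      (fun k _ q _ r _ h => h.imp (congrArg (k • ·)) (GArc.smul k)) (f := f)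
      (fun y hy _ _ => hmaps hy) (fun y hy t ht _ h _ => hpres y hy t ht h)
      (fun k hk => hk.2.1) hKf

end

/-- Every glued point is an element of some `V a` or the reversal of one, and the pairs formed by an
index and an element have finitely many orbits. -/
theorem exists_finite_orbits (hV : InvFamily L M V) (hM : OmegaCategorical L M)
    (hm : ∀ a, (V a).Minimal L M a) :
    ∃ T : Set (hV.ordSys hM hm).Glued, T.Finite ∧ ∀ p, ∃ t ∈ T, ∃ g : autGroup L M, g • t = p := by
  obtain ⟨T₀, hT₀, h⟩ := hM.finite_orbits (D × X) ∅
  let T₁ : Set (hV.ordSys hM hm).Glued := ⋃ t ∈ T₀, {p | ∃ z, IsPt t.1 t.2 z ∧ Rep p z}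
  have hT₁ : T₁.Finite := hT₀.biUnion fun t _ => Set.Subsingleton.finite <| by
    rintro p ⟨z, hz, hp⟩ q ⟨z', hz', hq⟩
    exact hp.unique (hz.unique hz' ▸ hq)
  have key : ∀ a x z p, IsPt a x z → Rep p z → ∃ t ∈ T₁, ∃ g : autGroup L M, g • t = p := by
    intro a x z p hz hp
    obtain ⟨t, ht, g, -, hg⟩ := h (a, x)
    have h1 := hz.smul g⁻¹
    rw [act_prod, Prod.mk.injEq] at hg
    rw [← hg.1, ← hg.2, act_inv_act, act_inv_act] at h1
    exact ⟨g⁻¹ • p, mem_biUnion ht ⟨_, h1, hp.smul g⁻¹⟩, g, by simp⟩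
  refine ⟨T₁ ∪ (hV.ordSys hM hm).gnu '' T₁, hT₁.union (hT₁.image _), fun p => ?_⟩
  obtain ⟨z, ⟨x, hx, hseg⟩, hp⟩ := exists_rep p
  cases hb : z.pos
  · obtain ⟨t, ht, g, hg⟩ := key z.val.idx x ((hV.ordSys hM hm).nu z) _ ⟨hx, by
      show (!z.pos) = true
      rw [hb]; rfl, rfl, hseg⟩ hp.nu
    exact ⟨_, Or.inr ⟨t, ht, rfl⟩, g, by rw [← gnu_smul, hg, gnu_gnu]⟩
  · obtain ⟨t, ht, g, hg⟩ := key z.val.idx x z p ⟨hx, hb, rfl, hseg⟩ hp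
    exact ⟨t, Or.inl ht, g, hg⟩

theorem exists_support_glued (p : (hV.ordSys hM hm).Glued) :
    ∃ s : Finset M, ∀ g : autGroup L M, Fixes s g → g • p = p := by
  obtain ⟨K, ⟨s, hs⟩, h⟩ := (hV.ordSys hM hm).exists_op_smul_eq p
  exact ⟨s, fun g hg => h g (hs g hg)⟩

theorem exists_compatible [Nontrivial M] (hS : (hV.ordSys hM hm).Hausdorff) :
    ∃ (_ : Interp L M (hV.ordSys hM hm).Glued) (_ : Interp L M (Component hS)), Compatible hS := by
  obtain ⟨T, hT, h⟩ := exists_finite_orbits hV hM hm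
  obtain ⟨i₁, h₁⟩ := exists_interp hM T hT h exists_support_glued
  obtain ⟨i₂, h₂⟩ := exists_interp hM (compOf hS '' T) (hT.image _)
    (fun e => by
      obtain ⟨p, rfl⟩ := exists_compOf e
      obtain ⟨t, ht, g, rfl⟩ := h p
      exact ⟨_, ⟨t, ht, rfl⟩, g, (compOf_smul g t).symm⟩)
    (fun e => by
      obtain ⟨p, rfl⟩ := exists_compOf e
      obtain ⟨s, hs⟩ := exists_support_glued p
      exact ⟨s, fun g hg => by rw [← compOf_smul, hs g hg]⟩)
  exact ⟨i₁, i₂, Iff.rfl, h₁, h₂⟩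

end InvFamily

end DefOrd

/-! ### The theorem -/

theorem mainTheorem9 (L : FirstOrder.Language.{v, w}) [Countable L.Symbols]
    (M : Type u) [L.Structure M] [Countable M] (hM : OmegaCategorical L M)
    (D X : Type u) [Interp L M D] [Interp L M X]
    (V : D → LinOrdOn X) (hV : ZeroDefLinFamily L M V)
    (hmin : ∀ a : D, (V a).Minimal L M a)
    (hD : Ranked L M (Set.univ : Set D)) :
    ∃ (F P : Type u) (_ : Interp L M F) (_ : Interp L M P) (W : F → LinOrCircOn P),
      ZeroDefFamily L M W ∧
      (∀ e : F, (W e).Minimal L M e) ∧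
      (∀ e e' : F, e ≠ e' →
        LinOrCircOn.Independent L M (e, e') (W e) (W e') ∨
        LinOrCircOn.InReversingBijection L M (W e) (W e')) ∧
      ∀ a : D, ∃! e : F, LinOrCircOn.Embeds L M (V a) (W e) := by
  -- The empty family is treated apart, because M could then be a single point and coding by
  -- `exists_interp` needs two elements.
  rcases isEmpty_or_nonempty D with hemp | ⟨⟨a₀⟩⟩
  · refine ⟨D, X, inferInstance, inferInstance, fun a => .linear (V a), ⟨?_, ?_, ?_, ?_⟩,
      fun e => isEmptyElim e, fun e => isEmptyElim e, fun a => isEmptyElim a⟩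
    · exact (zeroDef_iff hM).2 fun _ x => isEmptyElim x
    all_goals exact (zeroDef_iff hM).2 fun _ x => isEmptyElim x.1
  have hI := hV.inv hM
  have hS := InvFamily.hausdorff hI hM hmin hD
  -- Some automorphism moves a cut by `nofix`, so M has more than one element.
  have : Nontrivial M := by
    obtain ⟨x₀, hx₀⟩ := (hmin a₀).1.1.1
    obtain ⟨z, -⟩ := InvFamily.exists_isPt (hV := hI) (hmin a₀).1.1 hx₀
    obtain ⟨g, -, hg⟩ := (hI.ordSys hM hmin).nofix z
    exact nontrivial_of_smul_ne hg
  obtain ⟨i₁, i₂, hC⟩ := InvFamily.exists_compatible hS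
  refine ⟨OrdSys.Component hS, _, i₂, i₁, OrdSys.compOrd, OrdSys.zeroDefFamily_compOrd hM hC,
    OrdSys.compOrd_minimal hM hC, fun e e' hne => ?_, fun a => ?_⟩
  · by_cases he : e' = OrdSys.cnu hS e
    · rw [he]
      exact Or.inr (OrdSys.inReversingBijection_cnu hM hC e)
    · exact Or.inl (OrdSys.compOrd_independent hM hC hne he)
  · obtain ⟨e, h1, h2⟩ := InvFamily.exists_embeds hC a
    refine ⟨e, h1, fun e' he' => ?_⟩
    obtain ⟨x₀, hx₀⟩ := (hmin a).1.1.1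
    obtain ⟨z, p, hz, hp⟩ := InvFamily.exists_isPt_rep hM hmin hx₀
    rw [← h2 x₀ z p hz hp]
    exact (InvFamily.eq_of_embeds hC he' hz hp).symm
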